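/- **Setting.** Let $\Lambda$ be a complete local Noetherian ring with residue field $k$. Let $s\mathcal C_\Lambda$ be the category of Artinian simplicial local $\Lambda$-algebras with residue field $k$ (every level is a local Artinian $\Lambda$-algebra with residue field $k$, and simplicial ideals satisfy the descending chain condition), and let $sc\mathrm{Sp}$ be the category of functors $s\mathcal C_\Lambda\to\mathbb S$ to simplicial sets that preserve finite limits. A morphism $A\to B$ of $s\mathcal C_\Lambda$ is surjective if it is so in every level, and acyclic if it induces isomorphisms on all $\pi_i$. A map $\alpha:F\to G$ in $sc\mathrm{Sp}$ is *quasi-smooth* if for every surjection $A\to B$ the map $F(A)\to F(B)\times_{G(B)}G(A)$ is a Kan fibration, and for every acyclic surjection it is a trivial fibration. For a simplicial $k$-vector space $V$ with finite-dimensional normalisation, $\tan F(V):=F(k\oplus V)$ with $V^2=0$, a simplicial $k$-vector space, and $\tan(F/G)(V):=\ker(\tan F(V)\to\tan G(V))$. $K^n$ is the simplicial vector space with normalisation $k$ in degree $n$, and $V[-n]:=V\otimes K^n$. A *small extension* $I\to A\xrightarrow{f}B$ is a surjection $f$ in $s\mathcal C_\Lambda$ with kernel $I$ such that $\mathfrak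 m(A)\cdot I=0$; then $I$ is a simplicial $k$-vector space with finite-dimensional normalisation. Homotopy groups of simplicial sets that need not be fibrant are those of a Kan replacement. **Theorem.** Let $\alpha:F\to G$ be quasi-smooth in $sc\mathrm{Sp}$, let $I\to A\xrightarrow{f}B$ be a small extension, and write $X:=FB\times_{GB}GA$, $f_*:FA\to X$ for the natural map and $T:=\tan(F/G)(I[-1])$. There are a simplicial set $E$, a factorisation $f_*=q\circ j$ with $j:FA\to E$ and $q:E\to X$ a trivial fibration, and a map $p:E\to T$ such that $j$ identifies $FA$ with the fibre of $p$ over $0$, with the following properties. Let $o_e:\pi_0X\to\pi_0T$ and $o_e:\pi_n(X,f_*y)\to\pi_nT$ ($n\ge1$, $y\in F_0A$) be the maps $p_*\circ q_*^{-1}$. 1. The sequence $\pi_0(FA)\xrightarrow{f_*}\pi_0(X)\xrightarrow{o_e}\pi_0T$ is exact: $o_e^{-1}(0)$ is the image of $f_*$. 2. There is an action of the group $\pi_1T$ on $\pi_0(FA)$ whose orbits are exactly the fibres of $f_*:\pi_0(FA)\to\pi_0(X)$. It is the action by lifting of loops: if $\varepsilon\in E_1$ runs from $j(y)$ to $j(w)$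 and $p(\varepsilon)$ represents $u\in\pi_1T$, then $u*[y]=[w]$. 3. For every $y\in F_0A$, with $x=f_*y$, the fibre of $f_*:FA\to X$ over $x$ is isomorphic to $\tan(F/G)(I)$, with $0$ corresponding to $y$. 4. For every $y\in F_0A$, with $x=f_*y$, there is a long exact sequence $$\cdots\to\pi_n(FA,y)\xrightarrow{f_*}\pi_n(X,x)\xrightarrow{o_e}\pi_nT\xrightarrow{\partial_e}\pi_{n-1}(FA,y)\xrightarrow{f_*}\cdots\to\pi_1(FA,y)\xrightarrow{f_*}\pi_1(X,x)\xrightarrow{o_e}\pi_1T\xrightarrow{-*y}\pi_0(FA),$$ in which the maps $o_e:\pi_n(X,x)\to\pi_nT$ ($n\ge1$) and $\partial_e:\pi_nT\to\pi_{n-1}(FA,y)$ ($n\ge2$) are group homomorphisms, $\partial_e$ is the boundary map (lift a cycle of $T$ to a simplex of $E$ all of whose faces except the zeroth are degeneracies of $j(y)$, and take the zeroth face), and exactness at $\pi_1T$ means that the stabiliser of $[y]$ is the image of $o_e$. Moreover, the spaces $\pi_i\tan(F/G)(K^n)$ depend, up to isomorphism of $k$-vector spaces, only on $j=n-i$; write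 $H^j(F/G)$ for them. For every simplicial $k$-vector space $V$ with finite-dimensional normalisation and all $n\ge0$, $$\pi_n\tan(F/G)(V[-1])\;\cong\;H^{1-n}(F/G\otimes V):=\bigoplus_{m\ge0}H^{1-n+m}(F/G)\otimes_k\pi_m(V).$$ In particular $\pi_nT\cong H^{1-n}(F/G\otimes I)$ above, so the groups $H^i(F/G)$ serve as both tangent and obstruction spaces. -/

import Mathlib

open CategoryTheory Limits Opposite IsLocalRing
open scoped TensorProduct DirectSum

universe u

namespace DerivedDef
noncomputable section

section SimplicialModules
variable {R : Type u} [CommRing R]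

/-- The simplicial set underlying a simplicial module. -/
abbrev toSSet (V : SimplicialObject (ModuleCat.{u} R)) : SSet.{u} := V ⋙ forget _

/-- The homotopy group `π_n(V)` of a simplicial module, the homology of its normalised complex. -/
abbrev piMod (n : ℕ) (V : SimplicialObject (ModuleCat.{u} R)) : ModuleCat.{u} R :=
  ((AlgebraicTopology.normalizedMooreComplex _).obj V).homology n

variable (V : SimplicialObject (ModuleCat.{u} R))

/-- The underlying submodule of `V_n` of the `n`-th term of the normalised complex. -/
def normSub : ∀ n : ℕ, Submodule R (V.obj (op (.mk n)))
  | 0 => ⊤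
  | n + 1 => ⨅ i : Fin (n + 1), LinearMap.ker (V.δ i.succ).hom

lemma range_arrow (n : ℕ) :
    LinearMap.range (AlgebraicTopology.NormalizedMooreComplex.objX V n).arrow.hom = normSub V n := by
  cases n with
  | zero =>
    rw [normSub, LinearMap.range_eq_top, ← ModuleCat.epi_iff_surjective]
    rw [AlgebraicTopology.NormalizedMooreComplex.objX_zero]
    infer_instance
  | succ n =>
    apply le_antisymm
    · rintro _ ⟨x, rfl⟩
      simp only [normSub, Submodule.mem_iInf, LinearMap.mem_ker]
      intro i
      have h : (AlgebraicTopology.NormalizedMooreComplex.objX V (n+1)).arrow ≫ V.δ i.succ = 0 := by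
        change (Finset.univ.inf fun k : Fin (n+1) => kernelSubobject (V.δ k.succ)).arrow ≫ _ = 0
        rw [← Subobject.factorThru_arrow _ _ (Subobject.finset_inf_arrow_factors Finset.univ
          (fun k : Fin (n+1) => kernelSubobject (V.δ k.succ)) i (by simp)), Category.assoc,
          kernelSubobject_arrow_comp, comp_zero]
      exact ConcreteCategory.congr_hom h x
    · intro v hv
      simp only [normSub, Submodule.mem_iInf, LinearMap.mem_ker] at hv
      let g : ModuleCat.of R R ⟶ V.obj (op (.mk (n+1))) := ModuleCat.ofHom (LinearMap.toSpanSingleton R _ v)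
      have hg : (AlgebraicTopology.NormalizedMooreComplex.objX V (n+1)).Factors g := by
        refine (Subobject.finset_inf_factors _).mpr fun i _ => kernelSubobject_factors _ _ ?_
        ext
        simpa [g] using hv i
      refine ⟨(Subobject.factorThru _ g hg) (1 : R), ?_⟩
      have := ConcreteCategory.congr_hom (Subobject.factorThru_arrow _ g hg) (1 : R)
      refine this.trans ?_
      simp [g]

lemma arrow_injective (n : ℕ) :
    Function.Injective (AlgebraicTopology.NormalizedMooreComplex.objX V n).arrow.hom :=
  (ModuleCat.mono_iff_injective _).1 inferInstance

/-- The terms of the normalised complex are the submodules `normSub V n`. -/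
def normEquiv (n : ℕ) : ((AlgebraicTopology.normalizedMooreComplex _).obj V).X n ≃ₗ[R] normSub V n :=
  (LinearEquiv.ofInjective _ (arrow_injective V n)).trans (LinearEquiv.ofEq _ _ (range_arrow V n))

/-- A simplicial module has finite-dimensional normalisation. -/
def IsFD : Prop :=
  (∀ n, Module.Finite R (((AlgebraicTopology.normalizedMooreComplex _).obj V).X n)) ∧
  ∃ m, ∀ n, m < n → Subsingleton (((AlgebraicTopology.normalizedMooreComplex _).obj V).X n)

lemma isFD_iff : IsFD V ↔ (∀ n, Module.Finite R (normSub V n)) ∧ ∃ m, ∀ n, m < n → normSub V n = ⊥ := by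
  unfold IsFD
  refine and_congr (forall_congr' fun n => ?_) (exists_congr fun m => forall_congr' fun n => forall_congr' fun _ => ?_)
  · exact ⟨fun h => Module.Finite.equiv (normEquiv V n), fun h => Module.Finite.equiv (normEquiv V n).symm⟩
  · rw [(normEquiv V n).toEquiv.subsingleton_congr, Submodule.subsingleton_iff_eq_bot]

open AlgebraicTopology DoldKan in
lemma exists_norm (n : ℕ) (x : V.obj (op (.mk (n+1)))) :
    ∃ y ∈ normSub V (n+1), x - y ∈ ⨆ j : Fin (n+1), LinearMap.range (V.σ j).hom := by
  have h1 : (PInfty (X := V)).f (n+1) + QInfty.f (n+1) = 𝟙 _ := PInfty_f_add_QInfty_f (n+1)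
  have h1' := ConcreteCategory.congr_hom h1 x
  have h2 := decomposition_Q (X := V) n (n+1)
  let y : V.obj (op (.mk (n+1))) := ((PInfty (X := V)).f (n+1)).hom x
  refine ⟨y, ?_, ?_⟩
  · simp only [normSub, Submodule.mem_iInf, LinearMap.mem_ker]
    intro i
    have h3 : HigherFacesVanish (n+1) ((PInfty (X := V)).f (n+1)) := by
      rw [PInfty_f]; exact HigherFacesVanish.of_P (n+1) n
    exact ConcreteCategory.congr_hom (h3 i (by omega)) x
  · have h4 : x - y = ((QInfty (X := V)).f (n+1)).hom x := by
      rw [sub_eq_iff_eq_add']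
      exact h1'.symm
    rw [h4]
    change (((Q (X := V) (n+1)).f (n+1)).hom x) ∈ _
    rw [h2, ModuleCat.hom_sum, LinearMap.sum_apply]
    refine Submodule.sum_mem _ fun i _ => ?_
    exact Submodule.mem_iSup_of_mem (Fin.rev i) ⟨_, rfl⟩

open AlgebraicTopology DoldKan in
lemma norm_inf_degenerate (n : ℕ) (x : V.obj (op (.mk (n+1)))) (hx : x ∈ normSub V (n+1))
    (hx' : x ∈ ⨆ j : Fin (n+1), LinearMap.range (V.σ j).hom) : x = 0 := by
  have h1 : ((PInfty (X := V)).f (n+1)).hom x = x := by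
    rw [← range_arrow] at hx
    obtain ⟨z, rfl⟩ := hx
    exact ConcreteCategory.congr_hom (HomologicalComplex.congr_hom (inclusionOfMooreComplexMap_comp_PInfty V) (n+1)) z
  rw [← h1, ← LinearMap.mem_ker]
  revert hx'
  suffices h : (⨆ j : Fin (n+1), LinearMap.range (V.σ j).hom) ≤
      LinearMap.ker ((PInfty (X := V)).f (n+1)).hom from fun hx' => h hx'
  refine iSup_le fun j => ?_
  rintro _ ⟨y, rfl⟩
  exact ConcreteCategory.congr_hom (σ_comp_PInfty V j) y

variable {V}

/-- The simplicial module on a stable family of submodules. -/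
def subObj (J : ∀ n, Submodule R (V.obj n))
    (hJ : ∀ {m n} (θ : m ⟶ n), ∀ x ∈ J m, (V.map θ).hom x ∈ J n) : SimplicialObject (ModuleCat.{u} R) where
  obj n := ModuleCat.of R (J n)
  map θ := ModuleCat.ofHom ((V.map θ).hom.restrict (hJ θ))
  map_id n := ModuleCat.hom_ext (LinearMap.ext fun x : J _ => Subtype.ext (ConcreteCategory.congr_hom (V.map_id n) x.1))
  map_comp a b := ModuleCat.hom_ext (LinearMap.ext fun x : J _ => Subtype.ext (ConcreteCategory.congr_hom (V.map_comp a b) x.1))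

lemma exists_norm_sub (J : ∀ n, Submodule R (V.obj n))
    (hJ : ∀ {m n} (θ : m ⟶ n), ∀ x ∈ J m, (V.map θ).hom x ∈ J n) (n : ℕ)
    (x : V.obj (op (.mk (n+1)))) (hx : x ∈ J _) :
    ∃ y ∈ normSub V (n+1), y ∈ J _ ∧ x - y ∈ ⨆ j : Fin (n+1), (J _).map (V.σ j).hom := by
  obtain ⟨y, hy, hy'⟩ := exists_norm (subObj J hJ) n ⟨x, hx⟩
  refine ⟨y.1, ?_, y.2, ?_⟩
  · simp only [normSub, Submodule.mem_iInf, LinearMap.mem_ker] at hy ⊢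
    exact fun i => congrArg Subtype.val (hy i)
  · suffices h : (⨆ j : Fin (n+1), LinearMap.range ((subObj J hJ).σ j).hom) ≤
        (⨆ j : Fin (n+1), (J _).map (V.σ j).hom).comap (J _).subtype from h hy'
    refine iSup_le fun j => ?_
    rintro _ ⟨z, rfl⟩
    exact Submodule.mem_iSup_of_mem j ⟨z.1, z.2, rfl⟩

lemma eq_of_norm_eq (J J' : ∀ n, Submodule R (V.obj n))
    (hJ : ∀ {m n} (θ : m ⟶ n), ∀ x ∈ J m, (V.map θ).hom x ∈ J n)
    (hJ' : ∀ {m n} (θ : m ⟶ n), ∀ x ∈ J' m, (V.map θ).hom x ∈ J' n)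
    (hle : ∀ n, J n ≤ J' n) (h : ∀ n : ℕ, ∀ x ∈ normSub V n, x ∈ J' _ → x ∈ J _) (n : ℕ) :
    J (op (.mk n)) = J' (op (.mk n)) := by
  refine le_antisymm (hle _) ?_
  induction n with
  | zero => exact fun x hx => h 0 x (by simp [normSub]) hx
  | succ n ih =>
    intro x hx
    obtain ⟨y, hy, hyJ, hxy⟩ := exists_norm_sub J' hJ' n x hx
    have h1 : x - y ∈ J _ := by
      refine (iSup_le fun j => ?_ : _ ≤ J _) hxy
      rintro _ ⟨z, hz, rfl⟩
      exact hJ _ z (ih hz)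
    simpa using add_mem h1 (h _ y hy hyJ)

end SimplicialModules

section Field
variable {K : Type u} [Field K] {V : SimplicialObject (ModuleCat.{u} K)}

lemma finite_of_isFD (hV : IsFD V) (n : ℕ) : Module.Finite K (V.obj (op (.mk n))) := by
  rw [isFD_iff] at hV
  induction n with
  | zero =>
    have := hV.1 0
    exact Module.finite_def.2 ((Module.Finite.iff_fg (N := normSub V 0)).1 this)
  | succ n ih =>
    have h1 : (⊤ : Submodule K (V.obj (op (.mk (n+1))))) =
      normSub V (n+1) ⊔ ⨆ j : Fin (n+1), LinearMap.range (V.σ j).hom := by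
      refine (eq_top_iff.2 fun x _ => ?_).symm
      obtain ⟨y, hy, hxy⟩ := exists_norm V n x
      rw [← add_sub_cancel y x]
      exact Submodule.add_mem_sup hy hxy
    rw [Module.finite_def, h1]
    refine Submodule.FG.sup ((Module.Finite.iff_fg).1 (hV.1 _)) (Submodule.fg_iSup _ fun j => ?_)
    rw [← Module.Finite.iff_fg]
    exact Module.Finite.range _

lemma dcc_of_isFD (hV : IsFD V) (J : ℕ → ∀ n, Submodule K (V.obj n))
    (hJ : ∀ (i) {m n} (θ : m ⟶ n), ∀ x ∈ J i m, (V.map θ).hom x ∈ J i n)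
    (hanti : ∀ i n, J (i+1) n ≤ J i n) : ∃ N, ∀ i, N ≤ i → ∀ n, J i n = J N n := by
  rw [isFD_iff] at hV
  obtain ⟨hfin, m, hm⟩ := hV
  have ha : ∀ i i', i ≤ i' → ∀ n, J i' n ≤ J i n := fun i i' h n =>
    antitone_nat_of_succ_le (f := fun i => J i n) (fun i => hanti i n) h
  have hst : ∀ n : ℕ, ∃ N, ∀ i, N ≤ i → ∀ x ∈ normSub V n, x ∈ J N _ → x ∈ J i _ := by
    intro n
    have := hfin n
    obtain ⟨N, hN⟩ := IsArtinian.monotone_stabilizes (R := K) (M := normSub V n)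
      { toFun := fun i => OrderDual.toDual ((J i (op (.mk n))).comap (normSub V n).subtype)
        monotone' := fun i i' h => Submodule.comap_mono (ha i i' h _) }
    refine ⟨N, fun i hi x hx hxN => ?_⟩
    have := hN i hi
    have h2 : (⟨x, hx⟩ : normSub V n) ∈ (J N (op (.mk n))).comap (normSub V n).subtype := hxN
    have h3 : (J N (op (.mk n))).comap (normSub V n).subtype = (J i (op (.mk n))).comap (normSub V n).subtype := this
    rw [h3] at h2
    exact h2
  choose M hM using hst
  refine ⟨(Finset.range (m+1)).sup M, fun i hi n => ?_⟩
  obtain ⟨⟨n⟩⟩ := n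
  refine eq_of_norm_eq (J i) (J _) (hJ i) (hJ _) (ha _ _ hi) (fun n x hx hxJ => ?_) n
  by_cases hn : m < n
  · rw [hm n hn] at hx
    rw [(Submodule.mem_bot _).1 hx]
    exact zero_mem _
  · have h1 : M n ≤ (Finset.range (m+1)).sup M := Finset.le_sup (by simp; omega)
    exact hM n i (h1.trans hi) x hx (ha _ _ h1 _ hxJ)

lemma span_of_isFD (m : ℕ)
    (hm : ∀ n, m < n → normSub V n = ⊥) (n : ℕ) :
    (⊤ : Submodule K (V.obj (op (.mk n)))) = Submodule.span K
      {x | ∃ (i : ℕ) (_ : i ≤ m) (θ : SimplexCategory.mk n ⟶ .mk i) (y : V.obj (op (.mk i))),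
        x = (V.map θ.op).hom y} := by
  refine (eq_top_iff.2 ?_).symm
  induction n with
  | zero =>
    exact fun x _ => Submodule.subset_span ⟨0, m.zero_le, 𝟙 _, x, by simp⟩
  | succ n ih =>
    intro x _
    by_cases hn : n + 1 ≤ m
    · exact Submodule.subset_span ⟨n+1, hn, 𝟙 _, x, by simp⟩
    obtain ⟨y, hy, hxy⟩ := exists_norm V n x
    rw [hm _ (by omega), Submodule.mem_bot] at hy
    rw [hy, sub_zero] at hxy
    refine (iSup_le fun j => ?_ : _ ≤ Submodule.span K _) hxy
    rw [LinearMap.range_eq_map, Submodule.map_le_iff_le_comap]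
    refine ih.trans (Submodule.span_le.2 ?_)
    rintro _ ⟨i, hi, θ, y, rfl⟩
    refine Submodule.subset_span ⟨i, hi, SimplexCategory.σ j ≫ θ, y, ?_⟩
    rw [op_comp, V.map_comp]
    rfl

/-- The levelwise tensor product. -/
def tensor (V W : SimplicialObject (ModuleCat.{u} K)) : SimplicialObject (ModuleCat.{u} K) where
  obj n := ModuleCat.of K (V.obj n ⊗[K] W.obj n)
  map θ := ModuleCat.ofHom (TensorProduct.map (V.map θ).hom (W.map θ).hom)
  map_id n := by
    ext : 1
    simp
  map_comp a b := by
    ext : 1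
    simp [TensorProduct.map_comp]

lemma isFD_tensor {V W : SimplicialObject (ModuleCat.{u} K)} (hV : IsFD V) (hW : IsFD W) :
    IsFD (tensor V W) := by
  have fV := finite_of_isFD hV
  have fW := finite_of_isFD hW
  rw [isFD_iff] at hV hW ⊢
  obtain ⟨-, p, hp⟩ := hV
  obtain ⟨-, q, hq⟩ := hW
  refine ⟨fun n => ?_, p + q, fun n hn => ?_⟩
  · have : Module.Finite K ((tensor V W).obj (op (.mk n))) := by
      have := fV n
      have := fW n
      exact inferInstanceAs (Module.Finite K (V.obj (op (.mk n)) ⊗[K] W.obj (op (.mk n))))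
    infer_instance
  · obtain ⟨n, rfl⟩ : ∃ n', n = n' + 1 := ⟨n - 1, by omega⟩
    rw [eq_bot_iff]
    intro x hx
    rw [Submodule.mem_bot]
    refine norm_inf_degenerate _ n x hx ?_
    have htop : ∀ S : Submodule K (V.obj (op (.mk (n+1))) ⊗[K] W.obj (op (.mk (n+1)))),
        (∀ (l : Fin (n+1)) v w, (V.σ l).hom v ⊗ₜ (W.σ l).hom w ∈ S) → ⊤ ≤ S := by
      intro S hS
      rw [← TensorProduct.map₂_mk_top_top_eq_top, span_of_isFD p hp (n+1),
        span_of_isFD q hq (n+1), Submodule.map₂_span_span, Submodule.span_le]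
      rintro _ ⟨_, ⟨i, hi, θ, y, rfl⟩, _, ⟨j, hj, τ, z, rfl⟩, rfl⟩
      obtain ⟨l, h1, h2⟩ : ∃ l : Fin (n+1), θ.toOrderHom l.castSucc = θ.toOrderHom l.succ ∧
          τ.toOrderHom l.castSucc = τ.toOrderHom l.succ := by
        by_contra! hcon
        have key : ∀ l : Fin (n+2), (l : ℕ) ≤ (θ.toOrderHom l : ℕ) + (τ.toOrderHom l : ℕ) := by
          intro l
          induction l using Fin.induction with
          | zero => simp
          | succ l ih =>
            have m1 : θ.toOrderHom l.castSucc ≤ θ.toOrderHom l.succ :=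
              θ.toOrderHom.monotone Fin.castSucc_lt_succ.le
            have m2 : τ.toOrderHom l.castSucc ≤ τ.toOrderHom l.succ :=
              τ.toOrderHom.monotone Fin.castSucc_lt_succ.le
            have h3 := hcon l
            simp only [Fin.le_def, ne_eq, Fin.ext_iff, Fin.val_succ, Fin.val_castSucc] at *
            by_cases h4 : (θ.toOrderHom l.castSucc : ℕ) = (θ.toOrderHom l.succ : ℕ)
            · have := h3 h4
              omega
            · omega
        have := key (Fin.last _)
        have b1 := (θ.toOrderHom (Fin.last _)).is_le
        have b2 := (τ.toOrderHom (Fin.last _)).is_le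
        simp only [Fin.val_last, SimplexCategory.len_mk] at *
        omega
      obtain ⟨θ', rfl⟩ := SimplexCategory.eq_σ_comp_of_not_injective' θ l h1
      obtain ⟨τ', rfl⟩ := SimplexCategory.eq_σ_comp_of_not_injective' τ l h2
      rw [op_comp, op_comp, V.map_comp, W.map_comp]
      exact hS l _ _
    exact htop (⨆ j : Fin (n+1), LinearMap.range ((tensor V W).σ j).hom)
      (fun l v w => Submodule.mem_iSup_of_mem l ⟨v ⊗ₜ w, rfl⟩) trivial

end Field

section KLn
variable (k : Type u) [Field k]

/-- The simplicial vector space `K^n = N⁻¹ k[-n]`, with normalisation `k` in degree `n`. -/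
def eilenbergMacLane (n : ℕ) : SimplicialObject (ModuleCat.{u} k) :=
  Abelian.DoldKan.equivalence.inverse.obj
    ((HomologicalComplex.single (ModuleCat.{u} k) (ComplexShape.down ℕ) n).obj (ModuleCat.of k k))

lemma isFD_eilenbergMacLane (n : ℕ) : IsFD (eilenbergMacLane k n) := by
  let e := Abelian.DoldKan.equivalence.counitIso.app
    ((HomologicalComplex.single (ModuleCat.{u} k) (ComplexShape.down ℕ) n).obj (ModuleCat.of k k))
  have e' : ∀ m, ((AlgebraicTopology.normalizedMooreComplex _).obj (eilenbergMacLane k n)).X m ≅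
    ((HomologicalComplex.single (ModuleCat.{u} k) (ComplexShape.down ℕ) n).obj (ModuleCat.of k k)).X m :=
    fun m => (HomologicalComplex.eval _ _ m).mapIso e
  have hz : ∀ m, m ≠ n → Subsingleton (((AlgebraicTopology.normalizedMooreComplex _).obj (eilenbergMacLane k n)).X m) := by
    intro m hm
    have h1 := (HomologicalComplex.isZero_single_obj_X (ComplexShape.down ℕ) n (ModuleCat.of k k) m hm).of_iso (e' m)
    exact ModuleCat.subsingleton_of_isZero h1
  refine ⟨fun m => ?_, n, fun m hm => hz m hm.ne'⟩
  by_cases hm : m = n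
  · subst hm
    have e2 := (e' m).trans (HomologicalComplex.singleObjXSelf _ m _)
    exact Module.Finite.equiv e2.toLinearEquiv.symm
  · have := hz m hm
    infer_instance

end KLn

section Artinian
variable (Λ : Type u) [CommRing Λ] [IsLocalRing Λ]

/-- Local Artinian `Λ`-algebras with the same residue field as `Λ`. -/
structure IsLocalArtinian (A : CommAlgCat.{u} Λ) : Prop where
  isLocalRing : IsLocalRing A
  isArtinianRing : IsArtinianRing A
  residue_surjective : Function.Surjective ((residue A).comp (algebraMap Λ A))

variable {Λ}

/-- Simplicial ideals of a simplicial algebra. -/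
structure SimplicialIdeal (A : SimplicialObject (CommAlgCat.{u} Λ)) where
  ideal : ∀ n, Ideal (A.obj n)
  map_mem : ∀ {m n} (θ : m ⟶ n) (a : A.obj m), a ∈ ideal m → (A.map θ).hom a ∈ ideal n

variable (Λ)

/-- Artinian simplicial local `Λ`-algebras with the residue field of `Λ`: they satisfy the
descending chain condition on simplicial ideals, and every level is a local Artinian algebra. -/
structure IsArtinianSimplicial (A : SimplicialObject (CommAlgCat.{u} Λ)) : Prop where
  isLocalArtinian : ∀ n, IsLocalArtinian Λ (A.obj n)
  dcc : ∀ J : ℕ → SimplicialIdeal A, (∀ i n, (J (i + 1)).ideal n ≤ (J i).ideal n) →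
    ∃ N, ∀ i, N ≤ i → ∀ n, (J i).ideal n = (J N).ideal n

/-- The category of Artinian simplicial local `Λ`-algebras with the residue field of `Λ`. -/
abbrev SArt : Type (u + 1) :=
  ObjectProperty.FullSubcategory (C := SimplicialObject (CommAlgCat.{u} Λ)) (IsArtinianSimplicial Λ)

/-- The category of simplicial vector spaces over the residue field with finite-dimensional
normalisation. -/
abbrev SFDVect : Type (u + 1) :=
  ObjectProperty.FullSubcategory (C := SimplicialObject (ModuleCat.{u} (ResidueField Λ))) IsFD

section SqZero
variable (M : Type u) [AddCommGroup M] [Module (ResidueField Λ) M]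

/-- `k ⊕ M` with `M^2 = 0`. -/
def SqZero : Type u := TrivSqZeroExt (ResidueField Λ) M

/-- The right module structure. -/
@[reducible] def rightModule : Module (ResidueField Λ)ᵐᵒᵖ M :=
  Module.compHom M ((RingHom.id (ResidueField Λ)).fromOpposite fun _ _ => mul_comm _ _)

attribute [local instance] rightModule

lemma rightModule_central : IsCentralScalar (ResidueField Λ) M := ⟨fun _ _ => rfl⟩

attribute [local instance] rightModule_central

instance : CommRing (SqZero Λ M) := inferInstanceAs (CommRing (TrivSqZeroExt (ResidueField Λ) M))

instance : Algebra (ResidueField Λ) (SqZero Λ M) :=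
  inferInstanceAs (Algebra (ResidueField Λ) (TrivSqZeroExt (ResidueField Λ) M))

instance : Algebra Λ (SqZero Λ M) := Algebra.compHom _ (algebraMap Λ (ResidueField Λ))

variable {Λ M}

/-- The element `a + v`. -/
def SqZero.mk (a : ResidueField Λ) (v : M) : SqZero Λ M := (a, v)

def SqZero.fst (x : SqZero Λ M) : ResidueField Λ := TrivSqZeroExt.fst x
def SqZero.snd (x : SqZero Λ M) : M := TrivSqZeroExt.snd x

@[ext] lemma SqZero.ext {x y : SqZero Λ M} (h1 : x.fst = y.fst) (h2 : x.snd = y.snd) : x = y :=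
  TrivSqZeroExt.ext h1 h2

@[simp] lemma SqZero.fst_mk (a : ResidueField Λ) (v : M) : (SqZero.mk a v).fst = a := rfl
@[simp] lemma SqZero.snd_mk (a : ResidueField Λ) (v : M) : (SqZero.mk a v).snd = v := rfl
@[simp] lemma SqZero.fst_zero : (0 : SqZero Λ M).fst = 0 := rfl
@[simp] lemma SqZero.snd_zero : (0 : SqZero Λ M).snd = 0 := rfl
@[simp] lemma SqZero.fst_one : (1 : SqZero Λ M).fst = 1 := rfl
@[simp] lemma SqZero.snd_one : (1 : SqZero Λ M).snd = 0 := rfl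
@[simp] lemma SqZero.fst_add (x y : SqZero Λ M) : (x + y).fst = x.fst + y.fst := rfl
@[simp] lemma SqZero.snd_add (x y : SqZero Λ M) : (x + y).snd = x.snd + y.snd := rfl
@[simp] lemma SqZero.fst_sub (x y : SqZero Λ M) : (x - y).fst = x.fst - y.fst := rfl
@[simp] lemma SqZero.fst_mul (x y : SqZero Λ M) : (x * y).fst = x.fst * y.fst := rfl
@[simp] lemma SqZero.snd_mul (x y : SqZero Λ M) : (x * y).snd = x.fst • y.snd + y.fst • x.snd := rfl
@[simp] lemma SqZero.fst_algebraMap (l : Λ) :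
    (algebraMap Λ (SqZero Λ M) l).fst = algebraMap Λ (ResidueField Λ) l := rfl
@[simp] lemma SqZero.snd_algebraMap (l : Λ) : (algebraMap Λ (SqZero Λ M) l).snd = 0 := rfl

lemma SqZero.isUnit_iff (x : SqZero Λ M) : IsUnit x ↔ x.fst ≠ 0 := by
  constructor
  · intro h h0
    obtain ⟨y, hy⟩ := h.exists_right_inv
    simpa [h0] using congrArg SqZero.fst hy
  · intro h
    refine IsUnit.of_mul_eq_one (SqZero.mk x.fst⁻¹ (-(x.fst⁻¹ * x.fst⁻¹) • x.snd)) ?_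
    ext
    · simp [h]
    · simp [smul_smul, mul_inv_cancel_left₀ h]

variable {M' : Type u} [AddCommGroup M'] [Module (ResidueField Λ) M']

def SqZero.map (f : M →ₗ[ResidueField Λ] M') : SqZero Λ M →ₐ[Λ] SqZero Λ M' where
  toFun x := SqZero.mk x.fst (f x.snd)
  map_one' := by ext <;> simp
  map_zero' := by ext <;> simp
  map_add' x y := by ext <;> simp
  map_mul' x y := by ext <;> simp
  commutes' l := by ext <;> simp

@[simp] lemma SqZero.fst_map (f : M →ₗ[ResidueField Λ] M') (x : SqZero Λ M) :
  (SqZero.map f x).fst = x.fst := rfl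
@[simp] lemma SqZero.snd_map (f : M →ₗ[ResidueField Λ] M') (x : SqZero Λ M) :
  (SqZero.map f x).snd = f x.snd := rfl

lemma SqZero.isLocalRing : IsLocalRing (SqZero Λ M) := by
  have : Nontrivial (SqZero Λ M) := ⟨0, 1, fun h => zero_ne_one (congrArg SqZero.fst h)⟩
  refine IsLocalRing.of_nonunits_add fun a b ha hb => ?_
  simp only [mem_nonunits_iff, SqZero.isUnit_iff, not_not, SqZero.fst_add] at *
  simp [ha, hb]

lemma SqZero.isLocalArtinian [Module.Finite (ResidueField Λ) M] :
    IsLocalArtinian Λ (CommAlgCat.of Λ (SqZero Λ M)) where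
  isLocalRing := SqZero.isLocalRing
  isArtinianRing := by
    have : Module.Finite (ResidueField Λ) (SqZero Λ M) :=
      inferInstanceAs (Module.Finite (ResidueField Λ) (ResidueField Λ × M))
    exact IsArtinianRing.of_finite (ResidueField Λ) (SqZero Λ M)
  residue_surjective := by
    have := SqZero.isLocalRing (Λ := Λ) (M := M)
    intro y
    obtain ⟨x, rfl⟩ := residue_surjective y
    obtain ⟨l, hl⟩ := residue_surjective (R := Λ) x.fst
    refine ⟨l, ?_⟩
    change residue (SqZero Λ M) (algebraMap Λ _ l) = residue (SqZero Λ M) x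
    rw [← sub_eq_zero, ← map_sub, residue_eq_zero_iff, mem_maximalIdeal, mem_nonunits_iff,
      SqZero.isUnit_iff, not_not]
    rw [SqZero.fst_sub, SqZero.fst_algebraMap, sub_eq_zero, ← hl]
    rfl

end SqZero

variable {Λ}

/-- The simplicial algebra `k ⊕ V` with `V² = 0`. -/
def sqZeroObj (V : SimplicialObject (ModuleCat.{u} (ResidueField Λ))) :
    SimplicialObject (CommAlgCat.{u} Λ) where
  obj n := CommAlgCat.of Λ (SqZero Λ (V.obj n))
  map θ := CommAlgCat.ofHom (SqZero.map (V.map θ).hom)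
  map_id n := by
    ext x : 2
    apply SqZero.ext <;> simp
  map_comp a b := by
    ext x : 2
    apply SqZero.ext <;> simp

lemma isArtinianSimplicial_sqZeroObj {V : SimplicialObject (ModuleCat.{u} (ResidueField Λ))}
    (hV : IsFD V) : IsArtinianSimplicial Λ (sqZeroObj V) where
  isLocalArtinian n := by
    obtain ⟨⟨n⟩⟩ := n
    have := finite_of_isFD hV n
    exact SqZero.isLocalArtinian
  dcc J hJ := by
    have hmono : ∀ i i', i ≤ i' → ∀ n, (J i').ideal n ≤ (J i).ideal n := fun i i' h n =>
      antitone_nat_of_succ_le (f := fun i => (J i).ideal n) (fun i => hJ i n) h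
    let P : ℕ → ∀ n, Submodule (ResidueField Λ) (V.obj n) := fun i n =>
      { carrier := {v | (SqZero.mk 0 v : SqZero Λ (V.obj n)) ∈ (J i).ideal n}
        zero_mem' := ((J i).ideal n).zero_mem
        add_mem' := fun {v w} hv hw => by
          have := ((J i).ideal n).add_mem hv hw
          have e : (SqZero.mk 0 v + SqZero.mk 0 w : SqZero Λ (V.obj n)) = SqZero.mk 0 (v + w) :=
            SqZero.ext (add_zero (0 : ResidueField Λ)) rfl
          exact (congrArg (· ∈ (J i).ideal n) e).mp this
        smul_mem' := fun c v hv => by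
          have := ((J i).ideal n).mul_mem_left (SqZero.mk c 0 : SqZero Λ (V.obj n)) hv
          have e : (SqZero.mk c 0 * SqZero.mk 0 v : SqZero Λ (V.obj n)) = SqZero.mk 0 (c • v) := by
            apply SqZero.ext <;> simp
          exact (congrArg (· ∈ (J i).ideal n) e).mp this }
    have hP : ∀ (i) {m n} (θ : m ⟶ n), ∀ x ∈ P i m, (V.map θ).hom x ∈ P i n :=
      fun i m n θ x hx => (J i).map_mem θ _ hx
    obtain ⟨N, hN⟩ := dcc_of_isFD hV P hP (fun i n v hv => hJ i n hv)
    by_cases h : ∀ i, (1 : (sqZeroObj V).obj (op (.mk 0))) ∈ (J i).ideal (op (.mk 0))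
    · refine ⟨0, fun i _ n => ?_⟩
      have h1 : ∀ i, (J i).ideal n = ⊤ := fun i => by
        rw [Ideal.eq_top_iff_one]
        have := (J i).map_mem (n := n) (SimplexCategory.const n.unop (.mk 0) 0).op _ (h i)
        rwa [map_one] at this
      rw [h1, h1]
    · push Not at h
      obtain ⟨i₀, hi₀⟩ := h
      have h2 : ∀ i, i₀ ≤ i → ∀ n (x : SqZero Λ (V.obj n)),
          x ∈ (J i).ideal n ↔ x.fst = 0 ∧ x.snd ∈ P i n := by
        intro i hi n x
        have h3 : x ∈ (J i).ideal n → x.fst = 0 := by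
          intro hx
          by_contra hu
          have hu' : IsUnit x := (SqZero.isUnit_iff x).2 hu
          have h4 := Ideal.eq_top_of_isUnit_mem _ hx hu'
          have h5 : (1 : (sqZeroObj V).obj n) ∈ (J i).ideal n := by rw [h4]; trivial
          have h6 := (J i).map_mem (n := op (.mk 0)) (SimplexCategory.const (.mk 0) n.unop 0).op _ h5
          rw [map_one] at h6
          exact hi₀ (hmono _ _ hi _ h6)
        have h7 : x.fst = 0 → x = SqZero.mk 0 x.snd := fun h => SqZero.ext h rfl
        constructor
        · intro hx
          exact ⟨h3 hx, (congrArg (· ∈ (J i).ideal n) (h7 (h3 hx))).mp hx⟩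
        · rintro ⟨h8, h9⟩
          exact (congrArg (· ∈ (J i).ideal n) (h7 h8)).mpr h9
      refine ⟨max N i₀, fun i hi n => Ideal.ext fun x => ?_⟩
      refine (h2 i (le_trans (le_max_right _ _) hi) n x).trans (Iff.trans ?_ (h2 _ (le_max_right _ _) n x).symm)
      rw [hN i (le_trans (le_max_left _ _) hi), hN _ (le_max_left N i₀)]

variable (Λ)

/-- The functor `V ↦ k ⊕ V`. -/
def sqZero : SFDVect Λ ⥤ SArt Λ where
  obj V := ⟨sqZeroObj V.obj, isArtinianSimplicial_sqZeroObj V.property⟩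
  map f := ObjectProperty.homMk
    { app := fun n => CommAlgCat.ofHom (SqZero.map (f.hom.app n).hom)
      naturality := fun m n θ => by
        ext x : 2
        apply SqZero.ext
        · rfl
        · exact ConcreteCategory.congr_hom (f.hom.naturality θ) x.snd }
  map_id V := by
    ext n x : 5
    apply SqZero.ext <;> rfl
  map_comp f g := by
    ext n x : 5
    apply SqZero.ext <;> rfl

variable {Λ}

/-- Any two maps to `k` agree. -/
lemma algHom_residue_unique {A : CommAlgCat.{u} Λ} (hA : IsLocalArtinian Λ A)
    (f g : A →ₐ[Λ] ResidueField Λ) : f = g := by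
  have := hA.isLocalRing
  have key : ∀ (h : A →ₐ[Λ] ResidueField Λ) (a : A), a ∈ maximalIdeal A → h a = 0 := by
    intro h a ha
    have hs : Function.Surjective (h : A →+* ResidueField Λ) := fun y => by
      obtain ⟨l, rfl⟩ := residue_surjective y
      exact ⟨algebraMap Λ A l, h.commutes l⟩
    have hm := RingHom.ker_isMaximal_of_surjective (h : A →+* ResidueField Λ) hs
    have := eq_maximalIdeal hm
    rw [← this] at ha
    exact ha
  ext a
  obtain ⟨l, hl⟩ := hA.residue_surjective (residue A a)
  have h1 : a - algebraMap Λ A l ∈ maximalIdeal A := by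
    rw [← residue_eq_zero_iff, map_sub, sub_eq_zero]
    exact hl.symm
  have h2 := key f _ h1
  have h3 := key g _ h1
  rw [map_sub, sub_eq_zero] at h2 h3
  rw [h2, h3, f.commutes, g.commutes]

lemma exists_algHom_residue {A : CommAlgCat.{u} Λ} (hA : IsLocalArtinian Λ A) :
    Nonempty (A →ₐ[Λ] ResidueField Λ) := by
  have := hA.isLocalRing
  have hmax := RingHom.ker_isMaximal_of_surjective _ hA.residue_surjective
  have hker := eq_maximalIdeal hmax
  let e := RingHom.quotientKerEquivOfSurjective hA.residue_surjective
  let e2 : ResidueField Λ ≃+* ResidueField A :=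
    (Ideal.quotEquivOfEq hker.symm).trans e
  have he2 : ∀ l, e2 (residue Λ l) = residue A (algebraMap Λ A l) := fun l => rfl
  refine ⟨{ (e2.symm : ResidueField A →+* ResidueField Λ).comp (residue A) with
    commutes' := fun l => ?_ }⟩
  change e2.symm (residue A (algebraMap Λ A l)) = residue Λ l
  rw [← he2, RingEquiv.symm_apply_apply]

/-- Morphisms from levelwise linear maps. -/
def homOfLinear {V W : SFDVect Λ} (f : ∀ n, V.obj.obj n →ₗ[ResidueField Λ] W.obj.obj n)
    (hf : ∀ {m n} (θ : m ⟶ n) x, f n ((V.obj.map θ).hom x) = (W.obj.map θ).hom (f m x)) : V ⟶ W :=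
  ObjectProperty.homMk { app := fun n => ModuleCat.ofHom (f n),
                         naturality := fun m n θ => by ext x; exact hf θ x }

lemma SFDVect.hom_ext {V W : SFDVect Λ} {f g : V ⟶ W} (h : ∀ n (x : V.obj.obj n),
    (f.hom.app n).hom x = (g.hom.app n).hom x) : f = g := by
  ext n x
  exact h n x

lemma SArt.hom_ext {A B : SArt Λ} {f g : A ⟶ B} (h : ∀ n (x : A.obj.obj n),
    (f.hom.app n).hom x = (g.hom.app n).hom x) : f = g := by
  ext n x
  exact h n x

/-- The levelwise product of simplicial vector spaces. -/
def prodObj {K : Type u} [Field K] (V W : SimplicialObject (ModuleCat.{u} K)) :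
    SimplicialObject (ModuleCat.{u} K) where
  obj n := ModuleCat.of K (V.obj n × W.obj n)
  map θ := ModuleCat.ofHom (LinearMap.prodMap (V.map θ).hom (W.map θ).hom)
  map_id n := by ext x <;> simp
  map_comp a b := by ext x <;> simp

lemma isFD_prodObj {K : Type u} [Field K] {V W : SimplicialObject (ModuleCat.{u} K)}
    (hV : IsFD V) (hW : IsFD W) : IsFD (prodObj V W) := by
  have fV := finite_of_isFD hV
  have fW := finite_of_isFD hW
  obtain ⟨-, p, hp⟩ := (isFD_iff _).1 hV
  obtain ⟨-, q, hq⟩ := (isFD_iff _).1 hW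
  rw [isFD_iff]
  refine ⟨fun n => ?_, p + q, fun n hn => ?_⟩
  · have := fV n
    have := fW n
    have : Module.Finite K ((prodObj V W).obj (op (.mk n))) :=
      inferInstanceAs (Module.Finite K (V.obj (op (.mk n)) × W.obj (op (.mk n))))
    infer_instance
  · obtain ⟨n, rfl⟩ : ∃ n', n = n' + 1 := ⟨n - 1, by omega⟩
    rw [eq_bot_iff]
    intro x hx
    simp only [normSub, Submodule.mem_iInf, LinearMap.mem_ker] at hx
    have h1 : x.1 ∈ normSub V (n+1) := by
      simp only [normSub, Submodule.mem_iInf, LinearMap.mem_ker]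
      exact fun i => congrArg Prod.fst (hx i)
    have h2 : x.2 ∈ normSub W (n+1) := by
      simp only [normSub, Submodule.mem_iInf, LinearMap.mem_ker]
      exact fun i => congrArg Prod.snd (hx i)
    rw [hp _ (by omega), Submodule.mem_bot] at h1
    rw [hq _ (by omega), Submodule.mem_bot] at h2
    exact (Submodule.mem_bot _).2 (Prod.ext h1 h2)

/-- The product of two simplicial vector spaces. -/
def SFDVect.prod (V W : SFDVect Λ) : SFDVect Λ :=
  ⟨prodObj V.obj W.obj, isFD_prodObj V.property W.property⟩

def SFDVect.fst (V W : SFDVect Λ) : SFDVect.prod V W ⟶ V :=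
  homOfLinear (fun _ => LinearMap.fst _ _ _) (fun _ _ => rfl)

def SFDVect.snd (V W : SFDVect Λ) : SFDVect.prod V W ⟶ W :=
  homOfLinear (fun _ => LinearMap.snd _ _ _) (fun _ _ => rfl)

def SFDVect.lift {X V W : SFDVect Λ} (a : X ⟶ V) (b : X ⟶ W) : X ⟶ SFDVect.prod V W :=
  homOfLinear (fun n => LinearMap.prod (a.hom.app n).hom (b.hom.app n).hom) (fun θ x =>
    Prod.ext (ConcreteCategory.congr_hom (a.hom.naturality θ) x)
      (ConcreteCategory.congr_hom (b.hom.naturality θ) x))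

def zeroObj (K : Type u) [Field K] : SimplicialObject (ModuleCat.{u} K) where
  obj _ := ModuleCat.of K PUnit
  map _ := 𝟙 _

lemma isFD_zeroObj (K : Type u) [Field K] : IsFD (zeroObj K) := by
  have : ∀ n, Subsingleton ((zeroObj K).obj n) := fun _ => inferInstanceAs (Subsingleton PUnit)
  rw [isFD_iff]
  exact ⟨fun n => inferInstance, 0, fun n hn => Subsingleton.elim _ _⟩

def SFDVect.zero (Λ : Type u) [CommRing Λ] [IsLocalRing Λ] : SFDVect Λ :=
  ⟨zeroObj _, isFD_zeroObj _⟩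

/-- The sum of two morphisms. -/
def SFDVect.addHom {X V : SFDVect Λ} (a b : X ⟶ V) : X ⟶ V :=
  homOfLinear (fun n => (a.hom.app n).hom + (b.hom.app n).hom) (fun θ x => by
    have h1 := ConcreteCategory.congr_hom (a.hom.naturality θ) x
    have h2 := ConcreteCategory.congr_hom (b.hom.naturality θ) x
    rw [LinearMap.add_apply, LinearMap.add_apply, map_add]
    exact congrArg₂ (· + ·) h1 h2)

/-- Multiplication by a scalar. -/
def SFDVect.smulHom (V : SFDVect Λ) (c : ResidueField Λ) : V ⟶ V :=
  homOfLinear (fun n => c • LinearMap.id) (fun θ x => by simp)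

/-- The zero morphism. -/
def SFDVect.zeroHom (V W : SFDVect Λ) : V ⟶ W :=
  homOfLinear (fun n => 0) (fun θ x => by simp)

/-- The projection to `k`. -/
def SqZero.fstHom (M : Type u) [AddCommGroup M] [Module (ResidueField Λ) M] :
    SqZero Λ M →ₐ[Λ] ResidueField Λ where
  toFun := SqZero.fst
  map_one' := rfl
  map_zero' := rfl
  map_mul' _ _ := rfl
  map_add' _ _ := rfl
  commutes' _ := rfl

lemma fst_unique {X : SArt Λ} {V W : SFDVect Λ} (f : X ⟶ (sqZero Λ).obj V)
    (g : X ⟶ (sqZero Λ).obj W) (n) (x : X.obj.obj n) :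
    SqZero.fst ((f.hom.app n).hom x) = SqZero.fst ((g.hom.app n).hom x) :=
  DFunLike.congr_fun (algHom_residue_unique (X.property.isLocalArtinian n)
      ((SqZero.fstHom _).comp (f.hom.app n).hom) ((SqZero.fstHom _).comp (g.hom.app n).hom)) x

/-- The map `X_n → k ⊕ (V_n × W_n)` induced by maps to `k ⊕ V` and `k ⊕ W`. -/
def pairHom {X : SArt Λ} {V W : SFDVect Λ} (f : X ⟶ (sqZero Λ).obj V) (g : X ⟶ (sqZero Λ).obj W)
    (n : SimplexCategoryᵒᵖ) : X.obj.obj n →ₐ[Λ] SqZero Λ (V.obj.obj n × W.obj.obj n) where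
  toFun x := SqZero.mk (SqZero.fst ((f.hom.app n).hom x))
    (SqZero.snd ((f.hom.app n).hom x), SqZero.snd ((g.hom.app n).hom x))
  map_one' := by
    simp only [map_one]
    rfl
  map_zero' := by
    simp only [map_zero]
    rfl
  map_add' x y := by
    simp only [map_add]
    rfl
  map_mul' x y := by
    simp only [map_mul]
    refine SqZero.ext rfl (Prod.ext rfl ?_)
    refine (SqZero.snd_mul _ _).trans ?_
    rw [← fst_unique f g, ← fst_unique f g]
    rfl
  commutes' l := by
    simp only [AlgHom.commutes]
    rfl

lemma pairHom_naturality {X : SArt Λ} {V W : SFDVect Λ} (f : X ⟶ (sqZero Λ).obj V)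
    (g : X ⟶ (sqZero Λ).obj W) {m n : SimplexCategoryᵒᵖ} (θ : m ⟶ n) (x : X.obj.obj m) :
    pairHom f g n ((X.obj.map θ).hom x) =
      SqZero.map ((SFDVect.prod V W).obj.map θ).hom (pairHom f g m x) := by
  have h1 : (f.hom.app n).hom ((X.obj.map θ).hom x) =
      SqZero.map (V.obj.map θ).hom ((f.hom.app m).hom x) :=
    ConcreteCategory.congr_hom (f.hom.naturality θ) x
  have h2 : (g.hom.app n).hom ((X.obj.map θ).hom x) =
      SqZero.map (W.obj.map θ).hom ((g.hom.app m).hom x) :=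
    ConcreteCategory.congr_hom (g.hom.naturality θ) x
  have e1 : SqZero.fst ((f.hom.app n).hom ((X.obj.map θ).hom x)) =
      SqZero.fst ((f.hom.app m).hom x) := by rw [h1]; rfl
  have e2 : SqZero.snd ((f.hom.app n).hom ((X.obj.map θ).hom x)) =
      (V.obj.map θ).hom (SqZero.snd ((f.hom.app m).hom x)) := by rw [h1]; rfl
  have e3 : SqZero.snd ((g.hom.app n).hom ((X.obj.map θ).hom x)) =
      (W.obj.map θ).hom (SqZero.snd ((g.hom.app m).hom x)) := by rw [h2]; rfl
  exact SqZero.ext e1 (Prod.ext e2 e3)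

/-- The map into the product induced by `pairHom`. -/
def pairMor {X : SArt Λ} {V W : SFDVect Λ} (f : X ⟶ (sqZero Λ).obj V)
    (g : X ⟶ (sqZero Λ).obj W) : X ⟶ (sqZero Λ).obj (SFDVect.prod V W) :=
  ObjectProperty.homMk
    { app := fun n => CommAlgCat.ofHom (pairHom f g n)
      naturality := fun m n θ => by
        ext x : 2
        exact pairHom_naturality f g θ x }

lemma pairMor_fst {X : SArt Λ} {V W : SFDVect Λ} (f : X ⟶ (sqZero Λ).obj V)
    (g : X ⟶ (sqZero Λ).obj W) : pairMor f g ≫ (sqZero Λ).map (SFDVect.fst V W) = f :=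
  SArt.hom_ext fun _ _ => SqZero.ext rfl rfl

lemma pairMor_snd {X : SArt Λ} {V W : SFDVect Λ} (f : X ⟶ (sqZero Λ).obj V)
    (g : X ⟶ (sqZero Λ).obj W) : pairMor f g ≫ (sqZero Λ).map (SFDVect.snd V W) = g :=
  SArt.hom_ext fun n x => SqZero.ext (fst_unique f g n x) rfl

lemma pairMor_unique {X : SArt Λ} {V W : SFDVect Λ} (m m' : X ⟶ (sqZero Λ).obj (SFDVect.prod V W))
    (h1 : m ≫ (sqZero Λ).map (SFDVect.fst V W) = m' ≫ (sqZero Λ).map (SFDVect.fst V W))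
    (h2 : m ≫ (sqZero Λ).map (SFDVect.snd V W) = m' ≫ (sqZero Λ).map (SFDVect.snd V W)) :
    m = m' :=
  SArt.hom_ext fun n x => by
    have e1 : SqZero.map (LinearMap.fst (ResidueField Λ) (V.obj.obj n) (W.obj.obj n))
        ((m.hom.app n).hom x) = SqZero.map (LinearMap.fst (ResidueField Λ) (V.obj.obj n)
          (W.obj.obj n)) ((m'.hom.app n).hom x) :=
      congrArg (fun f : X ⟶ (sqZero Λ).obj V => (f.hom.app n).hom x) h1
    have e2 : SqZero.map (LinearMap.snd (ResidueField Λ) (V.obj.obj n) (W.obj.obj n))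
        ((m.hom.app n).hom x) = SqZero.map (LinearMap.snd (ResidueField Λ) (V.obj.obj n)
          (W.obj.obj n)) ((m'.hom.app n).hom x) :=
      congrArg (fun f : X ⟶ (sqZero Λ).obj W => (f.hom.app n).hom x) h2
    have d1 := congrArg SqZero.fst e1
    have d2 := congrArg SqZero.snd e1
    have d3 := congrArg SqZero.snd e2
    exact SqZero.ext d1 (Prod.ext d2 d3)

/-- `k ⊕ (V × W)` is the product of `k ⊕ V` and `k ⊕ W`. -/
def isLimitSqZeroProd (V W : SFDVect Λ) :
    IsLimit (BinaryFan.mk ((sqZero Λ).map (SFDVect.fst V W)) ((sqZero Λ).map (SFDVect.snd V W))) :=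
  BinaryFan.isLimitMk (fun s => pairMor s.fst s.snd) (fun s => pairMor_fst _ _)
    (fun s => pairMor_snd _ _) (fun s m h1 h2 => pairMor_unique _ _
      (h1.trans (pairMor_fst _ _).symm) (h2.trans (pairMor_snd _ _).symm))

/-- The map `X_n → k ⊕ 0`. -/
def toZeroHom (X : SArt Λ) (n : SimplexCategoryᵒᵖ) : X.obj.obj n →ₐ[Λ] SqZero Λ PUnit.{u+1} where
  toFun x := SqZero.mk ((exists_algHom_residue (X.property.isLocalArtinian n)).some x) PUnit.unit
  map_one' := SqZero.ext (map_one _) rfl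
  map_zero' := SqZero.ext (map_zero _) rfl
  map_add' _ _ := SqZero.ext (map_add _ _ _) rfl
  map_mul' _ _ := SqZero.ext (map_mul _ _ _) rfl
  commutes' l := SqZero.ext (AlgHom.commutes _ _) rfl

def isTerminalSqZeroZero : IsTerminal ((sqZero Λ).obj (SFDVect.zero Λ)) :=
  IsTerminal.ofUniqueHom (fun X => ObjectProperty.homMk
    { app := fun n => CommAlgCat.ofHom (toZeroHom X n)
      naturality := fun m n θ => by
        ext x : 2
        refine SqZero.ext ?_ rfl
        exact DFunLike.congr_fun (algHom_residue_unique (X.property.isLocalArtinian m)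
          ((exists_algHom_residue (X.property.isLocalArtinian n)).some.comp (X.obj.map θ).hom) _) x })
    (fun X f => SArt.hom_ext fun n x => SqZero.ext (fst_unique f _ n x) rfl)

end Artinian

section Tangent
variable {Λ : Type u} [CommRing Λ] [IsLocalRing Λ]

/-- The tangent space `H(k ⊕ V)` of a set-valued functor. -/
def Tan (H : SArt Λ ⥤ Type u) (V : SFDVect Λ) : Type u := H.obj ((sqZero Λ).obj V)

/-- The functoriality of the tangent space in `V`. -/
def Tan.map (H : SArt Λ ⥤ Type u) {V W : SFDVect Λ} (a : V ⟶ W) (x : Tan H V) : Tan H W :=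
  H.map ((sqZero Λ).map a) x

lemma Tan.map_comp (H : SArt Λ ⥤ Type u) {V W X : SFDVect Λ} (a : V ⟶ W) (b : W ⟶ X)
    (x : Tan H V) : Tan.map H (a ≫ b) x = Tan.map H b (Tan.map H a x) := by
  unfold Tan.map
  rw [(sqZero Λ).map_comp, H.map_comp]
  rfl

lemma Tan.map_id (H : SArt Λ ⥤ Type u) {V : SFDVect Λ} (x : Tan H V) :
    Tan.map H (𝟙 V) x = x := by
  unfold Tan.map
  rw [(sqZero Λ).map_id, H.map_id]
  rfl

section
variable (H : SArt Λ ⥤ Type u) [PreservesFiniteLimits H]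

lemma Tan.exists_pair {V W : SFDVect Λ} (x : Tan H V) (y : Tan H W) :
    ∃ z : Tan H (SFDVect.prod V W), Tan.map H (SFDVect.fst V W) z = x ∧
      Tan.map H (SFDVect.snd V W) z = y := by
  let l := mapIsLimitOfPreservesOfIsLimit H _ _ (isLimitSqZeroProd V W)
  obtain ⟨f, h1, h2⟩ := (BinaryFan.IsLimit.lift' l
    (↾(fun _ : PUnit.{u + 1} => x)) (↾(fun _ : PUnit.{u + 1} => y)))
  exact ⟨f PUnit.unit, ConcreteCategory.congr_hom h1 PUnit.unit,
    ConcreteCategory.congr_hom h2 PUnit.unit⟩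

lemma Tan.pair_ext {V W : SFDVect Λ} (z z' : Tan H (SFDVect.prod V W))
    (h1 : Tan.map H (SFDVect.fst V W) z = Tan.map H (SFDVect.fst V W) z')
    (h2 : Tan.map H (SFDVect.snd V W) z = Tan.map H (SFDVect.snd V W) z') : z = z' := by
  let l := mapIsLimitOfPreservesOfIsLimit H _ _ (isLimitSqZeroProd V W)
  have := BinaryFan.IsLimit.hom_ext l (f := ↾(fun _ : PUnit.{u + 1} => z))
    (g := ↾(fun _ : PUnit.{u + 1} => z')) (by ext; exact h1) (by ext; exact h2)
  exact ConcreteCategory.congr_hom this PUnit.unit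

lemma Tan.zero_unique : ∃ o : Tan H (SFDVect.zero Λ), ∀ x, x = o := by
  let l := IsTerminal.isTerminalObj H _ (isTerminalSqZeroZero (Λ := Λ))
  refine ⟨l.from PUnit.{u + 1} PUnit.unit, fun x => ?_⟩
  exact ConcreteCategory.congr_hom (l.hom_ext (↾(fun _ : PUnit.{u + 1} => x)) (l.from PUnit))
    PUnit.unit

variable {H}

/-- The sum is induced by the addition `V × V → V`, through `H(k ⊕ (V × V)) = H(k ⊕ V)²`. -/
instance (V : SFDVect Λ) : Add (Tan H V) :=
  ⟨fun x y => Tan.map H (SFDVect.addHom (SFDVect.fst V V) (SFDVect.snd V V))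
    (Tan.exists_pair H x y).choose⟩

/-- The scalar `c` acts through the endomorphism `c` of `V`. -/
instance (V : SFDVect Λ) : SMul (ResidueField Λ) (Tan H V) :=
  ⟨fun c x => Tan.map H (SFDVect.smulHom V c) x⟩

instance (V : SFDVect Λ) : Neg (Tan H V) := ⟨fun x => (-1 : ResidueField Λ) • x⟩

instance (V : SFDVect Λ) : Zero (Tan H V) :=
  ⟨Tan.map H (SFDVect.zeroHom _ V) (Tan.zero_unique H).choose⟩

lemma Tan.add_map {X V : SFDVect Λ} (a b : X ⟶ V) (w : Tan H X) :
    Tan.map H a w + Tan.map H b w = Tan.map H (SFDVect.addHom a b) w := by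
  have hs := (Tan.exists_pair H (Tan.map H a w) (Tan.map H b w)).choose_spec
  have : (Tan.exists_pair H (Tan.map H a w) (Tan.map H b w)).choose =
      Tan.map H (SFDVect.lift a b) w := by
    refine Tan.pair_ext H _ _ (hs.1.trans ?_) (hs.2.trans ?_)
    · rw [← Tan.map_comp]; rfl
    · rw [← Tan.map_comp]; rfl
  refine (congrArg (Tan.map H _) this).trans ?_
  rw [← Tan.map_comp]
  rfl

lemma Tan.zero_map {X V : SFDVect Λ} (w : Tan H X) :
    Tan.map H (SFDVect.zeroHom X V) w = 0 := by
  have e : SFDVect.zeroHom X V =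
    SFDVect.zeroHom X (SFDVect.zero Λ) ≫ SFDVect.zeroHom (SFDVect.zero Λ) V := rfl
  rw [e, Tan.map_comp]
  exact congrArg _ ((Tan.zero_unique H).choose_spec _)

lemma Tan.smul_def {V : SFDVect Λ} (c : ResidueField Λ) (x : Tan H V) :
    c • x = Tan.map H (SFDVect.smulHom V c) x := rfl

lemma Tan.map_add {V W : SFDVect Λ} (a : V ⟶ W) (x y : Tan H V) :
    Tan.map H a (x + y) = Tan.map H a x + Tan.map H a y := by
  obtain ⟨z, rfl, rfl⟩ := Tan.exists_pair H x y
  rw [Tan.add_map, ← Tan.map_comp, ← Tan.map_comp, ← Tan.map_comp, Tan.add_map]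
  congr 1
  exact SFDVect.hom_ext fun n x => LinearMap.map_add (a.hom.app n).hom _ _

lemma Tan.map_smul {V W : SFDVect Λ} (a : V ⟶ W) (c : ResidueField Λ) (x : Tan H V) :
    Tan.map H a (c • x) = c • Tan.map H a x := by
  rw [Tan.smul_def, Tan.smul_def, ← Tan.map_comp, ← Tan.map_comp]
  congr 1
  exact SFDVect.hom_ext fun n x => LinearMap.map_smul (a.hom.app n).hom _ _

instance (V : SFDVect Λ) : AddCommGroup (Tan H V) where
  add_assoc x y z := by
    obtain ⟨w, hx, rfl⟩ := Tan.exists_pair H x z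
    obtain ⟨w', rfl, rfl⟩ := Tan.exists_pair H y w
    subst hx
    simp only [← Tan.map_comp, Tan.add_map]
    congr 1
    exact SFDVect.hom_ext fun n x => add_assoc _ _ _
  zero_add x := by
    have e := Tan.add_map (SFDVect.zeroHom V V) (𝟙 V) x
    rw [Tan.zero_map, Tan.map_id] at e
    rw [e]
    nth_rewrite 2 [← Tan.map_id H x]
    congr 1
    exact SFDVect.hom_ext fun n x => zero_add _
  add_zero x := by
    have e := Tan.add_map (𝟙 V) (SFDVect.zeroHom V V) x
    rw [Tan.zero_map, Tan.map_id] at e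
    rw [e]
    nth_rewrite 2 [← Tan.map_id H x]
    congr 1
    exact SFDVect.hom_ext fun n x => add_zero _
  nsmul := nsmulRec
  zsmul := zsmulRec
  neg_add_cancel x := by
    change (-1 : ResidueField Λ) • x + x = 0
    rw [← Tan.zero_map x, Tan.smul_def]
    nth_rewrite 2 [← Tan.map_id H x]
    rw [Tan.add_map]
    congr 1
    exact SFDVect.hom_ext fun n x =>
      (congrArg (· + x) (neg_one_smul (ResidueField Λ) x)).trans (neg_add_cancel x)
  add_comm x y := by
    obtain ⟨z, rfl, rfl⟩ := Tan.exists_pair H x y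
    rw [Tan.add_map, Tan.add_map]
    congr 1
    exact SFDVect.hom_ext fun n x => add_comm _ _

instance (V : SFDVect Λ) : Module (ResidueField Λ) (Tan H V) where
  one_smul x := by
    rw [Tan.smul_def]
    nth_rewrite 2 [← Tan.map_id H x]
    congr 1
    exact SFDVect.hom_ext fun n x => one_smul _ x
  mul_smul c d x := by
    rw [Tan.smul_def, Tan.smul_def, Tan.smul_def, ← Tan.map_comp]
    congr 1
    exact SFDVect.hom_ext fun n x => mul_smul c d x
  smul_zero c := by
    change Tan.map H (SFDVect.smulHom V c) (Tan.map H (SFDVect.zeroHom _ V) _) = _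
    rw [← Tan.map_comp, ← Tan.zero_map (V := V) (Tan.zero_unique H).choose]
    congr 1
    exact SFDVect.hom_ext fun n x => smul_zero c
  smul_add c x y := by
    simp only [Tan.smul_def, Tan.map_add]
  add_smul c d x := by
    simp only [Tan.smul_def, Tan.add_map]
    congr 1
    exact SFDVect.hom_ext fun n x => add_smul c d x
  zero_smul x := by
    rw [← Tan.zero_map x, Tan.smul_def]
    congr 1
    exact SFDVect.hom_ext fun n x => zero_smul _ x

/-- A natural transformation induces linear maps on tangent spaces. -/
def Tan.natTrans {H H' : SArt Λ ⥤ Type u} [PreservesFiniteLimits H] [PreservesFiniteLimits H']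
    (τ : H ⟶ H') (V : SFDVect Λ) : Tan H V →ₗ[ResidueField Λ] Tan H' V :=
  have nat : ∀ {W X : SFDVect Λ} (a : W ⟶ X) (x : Tan H W),
      τ.app _ (Tan.map H a x) = Tan.map H' a (τ.app _ x) := fun a x =>
    ConcreteCategory.congr_hom (τ.naturality ((sqZero Λ).map a)) x
  { toFun := fun x => τ.app _ x
    map_add' := fun x y => by
      obtain ⟨z, rfl, rfl⟩ := Tan.exists_pair H x y
      rw [Tan.add_map, nat, nat, nat]
      exact (Tan.add_map (H := H') _ _ _).symm
    map_smul' := fun c x => nat _ x }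
end

/-- The set-valued functor of `n`-simplices. -/
abbrev level (F : SArt Λ ⥤ SSet.{u}) (n : SimplexCategoryᵒᵖ) : SArt Λ ⥤ Type u :=
  F ⋙ (evaluation SimplexCategoryᵒᵖ (Type u)).obj n

section
variable {F G : SArt Λ ⥤ SSet.{u}}

/-- The face and degeneracy maps between the functors of simplices. -/
abbrev levelMap (F : SArt Λ ⥤ SSet.{u}) {m n : SimplexCategoryᵒᵖ} (θ : m ⟶ n) :
    level F m ⟶ level F n :=
  Functor.whiskerLeft F ((evaluation SimplexCategoryᵒᵖ (Type u)).map θ)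

/-- The map of functors of `n`-simplices. -/
abbrev levelHom (α : F ⟶ G) (n : SimplexCategoryᵒᵖ) : level F n ⟶ level G n :=
  Functor.whiskerRight α ((evaluation SimplexCategoryᵒᵖ (Type u)).obj n)

variable [PreservesFiniteLimits F] [PreservesFiniteLimits G]

/-- The relative tangent space `tan(F/G)(V)`, the kernel of `tan F(V) → tan G(V)`. -/
def tangentRel (α : F ⟶ G) (V : SFDVect Λ) : SimplicialObject (ModuleCat.{u} (ResidueField Λ)) where
  obj n := ModuleCat.of _ (LinearMap.ker (Tan.natTrans (levelHom α n) V))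
  map {m n} θ := ModuleCat.ofHom ((Tan.natTrans (levelMap F θ) V).restrict fun x hx => by
    have e : Tan.natTrans (levelHom α n) V (Tan.natTrans (levelMap F θ) V x) =
        Tan.natTrans (levelMap G θ) V (Tan.natTrans (levelHom α m) V x) :=
      ConcreteCategory.congr_hom ((α.app _).naturality θ) x
    rw [LinearMap.mem_ker] at hx ⊢
    rw [e, hx, _root_.map_zero])
  map_id n := ModuleCat.hom_ext (LinearMap.ext fun
    (x : LinearMap.ker (Tan.natTrans (levelHom α n) V)) => by
      have h := ConcreteCategory.congr_hom ((F.obj ((sqZero Λ).obj V)).map_id n) x.1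
      exact Subtype.ext h)
  map_comp {m n p} a b := ModuleCat.hom_ext (LinearMap.ext fun
    (x : LinearMap.ker (Tan.natTrans (levelHom α m) V)) => by
      have h := ConcreteCategory.congr_hom ((F.obj ((sqZero Λ).obj V)).map_comp a b) x.1
      exact Subtype.ext h)
end
end Tangent

section SmallExt
variable {Λ : Type u} [CommRing Λ] [IsLocalRing Λ]

/-- A morphism of simplicial algebras is surjective when it is so in every level. -/
def IsSurjective {A B : SArt Λ} (f : A ⟶ B) : Prop :=
  ∀ n, Function.Surjective (f.hom.app n).hom

/-- The simplicial `Λ`-module underlying a simplicial `Λ`-algebra. -/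
abbrev underlyingModule : SArt Λ ⥤ SimplicialObject (ModuleCat.{u} Λ) :=
  ObjectProperty.ι _ ⋙ (SimplicialObject.whiskering _ _).obj
    (forget₂ (CommAlgCat.{u} Λ) (AlgCat.{u} Λ) ⋙ forget₂ (AlgCat.{u} Λ) (ModuleCat.{u} Λ))

/-- A morphism is acyclic when it induces isomorphisms on all homotopy groups, that is,
on the homology of the normalised complexes. -/
def IsAcyclic {A B : SArt Λ} (f : A ⟶ B) : Prop :=
  QuasiIso ((AlgebraicTopology.normalizedMooreComplex (ModuleCat.{u} Λ)).map
    (underlyingModule.map f))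

/-- A small extension `I → A → B`: a surjection `f : A → B` together with an identification
`incl` of `I` with the kernel of `f`, where this kernel is annihilated by the maximal ideals of
`A`. -/
structure SmallExtension (I : SimplicialObject (ModuleCat.{u} (ResidueField Λ))) {A B : SArt Λ}
    (f : A ⟶ B) where
  surjective : IsSurjective f
  incl : ∀ n, I.obj n →+ A.obj.obj n
  incl_smul : ∀ n (l : Λ) (v : I.obj n), incl n (residue Λ l • v) = l • incl n v
  incl_map : ∀ {m n : SimplexCategoryᵒᵖ} (θ : m ⟶ n) (v : I.obj m),
    incl n ((I.map θ).hom v) = (A.obj.map θ).hom (incl m v)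
  injective : ∀ n, Function.Injective (incl n)
  range_incl : ∀ n (a : A.obj.obj n), a ∈ Set.range (incl n) ↔ (f.hom.app n).hom a = 0
  mul_incl : ∀ n (a : A.obj.obj n) (v : I.obj n), a ∈ nonunits (A.obj.obj n) → a * incl n v = 0

namespace SmallExtension
variable {I : SimplicialObject (ModuleCat.{u} (ResidueField Λ))} {A B : SArt Λ} {f : A ⟶ B}

/-- Submodules of the kernel are ideals. -/
def toIdeal (e : SmallExtension I f) (n : SimplexCategoryᵒᵖ) (P : Submodule (ResidueField Λ) (I.obj n)) :
    Ideal (A.obj.obj n) where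
  carrier := e.incl n '' P
  zero_mem' := ⟨0, P.zero_mem, _root_.map_zero _⟩
  add_mem' := by
    rintro _ _ ⟨v, hv, rfl⟩ ⟨w, hw, rfl⟩
    exact ⟨v + w, P.add_mem hv hw, _root_.map_add _ _ _⟩
  smul_mem' := by
    rintro a _ ⟨v, hv, rfl⟩
    have hA := A.property.isLocalArtinian n
    have := hA.isLocalRing
    obtain ⟨l, hl⟩ := hA.residue_surjective (residue _ a)
    have h1 : a - algebraMap Λ _ l ∈ nonunits (A.obj.obj n) := by
      rw [← mem_maximalIdeal, ← residue_eq_zero_iff, map_sub, sub_eq_zero]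
      exact hl.symm
    refine ⟨residue Λ l • v, P.smul_mem _ hv, ?_⟩
    have h2 := e.mul_incl n _ v h1
    rw [sub_mul, sub_eq_zero] at h2
    rw [e.incl_smul, smul_eq_mul, h2, Algebra.smul_def]

lemma toIdeal_le_iff (e : SmallExtension I f) (n : SimplexCategoryᵒᵖ) (P Q : Submodule (ResidueField Λ) (I.obj n)) :
    e.toIdeal n P ≤ e.toIdeal n Q ↔ P ≤ Q := by
  constructor
  · intro h v hv
    obtain ⟨w, hw, hwv⟩ := h (⟨v, hv, rfl⟩ : e.incl n v ∈ e.toIdeal n P)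
    rwa [← e.injective n hwv]
  · rintro h _ ⟨v, hv, rfl⟩
    exact ⟨v, h hv, rfl⟩

lemma finite (e : SmallExtension I f) (n : SimplexCategoryᵒᵖ) : Module.Finite (ResidueField Λ) (I.obj n) := by
  have hA := (A.property.isLocalArtinian n).isArtinianRing
  have : IsArtinian (ResidueField Λ) (I.obj n) := by
    have h : WellFoundedLT (Ideal (A.obj.obj n)) := inferInstanceAs (IsArtinian _ _)
    exact StrictMono.wellFoundedLT (f := e.toIdeal n) fun P Q h =>
      lt_of_le_not_ge ((e.toIdeal_le_iff n P Q).2 h.le)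
        fun h' => h.not_ge ((e.toIdeal_le_iff n Q P).1 h')
  exact IsSemisimpleModule.finite_tfae.out 2 0 |>.1 this

/-- The subobject of `I` of elements whose faces of dimension at most `m` vanish. -/
def trunc (I : SimplicialObject (ModuleCat.{u} (ResidueField Λ))) (m : ℕ)
    (n : SimplexCategoryᵒᵖ) : Submodule (ResidueField Λ) (I.obj n) :=
  ⨅ (i : ℕ) (_ : i ≤ m) (θ : n ⟶ op (.mk i)), LinearMap.ker (I.map θ).hom

lemma mem_trunc (m : ℕ) (n : SimplexCategoryᵒᵖ) (v : I.obj n) :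
    v ∈ trunc I m n ↔ ∀ i, i ≤ m → ∀ θ : n ⟶ op (.mk i), (I.map θ).hom v = 0 := by
  simp [trunc, Submodule.mem_iInf]

lemma mem_trunc_of_faces (n : ℕ) (v : I.obj (op (.mk (n + 1))))
    (hv : ∀ j, (I.δ j).hom v = 0) : v ∈ trunc I n (op (.mk (n + 1))) := by
  rw [mem_trunc]
  intro i hi θ
  have hs : ¬ Function.Surjective θ.unop.toOrderHom := by
    intro h
    have := Fintype.card_le_of_surjective _ h
    simp at this
    omega
  obtain ⟨j, θ', h⟩ := SimplexCategory.eq_comp_δ_of_not_surjective θ.unop hs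
  have h' : θ = (SimplexCategory.δ j).op ≫ θ'.op := Quiver.Hom.unop_inj h
  rw [h', I.map_comp]
  exact (congrArg (I.map θ'.op).hom (hv j)).trans (_root_.map_zero _)

lemma isFD (e : SmallExtension I f) : IsFD I := by
  have hfin := e.finite
  rw [isFD_iff]
  refine ⟨fun n => inferInstance, ?_⟩
  have hmap : ∀ (i : ℕ) {m n : SimplexCategoryᵒᵖ} (θ : m ⟶ n) (v : I.obj m),
      v ∈ trunc I i m → (I.map θ).hom v ∈ trunc I i n := by
    intro i m n θ v hv
    rw [mem_trunc] at hv ⊢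
    intro j hj τ
    have := hv j hj (θ ≫ τ)
    rwa [I.map_comp] at this
  obtain ⟨N, hN⟩ := A.property.dcc
    (fun i => { ideal := fun n => e.toIdeal n (trunc I i n)
                map_mem := by
                  rintro m n θ _ ⟨v, hv, rfl⟩
                  exact ⟨_, hmap i θ v hv, e.incl_map θ v⟩ })
    (fun i n => (e.toIdeal_le_iff n _ _).2 fun v hv => by
      rw [mem_trunc] at hv ⊢
      exact fun j hj => hv j (by omega))
  have hN' : ∀ i, N ≤ i → ∀ n, trunc I i n = trunc I N n := fun i hi n =>
    le_antisymm ((e.toIdeal_le_iff n _ _).1 (hN i hi n).le)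
      ((e.toIdeal_le_iff n _ _).1 (hN i hi n).ge)
  have key : ∀ n, N ≤ n → ∀ v : I.obj (op (.mk (n + 1))), (∀ j, (I.δ j).hom v = 0) → v = 0 := by
    intro n hn v hv
    have h1 := mem_trunc_of_faces n v hv
    rw [hN' n hn, ← hN' (n + 1) (by omega), mem_trunc] at h1
    simpa using h1 (n + 1) le_rfl (𝟙 _)
  refine ⟨N + 1, fun n hn => ?_⟩
  obtain ⟨n, rfl⟩ : ∃ n', n = n' + 2 := ⟨n - 2, by omega⟩
  rw [eq_bot_iff]
  intro v hv
  simp only [normSub, Submodule.mem_iInf, LinearMap.mem_ker] at hv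
  have h0 : (I.δ 0).hom v = 0 := by
    refine key n (by omega) _ fun j => ?_
    have h1 : I.δ j.succ ≫ I.δ 0 = I.δ 0 ≫ I.δ j := I.δ_comp_δ (Fin.zero_le j)
    have h2 := ConcreteCategory.congr_hom h1 v
    refine h2.symm.trans ?_
    exact (congrArg (I.δ 0).hom (hv j)).trans (_root_.map_zero _)
  refine (Submodule.mem_bot _).2 (key (n + 1) (by omega) v fun j => ?_)
  refine Fin.cases h0 (fun j => hv j) j

end SmallExtension

end SmallExt

section HomotopyGroups
open Simplicial SSet

/-- Trivial fibrations of simplicial sets: the right lifting property with respect to all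
boundary inclusions `∂Δ[n] ⟶ Δ[n]`. -/
def IsTrivialFibration {X Y : SSet.{u}} (f : X ⟶ Y) : Prop := modelCategoryQuillen.I.rlp f

/-- Kan fibrations of simplicial sets: the right lifting property with respect to all horn
inclusions. -/
def IsFibration {X Y : SSet.{u}} (f : X ⟶ Y) : Prop := modelCategoryQuillen.J.rlp f

/-- The functorial factorisation of `X ⟶ *` into an anodyne extension and a Kan fibration. -/
def kanFactorization :
    MorphismProperty.FunctorialFactorizationData modelCategoryQuillen.J.{u}.rlp.llp
      modelCategoryQuillen.J.{u}.rlp :=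
  MorphismProperty.functorialFactorizationData _ _

/-- The functorial Kan replacement of a simplicial set. -/
def kanRepl (X : SSet.{u}) : SSet.{u} :=
  (kanFactorization.factorizationData (terminal.from X)).Z

/-- The anodyne extension from a simplicial set to its Kan replacement. -/
def kanIncl (X : SSet.{u}) : X ⟶ kanRepl X :=
  (kanFactorization.factorizationData (terminal.from X)).i

/-- The map induced on Kan replacements. -/
def kanMap {X Y : SSet.{u}} (f : X ⟶ Y) : kanRepl X ⟶ kanRepl Y :=
  kanFactorization.mapZ (f := terminal.from X) (g := terminal.from Y)
    (Arrow.homMk f (𝟙 _) (by simp))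

lemma kanIncl_kanMap {X Y : SSet.{u}} (f : X ⟶ Y) : kanIncl X ≫ kanMap f = f ≫ kanIncl Y :=
  kanFactorization.i_mapZ (f := terminal.from X) (g := terminal.from Y) _

lemma kanMap_app {X Y : SSet.{u}} (f : X ⟶ Y) {x : X _⦋0⦌} {y : Y _⦋0⦌} (h : f.app _ x = y) :
    (kanMap f).app _ ((kanIncl X).app _ x) = (kanIncl Y).app _ y := by
  subst h
  exact ConcreteCategory.congr_hom (NatTrans.congr_app (kanIncl_kanMap f) (op ⦋0⦌)) x

/-- The homotopy group `π_n(X, x)` of a pointed simplicial set: homotopy classes, relative to the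
boundary, of maps from `(Δ[n], ∂Δ[n])` to the Kan replacement. -/
def PiGroup (n : ℕ) (X : SSet.{u}) (x : X _⦋0⦌) : Type u :=
  RelativeMorphism.HomotopyClass (boundary n) (Subcomplex.ofSimplex ((kanIncl X).app _ x))
    (SSet.const ⟨(kanIncl X).app _ x, Subcomplex.mem_ofSimplex_obj _⟩)

namespace PiGroup
variable {n : ℕ} {X Y : SSet.{u}} {x : X _⦋0⦌} {y : Y _⦋0⦌}

/-- The class of an `n`-simplex of the Kan replacement with constant boundary. -/
def mk (s : (kanRepl X).PtSimplex n ((kanIncl X).app _ x)) : PiGroup n X x :=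
  RelativeMorphism.homotopyClass s

/-- The neutral element, the class of the constant simplex. -/
instance : One (PiGroup n X x) := ⟨mk RelativeMorphism.const⟩

/-- The functoriality of homotopy groups. -/
def map (f : X ⟶ Y) (h : f.app _ x = y) (c : PiGroup n X x) : PiGroup n Y y :=
  RelativeMorphism.HomotopyClass.postcomp c
    (RelativeMorphism.ofSimplex₀ (kanMap f) _ _ (kanMap_app f h)) rfl

/-- `c` is the product of `a` and `b` in `π_{n+1}(X, x)`: there is an `(n+2)`-simplex of the Kan
replacement whose last three faces represent `b`, `c`, `a`, in this order, and whose other faces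
are constant. -/
def IsMul (a b c : PiGroup (n + 1) X x) : Prop :=
  ∃ s t r : (kanRepl X).PtSimplex (n + 1) ((kanIncl X).app _ x),
    mk s = a ∧ mk t = b ∧ mk r = c ∧ Nonempty (PtSimplex.MulStruct s t r (Fin.last n))

/-- The class `c` is represented by the `n`-simplex `s` of `X`. -/
def IsRepresentedBy (c : PiGroup n X x) (s : X _⦋n⦌) : Prop :=
  ∃ t : (kanRepl X).PtSimplex n ((kanIncl X).app _ x),
    yonedaEquiv t.map = (kanIncl X).app _ s ∧ mk t = c

end PiGroup

end HomotopyGroups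

section QuasiSmooth
variable {Λ : Type u} [CommRing Λ] [IsLocalRing Λ] {F G : SArt Λ ⥤ SSet.{u}}

/-- The fibre product `F(B) ×_{G(B)} G(A)`. -/
abbrev relTarget (α : F ⟶ G) {A B : SArt Λ} (f : A ⟶ B) : SSet.{u} :=
  pullback (α.app B) (G.map f)

/-- The map `F(A) → F(B) ×_{G(B)} G(A)`. -/
abbrev relMap (α : F ⟶ G) {A B : SArt Λ} (f : A ⟶ B) : F.obj A ⟶ relTarget α f :=
  pullback.lift (F.map f) (α.app A) (α.naturality f)

/-- Quasi-smooth morphisms. -/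
structure QuasiSmooth (α : F ⟶ G) : Prop where
  trivialFibration : ∀ {A B : SArt Λ} (f : A ⟶ B), IsSurjective f → IsAcyclic f →
    IsTrivialFibration (relMap α f)
  fibration : ∀ {A B : SArt Λ} (f : A ⟶ B), IsSurjective f → IsFibration (relMap α f)

variable (Λ) in
/-- The simplicial vector space `K^n`, with normalisation `k` in degree `n`. -/
def KObj (n : ℕ) : SFDVect Λ :=
  ⟨eilenbergMacLane (ResidueField Λ) n, isFD_eilenbergMacLane _ n⟩

/-- The shift `V[-n] = V ⊗ K^n`. -/
def shift (V : SFDVect Λ) (n : ℕ) : SFDVect Λ :=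
  ⟨tensor V.obj (KObj Λ n).obj, isFD_tensor V.property (KObj Λ n).property⟩

/-- The kernel of a small extension, as a simplicial vector space with finite-dimensional
normalisation. -/
def SmallExtension.ker {I : SimplicialObject (ModuleCat.{u} (ResidueField Λ))} {A B : SArt Λ}
    {f : A ⟶ B} (e : SmallExtension I f) : SFDVect Λ := ⟨I, e.isFD⟩

variable [PreservesFiniteLimits F] [PreservesFiniteLimits G]

/-- The cohomology group `H^j(F/G) = π_i tan(F/G)(K^n)`, where `n - i = j`; here `(n, i)` is
`(j, 0)` for `j ≥ 0` and `(0, -j)` for `j ≤ 0`. -/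
abbrev cohomology (α : F ⟶ G) (j : ℤ) : ModuleCat.{u} (ResidueField Λ) :=
  piMod (-j).toNat (tangentRel α (KObj Λ j.toNat))

/-- The cohomology group `H^i(F/G ⊗ V) = ⨁_{m ≥ 0} H^{i+m}(F/G) ⊗ π_m(V)`. -/
abbrev cohomologyCoeff (α : F ⟶ G) (V : SFDVect Λ) (i : ℤ) : Type u :=
  ⨁ m : ℕ, (cohomology α (i + m) ⊗[ResidueField Λ] piMod m V.obj)
end QuasiSmooth

section Obstruction
open Simplicial SSet
variable {R : Type u} [CommRing R]

/-- The class `h` in `π_n(T)` is represented by `v ∈ T_n`, a cycle of the normalised complex. -/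
def Represents (T : SimplicialObject (ModuleCat.{u} R)) (n : ℕ) (v : (toSSet T) _⦋n⦌)
    (h : piMod n T) : Prop :=
  ∃ z : ((AlgebraicTopology.normalizedMooreComplex _).obj T).cycles n,
    (AlgebraicTopology.NormalizedMooreComplex.objX T n).arrow
      (((AlgebraicTopology.normalizedMooreComplex _).obj T).iCycles n z) = v ∧
    ((AlgebraicTopology.normalizedMooreComplex _).obj T).homologyπ n z = h

/-- The zero vertex of a simplicial module. -/
def zeroVertex (T : SimplicialObject (ModuleCat.{u} R)) : (toSSet T) _⦋0⦌ :=
  (0 : T.obj (op ⦋0⦌))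

/-- A presentation of `φ : X → Y` as the fibre of a map `Y → T` defined up to homotopy: a
trivial fibration `q : E → Y`, a map `p : E → T` and an identification `j` of `X` with the fibre
of `p` over `0`, such that `φ = q ∘ j`. -/
structure ObstructionMap {X Y : SSet.{u}} (φ : X ⟶ Y) (T : SimplicialObject (ModuleCat.{u} R)) where
  E : SSet.{u}
  q : E ⟶ Y
  p : E ⟶ toSSet T
  j : X ⟶ E
  toPoint : X ⟶ Δ[0]
  trivialFibration : IsTrivialFibration q
  fac : j ≫ q = φ
  isPullback : IsPullback j toPoint p (yonedaEquiv.symm (zeroVertex T))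

namespace ObstructionMap
variable {X Y : SSet.{u}} {φ : X ⟶ Y} {T : SimplicialObject (ModuleCat.{u} R)}
  (Q : ObstructionMap φ T)

/-- The map `o : π₀(Y) → π₀(T)` is induced by the span `Y ← E → T`. -/
def Induces₀ (o : π₀ Y → piMod 0 T) : Prop :=
  ∀ (e : Q.E _⦋0⦌) (h : piMod 0 T), Represents T 0 (Q.p.app _ e) h → o (π₀.mk (Q.q.app _ e)) = h

lemma q_j (y : X _⦋0⦌) : Q.q.app _ (Q.j.app _ y) = φ.app _ y :=
  ConcreteCategory.congr_hom (NatTrans.congr_app Q.fac (op ⦋0⦌)) y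

lemma p_j (y : X _⦋0⦌) : Q.p.app _ (Q.j.app _ y) = zeroVertex T := by
  have h := ConcreteCategory.congr_hom (NatTrans.congr_app Q.isPullback.w (op ⦋0⦌)) y
  refine h.trans ?_
  have h0 : Q.toPoint.app _ y = stdSimplex.objEquiv.symm (𝟙 _) :=
    stdSimplex.objEquiv.injective (SimplexCategory.isTerminalZero.hom_ext _ _)
  refine (congrArg ((yonedaEquiv.symm (zeroVertex T)).app (op ⦋0⦌)) h0).trans ?_
  exact yonedaEquiv.apply_symm_apply (zeroVertex T)

/-- The map `o : π_n(Y, φ y) → π_n(T)` is induced by the span `Y ← E → T`. -/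
def Induces (y : X _⦋0⦌) (n : ℕ) (o : PiGroup n Y (φ.app _ y) → piMod n T) : Prop :=
  ∀ (c : PiGroup n Q.E (Q.j.app _ y)) (v : (toSSet T) _⦋n⦌) (h : piMod n T),
    Represents T n v h → (c.map Q.p (Q.p_j y)).IsRepresentedBy v →
      o (c.map Q.q (Q.q_j y)) = h

/-- `ε ∈ E_{n+1}` is a lift of a cycle representing `u ∈ π_{n+1}(T)`; its face `∂_0 ε` is the
simplex `w` of `X`, and all other faces are degeneracies of the vertex `y` of `X`. -/
def IsLift {n : ℕ} (ε : Q.E _⦋n + 1⦌) (y : X _⦋0⦌) (w : X _⦋n⦌) (u : piMod (n + 1) T) : Prop :=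
  Represents T (n + 1) (Q.p.app _ ε) u ∧ Q.E.δ 0 ε = Q.j.app _ w ∧
    ∀ i : Fin (n + 1), Q.E.δ i.succ ε =
      Q.j.app _ (X.map (SimplexCategory.const ⦋n⦌ ⦋0⦌ 0).op y)

/-- The action of `π₁(T)` on `π₀(X)` moves the component of `y` to that of `w` along paths
from `y` to `w` in `E`. -/
def InducesAction (act : piMod 1 T → π₀ X → π₀ X) : Prop :=
  ∀ (ε : Q.E _⦋1⦌) (y w : X _⦋0⦌) (u : piMod 1 T), Q.IsLift ε y w u → act u (π₀.mk y) = π₀.mk w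

/-- The map `d : π_{n+1}(T) → π_n(X, y)` is the boundary map: it lifts cycles to `E` and takes
the zeroth face. -/
def InducesBoundary (y : X _⦋0⦌) (n : ℕ) (d : piMod (n + 1) T → PiGroup n X y) : Prop :=
  ∀ (ε : Q.E _⦋n + 1⦌) (w : X _⦋n⦌) (u : piMod (n + 1) T), Q.IsLift ε y w u →
    (d u).IsRepresentedBy w

end ObstructionMap
end Obstruction

end
end DerivedDef

open Simplicial SSet DerivedDef

/-!
Let `0 → I → CI → I ⊗ K¹ → 0` be the sequence obtained from `0 → k → D → K¹ → 0` by tensoring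
with `I`, where `D` is the simplicial vector space of functions on the vertices of the standard
simplices. The cone `CI` is contractible. For a small extension `I → A → B`, attaching the cone on
`I` to `A` gives the Artinian simplicial algebra `C = A ×_k (k ⊕ CI)` modulo the antidiagonal copy
of `I` (`SmallExtension.coneExt`). It is a model of `B` in which the obstruction becomes visible:
`C → B` is a surjection with kernel `CI`, hence acyclic, and the collapse `C → k ⊕ (I ⊗ K¹)` has
fibre `A`.

With `X = F(B) ×_{G(B)} G(A)`, the space `E = F(C) ×_{G(C)} G(A)` maps to `X` by a trivial
fibration, as `α` is quasi-smooth (`QuasiSmooth.trivialFibration_relTarget`), and the collapse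
induces `p : E → T = tan(F/G)(I ⊗ K¹)` with fibre `F(A)` over `0`. The map `p` need not be a
fibration. However, `A ×_k (k ⊕ CI)` is the fibre product of `C` and `k ⊕ CI` over `k ⊕ (I ⊗ K¹)`
(`SmallExtension.isPullback_coneQuot`), so that the base change of `p` along the fibration
`tan(F/G)(CI) → T` is the product `F(A) × tan(F/G)(CI)` (`QuasiSmooth.exists_obstructionMap`). As
`tan(F/G)(CI)` is contractible, this product is equivalent both to `F(A)` and to the homotopy fibre
of `p`. In terms of lifting properties, factor `p` as an anodyne extension `E → E'` followed by a
Kan fibration `E' → T`. Anodyne extensions are stable under base change along fibrations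
(`anodyne_baseChange`), and therefore the map from `F(A)` to the fibre of `E' → T` is anodyne
(`exists_fibration_replacement`). The stability itself follows, by the adjunction between base
change and dependent product, from the fact that the part over a horn of a fibration over a simplex
is included in the total space by an anodyne extension (`anodyne_preimage_horn`).

The long exact sequence and the action of `π₁(T)` are those of the fibration `E' → T`
(`ObstructionMap.exists_exact`), where anodyne extensions to Kan complexes are used to compute
homotopy groups, and the homotopy groups of a simplicial module are identified with the homology of
its normalised complex (`kpiClass`). The description of the fibres of `F(A) → X` comes from the
isomorphism of `A ×_B A` with `A ×_k (k ⊕ I)` (`SmallExtension.isPullback_act`,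
`SmallExtension.exists_isPullback_fibre`).

For the second part, the tangent functor carries `0 → V → CV → V ⊗ K¹ → 0` to a sequence which is
left exact, has a contractible middle term, and ends with a fibration. The connecting maps are
therefore isomorphisms from `π_{n+1} tan(F/G)(V ⊗ K¹)` to `π_n tan(F/G)(V)`
(`QuasiSmooth.nonempty_piMod_shift`). Over a field, a simplicial vector space is the direct sum of
copies of the objects `K^m`, indexed by bases of its homotopy groups, and of an acyclic part, on
which the tangent functor has no homotopy. This gives the formula with coefficients
(`QuasiSmooth.nonempty_piMod_directSum`), and the independence of `π_i tan(F/G)(K^n)` of the choice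
of `i` and `n` with given difference follows by applying both statements to `V = K^n`.
-/

open Simplicial SSet DerivedDef

namespace DerivedDef
open MonoidalCategory CartesianMonoidalCategory HomotopicalAlgebra

/-! ### Lifting properties and homotopies of simplicial sets -/

lemma app_congr {X Y : SSet.{u}} {f g : X ⟶ Y} (h : f = g) (n : SimplexCategoryᵒᵖ) (x : X.obj n) :
    f.app n x = g.app n x := by rw [h]

lemma map_app_apply {X Y : SSet.{u}} (f : X ⟶ Y) {m n : SimplexCategoryᵒᵖ} (θ : m ⟶ n)
    (x : X.obj m) : f.app n (X.map θ x) = Y.map θ (f.app m x) :=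
  ConcreteCategory.congr_hom (f.naturality θ) x

section Lifting
variable {A B C D K L : SSet.{u}}

/-- The lifting property of a pushout-product, in terms of maps on the two parts of its source. -/
lemma exists_lift_of_pushoutObjObj {f : A ⟶ B} {g : C ⟶ D} {κ : K ⟶ L}
    (sq : (curriedTensor SSet.{u}).PushoutObjObj f g) [HasLiftingProperty sq.ι κ]
    (s : B ⊗ C ⟶ K) (t : A ⊗ D ⟶ K) (h : f ▷ C ≫ s = A ◁ g ≫ t) (w : B ⊗ D ⟶ L)
    (hs : s ≫ κ = B ◁ g ≫ w) (ht : t ≫ κ = f ▷ D ≫ w) :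
    ∃ l : B ⊗ D ⟶ K, B ◁ g ≫ l = s ∧ f ▷ D ≫ l = t ∧ l ≫ κ = w := by
  let d : sq.pt ⟶ K := sq.isPushout.desc s t h
  have e1 : sq.inl ≫ d = s := sq.isPushout.inl_desc _ _ _
  have e2 : sq.inr ≫ d = t := sq.isPushout.inr_desc _ _ _
  have i1 : sq.inl ≫ sq.ι = B ◁ g := sq.inl_ι
  have i2 : sq.inr ≫ sq.ι = f ▷ D := sq.inr_ι
  have c : CommSq d sq.ι κ w := ⟨sq.isPushout.hom_ext
    (by rw [← Category.assoc, e1, hs, ← i1, Category.assoc])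
    (by rw [← Category.assoc, e2, ht, ← i2, Category.assoc])⟩
  refine ⟨c.lift, ?_, ?_, c.fac_right⟩
  · rw [← i1, Category.assoc, c.fac_left, e1]
  · rw [← i2, Category.assoc, c.fac_left, e2]

lemma boundary_one_const {n : SimplexCategoryᵒᵖ} (t : (∂Δ[1] : SSet.{u}).obj n)
    (a b : Fin (n.unop.len + 1)) :
    (stdSimplex.objEquiv t.1).toOrderHom a = (stdSimplex.objEquiv t.1).toOrderHom b := by
  have h : ¬ Function.Surjective (stdSimplex.asOrderHom t.1) := t.2
  by_contra hab
  apply h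
  have key : ∀ x y z : Fin 2, x ≠ y → z = x ∨ z = y := by decide
  intro z
  rcases key _ _ z hab with h | h
  · exact ⟨a, h.symm⟩
  · exact ⟨b, h.symm⟩

open Classical in
/-- The map `B × ∂Δ[1] ⟶ K` which is `f` over the vertex `0` and `g` over the vertex `1`. -/
noncomputable def twoEnds (f g : B ⟶ K) : B ⊗ (∂Δ[1] : SSet.{u}) ⟶ K where
  app n := ↾fun x => if (stdSimplex.objEquiv x.2.1).toOrderHom 0 = 0 then f.app n x.1 else g.app n x.1
  naturality m n θ := by
    ext ⟨x, t⟩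
    have h : (stdSimplex.objEquiv ((∂Δ[1] : SSet.{u}).map θ t).1).toOrderHom 0 =
      (stdSimplex.objEquiv t.1).toOrderHom 0 := boundary_one_const t _ _
    change (if (stdSimplex.objEquiv ((∂Δ[1] : SSet.{u}).map θ t).1).toOrderHom 0 = 0 then
      f.app n (B.map θ x) else g.app n (B.map θ x)) = K.map θ (if _ then f.app m x else g.app m x)
    rw [h]
    split_ifs
    · exact ConcreteCategory.congr_hom (f.naturality θ) x
    · exact ConcreteCategory.congr_hom (g.naturality θ) x

lemma whisker_boundary_eq_twoEnds (w : B ⊗ Δ[1] ⟶ K) :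
    B ◁ ∂Δ[1].ι ≫ w = twoEnds (ι₀ ≫ w) (ι₁ ≫ w) := by
  ext n ⟨x, t⟩
  have hc := boundary_one_const t
  change w.app n (x, t.1) = if (stdSimplex.objEquiv t.1).toOrderHom 0 = 0 then
    w.app n (x, SSet.stdSimplex.const 1 0 n) else w.app n (x, SSet.stdSimplex.const 1 1 n)
  split_ifs with h
  · congr 2
    apply stdSimplex.objEquiv.injective
    ext a : 3
    rw [hc a 0, h]; rfl
  · congr 2
    apply stdSimplex.objEquiv.injective
    ext a : 3
    rw [hc a 0]
    have key : ∀ z : Fin 2, z ≠ 0 → z = 1 := by decide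
    exact key _ h

lemma twoEnds_comp (f g : B ⟶ K) (κ : K ⟶ L) : twoEnds f g ≫ κ = twoEnds (f ≫ κ) (g ≫ κ) := by
  ext n ⟨x, t⟩
  change κ.app n (if _ then _ else _) = if _ then _ else _
  split_ifs <;> rfl

lemma whiskerRight_twoEnds (i : A ⟶ B) (f g : B ⟶ K) :
    i ▷ _ ≫ twoEnds f g = twoEnds (i ≫ f) (i ≫ g) := by
  ext n ⟨x, t⟩
  rfl

lemma twoEnds_injective {f g f' g' : B ⟶ K} (h : twoEnds f g = twoEnds f' g') :
    f = f' ∧ g = g' := by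
  have mem : ∀ (k : Fin 2) n, SSet.stdSimplex.const 1 k n ∈
      (∂Δ[1] : (Δ[1] : SSet.{u}).Subcomplex).obj n := by
    intro k n hs
    obtain ⟨a, ha⟩ := hs 0
    obtain ⟨b, hb⟩ := hs 1
    have ha' : k = 0 := ha
    have hb' : k = 1 := hb
    rw [ha'] at hb'
    exact zero_ne_one hb'
  constructor
  · ext n x
    exact app_congr h n (x, ⟨SSet.stdSimplex.const 1 0 n, mem 0 n⟩)
  · ext n x
    exact app_congr h n (x, ⟨SSet.stdSimplex.const 1 1 n, mem 1 n⟩)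

/-- A homotopy with given ends and given restriction to `A` is a lift along the pushout-product of
`A ⟶ B` with the inclusion of the ends of `Δ[1]`. -/
lemma exists_homotopy_aux {i : A ⟶ B} {κ : K ⟶ L}
    (sq : (curriedTensor SSet.{u}).PushoutObjObj i ∂Δ[1].ι) [HasLiftingProperty sq.ι κ]
    (f g : B ⟶ K) (t : A ⊗ Δ[1] ⟶ K) (w : B ⊗ Δ[1] ⟶ L)
    (h0 : ι₀ ≫ t = i ≫ f) (h1 : ι₁ ≫ t = i ≫ g)
    (w0 : ι₀ ≫ w = f ≫ κ) (w1 : ι₁ ≫ w = g ≫ κ) (ht : t ≫ κ = i ▷ _ ≫ w) :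
    ∃ l : B ⊗ Δ[1] ⟶ K, ι₀ ≫ l = f ∧ ι₁ ≫ l = g ∧ i ▷ _ ≫ l = t ∧ l ≫ κ = w := by
  obtain ⟨l, l1, l2, l3⟩ := exists_lift_of_pushoutObjObj sq (twoEnds f g) t
    (by rw [whisker_boundary_eq_twoEnds, h0, h1, whiskerRight_twoEnds]) w
    (by rw [whisker_boundary_eq_twoEnds, w0, w1, twoEnds_comp]) ht
  rw [whisker_boundary_eq_twoEnds] at l1
  obtain ⟨e0, e1⟩ := twoEnds_injective l1
  exact ⟨l, e0, e1, l2, l3⟩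

/-- Relative homotopies extend along anodyne extensions and lift through fibrations. -/
lemma exists_homotopy_of_anodyne {i : A ⟶ B} (hi : anodyneExtensions i) {κ : K ⟶ L}
    (hκ : IsFibration κ) (f g : B ⟶ K) (t : A ⊗ Δ[1] ⟶ K) (w : B ⊗ Δ[1] ⟶ L)
    (h0 : ι₀ ≫ t = i ≫ f) (h1 : ι₁ ≫ t = i ≫ g)
    (w0 : ι₀ ≫ w = f ≫ κ) (w1 : ι₁ ≫ w = g ≫ κ) (ht : t ≫ κ = i ▷ _ ≫ w) :
    ∃ l : B ⊗ Δ[1] ⟶ K, ι₀ ≫ l = f ∧ ι₁ ≫ l = g ∧ i ▷ _ ≫ l = t ∧ l ≫ κ = w := by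
  let sq := Functor.PushoutObjObj.ofHasPushout (curriedTensor SSet.{u}) i ∂Δ[1].ι
  have := anodyneExtensions_pushoutObjObjι' sq hi κ hκ
  exact exists_homotopy_aux sq f g t w h0 h1 w0 w1 ht

lemma IsTrivialFibration.hasLiftingProperty {κ : K ⟶ L} (hκ : IsTrivialFibration κ) (i : A ⟶ B)
    [Mono i] : HasLiftingProperty i κ := by
  have h : (MorphismProperty.monomorphisms SSet.{u}).rlp κ := by rw [rlp_monomorphisms]; exact hκ
  exact h i (MorphismProperty.monomorphisms.infer_property i)

/-- Homotopies relative to a subcomplex lift through trivial fibrations. -/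
lemma exists_homotopy_of_trivialFibration (S : B.Subcomplex) {κ : K ⟶ L}
    (hκ : IsTrivialFibration κ) (f g : B ⟶ K) (t : (S : SSet.{u}) ⊗ Δ[1] ⟶ K) (w : B ⊗ Δ[1] ⟶ L)
    (h0 : ι₀ ≫ t = S.ι ≫ f) (h1 : ι₁ ≫ t = S.ι ≫ g)
    (w0 : ι₀ ≫ w = f ≫ κ) (w1 : ι₁ ≫ w = g ≫ κ) (ht : t ≫ κ = S.ι ▷ _ ≫ w) :
    ∃ l : B ⊗ Δ[1] ⟶ K, ι₀ ≫ l = f ∧ ι₁ ≫ l = g ∧ S.ι ▷ _ ≫ l = t ∧ l ≫ κ = w := by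
  let sq := Subcomplex.unionProd.pushoutObjObj S ∂Δ[1]
  have : Mono sq.ι := inferInstanceAs (Mono (S.unionProd ∂Δ[1]).ι)
  have := hκ.hasLiftingProperty sq.ι
  exact exists_homotopy_aux sq f g t w h0 h1 w0 w1 ht

/-- The inclusion of a vertex of `Δ[1]`. -/
noncomputable abbrev vertexMap (e : Fin 2) : (Δ[0] : SSet.{u}) ⟶ Δ[1] :=
  SSet.const (stdSimplex.obj₀Equiv.symm e)

/-- The inclusion of the end `B × {e}` of the cylinder on `B`. -/
noncomputable def cylEnd (e : Fin 2) : B ⟶ B ⊗ Δ[1] :=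
  lift (𝟙 B) (SSet.const (stdSimplex.obj₀Equiv.symm e))

lemma cylEnd_one : cylEnd (B := B) 1 = ι₁ := rfl

lemma cylEnd_whiskerRight (e : Fin 2) (f : A ⟶ B) : cylEnd e ≫ f ▷ Δ[1] = f ≫ cylEnd e := rfl

lemma cylEnd_fst (e : Fin 2) : cylEnd (B := B) e ≫ fst B Δ[1] = 𝟙 B := rfl

lemma anodyne_vertexMap (e : Fin 2) : anodyneExtensions (vertexMap.{u} e) := by
  -- the inclusion of a vertex of `Δ[1]` is that of a horn, which has a single face, the one of the
  -- other index
  have key : ∀ j : Fin 2, j ≠ e → stdSimplex.{u}.δ j = vertexMap.{u} e := by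
    intro j hj
    fin_cases j <;> fin_cases e
    · exact absurd rfl hj
    · exact stdSimplex.δ_zero_eq_const
    · exact stdSimplex.δ_one_eq_const
    · exact absurd rfl hj
  intro K L κ hκ
  have := (modelCategoryQuillen.fibration_iff κ).2 hκ
  refine ⟨fun {f w} sq => ?_⟩
  have hf : horn.IsCompatible (i := e) (fun (j : Fin 2) (_ : j ≠ e) => f) := trivial
  obtain ⟨l, l1, l2⟩ := hf.exists_lift κ w fun j hj => by rw [key j hj]; exact sq.w
  obtain ⟨j, hj⟩ := exists_ne e
  exact ⟨⟨⟨l, by rw [← key j hj]; exact l1 j hj, l2⟩⟩⟩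

lemma whisker_vertexMap (e : Fin 2) (w : B ⊗ Δ[1] ⟶ K) :
    B ◁ vertexMap e ≫ w = fst B Δ[0] ≫ cylEnd e ≫ w := by
  ext n ⟨x, t⟩
  rfl

/-- The homotopy lifting property of fibrations, relative to a monomorphism. -/
lemma exists_homotopy_lift (e : Fin 2) (i : A ⟶ B) [Mono i] {κ : K ⟶ L} (hκ : IsFibration κ)
    (f : B ⟶ K) (t : A ⊗ Δ[1] ⟶ K) (w : B ⊗ Δ[1] ⟶ L) (h0 : cylEnd e ≫ t = i ≫ f)
    (w0 : cylEnd e ≫ w = f ≫ κ) (ht : t ≫ κ = i ▷ _ ≫ w) :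
    ∃ l : B ⊗ Δ[1] ⟶ K, cylEnd e ≫ l = f ∧ i ▷ _ ≫ l = t ∧ l ≫ κ = w := by
  let sq := Functor.PushoutObjObj.ofHasPushout (curriedTensor SSet.{u}) i (vertexMap e)
  have := anodyneExtensions_pushoutObjObjι sq (anodyne_vertexMap e) κ hκ
  obtain ⟨l, l1, l2, l3⟩ := exists_lift_of_pushoutObjObj sq (fst _ _ ≫ f) t
    (by rw [whisker_vertexMap, h0]; rfl) w
    (by rw [whisker_vertexMap, w0, Category.assoc]) ht
  rw [whisker_vertexMap] at l1
  refine ⟨l, ?_, l2, l3⟩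
  ext n x
  exact app_congr l1 n (x, SSet.stdSimplex.const 0 0 n)

/-- Strong deformation retracts are anodyne extensions. -/
lemma anodyne_of_deformation (e e' : Fin 2) (i : A ⟶ B) [Mono i] (r : B ⟶ A)
    (H : B ⊗ Δ[1] ⟶ B) (h0 : cylEnd e ≫ H = r ≫ i) (h1 : cylEnd e' ≫ H = 𝟙 B)
    (hi : i ▷ _ ≫ H = fst _ _ ≫ i) : anodyneExtensions i := by
  have hr : i ≫ r = 𝟙 A := by
    rw [← cancel_mono i, Category.assoc, ← h0, ← Category.assoc, ← cylEnd_whiskerRight,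
      Category.assoc, hi, ← Category.assoc, cylEnd_fst]
  intro K L κ hκ
  refine ⟨fun {u w} sq => ?_⟩
  -- starting from the lift `r ≫ u` of `r ≫ i ≫ w`, lift the homotopy `H ≫ w`; its other end is the
  -- required diagonal
  obtain ⟨l, l1, l2, l3⟩ := exists_homotopy_lift e i hκ (r ≫ u) (fst _ _ ≫ u) (H ≫ w)
    (by rw [← Category.assoc, ← Category.assoc, hr, cylEnd_fst])
    (by rw [← Category.assoc, h0, Category.assoc, Category.assoc, sq.w])
    (by rw [← Category.assoc, hi, Category.assoc, Category.assoc, sq.w])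
  refine ⟨⟨⟨cylEnd e' ≫ l, ?_, ?_⟩⟩⟩
  · rw [← Category.assoc, ← cylEnd_whiskerRight, Category.assoc, l2, ← Category.assoc, cylEnd_fst,
      Category.id_comp]
  · rw [Category.assoc, l3, ← Category.assoc, h1, Category.id_comp]

/-- Right cancellation for anodyne extensions. -/
lemma anodyne_of_comp (a : A ⟶ B) (b : B ⟶ C) [Mono b] (ha : anodyneExtensions a)
    (hab : anodyneExtensions (a ≫ b)) : anodyneExtensions b := by
  intro K L κ hκ
  refine ⟨fun {u w} sq => ?_⟩
  have := hab κ hκ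
  have s1 : CommSq (a ≫ u) (a ≫ b) κ w := ⟨by rw [Category.assoc, sq.w, Category.assoc]⟩
  -- the two lifts `b ≫ v` and `u` agree on `A`, hence are homotopic relative to `A` over `L`
  obtain ⟨t, t0, t1, -, t3⟩ := exists_homotopy_of_anodyne ha hκ (b ≫ s1.lift) u
    (fst _ _ ≫ a ≫ u) (fst _ _ ≫ b ≫ w)
    (by rw [← Category.assoc a b, s1.fac_left]; rfl) rfl
    (by rw [Category.assoc, s1.fac_right]; rfl) sq.w.symm
    (by simp only [Category.assoc, sq.w, whiskerRight_fst_assoc])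
  -- extending this homotopy to `C` turns the lift for the composite into a lift for `b`
  obtain ⟨l, l1, l2, l3⟩ := exists_homotopy_lift 0 b hκ s1.lift t (fst _ _ ≫ w) t0
    (by rw [s1.fac_right]; rfl) (by rw [t3, whiskerRight_fst_assoc])
  refine ⟨⟨⟨cylEnd 1 ≫ l, ?_, ?_⟩⟩⟩
  · rw [← Category.assoc, ← cylEnd_whiskerRight, Category.assoc, l2, cylEnd_one, t1]
  · rw [Category.assoc, l3]; rfl

end Lifting

/-! ### Fibre products on elements and parts of fibrations over horns -/

section Elements
variable {P X Y Z : SSet.{u}} {a : P ⟶ X} {b : P ⟶ Y} {f : X ⟶ Z} {g : Y ⟶ Z}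

lemma isPullback_app (h : IsPullback a b f g) (n : SimplexCategoryᵒᵖ) :
    IsPullback (a.app n) (b.app n) (f.app n) (g.app n) :=
  h.map ((evaluation SimplexCategoryᵒᵖ (Type u)).obj n)

lemma exists_of_isPullback (h : IsPullback a b f g) {n : SimplexCategoryᵒᵖ} (x : X.obj n)
    (y : Y.obj n) (e : f.app n x = g.app n y) : ∃ z : P.obj n, a.app n z = x ∧ b.app n z = y := by
  have h' := isPullback_app h n
  let l := h'.lift (↾(fun _ : PUnit.{u+1} => x)) (↾(fun _ : PUnit.{u+1} => y)) (by ext; exact e)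
  exact ⟨l PUnit.unit, ConcreteCategory.congr_hom (h'.lift_fst _ _ _) PUnit.unit,
    ConcreteCategory.congr_hom (h'.lift_snd _ _ _) PUnit.unit⟩

lemma ext_of_isPullback (h : IsPullback a b f g) {n : SimplexCategoryᵒᵖ} {z z' : P.obj n}
    (h1 : a.app n z = a.app n z') (h2 : b.app n z = b.app n z') : z = z' := by
  have h' := isPullback_app h n
  have : (↾(fun _ : PUnit.{u+1} => z)) = (↾(fun _ : PUnit.{u+1} => z')) :=
    h'.hom_ext (by ext; exact h1) (by ext; exact h2)
  exact ConcreteCategory.congr_hom this PUnit.unit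

lemma isPullback_of_elements (w : a ≫ f = b ≫ g)
    (ex : ∀ n (x : X.obj n) (y : Y.obj n), f.app n x = g.app n y →
      ∃ z : P.obj n, a.app n z = x ∧ b.app n z = y)
    (un : ∀ n (z z' : P.obj n), a.app n z = a.app n z' → b.app n z = b.app n z' → z = z') :
    IsPullback a b f g := by
  have inst : IsIso (pullback.lift a b w) := by
    rw [NatTrans.isIso_iff_isIso_app]
    intro n
    rw [isIso_iff_bijective]
    have hp := IsPullback.of_hasPullback f g
    have e1 : ∀ z, (pullback.fst f g).app n ((pullback.lift a b w).app n z) = a.app n z :=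
      fun z => app_congr (pullback.lift_fst a b w) n z
    have e2 : ∀ z, (pullback.snd f g).app n ((pullback.lift a b w).app n z) = b.app n z :=
      fun z => app_congr (pullback.lift_snd a b w) n z
    constructor
    · intro z z' h
      exact un n z z' (by rw [← e1, ← e1, h]) (by rw [← e2, ← e2, h])
    · intro t
      obtain ⟨z, h1, h2⟩ := ex n ((pullback.fst f g).app n t) ((pullback.snd f g).app n t)
        (app_congr hp.w n t)
      exact ⟨z, ext_of_isPullback hp ((e1 z).trans h1) ((e2 z).trans h2)⟩
  exact IsPullback.of_iso_pullback ⟨w⟩ (asIso (pullback.lift a b w))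
    (pullback.lift_fst a b w) (pullback.lift_snd a b w)

lemma IsFibration.of_isPullback (h : IsPullback a b f g) (hg : IsFibration g) : IsFibration a :=
  MorphismProperty.of_isPullback (P := modelCategoryQuillen.J.rlp) h.flip hg

lemma IsTrivialFibration.of_isPullback (h : IsPullback a b f g) (hg : IsTrivialFibration g) :
    IsTrivialFibration a :=
  MorphismProperty.of_isPullback (P := modelCategoryQuillen.I.rlp) h.flip hg

end Elements

section Horns

/-- The map `Δ[n] × Δ[1] ⟶ Δ[m]` induced by a monotone map of vertices. -/
def prismMap {n m : ℕ} (φ : Fin (n + 1) × Fin 2 →o Fin (m + 1)) :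
    (Δ[n] : SSet.{u}) ⊗ Δ[1] ⟶ Δ[m] where
  app _ := ↾fun x => stdSimplex.objMk
    ⟨fun a => φ (stdSimplex.asOrderHom x.1 a, stdSimplex.asOrderHom x.2 a), fun _ _ h =>
      φ.monotone ⟨(stdSimplex.asOrderHom x.1).monotone h, (stdSimplex.asOrderHom x.2).monotone h⟩⟩
  naturality _ _ _ := rfl

lemma asOrderHom_prismMap {n m : ℕ} (φ : Fin (n + 1) × Fin 2 →o Fin (m + 1))
    {N : SimplexCategoryᵒᵖ} (x : (Δ[n] : SSet.{u}).obj N) (t : (Δ[1] : SSet.{u}).obj N) (a) :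
    stdSimplex.asOrderHom ((prismMap φ).app N (x, t)) a =
      φ (stdSimplex.asOrderHom x a, stdSimplex.asOrderHom t a) := rfl

lemma stdSimplex_ext {n : ℕ} {N : SimplexCategoryᵒᵖ} {x y : (Δ[n] : SSet.{u}).obj N}
    (h : ∀ a, stdSimplex.asOrderHom x a = stdSimplex.asOrderHom y a) : x = y := by
  apply stdSimplex.objEquiv.injective
  ext a : 3
  exact h a

variable {P B : SSet.{u}}

/-- If a deformation of the base onto `A₀` preserves `A ⊇ A₀`, then the inclusion of the
part over `A` of a fibration is anodyne. -/
lemma anodyne_preimage_of_deformation {π : P ⟶ B} (hπ : IsFibration π) {A₀ A : B.Subcomplex}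
    (hA : A₀ ≤ A) (e e' : Fin 2) (H : B ⊗ Δ[1] ⟶ B) (h1 : cylEnd e' ≫ H = 𝟙 B)
    (h0 : ∀ n (x : B.obj n), (cylEnd e ≫ H).app n x ∈ A₀.obj n)
    (hst : ∀ n (x : B.obj n) (t : (Δ[1] : SSet.{u}).obj n), x ∈ A₀.obj n → H.app n (x, t) = x)
    (hpr : ∀ n (x : B.obj n) (t : (Δ[1] : SSet.{u}).obj n), x ∈ A.obj n → H.app n (x, t) ∈ A.obj n) :
    anodyneExtensions (A.preimage π).ι := by
  -- lift the deformation to `P`, keeping the part over `A₀` fixed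
  obtain ⟨K, k1, k2, k3⟩ := exists_homotopy_lift e' (A₀.preimage π).ι hπ (𝟙 P)
    (fst _ _ ≫ (A₀.preimage π).ι) (π ▷ _ ≫ H) rfl
    (by rw [← Category.assoc, cylEnd_whiskerRight, Category.assoc, h1, Category.comp_id,
      Category.id_comp])
    (by
      ext n ⟨x, t⟩
      exact (hst n (π.app n x.1) t x.2).symm)
  have key : ∀ n (x : P.obj n) t, π.app n (K.app n (x, t)) = H.app n (π.app n x, t) := fun n x t =>
    app_congr k3 n (x, t)
  have hr : Subcomplex.range (cylEnd e ≫ K) ≤ A₀.preimage π := by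
    rintro n _ ⟨x, rfl⟩
    change π.app n _ ∈ A₀.obj n
    have : π.app n ((cylEnd e ≫ K).app n x) = (cylEnd e ≫ H).app n (π.app n x) := key n x _
    rw [this]
    exact h0 n _
  have hle : A₀.preimage π ≤ A.preimage π := fun n x hx => hA n hx
  have hK : Subcomplex.range ((A.preimage π).ι ▷ Δ[1] ≫ K) ≤ A.preimage π := by
    rintro n _ ⟨⟨x, t⟩, rfl⟩
    change π.app n (K.app n (x.1, t)) ∈ A.obj n
    rw [key]
    exact hpr n _ _ x.2
  -- the lifted deformation retracts both the part over `A` and the whole of `P` onto the part over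
  -- `A₀`; cancel the first of these two anodyne extensions
  refine anodyne_of_comp (Subcomplex.homOfLE hle) _ ?_ ?_
  · refine anodyne_of_deformation e e' _ (Subcomplex.lift ((A.preimage π).ι ≫ cylEnd e ≫ K) ?_)
      (Subcomplex.lift _ hK) ?_ ?_ ?_
    · rintro n _ ⟨x, rfl⟩
      exact hr n ⟨x.1, rfl⟩
    · rfl
    · ext n x
      exact Subtype.ext (app_congr k1 n x.1)
    · ext n ⟨x, t⟩
      exact Subtype.ext (app_congr k2 n (x, t))
  · exact anodyne_of_deformation e e' _ (Subcomplex.lift _ hr) K rfl k1 k2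

lemma mem_face_of_forall {n : ℕ} {S : Finset (Fin (n + 1))} {N : SimplexCategoryᵒᵖ}
    (x : (Δ[n] : SSet.{u}).obj N) : x ∈ (stdSimplex.face S).obj N ↔
      ∀ a, stdSimplex.asOrderHom x a ∈ S := by
  constructor
  · intro h a
    exact h (Finset.mem_image.2 ⟨a, Finset.mem_univ _, rfl⟩)
  · intro h b hb
    obtain ⟨a, -, rfl⟩ := Finset.mem_image.1 hb
    exact h a

lemma mem_horn_of_missing {n : ℕ} {i j : Fin (n + 2)} (hj : j ≠ i) {N : SimplexCategoryᵒᵖ}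
    (x : (Δ[n + 1] : SSet.{u}).obj N) (h : ∀ a, stdSimplex.asOrderHom x a ≠ j) :
    x ∈ Λ[n + 1, i].obj N := by
  rw [mem_horn_iff]
  intro h'
  have : j ∈ Set.range (stdSimplex.asOrderHom x) ∪ {i} := h' ▸ Set.mem_univ j
  rcases this with ⟨a, ha⟩ | hj'
  · exact h a ha
  · exact hj hj'

lemma exists_missing_of_mem_horn {n : ℕ} {i : Fin (n + 2)} {N : SimplexCategoryᵒᵖ}
    {x : (Δ[n + 1] : SSet.{u}).obj N} (h : x ∈ Λ[n + 1, i].obj N) :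
    ∃ j, j ≠ i ∧ ∀ a, stdSimplex.asOrderHom x a ≠ j := by
  rw [mem_horn_iff, Set.ne_univ_iff_exists_notMem] at h
  obtain ⟨j, hj⟩ := h
  exact ⟨j, fun e => hj (Or.inr e), fun a ha => hj (Or.inl ⟨a, ha⟩)⟩

/-- The part over a horn of a fibration over a simplex is an anodyne extension. -/
lemma anodyne_preimage_horn {n : ℕ} (i : Fin (n + 2)) {π : P ⟶ Δ[n + 1]} (hπ : IsFibration π) :
    anodyneExtensions (Λ[n + 1, i].preimage π).ι := by
  by_cases hi : i = Fin.last _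
  -- the horn at the last vertex is preserved by the contraction of the simplex to this vertex
  · subst hi
    let φ : Fin (n + 1 + 1) × Fin 2 →o Fin (n + 1 + 1) :=
      ⟨fun x => if x.2 = 0 then x.1 else Fin.last _, by
        rintro ⟨a, s⟩ ⟨b, t⟩ ⟨h1, h2⟩
        dsimp at h1 h2 ⊢
        split_ifs with h3 h4
        · exact h1
        · exact Fin.le_last _
        · subst_vars
          exact absurd (le_antisymm h2 (Fin.zero_le _)) h3
        · exact le_rfl⟩
    have hφ : ∀ a s, φ (a, s) = a ∨ φ (a, s) = Fin.last _ := by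
      intro a s
      change (if s = 0 then a else Fin.last _) = a ∨ (if s = 0 then a else Fin.last _) = Fin.last _
      split_ifs <;> simp
    refine anodyne_preimage_of_deformation hπ (A₀ := stdSimplex.face {Fin.last _}) ?_ 1 0
      (prismMap φ) ?_ ?_ ?_ ?_
    · intro N x hx
      rw [mem_face_of_forall] at hx
      refine mem_horn_of_missing (j := 0) (Fin.last_pos).ne x fun a ha => ?_
      exact (Fin.last_pos).ne (ha.symm.trans (Finset.mem_singleton.1 (hx a)))
    · ext N x
      exact stdSimplex_ext fun a => rfl
    · intro N x
      rw [mem_face_of_forall]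
      intro a
      exact Finset.mem_singleton.2 rfl
    · intro N x t hx
      rw [mem_face_of_forall] at hx
      refine stdSimplex_ext fun a => ?_
      have hx' := Finset.mem_singleton.1 (hx a)
      rw [asOrderHom_prismMap]
      rcases hφ (stdSimplex.asOrderHom x a) (stdSimplex.asOrderHom t a) with h | h
      · exact h
      · exact h.trans hx'.symm
    · intro N x t hx
      obtain ⟨j, hj, hxj⟩ := exists_missing_of_mem_horn hx
      refine mem_horn_of_missing hj _ fun a => ?_
      rw [asOrderHom_prismMap]
      rcases hφ (stdSimplex.asOrderHom x a) (stdSimplex.asOrderHom t a) with h | h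
      · rw [h]; exact hxj a
      · rw [h]; exact hj.symm
  -- otherwise push the vertices down to `i`; this preserves the horn and retracts the simplex to
  -- its face on the vertices up to `i`, which lies in the horn
  · let φ : Fin (n + 1 + 1) × Fin 2 →o Fin (n + 1 + 1) :=
      ⟨fun x => if x.2 = 0 then min x.1 i else x.1, by
        rintro ⟨a, s⟩ ⟨b, t⟩ ⟨h1, h2⟩
        dsimp at h1 h2 ⊢
        split_ifs with h3 h4
        · exact min_le_min_right _ h1
        · exact (min_le_left _ _).trans h1
        · subst_vars
          exact absurd (le_antisymm h2 (Fin.zero_le _)) h3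
        · exact h1⟩
    have hφ : ∀ a s, φ (a, s) = a ∨ φ (a, s) = i := by
      intro a s
      change (if s = 0 then min a i else a) = a ∨ (if s = 0 then min a i else a) = i
      split_ifs
      · exact min_choice a i
      · simp
    refine anodyne_preimage_of_deformation hπ (A₀ := stdSimplex.face (Finset.Iic i)) ?_ 0 1
      (prismMap φ) ?_ ?_ ?_ ?_
    · intro N x hx
      rw [mem_face_of_forall] at hx
      refine mem_horn_of_missing (j := Fin.last _) (Ne.symm hi) x fun a ha => hi ?_
      exact (Fin.last_le_iff.1 (ha ▸ Finset.mem_Iic.1 (hx a)))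
    · ext N x
      exact stdSimplex_ext fun a => rfl
    · intro N x
      rw [mem_face_of_forall]
      intro a
      exact Finset.mem_Iic.2 (min_le_right _ _)
    · intro N x t hx
      rw [mem_face_of_forall] at hx
      refine stdSimplex_ext fun a => ?_
      have hx' := Finset.mem_Iic.1 (hx a)
      rw [asOrderHom_prismMap]
      change (if _ then min _ i else _) = _
      split_ifs
      · exact min_eq_left hx'
      · rfl
    · intro N x t hx
      obtain ⟨j, hj, hxj⟩ := exists_missing_of_mem_horn hx
      refine mem_horn_of_missing hj _ fun a => ?_
      rw [asOrderHom_prismMap]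
      rcases hφ (stdSimplex.asOrderHom x a) (stdSimplex.asOrderHom t a) with h | h
      · rw [h]; exact hxj a
      · rw [h]; exact hj.symm

end Horns

/-! ### Base change of anodyne extensions along fibrations -/

section DependentProduct
variable {C T : SSet.{u}}

/-- A simplex of the dependent product along `g : C ⟶ T` of the simplicial set `C × Z` over `C`:
a simplex of `T` and a map to `Z` from the pullback of `C` to this simplex. -/
structure PiSimplex (g : C ⟶ T) (Z : SSet.{u}) (n : SimplexCategoryᵒᵖ) where
  base : T.obj n
  toFun : ∀ {m : SimplexCategoryᵒᵖ} (θ : n ⟶ m) (c : C.obj m), g.app m c = T.map θ base → Z.obj m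
  nat : ∀ {m m' : SimplexCategoryᵒᵖ} (θ : n ⟶ m) (τ : m ⟶ m') (c : C.obj m)
    (h : g.app m c = T.map θ base) (h' : g.app m' (C.map τ c) = T.map (θ ≫ τ) base),
    Z.map τ (toFun θ c h) = toFun (θ ≫ τ) (C.map τ c) h'

variable {g : C ⟶ T} {Z W : SSet.{u}}

lemma PiSimplex.ext' {n : SimplexCategoryᵒᵖ} {s t : PiSimplex g Z n} (hb : s.base = t.base)
    (h : ∀ {m} (θ : n ⟶ m) (c : C.obj m) (hs : g.app m c = T.map θ s.base)
      (ht : g.app m c = T.map θ t.base), s.toFun θ c hs = t.toFun θ c ht) : s = t := by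
  obtain ⟨b, f, _⟩ := s
  obtain ⟨b', f', _⟩ := t
  obtain rfl : b = b' := hb
  congr
  funext m θ c hs
  exact h θ c hs hs

lemma PiSimplex.toFun_congr {n m : SimplexCategoryᵒᵖ} {s t : PiSimplex g Z n} (h : s = t)
    {θ θ' : n ⟶ m} (hθ : θ = θ') {c c' : C.obj m} (hc : c = c') (hs) (ht) :
    s.toFun θ c hs = t.toFun θ' c' ht := by
  subst h hθ hc
  rfl

variable (g Z) in
/-- The dependent product along `g : C ⟶ T` of the simplicial set `C × Z` over `C`. -/
def piObj : SSet.{u} where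
  obj n := PiSimplex g Z n
  map {n n'} θ₀ := ↾fun s =>
    { base := T.map θ₀ s.base
      toFun := fun θ c h => s.toFun (θ₀ ≫ θ) c (by rw [h, Functor.map_comp]; rfl)
      nat := fun θ τ c h h' => (s.nat (θ₀ ≫ θ) τ c _
        (by rw [h', Category.assoc, T.map_comp θ₀]; rfl)).trans
        (PiSimplex.toFun_congr rfl (Category.assoc _ _ _) rfl _ _) }
  map_id n := by
    ext s
    refine PiSimplex.ext' (by simp) fun θ c hs ht => ?_
    exact PiSimplex.toFun_congr rfl (Category.id_comp _) rfl _ _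
  map_comp a b := by
    ext s
    refine PiSimplex.ext' (by simp) fun θ c hs ht => ?_
    exact PiSimplex.toFun_congr rfl (Category.assoc _ _ _) rfl _ _

variable (g Z) in
/-- The structure map of the dependent product. -/
def piBase : piObj g Z ⟶ T where
  app _ := ↾fun s => PiSimplex.base s
  naturality _ _ _ := rfl

variable (g) in
/-- The functoriality of the dependent product. -/
def piMap (κ : Z ⟶ W) : piObj g Z ⟶ piObj g W where
  app _ := ↾fun s =>
    { base := PiSimplex.base s
      toFun := fun θ c h => κ.app _ (PiSimplex.toFun s θ c h)
      nat := fun θ τ c h h' => (map_app_apply κ τ _).symm.trans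
        (congrArg (κ.app _) (PiSimplex.nat s θ τ c h h')) }
  naturality _ _ _ := rfl

variable {A Q : SSet.{u}} {w : A ⟶ T} {b : Q ⟶ A} {c : Q ⟶ C}

lemma pullback_toFun_aux (sq : IsPullback b c w g) {n m : SimplexCategoryᵒᵖ} (a : A.obj n)
    (θ : n ⟶ m) (x : C.obj m)
    (h : g.app m x = T.map θ (w.app n a)) :
    ∃ z : Q.obj m, b.app m z = A.map θ a ∧ c.app m z = x :=
  exists_of_isPullback sq _ _ (by rw [map_app_apply, h])

/-- Maps to the dependent product from maps on the pullback. -/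
noncomputable def piCurry (sq : IsPullback b c w g) (ψ : Q ⟶ Z) : A ⟶ piObj g Z where
  app n := ↾fun a =>
    { base := w.app n a
      toFun := fun θ x h => ψ.app _ (pullback_toFun_aux sq a θ x h).choose
      nat := fun θ τ x h h' => by
        rw [← map_app_apply]
        congr 1
        have h1 := (pullback_toFun_aux sq a θ x h).choose_spec
        have h2 := (pullback_toFun_aux sq a _ _ h').choose_spec
        refine ext_of_isPullback sq ?_ ?_
        · rw [map_app_apply, h1.1, h2.1]; simp
        · rw [map_app_apply, h1.2, h2.2] }
  naturality n n' θ₀ := by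
    ext a
    refine PiSimplex.ext' (map_app_apply w θ₀ a) fun θ x hs ht => ?_
    have ht' : g.app _ x = T.map (θ₀ ≫ θ) (w.app n a) := by
      rw [Functor.map_comp]; exact ht
    change ψ.app _ (pullback_toFun_aux sq (A.map θ₀ a) θ x hs).choose =
      ψ.app _ (pullback_toFun_aux sq a (θ₀ ≫ θ) x ht').choose
    congr 1
    have h1 := (pullback_toFun_aux sq (A.map θ₀ a) θ x hs).choose_spec
    have h2 := (pullback_toFun_aux sq a (θ₀ ≫ θ) x ht').choose_spec
    refine ext_of_isPullback sq ?_ ?_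
    · rw [h1.1, h2.1]; simp
    · rw [h1.2, h2.2]

lemma piCurry_toFun (sq : IsPullback b c w g) (ψ : Q ⟶ Z) {n m : SimplexCategoryᵒᵖ} (a : A.obj n)
    (θ : n ⟶ m) (x : C.obj m) (h) (z : Q.obj m) (h1 : b.app m z = A.map θ a) (h2 : c.app m z = x) :
    PiSimplex.toFun ((piCurry sq ψ).app n a) θ x h = ψ.app m z := by
  change ψ.app _ (pullback_toFun_aux sq a θ x h).choose = _
  congr 1
  have h3 := (pullback_toFun_aux sq a θ x h).choose_spec
  exact ext_of_isPullback sq (h3.1.trans h1.symm) (h3.2.trans h2.symm)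

/-- The map on the pullback from a map to the dependent product. -/
def piUncurry (sq : b ≫ w = c ≫ g) (f : A ⟶ piObj g Z) (hf : f ≫ piBase g Z = w) : Q ⟶ Z where
  app n := ↾fun z => PiSimplex.toFun (f.app n (b.app n z)) (𝟙 n) (c.app n z) (by
    have := app_congr sq n z
    have h2 := app_congr hf n (b.app n z)
    rw [T.map_id]
    exact this.symm.trans h2.symm)
  naturality n m τ := by
    ext z
    change PiSimplex.toFun (f.app m (b.app m (Q.map τ z))) (𝟙 m) (c.app m (Q.map τ z)) _ =
      Z.map τ (PiSimplex.toFun (f.app n (b.app n z)) (𝟙 n) (c.app n z) _)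
    have e : f.app m (b.app m (Q.map τ z)) = (piObj g Z).map τ (f.app n (b.app n z)) := by
      rw [map_app_apply, map_app_apply]
    have h2 := app_congr hf n (b.app n z)
    refine Eq.trans ?_ (PiSimplex.nat _ _ _ _ _ (by
      rw [map_app_apply, Category.id_comp]
      exact congrArg (T.map τ) ((app_congr sq n z).symm.trans h2.symm))).symm
    refine (PiSimplex.toFun_congr e rfl (map_app_apply c τ z) _ (by
      rw [map_app_apply, T.map_id]
      exact congrArg (T.map τ) ((app_congr sq n z).symm.trans h2.symm))).trans ?_
    exact PiSimplex.toFun_congr rfl ((Category.comp_id _).trans (Category.id_comp _).symm) rfl _ _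

/-- The value of `piUncurry` at `z` can be computed from any simplex `a` of which `b z` is an
iterated face or degeneracy. -/
lemma piUncurry_app (sq : b ≫ w = c ≫ g) (f : A ⟶ piObj g Z) (hf : f ≫ piBase g Z = w)
    {n m : SimplexCategoryᵒᵖ} (a : A.obj n) (θ : n ⟶ m) (x : C.obj m) (h) (z : Q.obj m)
    (h1 : b.app m z = A.map θ a) (h2 : c.app m z = x) :
    (piUncurry sq f hf).app m z = PiSimplex.toFun (f.app n a) θ x h := by
  have e : f.app m (b.app m z) = (piObj g Z).map θ (f.app n a) := by
    rw [h1, map_app_apply]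
  refine (PiSimplex.toFun_congr e rfl h2 _ ?_).trans
    (PiSimplex.toFun_congr rfl (Category.comp_id _) rfl _ _)
  rw [T.map_id]
  exact h

/-- Lifting problems for a base change along `g` are lifting problems for the dependent product
along `g`. -/
lemma lift_of_lift_piMap {A' Q' : SSet.{u}} {w' : A' ⟶ T} {b' : Q' ⟶ A'} {c' : Q' ⟶ C}
    (sq : IsPullback b c w g) (sq' : IsPullback b' c' w' g) {i : A ⟶ A'} {k : Q ⟶ Q'}
    (hw : i ≫ w' = w) (hb : k ≫ b' = b ≫ i) (hc : k ≫ c' = c) {κ : Z ⟶ W}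
    [HasLiftingProperty i (piMap g κ)] : HasLiftingProperty k κ := by
  refine ⟨fun {u v} s => ?_⟩
  have cs : CommSq (piCurry sq u) i (piMap g κ) (piCurry sq' v) := ⟨by
    ext n a
    refine PiSimplex.ext' (app_congr hw n a).symm fun {m} θ x hs ht => ?_
    obtain ⟨z, z1, z2⟩ := pullback_toFun_aux sq a θ x hs
    change κ.app _ (PiSimplex.toFun ((piCurry sq u).app n a) θ x hs) = _
    refine (congrArg (κ.app _) (piCurry_toFun sq u a θ x hs z z1 z2)).trans
      ((app_congr s.w m z).trans ?_)
    refine (piCurry_toFun sq' v (i.app n a) θ x ht (k.app m z) ?_ ?_).symm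
    · rw [← map_app_apply, ← z1]; exact app_congr hb m z
    · rw [← z2]; exact app_congr hc m z⟩
  have hl : cs.lift ≫ piBase g Z = w' := by
    have : cs.lift ≫ piMap g κ ≫ piBase g W = piCurry sq' v ≫ piBase g W := by
      rw [← Category.assoc, cs.fac_right]
    exact this
  refine ⟨⟨⟨piUncurry sq'.w cs.lift hl, ?_, ?_⟩⟩⟩
  · ext n z
    have e : cs.lift.app n (b'.app n (k.app n z)) = (piCurry sq u).app n (b.app n z) := by
      exact (congrArg (cs.lift.app n) (app_congr hb n z)).trans (app_congr cs.fac_left n _)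
    refine (PiSimplex.toFun_congr e rfl (app_congr hc n z) _ ?_).trans
      (piCurry_toFun sq u _ _ _ _ z (by simp) rfl)
    rw [T.map_id]
    exact (app_congr sq.w n z).symm
  · ext n z
    have e := app_congr cs.fac_right n (b'.app n z)
    refine (PiSimplex.toFun_congr e rfl rfl _ ?_).trans
      (piCurry_toFun sq' v _ _ _ _ z (by simp) rfl)
    rw [T.map_id]
    exact (app_congr sq'.w n z).symm

lemma isPullback_preimage {P B : SSet.{u}} (S : B.Subcomplex) (π : P ⟶ B) :
    IsPullback (S.fromPreimage π) (S.preimage π).ι S.ι π := by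
  refine isPullback_of_elements rfl ?_ ?_
  · intro n x y h
    exact ⟨⟨y, show π.app n y ∈ S.obj n from h ▸ x.2⟩, Subtype.ext h.symm, rfl⟩
  · intro n z z' _ h
    exact Subtype.ext h

/-- The dependent product along a fibration preserves fibrations. -/
lemma isFibration_piMap (hg : IsFibration g) {κ : Z ⟶ W} (hκ : IsFibration κ) :
    IsFibration (piMap g κ) := by
  intro X Y i hi
  simp only [modelCategoryQuillen.J, MorphismProperty.iSup_iff] at hi
  obtain ⟨n, ⟨i⟩⟩ := hi
  refine ⟨fun {s t} sq => ?_⟩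
  -- the lifting problem is equivalent to one for the part over the horn of a fibration over `Δ[n+1]`
  let w : Δ[n + 1] ⟶ T := t ≫ piBase g W
  have p1 : IsPullback (pullback.fst w g) (pullback.snd w g) w g := IsPullback.of_hasPullback _ _
  have p2 := isPullback_preimage Λ[n + 1, i] (pullback.fst w g)
  have p3 := p2.paste_vert p1
  have hs : s ≫ piBase g Z = Λ[n + 1, i].ι ≫ w := by
    rw [← Category.assoc, ← sq.w]; rfl
  have hl := anodyne_preimage_horn i (IsFibration.of_isPullback p1 hg) κ hκ
  have cs : CommSq (piUncurry p3.w s hs) (Λ[n + 1, i].preimage (pullback.fst w g)).ι κ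
      (piUncurry p1.w t rfl) := ⟨by
    ext m z
    have e : (piMap g κ).app m (s.app m ((Λ[n + 1, i].fromPreimage (pullback.fst w g)).app m z)) =
        t.app m ((pullback.fst w g).app m z.1) := app_congr sq.w m _
    exact PiSimplex.toFun_congr e rfl rfl _ _⟩
  refine ⟨⟨⟨piCurry p1 cs.lift, ?_, ?_⟩⟩⟩
  · ext m a
    refine PiSimplex.ext' (app_congr hs m a).symm fun {m'} θ x h h' => ?_
    obtain ⟨z, z1, z2⟩ := pullback_toFun_aux p3 a θ x h
    refine (piCurry_toFun p1 _ _ θ x h z.1 (congrArg Subtype.val z1) z2).trans ?_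
    refine (app_congr cs.fac_left m' z).trans ?_
    exact piUncurry_app p3.w s hs a θ x h' z z1 z2
  · ext m a
    refine PiSimplex.ext' rfl fun {m'} θ x h h' => ?_
    obtain ⟨z, z1, z2⟩ := pullback_toFun_aux p1 a θ x h
    refine (congrArg (κ.app _) (piCurry_toFun p1 _ _ θ x h z z1 z2)).trans ?_
    exact (app_congr cs.fac_right m' z).trans (piUncurry_app p1.w t rfl a θ x h' z z1 z2)

/-- Anodyne extensions are stable under base change along fibrations. -/
lemma anodyne_baseChange (hg : IsFibration g) {A' Q' : SSet.{u}} {w' : A' ⟶ T} {b' : Q' ⟶ A'}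
    {c' : Q' ⟶ C} (sq : IsPullback b c w g) (sq' : IsPullback b' c' w' g) {i : A ⟶ A'}
    (hi : anodyneExtensions i) {k : Q ⟶ Q'} (hw : i ≫ w' = w) (hb : k ≫ b' = b ≫ i)
    (hc : k ≫ c' = c) : anodyneExtensions k := by
  intro Z W κ hκ
  have := hi (piMap g κ) (isFibration_piMap hg hκ)
  exact lift_of_lift_piMap sq sq' hw hb hc

end DependentProduct

/-! ### Homotopy groups through maps to Kan complexes -/

section KanPi
open modelCategoryQuillen
variable {n : ℕ} {X Y Z W : SSet.{u}} {x : X _⦋0⦌} {y : Y _⦋0⦌} {z : Z _⦋0⦌} {w : W _⦋0⦌}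

/-- Homotopy classes of pointed `n`-simplices. For a Kan complex this is `π_n(Z, z)`. -/
abbrev KPi (n : ℕ) (Z : SSet.{u}) (z : Z _⦋0⦌) : Type u :=
  RelativeMorphism.HomotopyClass (boundary n) (Subcomplex.ofSimplex z)
    (SSet.const ⟨z, Subcomplex.mem_ofSimplex_obj z⟩)

/-- The class of a pointed simplex. -/
def KPi.mk (s : Z.PtSimplex n z) : KPi n Z z := RelativeMorphism.homotopyClass s

lemma KPi.exists_mk (c : KPi n Z z) : ∃ s, KPi.mk s = c := c.eq_homotopyClass

/-- The image of a pointed simplex under a pointed map. -/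
def ptMap (f : Z ⟶ W) (h : f.app _ z = w) (s : Z.PtSimplex n z) : W.PtSimplex n w :=
  s.comp (RelativeMorphism.ofSimplex₀ f z w h) rfl

@[simp] lemma ptMap_map (f : Z ⟶ W) (h : f.app _ z = w) (s : Z.PtSimplex n z) :
    (ptMap f h s).map = s.map ≫ f := rfl

/-- The functoriality of homotopy classes of pointed simplices. -/
def KPi.map (f : Z ⟶ W) (h : f.app _ z = w) (c : KPi n Z z) : KPi n W w :=
  c.postcomp (RelativeMorphism.ofSimplex₀ f z w h) rfl

lemma KPi.map_mk (f : Z ⟶ W) (h : f.app _ z = w) (s : Z.PtSimplex n z) :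
    KPi.map f h (KPi.mk s) = KPi.mk (ptMap f h s) := rfl

lemma KPi.map_map (f : X ⟶ Y) (h : f.app _ x = y) (g : Y ⟶ Z) (h' : g.app _ y = z) (k : X ⟶ Z)
    (hk : f ≫ g = k) (hk' : k.app _ x = z) (c : KPi n X x) :
    KPi.map g h' (KPi.map f h c) = KPi.map k hk' c := by
  obtain ⟨s, rfl⟩ := c.exists_mk
  subst hk
  rfl

lemma KPi.map_id (h : (𝟙 X : X ⟶ X).app _ x = x) (c : KPi n X x) : KPi.map (𝟙 X) h c = c := by
  obtain ⟨s, rfl⟩ := c.exists_mk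
  rfl

/-- The degeneracies of a vertex. -/
abbrev pt (z : Z _⦋0⦌) (m : SimplexCategoryᵒᵖ) : Z.obj m :=
  Z.map (SimplexCategory.const m.unop ⦋0⦌ 0).op z

lemma app_pt (f : Z ⟶ W) (h : f.app _ z = w) (m) : f.app m (pt z m) = pt w m := by
  rw [map_app_apply, h]

/-- Maps which are homotopic relative to the base point induce the same map. -/
lemma KPi.map_congr {f g : Z ⟶ W} (H : Z ⊗ Δ[1] ⟶ W) (h0 : ι₀ ≫ H = f) (h1 : ι₁ ≫ H = g)
    (hz : ∀ m (t : (Δ[1] : SSet.{u}).obj m), H.app m (pt z m, t) = pt w m)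
    (hf : f.app _ z = w) (hg : g.app _ z = w) (c : KPi n Z z) :
    KPi.map f hf c = KPi.map g hg c := by
  obtain ⟨s, rfl⟩ := c.exists_mk
  refine RelativeMorphism.Homotopy.eq ⟨s.map ▷ _ ≫ H, ?_, ?_, ?_⟩
  · subst h0; rfl
  · subst h1; rfl
  · ext m ⟨a, t⟩
    have : s.map.app m a.1 = pt z m := app_congr s.comm m a
    change H.app m (s.map.app m a.1, t) = pt w m
    rw [this, hz]

lemma KanComplex.isFibration_from (Z : SSet.{u}) [KanComplex Z] : IsFibration (terminal.from Z) :=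
  (modelCategoryQuillen.fibration_iff _).1 inferInstance

lemma anodyne_kanIncl (X : SSet.{u}) : anodyneExtensions (kanIncl X) :=
  (kanFactorization.factorizationData (terminal.from X)).hi

instance (X : SSet.{u}) : KanComplex (kanRepl X) := by
  have h := (kanFactorization.factorizationData (terminal.from X)).hp
  have : modelCategoryQuillen.J.rlp (terminal.from (kanRepl X)) := by
    rw [Subsingleton.elim (terminal.from (kanRepl X))
      (kanFactorization.factorizationData (terminal.from X)).p]
    exact h
  exact (isFibrant_iff _).2 ((modelCategoryQuillen.fibration_iff _).2 this)

lemma exists_extension_of_anodyne {i : X ⟶ Y} (hi : anodyneExtensions i) [KanComplex Z]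
    (u : X ⟶ Z) : ∃ v : Y ⟶ Z, i ≫ v = u := by
  have := hi (terminal.from Z) (KanComplex.isFibration_from Z)
  have sq : CommSq u i (terminal.from Z) (terminal.from Y) := ⟨Subsingleton.elim _ _⟩
  exact ⟨sq.lift, sq.fac_left⟩

/-- Homotopies of maps to a Kan complex extend along anodyne extensions. -/
lemma exists_homotopy_extension {i : X ⟶ Y} (hi : anodyneExtensions i) [KanComplex Z]
    (f g : Y ⟶ Z) (t : X ⊗ Δ[1] ⟶ Z) (h0 : ι₀ ≫ t = i ≫ f) (h1 : ι₁ ≫ t = i ≫ g) :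
    ∃ l : Y ⊗ Δ[1] ⟶ Z, ι₀ ≫ l = f ∧ ι₁ ≫ l = g ∧ i ▷ _ ≫ l = t := by
  obtain ⟨l, l0, l1, l2, -⟩ := exists_homotopy_of_anodyne hi (KanComplex.isFibration_from Z) f g t
    (terminal.from _) h0 h1 (Subsingleton.elim _ _) (Subsingleton.elim _ _) (Subsingleton.elim _ _)
  exact ⟨l, l0, l1, l2⟩

/-- Pointed maps to a Kan complex induce the same map on homotopy classes of pointed simplices if
they are homotopic, relative to the base point, after restriction along an anodyne extension. -/
lemma KPi.map_congr_of_anodyne {i : X ⟶ Y} (hi : anodyneExtensions i) [KanComplex Z]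
    {f g : Y ⟶ Z} (t : X ⊗ Δ[1] ⟶ Z) (h0 : ι₀ ≫ t = i ≫ f) (h1 : ι₁ ≫ t = i ≫ g)
    (hix : i.app _ x = y) (hx : ∀ m (s : (Δ[1] : SSet.{u}).obj m), t.app m (pt x m, s) = pt z m)
    (hf : f.app _ y = z) (hg : g.app _ y = z) (c : KPi n Y y) :
    KPi.map f hf c = KPi.map g hg c := by
  obtain ⟨l, l0, l1, l2⟩ := exists_homotopy_extension hi f g t h0 h1
  refine KPi.map_congr l l0 l1 (fun m s => ?_) hf hg c
  rw [← app_pt i hix]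
  exact (app_congr l2 m (pt x m, s)).trans (hx m s)

lemma KPi.map_congr_of_anodyne' {i : X ⟶ Y} (hi : anodyneExtensions i) [KanComplex Z]
    {f g : Y ⟶ Z} (h : i ≫ f = i ≫ g)
    (hix : i.app _ x = y) (hf : f.app _ y = z) (hg : g.app _ y = z) (c : KPi n Y y) :
    KPi.map f hf c = KPi.map g hg c := by
  refine KPi.map_congr_of_anodyne hi (CartesianMonoidalCategory.fst _ _ ≫ i ≫ f) rfl h hix
    (fun m s => ?_) hf hg c
  change f.app m (i.app m (pt x m)) = _
  rw [app_pt i hix, app_pt f hf]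

/-- An extension to the Kan replacement of a map to a Kan complex. -/
noncomputable def kanExt (u : X ⟶ Z) [KanComplex Z] : kanRepl X ⟶ Z :=
  (exists_extension_of_anodyne (anodyne_kanIncl X) u).choose

lemma kanIncl_kanExt (u : X ⟶ Z) [KanComplex Z] : kanIncl X ≫ kanExt u = u :=
  (exists_extension_of_anodyne (anodyne_kanIncl X) u).choose_spec

lemma kanExt_app (u : X ⟶ Z) [KanComplex Z] (h : u.app _ x = z) :
    (kanExt u).app _ ((kanIncl X).app _ x) = z :=
  (app_congr (kanIncl_kanExt u) _ x).trans h

/-- The map from the homotopy groups of `X` to those of a Kan complex. -/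
noncomputable def toKan (u : X ⟶ Z) [KanComplex Z] (h : u.app _ x = z) (c : PiGroup n X x) :
    KPi n Z z := KPi.map (kanExt u) (kanExt_app u h) c

lemma toKan_map [KanComplex Z] (f : X ⟶ Y) (hf : f.app _ x = y) (u : Y ⟶ Z) (hu : u.app _ y = z)
    (v : X ⟶ Z) (hv : f ≫ u = v) (hv' : v.app _ x = z) (c : PiGroup n X x) :
    toKan u hu (c.map f hf) = toKan v hv' c := by
  refine (KPi.map_map (kanMap f) (kanMap_app f hf) (kanExt u) (kanExt_app u hu) _ rfl
    ?_ c).trans ?_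
  · exact (congrArg ((kanExt u).app _) (kanMap_app f hf)).trans (kanExt_app u hu)
  · refine KPi.map_congr_of_anodyne' (anodyne_kanIncl X) ?_ rfl _ _ c
    rw [← Category.assoc, kanIncl_kanMap, Category.assoc, kanIncl_kanExt, kanIncl_kanExt, hv]

lemma map_toKan [KanComplex Z] [KanComplex W] (u : X ⟶ Z) (hu : u.app _ x = z) (g : Z ⟶ W)
    (hg : g.app _ z = w) (v : X ⟶ W) (hv : u ≫ g = v) (hv' : v.app _ x = w) (c : PiGroup n X x) :
    KPi.map g hg (toKan u hu c) = toKan v hv' c := by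
  refine (KPi.map_map (kanExt u) (kanExt_app u hu) g hg _ rfl
    ((congrArg (g.app _) (kanExt_app u hu)).trans hg) c).trans ?_
  refine KPi.map_congr_of_anodyne' (anodyne_kanIncl X) ?_ rfl _ _ c
  rw [← Category.assoc, kanIncl_kanExt, kanIncl_kanExt, hv]

lemma toKan_congr [KanComplex Z] {u v : X ⟶ Z} (H : X ⊗ Δ[1] ⟶ Z) (h0 : ι₀ ≫ H = u)
    (h1 : ι₁ ≫ H = v) (hx : ∀ m (s : (Δ[1] : SSet.{u}).obj m), H.app m (pt x m, s) = pt z m)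
    (hu : u.app _ x = z) (hv : v.app _ x = z) (c : PiGroup n X x) : toKan u hu c = toKan v hv c :=
  KPi.map_congr_of_anodyne (anodyne_kanIncl X) H (by rw [h0, kanIncl_kanExt])
    (by rw [h1, kanIncl_kanExt]) rfl hx _ _ c

/-- A homotopy inverse of `kanExt u`, for an anodyne extension `u` to a Kan complex. -/
lemma exists_inverse {u : X ⟶ Z} [KanComplex Z] (hu : anodyneExtensions u) (h : u.app _ x = z) :
    ∃ (v : Z ⟶ kanRepl X) (hv : v.app _ z = (kanIncl X).app _ x), u ≫ v = kanIncl X ∧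
      (∀ n (c : PiGroup n X x), KPi.map v hv (toKan u h c) = c) ∧
      ∀ n (c : KPi n Z z), toKan u h (KPi.map v hv c : PiGroup n X x) = c := by
  obtain ⟨v, hv⟩ := exists_extension_of_anodyne hu (kanIncl X)
  have hv' : v.app _ z = (kanIncl X).app _ x := by
    rw [← h]; exact app_congr hv _ x
  refine ⟨v, hv', hv, fun n c => ?_, fun n c => ?_⟩
  · refine (KPi.map_map (kanExt u) (kanExt_app u h) v hv' _ rfl
      ((congrArg (v.app _) (kanExt_app u h)).trans hv') c).trans ?_
    refine (KPi.map_congr_of_anodyne' (anodyne_kanIncl X) ?_ rfl _ rfl c).trans (KPi.map_id rfl c)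
    rw [← Category.assoc, kanIncl_kanExt, hv, Category.comp_id]
  · refine (KPi.map_map v hv' (kanExt u) (kanExt_app u h) _ rfl
      ((congrArg ((kanExt u).app _) hv').trans (kanExt_app u h)) c).trans ?_
    refine (KPi.map_congr_of_anodyne' hu ?_ h _ rfl c).trans (KPi.map_id rfl c)
    rw [← Category.assoc, hv, kanIncl_kanExt, Category.comp_id]

/-- An anodyne extension to a Kan complex computes the homotopy groups. -/
lemma toKan_bijective {u : X ⟶ Z} [KanComplex Z] (hu : anodyneExtensions u) (h : u.app _ x = z) :
    Function.Bijective (toKan u h : PiGroup n X x → KPi n Z z) := by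
  obtain ⟨v, hv, -, h1, h2⟩ := exists_inverse hu h
  exact Function.bijective_iff_has_inverse.2 ⟨fun c => KPi.map v hv c, h1 n, h2 n⟩

lemma toKan_one {u : X ⟶ Z} [KanComplex Z] (h : u.app _ x = z) :
    toKan u h (1 : PiGroup n X x) = KPi.mk RelativeMorphism.const := by
  subst h
  change KPi.mk (ptMap _ _ _) = _
  congr 1
  ext1
  exact (SSet.const_comp _ _).trans (congrArg SSet.const (kanExt_app u rfl))

/-- The product relation on homotopy classes of pointed simplices. -/
def KPi.IsMul (a b c : KPi (n + 1) Z z) : Prop :=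
  ∃ s t r : Z.PtSimplex (n + 1) z, KPi.mk s = a ∧ KPi.mk t = b ∧ KPi.mk r = c ∧
    Nonempty (PtSimplex.MulStruct s t r (Fin.last n))

lemma const_comp' {A : SSet.{u}} (f : Z ⟶ W) (h : f.app _ z = w) :
    (SSet.const z : A ⟶ Z) ≫ f = SSet.const w := by
  rw [SSet.const_comp, h]

lemma KPi.IsMul.map {a b c : KPi (n + 1) Z z} (hm : KPi.IsMul a b c) (f : Z ⟶ W)
    (h : f.app _ z = w) : KPi.IsMul (KPi.map f h a) (KPi.map f h b) (KPi.map f h c) := by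
  obtain ⟨s, t, r, rfl, rfl, rfl, ⟨m⟩⟩ := hm
  exact ⟨ptMap f h s, ptMap f h t, ptMap f h r, rfl, rfl, rfl,
    ⟨{map := m.map ≫ f
      δ_castSucc_castSucc_map := by rw [← Category.assoc, m.δ_castSucc_castSucc_map]; rfl
      δ_succ_castSucc_map := by rw [← Category.assoc, m.δ_succ_castSucc_map]; rfl
      δ_succ_succ_map := by rw [← Category.assoc, m.δ_succ_succ_map]; rfl
      δ_map_of_lt := fun j hj => by rw [← Category.assoc, m.δ_map_of_lt j hj, const_comp' f h]
      δ_map_of_gt := fun j hj => by rw [← Category.assoc, m.δ_map_of_gt j hj, const_comp' f h] }⟩⟩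

lemma isMul_toKan [KanComplex Z] (u : X ⟶ Z) (h : u.app _ x = z) {a b c : PiGroup (n + 1) X x}
    (hm : PiGroup.IsMul a b c) : KPi.IsMul (toKan u h a) (toKan u h b) (toKan u h c) :=
  KPi.IsMul.map (n := n) hm _ _

lemma isMul_of_toKan [KanComplex Z] {u : X ⟶ Z} (hu : anodyneExtensions u) (h : u.app _ x = z)
    {a b c : PiGroup (n + 1) X x} (hm : KPi.IsMul (toKan u h a) (toKan u h b) (toKan u h c)) :
    PiGroup.IsMul a b c := by
  obtain ⟨v, hv, -, h1, -⟩ := exists_inverse hu h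
  have := hm.map v hv
  rw [h1, h1, h1] at this
  exact this

/-- Simplices of `X` that represent an element of `π_n(X)` are sent to representatives of its image.
-/
lemma toKan_of_isRepresentedBy [KanComplex Z] (u : X ⟶ Z) (h : u.app _ x = z)
    {c : PiGroup n X x} {s : X _⦋n⦌} (hc : c.IsRepresentedBy s) :
    ∃ t : Z.PtSimplex n z, yonedaEquiv t.map = u.app _ s ∧ KPi.mk t = toKan u h c := by
  obtain ⟨t, ht, rfl⟩ := hc
  refine ⟨ptMap (kanExt u) (kanExt_app u h) t, ?_, rfl⟩
  rw [ptMap_map, yonedaEquiv_comp, ht]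
  exact app_congr (kanIncl_kanExt u) _ s

lemma isRepresentedBy_of_toKan [KanComplex Z] {u : X ⟶ Z} (hu : anodyneExtensions u)
    (h : u.app _ x = z) {c : PiGroup n X x} {s : X _⦋n⦌} (t : Z.PtSimplex n z)
    (ht : yonedaEquiv t.map = u.app _ s) (hc : KPi.mk t = toKan u h c) : c.IsRepresentedBy s := by
  obtain ⟨v, hv, huv, h1, -⟩ := exists_inverse hu h
  refine ⟨ptMap v hv t, ?_, ?_⟩
  · rw [ptMap_map, yonedaEquiv_comp, ht]
    exact app_congr huv _ s
  · rw [← h1 n c, ← hc]; rfl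

end KanPi

/-! ### Homotopies of pointed simplices and the triangulation of the prism -/

section Prism

lemma val_predAbove {n : ℕ} (i : Fin n) (a : Fin (n + 1)) :
    (i.predAbove a : ℕ) = if (i : ℕ) < a then (a : ℕ) - 1 else a := by
  unfold Fin.predAbove
  simp only [Fin.lt_def, Fin.val_castSucc]
  split_ifs <;> rfl

lemma val_succAbove {n : ℕ} (i : Fin (n + 1)) (a : Fin n) :
    (i.succAbove a : ℕ) = if (a : ℕ) < i then (a : ℕ) else a + 1 := by
  unfold Fin.succAbove
  simp only [Fin.lt_def, Fin.val_castSucc]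
  split_ifs <;> rfl

variable {X : SSet.{u}} {x : X _⦋0⦌} {n : ℕ}

/-- The map of standard simplices induced by a monotone map of vertices. -/
def simplexMap {n m : ℕ} (φ : Fin (n + 1) →o Fin (m + 1)) : (Δ[n] : SSet.{u}) ⟶ Δ[m] where
  app _ := ↾fun x => stdSimplex.objMk (φ.comp (stdSimplex.asOrderHom x))
  naturality _ _ _ := rfl

lemma exists_δ_of_missing {m : SimplexCategoryᵒᵖ} (y : (Δ[n + 1] : SSet.{u}).obj m)
    (j : Fin (n + 2)) (h : ∀ a, stdSimplex.asOrderHom y a ≠ j) :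
    ∃ z : (Δ[n] : SSet.{u}).obj m, (stdSimplex.δ j).app m z = y := by
  obtain ⟨θ, hθ⟩ := SimplexCategory.eq_comp_δ_of_not_surjective' (stdSimplex.objEquiv y) j h
  refine ⟨stdSimplex.objEquiv.symm θ, ?_⟩
  apply stdSimplex.objEquiv.injective
  exact hθ.symm

lemma asOrderHom_δ {m : SimplexCategoryᵒᵖ} (z : (Δ[n] : SSet.{u}).obj m) (j : Fin (n + 2)) (a) :
    stdSimplex.asOrderHom ((stdSimplex.δ j).app m z) a = j.succAbove (stdSimplex.asOrderHom z a) :=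
  rfl

lemma mem_boundary_of_missing {m : SimplexCategoryᵒᵖ} (y : (Δ[n] : SSet.{u}).obj m)
    (j : Fin (n + 1)) (h : ∀ a, stdSimplex.asOrderHom y a ≠ j) : y ∈ (boundary n).obj m := by
  intro hs
  obtain ⟨a, ha⟩ := hs j
  exact h a ha

lemma exists_missing_of_mem_boundary {m : SimplexCategoryᵒᵖ} {y : (Δ[n] : SSet.{u}).obj m}
    (h : y ∈ (boundary n).obj m) : ∃ j, ∀ a, stdSimplex.asOrderHom y a ≠ j := by
  have h' : ¬ Function.Surjective (stdSimplex.asOrderHom y) := h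
  simpa [Function.Surjective] using h'

lemma ptSimplex_app (f : X.PtSimplex n x) {m : SimplexCategoryᵒᵖ} {y : (Δ[n] : SSet.{u}).obj m}
    (h : y ∈ (boundary n).obj m) : f.map.app m y = pt x m := f.map_eq_of_mem y h

lemma relStruct_homotopy_aux (i : Fin (n + 1)) :
    Monotone fun a : Fin (n + 1) × Fin 2 =>
      if a.2 = 0 then i.succ.succAbove a.1 else i.castSucc.succAbove a.1 := by
  rintro ⟨a, s⟩ ⟨b, t⟩ ⟨h1, h2⟩
  dsimp at h1 h2 ⊢
  simp only [Fin.succAbove, Fin.lt_def, Fin.le_def, Fin.ext_iff] at *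
  split_ifs <;> simp at * <;> omega

/-- Simplices related by a `RelStruct` are homotopic. -/
lemma KPi.mk_eq_of_relStruct {f g : X.PtSimplex n x} {i : Fin (n + 1)}
    (r : PtSimplex.RelStruct f g i) : KPi.mk f = KPi.mk g := by
  -- collapse the prism to `Δ[n+1]`, its ends going to the faces opposite to `i + 1` and `i`
  let φ : Fin (n + 1) × Fin 2 →o Fin (n + 1 + 1) := ⟨_, relStruct_homotopy_aux i⟩
  symm
  refine RelativeMorphism.Homotopy.eq ⟨prismMap φ ≫ r.map, ?_, ?_, ?_⟩
  · rw [← r.δ_succ_map, ← Category.assoc]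
    congr 1
  · rw [← r.δ_castSucc_map, ← Category.assoc]
    congr 1
  · ext m ⟨a, t⟩
    obtain ⟨j, hj⟩ := exists_missing_of_mem_boundary a.2
    let y := (prismMap φ).app m (a.1, t)
    change r.map.app m y = pt x m
    have hy : ∀ b, stdSimplex.asOrderHom y b = i.succ.succAbove (stdSimplex.asOrderHom a.1 b) ∨
        stdSimplex.asOrderHom y b = i.castSucc.succAbove (stdSimplex.asOrderHom a.1 b) := by
      intro b
      change (if _ then _ else _) = _ ∨ (if _ then _ else _) = _
      split_ifs <;> simp
    -- the `j`-th wall of the prism goes to the face opposite to `j` or `j + 1`, where `r` is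
    -- constant, except for `j = i`, when it goes to the boundary of a face
    rcases lt_trichotomy j i with h | rfl | h
    · obtain ⟨z, hz⟩ := exists_δ_of_missing y j.castSucc (fun b hb => hj b (by
        rcases hy b with e | e <;> rw [e] at hb <;>
        simp only [Fin.succAbove, Fin.lt_def, Fin.ext_iff] at * <;>
        split_ifs at hb <;> simp at * <;> omega))
      rw [← hz]
      exact app_congr (r.δ_map_of_lt j.castSucc (by simpa using h)) m z
    · obtain ⟨z, hz⟩ := exists_δ_of_missing y j.castSucc (fun b hb => hj b (by
        rcases hy b with e | e <;> rw [e] at hb <;>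
        simp only [Fin.succAbove, Fin.lt_def, Fin.ext_iff] at * <;>
        split_ifs at hb <;> simp at * <;> omega))
      rw [← hz]
      refine (app_congr r.δ_castSucc_map m z).trans (ptSimplex_app f ?_)
      refine mem_boundary_of_missing z j fun b hb => hj b ?_
      have e1 := asOrderHom_δ z j.castSucc b
      rw [hz, hb] at e1
      rcases hy b with e | e <;> rw [e] at e1 <;>
        simp only [Fin.succAbove, Fin.lt_def, Fin.ext_iff] at * <;>
        split_ifs at e1 <;> simp at * <;> omega
    · obtain ⟨z, hz⟩ := exists_δ_of_missing y j.succ (fun b hb => hj b (by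
        rcases hy b with e | e <;> rw [e] at hb <;>
        simp only [Fin.succAbove, Fin.lt_def, Fin.ext_iff] at * <;>
        split_ifs at hb <;> simp at * <;> omega))
      rw [← hz]
      exact app_congr (r.δ_map_of_gt j.succ (by simpa using h)) m z

lemma cut_aux (k : Fin (n + 2)) :
    Monotone fun a : Fin (n + 1) => if a.castSucc < k then (0 : Fin 2) else 1 := by
  intro a b h
  dsimp
  split_ifs with h1 h2
  · exact le_rfl
  · exact zero_le_one
  · exact absurd (lt_of_le_of_lt (Fin.castSucc_le_castSucc_iff.2 h) ‹_›) h1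
  · exact le_rfl

/-- The `n`-simplex of `Δ[n] × Δ[1]` which is the identity on the first factor and whose vertices
lie over `0` before position `k`. -/
def cutSimplex (k : Fin (n + 2)) : (Δ[n] : SSet.{u}) ⟶ Δ[n] ⊗ Δ[1] :=
  CartesianMonoidalCategory.lift (𝟙 _) (simplexMap ⟨_, cut_aux k⟩)

/-- The `i`-th top-dimensional simplex of the prism `Δ[n] × Δ[1]`. -/
def prismSimplex (i : Fin (n + 1)) : (Δ[n + 1] : SSet.{u}) ⟶ Δ[n] ⊗ Δ[1] :=
  CartesianMonoidalCategory.lift (stdSimplex.σ i) (simplexMap ⟨_, cut_aux i.castSucc.succ⟩)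

lemma prism_ext {A : SSet.{u}} {f g : A ⟶ (Δ[n] : SSet.{u}) ⊗ Δ[1]}
    (h1 : ∀ m (y : A.obj m) a, stdSimplex.asOrderHom (f.app m y).1 a =
      stdSimplex.asOrderHom (g.app m y).1 a)
    (h2 : ∀ m (y : A.obj m) a, stdSimplex.asOrderHom (f.app m y).2 a =
      stdSimplex.asOrderHom (g.app m y).2 a) : f = g := by
  apply NatTrans.ext
  funext m
  refine ConcreteCategory.hom_ext _ _ fun y => ?_
  exact Prod.ext (stdSimplex_ext (h1 m y)) (stdSimplex_ext (h2 m y))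

/-- A function on pointed simplices which is invariant under all the relations `RelStruct` is
invariant under homotopy. -/
lemma KPi.eq_of_relStruct_invariant {α : Sort*} (F : X.PtSimplex n x → α)
    (hF : ∀ i f g, PtSimplex.RelStruct f g i → F f = F g) {f g : X.PtSimplex n x}
    (h : KPi.mk f = KPi.mk g) : F f = F g := by
  refine congrArg (Quot.lift F ?_) h
  rintro f g ⟨H⟩
  have hc : ∀ {m} (y : (Δ[n] : SSet.{u}).obj m) t, y ∈ (boundary n).obj m →
      H.h.app m (y, t) = pt x m := fun y t hy => app_congr H.rel _ (⟨y, hy⟩, t)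
  -- the diagonal `n`-simplices of the prism interpolate between its two ends; consecutive ones are
  -- faces of the same `(n+1)`-simplex, whose other faces lie in the walls
  let G : Fin (n + 2) → X.PtSimplex n x := fun k =>
    { map := cutSimplex k ≫ H.h
      comm := by
        ext m a
        exact hc a.1 _ a.2 }
  have key : ∀ i : Fin (n + 1), F (G i.castSucc) = F (G i.succ) := by
    intro i
    refine hF i _ _ ⟨prismSimplex i ≫ H.h, ?_, ?_, ?_, ?_⟩
    · change _ = cutSimplex _ ≫ H.h
      rw [← Category.assoc]
      congr 1
      refine prism_ext (fun m y a => ?_) (fun m y a => ?_)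
      · change Fin.predAbove i (i.castSucc.succAbove (stdSimplex.asOrderHom y a)) =
          stdSimplex.asOrderHom y a
        simp
      · change (if (i.castSucc.succAbove (stdSimplex.asOrderHom y a)).castSucc < i.castSucc.succ
          then (0 : Fin 2) else 1) =
          if (stdSimplex.asOrderHom y a).castSucc < i.castSucc then 0 else 1
        generalize stdSimplex.asOrderHom y a = b
        refine if_congr ?_ rfl rfl
        simp only [Fin.lt_def, val_succAbove, Fin.val_castSucc, Fin.val_succ]
        split_ifs <;> omega
    · change _ = cutSimplex _ ≫ H.h
      rw [← Category.assoc]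
      congr 1
      refine prism_ext (fun m y a => ?_) (fun m y a => ?_)
      · change Fin.predAbove i (i.succ.succAbove (stdSimplex.asOrderHom y a)) =
          stdSimplex.asOrderHom y a
        generalize stdSimplex.asOrderHom y a = b
        simp only [Fin.ext_iff, val_predAbove, val_succAbove, Fin.val_succ]
        split_ifs <;> omega
      · change (if (i.succ.succAbove (stdSimplex.asOrderHom y a)).castSucc < i.castSucc.succ
          then (0 : Fin 2) else 1) =
          if (stdSimplex.asOrderHom y a).castSucc < i.succ then 0 else 1
        generalize stdSimplex.asOrderHom y a = b
        refine if_congr ?_ rfl rfl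
        simp only [Fin.lt_def, val_succAbove, Fin.val_castSucc, Fin.val_succ]
        split_ifs <;> omega
    · intro j hj
      ext m y
      refine hc _ _ (mem_boundary_of_missing _ ⟨j, by have := hj; simp [Fin.lt_def] at this; omega⟩ ?_)
      intro a
      change Fin.predAbove i (j.succAbove (stdSimplex.asOrderHom y a)) ≠ _
      generalize stdSimplex.asOrderHom y a = b
      simp only [ne_eq, Fin.ext_iff, val_predAbove, val_succAbove, Fin.lt_def,
        Fin.val_castSucc] at hj ⊢
      split_ifs <;> omega
    · intro j hj
      ext m y
      refine hc _ _ (mem_boundary_of_missing _ ⟨j - 1, by omega⟩ ?_)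
      intro a
      change Fin.predAbove i (j.succAbove (stdSimplex.asOrderHom y a)) ≠ _
      generalize stdSimplex.asOrderHom y a = b
      simp only [ne_eq, Fin.ext_iff, val_predAbove, val_succAbove, Fin.lt_def,
        Fin.val_succ] at hj ⊢
      split_ifs <;> omega
  have h0 : G 0 = g := by
    ext1
    rw [← H.h₁]
    change cutSimplex 0 ≫ H.h = _
    congr 1
  have h1 : G (Fin.last _) = f := by
    ext1
    rw [← H.h₀]
    change cutSimplex _ ≫ H.h = _
    congr 1
    refine prism_ext (fun m y a => rfl) (fun m y a => ?_)
    exact if_pos (Fin.castSucc_lt_last _)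
  have all : ∀ k, F (G k) = F g := by
    intro k
    induction k using Fin.induction with
    | zero => rw [h0]
    | succ i ih => rw [← key, ih]
  rw [← all (Fin.last _), h1]

end Prism

/-! ### Horn fillings and the boundary map of a fibration -/

section Fillings
variable {E F T X : SSet.{u}} {n : ℕ}

/-- The lifting property of fibrations against horns of dimension at least two, with the faces of
the horn given by a family indexed by all vertices. The member of index `i` is irrelevant. -/
lemma exists_fill {p : E ⟶ T} (hp : IsFibration p) {i : Fin (n + 3)}
    (f : Fin (n + 3) → ((Δ[n + 1] : SSet.{u}) ⟶ E)) (t : Δ[n + 2] ⟶ T)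
    (hf : ∀ (j k : Fin (n + 2)), j.castSucc ≠ i → k.succ ≠ i → j ≤ k →
      stdSimplex.δ k ≫ f j.castSucc = stdSimplex.δ j ≫ f k.succ)
    (hft : ∀ j, j ≠ i → f j ≫ p = stdSimplex.δ j ≫ t) :
    ∃ W : Δ[n + 2] ⟶ E, (∀ j, j ≠ i → stdSimplex.δ j ≫ W = f j) ∧ W ≫ p = t := by
  have := (modelCategoryQuillen.fibration_iff p).2 hp
  have hc : horn.IsCompatible (i := i) (fun j _ => f j) := by
    intro j k hj hk hjk
    obtain ⟨j, rfl⟩ := j.eq_castSucc_of_ne_last (Fin.ne_last_of_lt hjk)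
    obtain ⟨k, rfl⟩ := k.eq_succ_of_ne_zero (Fin.ne_zero_of_lt hjk)
    exact hf j k hj hk (Fin.castSucc_lt_succ_iff.1 hjk)
  exact hc.exists_lift p t hft

/-- Filling a horn in which the zeroth face `A` and one further face `B` are not constant. -/
lemma exists_fill_two {p : E ⟶ T} (hp : IsFibration p) {e : E _⦋0⦌} {o : T _⦋0⦌}
    (he : p.app _ e = o) {b c : Fin (n + 2)} (hbc : b ≠ c)
    (A B : (Δ[n + 1] : SSet.{u}) ⟶ E) (t : Δ[n + 2] ⟶ T)
    (hAB : stdSimplex.δ b ≫ A = stdSimplex.δ 0 ≫ B)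
    (hA : ∀ k, k ≠ b → k ≠ c → stdSimplex.δ k ≫ A = SSet.const e)
    (hB : ∀ k, k ≠ 0 → stdSimplex.δ k ≫ B = SSet.const e)
    (hAt : A ≫ p = stdSimplex.δ 0 ≫ t) (hBt : B ≫ p = stdSimplex.δ b.succ ≫ t)
    (ht : ∀ k, k ≠ b → k ≠ c → stdSimplex.δ k.succ ≫ t = SSet.const o) :
    ∃ W : Δ[n + 2] ⟶ E, stdSimplex.δ 0 ≫ W = A ∧ stdSimplex.δ b.succ ≫ W = B ∧
      (∀ k, k ≠ b → k ≠ c → stdSimplex.δ k.succ ≫ W = SSet.const e) ∧ W ≫ p = t := by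
  -- the faces of the horn: `A`, then `B` in position `b + 1`, and constant simplices elsewhere; the
  -- face of index `c + 1` is missing
  let g : Fin (n + 2) → ((Δ[n + 1] : SSet.{u}) ⟶ E) := fun k => if k = b then B else SSet.const e
  have gb : g b = B := if_pos rfl
  have gc : ∀ k, k ≠ b → g k = SSet.const e := fun k hk => if_neg hk
  have g0 : ∀ k l, l ≠ 0 → stdSimplex.δ l ≫ g k = SSet.const e := by
    intro k l hl
    by_cases hk : k = b
    · rw [hk, gb, hB l hl]
    · rw [gc k hk]; rfl
  obtain ⟨W, h1, h2⟩ := exists_fill hp (i := c.succ) (Fin.cases A g) t (by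
    intro j k hj hk hjk
    refine Fin.cases (fun hj hjk => ?_) (fun j hj hjk => ?_) j hj hjk
    · change stdSimplex.δ k ≫ A = stdSimplex.δ 0 ≫ g k
      by_cases hkb : k = b
      · rw [hkb, gb, hAB]
      · rw [gc k hkb, hA k hkb (by simpa using hk)]; rfl
    · change stdSimplex.δ k ≫ g j.castSucc = stdSimplex.δ j.succ ≫ g k
      rw [g0 _ _ (Fin.succ_ne_zero _), g0]
      rintro rfl
      simp at hjk) (by
    intro j hj
    refine Fin.cases (fun hj => hAt) (fun j hj => ?_) j hj
    change g j ≫ p = _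
    by_cases hjb : j = b
    · rw [hjb, gb, hBt]
    · rw [gc j hjb, ht j hjb (by simpa using hj), const_comp' p he])
  refine ⟨W, h1 0 (Fin.succ_ne_zero _).symm, (h1 b.succ (by simpa using hbc)).trans gb,
    fun k hk hk' => (h1 k.succ (by simpa using hk')).trans (gc k hk), h2⟩

/-- In a simplex whose faces with positive indices have constant faces with positive indices,
except possibly for one of them, that one has this property as well. -/
lemma δ_comp_δ_succ_eq_const {e : E _⦋0⦌} {c : Fin (n + 2)} (W : Δ[n + 2] ⟶ E)
    (hW : ∀ k, k ≠ c → ∀ l, l ≠ 0 → stdSimplex.δ l ≫ stdSimplex.δ k.succ ≫ W = SSet.const e)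
    (l : Fin (n + 2)) (hl : l ≠ 0) :
    stdSimplex.δ l ≫ stdSimplex.δ c.succ ≫ W = SSet.const e := by
  obtain ⟨l, rfl⟩ := Fin.exists_succ_eq.2 hl
  rcases le_or_gt l.succ c with h | h
  · rw [stdSimplex.δ_comp_δ_assoc h, ← Fin.succ_castSucc]
    refine hW _ (fun h' => ?_) _ (fun h' => ?_)
    · rw [← h'] at h
      simp [Fin.le_def] at h
    · rw [h'] at h
      simp at h
  · obtain ⟨c', rfl⟩ := c.eq_castSucc_of_ne_last (Fin.ne_last_of_lt h)
    have h2 : c'.succ ≤ l.succ := Fin.castSucc_lt_iff_succ_le.1 h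
    rw [Fin.succ_castSucc, ← stdSimplex.δ_comp_δ_assoc h2]
    exact hW _ h.ne' _ (Fin.succ_ne_zero _)

/-- The pointed simplex on a simplex with constant faces. -/
def ptMk {x : X _⦋0⦌} (s : (Δ[n + 1] : SSet.{u}) ⟶ X)
    (h : ∀ i, stdSimplex.δ i ≫ s = SSet.const x) : X.PtSimplex (n + 1) x where
  map := s
  comm := by
    refine boundary.hom_ext fun i => ?_
    rw [← Category.assoc, boundary.ι_ι, h]
    rfl

/-- The pointed simplex on a vertex. -/
def ptMk₀ {x : X _⦋0⦌} (s : (Δ[0] : SSet.{u}) ⟶ X) : X.PtSimplex 0 x where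
  map := s
  comm := by ext

section Null
variable {x : X _⦋0⦌}

/-- A pointed simplex is null when it is the zeroth face of a simplex all of whose other faces
are constant. -/
def IsNull (s : X.PtSimplex n x) : Prop :=
  ∃ y : (Δ[n + 1] : SSet.{u}) ⟶ X, stdSimplex.δ 0 ≫ y = s.map ∧
    ∀ k, k ≠ 0 → stdSimplex.δ k ≫ y = SSet.const x

lemma const_terminal_eq {A : SSet.{u}} (f g : A ⟶ ⊤_ SSet.{u}) : f = g := Subsingleton.elim _ _

/-- A pointed simplex that is joined to a null one by a simplex whose remaining faces are constant
is null. -/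
lemma isNull_of_relStruct_aux [KanComplex X] {f g : X.PtSimplex n x} (σ : (Δ[n + 1] : SSet.{u}) ⟶ X)
    {b c : Fin (n + 2)} (hbc : b ≠ c) (hb : stdSimplex.δ b ≫ σ = f.map)
    (hc : stdSimplex.δ c ≫ σ = g.map)
    (h : ∀ k, k ≠ b → k ≠ c → stdSimplex.δ k ≫ σ = SSet.const x) (hf : IsNull f) : IsNull g := by
  obtain ⟨y, hy, hy'⟩ := hf
  obtain ⟨W, h1, h2, h3, -⟩ := exists_fill_two (KanComplex.isFibration_from X) (e := x) rfl hbc σ y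
    (terminal.from _) (hb.trans hy.symm) h hy' (const_terminal_eq _ _) (const_terminal_eq _ _)
    (fun _ _ _ => const_terminal_eq _ _)
  refine ⟨stdSimplex.δ c.succ ≫ W, ?_, ?_⟩
  · rw [stdSimplex.δ_comp_δ_assoc (Fin.zero_le c), Fin.castSucc_zero, h1, hc]
  · refine δ_comp_δ_succ_eq_const W fun k hk l hl => ?_
    by_cases hkb : k = b
    · rw [hkb, h2, hy' l hl]
    · rw [h3 k hkb hk]; rfl

lemma relStruct_other {f g : X.PtSimplex n x} {i : Fin (n + 1)} (r : PtSimplex.RelStruct f g i)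
    (k : Fin (n + 2)) (h1 : k ≠ i.castSucc) (h2 : k ≠ i.succ) :
    stdSimplex.δ k ≫ r.map = SSet.const x := by
  rcases lt_or_gt_of_ne h1 with h | h
  · exact r.δ_map_of_lt k h
  · refine r.δ_map_of_gt k (lt_of_le_of_ne ?_ h2.symm)
    exact Fin.castSucc_lt_iff_succ_le.1 h

/-- In a Kan complex, the pointed simplices in the trivial homotopy class are the null ones. -/
lemma mk_eq_one_iff [KanComplex X] (s : X.PtSimplex n x) :
    KPi.mk s = KPi.mk RelativeMorphism.const ↔ IsNull s := by
  constructor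
  · intro h
    have := KPi.eq_of_relStruct_invariant (F := fun s : X.PtSimplex n x => IsNull s)
      (fun i f g r => propext ⟨fun hf => isNull_of_relStruct_aux r.map (b := i.castSucc)
        (c := i.succ) Fin.castSucc_lt_succ.ne r.δ_castSucc_map r.δ_succ_map
        (relStruct_other r) hf, fun hg => isNull_of_relStruct_aux r.map (b := i.succ)
        (c := i.castSucc) Fin.castSucc_lt_succ.ne' r.δ_succ_map r.δ_castSucc_map
        (fun k h1 h2 => relStruct_other r k h2 h1) hg⟩) h
    exact this.mpr ⟨SSet.const x, rfl, fun k _ => rfl⟩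
  · rintro ⟨y, h0, h1⟩
    refine KPi.mk_eq_of_relStruct (i := 0) ⟨y, h0, h1 _ (Fin.succ_ne_zero _), ?_, ?_⟩
    · intro j hj
      exact absurd hj (Fin.not_lt_zero j)
    · intro j hj
      exact h1 j (Fin.ne_zero_of_lt hj)

end Null

section LongExactSequence
variable {ι : F ⟶ E} {p : E ⟶ T} {x : F _⦋0⦌} {e : E _⦋0⦌} {o : T _⦋0⦌}

/-- `ι` is the inclusion of the fibre of `p` over the vertex `o`. -/
structure IsFibreOver (ι : F ⟶ E) (p : E ⟶ T) (o : T _⦋0⦌) : Prop where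
  mono : Mono ι
  w : ι ≫ p = SSet.const o
  exists_lift : ∀ {A : SSet.{u}} (g : A ⟶ E), g ≫ p = SSet.const o → ∃ g', g' ≫ ι = g

/-- `ε` is a lift to `E` of the pointed simplex `τ` of `T`, all of whose faces are constant, except
for the zeroth one, which is the simplex `w` of the fibre. -/
structure IsBoundaryLift (ι : F ⟶ E) (p : E ⟶ T) (e : E _⦋0⦌) (ε : (Δ[n + 1] : SSet.{u}) ⟶ E)
    (τ : T.PtSimplex (n + 1) o) (w : F.PtSimplex n x) : Prop where
  comp : ε ≫ p = τ.map
  zero : stdSimplex.δ 0 ≫ ε = w.map ≫ ι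
  pos : ∀ k, k ≠ 0 → stdSimplex.δ k ≫ ε = SSet.const e

variable (hp : IsFibration p) (hF : IsFibreOver ι p o) (hx : ι.app _ x = e) (he : p.app _ e = o)
include hp hF hx he

omit hx in
/-- Lift a pointed simplex of the base, starting from the horn all of whose faces are constant. -/
lemma exists_lift_zero (τ : T.PtSimplex (n + 1) o) :
    ∃ (ε : (Δ[n + 1] : SSet.{u}) ⟶ E) (w : Δ[n] ⟶ F), ε ≫ p = τ.map ∧
      stdSimplex.δ 0 ≫ ε = w ≫ ι ∧ ∀ k, k ≠ 0 → stdSimplex.δ k ≫ ε = SSet.const e := by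
  have := (modelCategoryQuillen.fibration_iff p).2 hp
  have hc : horn.IsCompatible (i := 0) (fun (j : Fin (n + 2)) (_ : j ≠ 0) =>
      (SSet.const e : (Δ[n] : SSet.{u}) ⟶ E)) := by
    cases n with
    | zero => trivial
    | succ n => intro j k _ _ _; rfl
  obtain ⟨ε, h1, h2⟩ := hc.exists_lift p τ.map (fun j _ => by
    rw [const_comp' p he, τ.δ_map])
  obtain ⟨w, hw⟩ := hF.exists_lift (stdSimplex.δ 0 ≫ ε) (by rw [Category.assoc, h2, τ.δ_map])
  exact ⟨ε, w, h2, hw.symm, h1⟩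

lemma exists_isBoundaryLift (τ : T.PtSimplex (n + 1) o) :
    ∃ (ε : (Δ[n + 1] : SSet.{u}) ⟶ E) (w : F.PtSimplex n x), IsBoundaryLift ι p e ε τ w := by
  obtain ⟨ε, w, h1, h2, h3⟩ := exists_lift_zero hp hF he τ
  have := hF.mono
  cases n with
  | zero => exact ⟨ε, ptMk₀ w, h1, h2, h3⟩
  | succ n =>
    refine ⟨ε, ptMk w fun i => ?_, h1, h2, h3⟩
    rw [← cancel_mono ι, Category.assoc, ← h2, const_comp' ι hx, ← Fin.castSucc_zero,
      ← stdSimplex.δ_comp_δ_assoc (Fin.zero_le i), h3 _ (Fin.succ_ne_zero i)]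
    rfl

omit hx he in
/-- Simplices with prescribed zeroth faces of their lifts assemble to a simplex of the fibre. -/
lemma exists_fibre_simplex (t : Δ[n + 2] ⟶ T) (ht : stdSimplex.δ 0 ≫ t = SSet.const o)
    (ε : Fin (n + 2) → ((Δ[n + 1] : SSet.{u}) ⟶ E)) (hε : ∀ j, ε j ≫ p = stdSimplex.δ j.succ ≫ t)
    (hk : ∀ j k, k ≠ 0 → stdSimplex.δ k ≫ ε j = SSet.const e) :
    ∃ v : Δ[n + 1] ⟶ F, ∀ j, stdSimplex.δ j ≫ v ≫ ι = stdSimplex.δ 0 ≫ ε j := by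
  -- place the `ε j` in position `j + 1`; the zeroth face of a filling over `t` lies in the fibre
  obtain ⟨W, h1, h2⟩ := exists_fill hp (i := 0) (Fin.cases (SSet.const e) ε) t (by
    intro j k hj _ hjk
    obtain ⟨j, rfl⟩ := Fin.exists_succ_eq.2 (show j ≠ 0 from fun h => hj (by rw [h]; rfl))
    change stdSimplex.δ k ≫ ε j.castSucc = stdSimplex.δ j.succ ≫ ε k
    rw [hk _ _ (Fin.succ_ne_zero _), hk]
    rintro rfl
    simp at hjk) (by
    intro j hj
    obtain ⟨j, rfl⟩ := Fin.exists_succ_eq.2 hj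
    exact hε j)
  obtain ⟨v, hv⟩ := hF.exists_lift (stdSimplex.δ 0 ≫ W) (by rw [Category.assoc, h2, ht])
  refine ⟨v, fun j => ?_⟩
  rw [hv, ← Fin.castSucc_zero, ← stdSimplex.δ_comp_δ_assoc (Fin.zero_le j),
    h1 _ (Fin.succ_ne_zero j)]
  rfl

/-- The boundary map is well defined. -/
lemma mk_eq_of_isBoundaryLift {ε ε' : (Δ[n + 1] : SSet.{u}) ⟶ E} {τ τ' : T.PtSimplex (n + 1) o}
    {w w' : F.PtSimplex n x} (h : IsBoundaryLift ι p e ε τ w) (h' : IsBoundaryLift ι p e ε' τ' w')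
    (r : PtSimplex.RelStruct τ τ' 1) : KPi.mk w = KPi.mk w' := by
  have := hF.mono
  have h01 : (0 : Fin (n + 3)) < (1 : Fin (n + 2)).castSucc := by simp
  obtain ⟨v, hv⟩ := exists_fibre_simplex hp hF r.map (r.δ_map_of_lt 0 h01)
    (Fin.cases ε (Fin.cases ε' fun _ => SSet.const e)) (by
    refine Fin.cases ?_ (Fin.cases ?_ fun j => ?_)
    · exact h.comp.trans r.δ_castSucc_map.symm
    · exact h'.comp.trans r.δ_succ_map.symm
    · refine (const_comp' p he).trans (r.δ_map_of_gt _ ?_).symm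
      exact Fin.succ_lt_succ_iff.2 (Fin.one_lt_succ_succ j)) (by
    refine Fin.cases h.pos (Fin.cases h'.pos fun j k _ => rfl))
  refine KPi.mk_eq_of_relStruct (i := 0) ⟨v, ?_, ?_, ?_, ?_⟩
  · rw [← cancel_mono ι, Category.assoc]
    exact (hv 0).trans h.zero
  · rw [← cancel_mono ι, Category.assoc]
    exact (hv 1).trans h'.zero
  · intro j hj
    exact absurd hj (Fin.not_lt_zero j)
  · intro j hj
    obtain ⟨j, rfl⟩ := Fin.exists_succ_eq.2 (Fin.ne_zero_of_lt hj)
    obtain ⟨n, rfl⟩ : ∃ m, n = m + 1 := Nat.exists_eq_succ_of_ne_zero fun hn => by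
      subst hn
      simp [Fin.lt_def] at hj
    obtain ⟨j, rfl⟩ := Fin.exists_succ_eq.2 (show j ≠ 0 from fun h => by
      subst h; simp at hj)
    rw [← cancel_mono ι, Category.assoc, hv, const_comp' ι hx]
    rfl

/-- The boundary map is compatible with products. -/
lemma isMul_of_isBoundaryLift {ε ε' ε'' : (Δ[n + 2] : SSet.{u}) ⟶ E}
    {τ τ' τ'' : T.PtSimplex (n + 2) o} {w w' w'' : F.PtSimplex (n + 1) x}
    (h : IsBoundaryLift ι p e ε τ w) (h' : IsBoundaryLift ι p e ε' τ' w')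
    (h'' : IsBoundaryLift ι p e ε'' τ'' w'')
    (r : PtSimplex.MulStruct τ τ' τ'' (Fin.last (n + 1))) :
    KPi.IsMul (KPi.mk w) (KPi.mk w') (KPi.mk w'') := by
  have := hF.mono
  -- the simplex `r` has the faces `τ'`, `τ''`, `τ` in its last three positions and constant faces
  -- elsewhere; their lifts are arranged accordingly and give a simplex of the fibre with faces
  -- `w'`, `w''`, `w`
  let f : Fin (n + 3) → ((Δ[n + 2] : SSet.{u}) ⟶ E) := fun j =>
    if j = (Fin.last n).castSucc.castSucc then ε' else if j = (Fin.last n).castSucc.succ then ε''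
      else if j = (Fin.last n).succ.succ then ε else SSet.const e
  have hlt : ∀ j : Fin (n + 3), j ≠ (Fin.last n).castSucc.castSucc → j ≠ (Fin.last n).castSucc.succ →
      j ≠ (Fin.last n).succ.succ → j < (Fin.last n).castSucc.castSucc := by
    intro j h1 h2 h3
    simp [Fin.ext_iff, Fin.lt_def] at *
    omega
  have f1 : f (Fin.last n).castSucc.castSucc = ε' := if_pos rfl
  have f2 : f (Fin.last n).castSucc.succ = ε'' := (if_neg (by simp [Fin.ext_iff])).trans (if_pos rfl)
  have f3 : f (Fin.last n).succ.succ = ε :=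
    (if_neg (fun h => by
      have := Fin.val_eq_of_eq h
      simp only [Fin.val_succ, Fin.val_castSucc, Fin.val_last] at this
      omega)).trans ((if_neg (by simp [Fin.ext_iff])).trans (if_pos rfl))
  have f4 : ∀ j, j < (Fin.last n).castSucc.castSucc → f j = SSet.const e := by
    intro j hj
    refine (if_neg hj.ne).trans ((if_neg ?_).trans (if_neg ?_)) <;>
    · simp [Fin.ext_iff, Fin.lt_def] at *
      omega
  obtain ⟨v, hv⟩ := exists_fibre_simplex hp hF r.map
    (r.δ_map_of_lt 0 (by simp [Fin.lt_def])) f (by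
    intro j
    by_cases h1 : j = (Fin.last n).castSucc.castSucc
    · rw [h1, f1, h'.comp]
      exact r.δ_castSucc_castSucc_map.symm
    by_cases h2 : j = (Fin.last n).castSucc.succ
    · rw [h2, f2, h''.comp]
      exact r.δ_succ_castSucc_map.symm
    by_cases h3 : j = (Fin.last n).succ.succ
    · rw [h3, f3, h.comp]
      exact r.δ_succ_succ_map.symm
    · have hj := hlt j h1 h2 h3
      rw [f4 j hj, const_comp' p he]
      refine (r.δ_map_of_lt _ ?_).symm
      simp [Fin.lt_def] at hj ⊢
      omega) (by
    intro j k hk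
    by_cases h1 : j = (Fin.last n).castSucc.castSucc
    · rw [h1, f1, h'.pos k hk]
    by_cases h2 : j = (Fin.last n).castSucc.succ
    · rw [h2, f2, h''.pos k hk]
    by_cases h3 : j = (Fin.last n).succ.succ
    · rw [h3, f3, h.pos k hk]
    · rw [f4 j (hlt j h1 h2 h3)]; rfl)
  refine ⟨w, w', w'', rfl, rfl, rfl, ⟨⟨v, ?_, ?_, ?_, ?_, ?_⟩⟩⟩
  · rw [← cancel_mono ι, Category.assoc, hv, f1, h'.zero]
  · rw [← cancel_mono ι, Category.assoc, hv, f2, h''.zero]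
  · rw [← cancel_mono ι, Category.assoc, hv, f3, h.zero]
  · intro j hj
    rw [← cancel_mono ι, Category.assoc, hv, f4 j hj, const_comp' ι hx]; rfl
  · intro j hj
    exact absurd hj (not_lt.2 (Fin.le_last _))

omit hp in
/-- Exactness at the base. -/
lemma exists_of_isNull_boundary [KanComplex E] {ε : (Δ[n + 1] : SSet.{u}) ⟶ E}
    {τ : T.PtSimplex (n + 1) o} {w : F.PtSimplex n x} (h : IsBoundaryLift ι p e ε τ w)
    (hw : IsNull w) : ∃ s : E.PtSimplex (n + 1) e, KPi.mk (ptMap p he s) = KPi.mk τ := by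
  obtain ⟨y, h0, h1⟩ := hw
  -- `y` and `ε` share the face `w`; gluing them gives a pointed simplex of `E`, the missing face of
  -- a horn, whose image differs from `τ` by the image of the filling
  obtain ⟨W, W0, W1, W2, -⟩ := exists_fill_two (KanComplex.isFibration_from E) (e := e) rfl
    (b := 0) (c := 1) (by simp) (y ≫ ι) ε (terminal.from _)
    (by rw [← Category.assoc, h0, h.zero])
    (fun k hk _ => by rw [← Category.assoc, h1 k hk, const_comp' ι hx]) h.pos
    (const_terminal_eq _ _) (const_terminal_eq _ _) (fun _ _ _ => const_terminal_eq _ _)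
  have hs : ∀ k, stdSimplex.δ k ≫ stdSimplex.δ (1 : Fin (n + 2)).succ ≫ W = SSet.const e := by
    intro k
    by_cases hk : k = 0
    · rw [hk, stdSimplex.δ_comp_δ_assoc (Fin.zero_le _), Fin.castSucc_zero, W0, ← Category.assoc,
        h1 _ (by simp), const_comp' ι hx]
    · refine δ_comp_δ_succ_eq_const W (fun k hk l hl => ?_) k hk
      by_cases hk0 : k = 0
      · rw [hk0, W1, h.pos l hl]
      · rw [W2 k hk0 hk]; rfl
  refine ⟨ptMk _ hs, ?_⟩
  symm
  refine KPi.mk_eq_of_relStruct (i := 1) ⟨W ≫ p, ?_, ?_, ?_, ?_⟩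
  · rw [← Category.assoc]
    have : (1 : Fin (n + 2)).castSucc = (0 : Fin (n + 2)).succ := rfl
    rw [this, W1, h.comp]
  · exact (Category.assoc _ _ _).symm
  · intro j hj
    have : j = 0 := Fin.lt_one_iff _ |>.1 (by rwa [Fin.castSucc_one] at hj)
    rw [this, ← Category.assoc, W0, Category.assoc, hF.w]; rfl
  · intro j hj
    obtain ⟨j, rfl⟩ := Fin.exists_succ_eq.2 (Fin.ne_zero_of_lt hj)
    have hj' : 1 < j := Fin.succ_lt_succ_iff.1 hj
    rw [← Category.assoc, W2 j (Fin.ne_zero_of_lt hj') hj'.ne', const_comp' p he]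

/-- Exactness at the total space. -/
lemma exists_of_isNull_comp (s : E.PtSimplex (n + 1) e) (hs : IsNull (ptMap p he s)) :
    ∃ f : F.PtSimplex (n + 1) x, KPi.mk (ptMap ι hx f) = KPi.mk s := by
  have := hF.mono
  obtain ⟨y, h0, h1⟩ := hs
  -- lift the null homotopy `y` to a homotopy that starts in `s`; the missing face of the horn lies
  -- in the fibre
  obtain ⟨W, W0, W1, W2, Wp⟩ := exists_fill_two hp he
    (b := 1) (c := 0) (by simp) s.map (SSet.const e) y
    (by rw [s.δ_map]; rfl) (fun k _ _ => s.δ_map k) (fun k _ => rfl) h0.symm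
    (by rw [const_comp' p he]; exact (h1 _ (Fin.succ_ne_zero _)).symm)
    (fun k _ _ => h1 _ (Fin.succ_ne_zero _))
  have hs : ∀ k, stdSimplex.δ k ≫ stdSimplex.δ (0 : Fin (n + 2)).succ ≫ W = SSet.const e := by
    intro k
    by_cases hk : k = 0
    · rw [hk, stdSimplex.δ_comp_δ_assoc (Fin.zero_le _), Fin.castSucc_zero, W0, s.δ_map]
    · refine δ_comp_δ_succ_eq_const W (fun k hk l hl => ?_) k hk
      by_cases hk1 : k = 1
      · rw [hk1, W1]; rfl
      · rw [W2 k hk1 hk]; rfl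
  obtain ⟨v, hv⟩ := hF.exists_lift (stdSimplex.δ (0 : Fin (n + 2)).succ ≫ W) (by
    rw [Category.assoc, Wp, h1 _ (Fin.succ_ne_zero _)])
  refine ⟨ptMk v fun i => ?_, ?_⟩
  · rw [← cancel_mono ι, Category.assoc, hv, hs, const_comp' ι hx]
  · symm
    refine KPi.mk_eq_of_relStruct (i := 0) ⟨W, W0, hv.symm, ?_, ?_⟩
    · intro j hj
      exact absurd hj (Fin.not_lt_zero j)
    · intro j hj
      obtain ⟨j, rfl⟩ := Fin.exists_succ_eq.2 (Fin.ne_zero_of_lt hj)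
      have hj' : 0 < j := Fin.succ_lt_succ_iff.1 hj
      by_cases hj1 : j = 1
      · rw [hj1, W1]
      · exact W2 j hj1 hj'.ne'

end LongExactSequence
end Fillings

/-! ### Homology of the normalised complex -/

section HomotopyOfModules
open AlgebraicTopology
variable {R : Type u} [CommRing R] (T : SimplicialObject (ModuleCat.{u} R))

/-- The cycles of degree `n` of the normalised complex, as a submodule of `T_n`. -/
def cyc (n : ℕ) : Submodule R (T.obj (op (.mk n))) :=
  match n with
  | 0 => ⊤
  | n + 1 => ⨅ i : Fin (n + 2), LinearMap.ker (T.δ i).hom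

lemma mem_cyc_succ {n : ℕ} (v : T.obj (op (.mk (n + 1)))) :
    v ∈ cyc T (n + 1) ↔ ∀ i, (T.δ i).hom v = 0 := by
  simp [cyc, Submodule.mem_iInf]

lemma mem_normSub_succ {n : ℕ} (v : T.obj (op (.mk (n + 1)))) :
    v ∈ normSub T (n + 1) ↔ ∀ i : Fin (n + 1), (T.δ i.succ).hom v = 0 := by
  simp [normSub, Submodule.mem_iInf]

/-- The inclusion of the normalised complex. -/
noncomputable abbrev normArrow (n : ℕ) :
    ((normalizedMooreComplex (ModuleCat.{u} R)).obj T).X n ⟶ T.obj (op (.mk n)) :=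
  (NormalizedMooreComplex.objX T n).arrow

lemma d_normArrow (n : ℕ) :
    ((normalizedMooreComplex (ModuleCat.{u} R)).obj T).d (n + 1) n ≫ normArrow T n =
      normArrow T (n + 1) ≫ T.δ 0 := by
  rw [normalizedMooreComplex_objD]
  cases n with
  | zero =>
    refine (Category.assoc _ _ _).trans ?_
    congr 1
    refine (Category.assoc _ _ _).trans ?_
    exact (congrArg (T.δ 0 ≫ ·) (@IsIso.inv_hom_id _ _ _ _
      (⊤ : Subobject (T.obj (op (.mk 0)))).arrow _)).trans (Category.comp_id _)
  | succ n =>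
    unfold NormalizedMooreComplex.objD
    exact Subobject.factorThru_arrow _ _ _

lemma normArrow_mem (n : ℕ) (x : ((normalizedMooreComplex (ModuleCat.{u} R)).obj T).X n) :
    normArrow T n x ∈ normSub T n := by
  rw [← range_arrow]
  exact ⟨x, rfl⟩

lemma exists_normArrow (n : ℕ) {v : T.obj (op (.mk n))} (hv : v ∈ normSub T n) :
    ∃ x, normArrow T n x = v := by
  rw [← range_arrow] at hv
  exact hv

lemma d_eq_zero_iff (n : ℕ) (x : ((normalizedMooreComplex (ModuleCat.{u} R)).obj T).X n) :
    ((normalizedMooreComplex (ModuleCat.{u} R)).obj T).d n ((ComplexShape.down ℕ).next n) x = 0 ↔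
      normArrow T n x ∈ cyc T n := by
  cases n with
  | zero =>
    refine iff_of_true ?_ trivial
    rw [HomologicalComplex.shape _ _ _ (by simp)]
    rfl
  | succ n =>
    rw [ChainComplex.next_nat_succ, mem_cyc_succ]
    have h1 := ConcreteCategory.congr_hom (d_normArrow T n) x
    have h2 := (mem_normSub_succ T _).1 (normArrow_mem T (n + 1) x)
    constructor
    · intro h i
      refine Fin.cases ?_ h2 i
      refine h1.symm.trans ?_
      refine (congrArg (normArrow T n).hom h).trans (_root_.map_zero _)
    · intro h
      apply arrow_injective T n
      refine (h1.trans (h 0)).trans (_root_.map_zero _).symm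

/-- The identification of the cycles with a submodule of `T_n`. -/
noncomputable def cycArrow (n : ℕ) :
    ((normalizedMooreComplex (ModuleCat.{u} R)).obj T).cycles n →ₗ[R] T.obj (op (.mk n)) :=
  (((normalizedMooreComplex (ModuleCat.{u} R)).obj T).iCycles n ≫ normArrow T n).hom

lemma cycArrow_injective (n : ℕ) : Function.Injective (cycArrow T n) := by
  have h : Function.Injective (((normalizedMooreComplex (ModuleCat.{u} R)).obj T).iCycles n) :=
    (ModuleCat.mono_iff_injective _).1 inferInstance
  exact (arrow_injective T n).comp h

lemma range_cycArrow (n : ℕ) : LinearMap.range (cycArrow T n) = cyc T n := by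
  apply le_antisymm
  · rintro _ ⟨z, rfl⟩
    refine (d_eq_zero_iff T n _).1 ?_
    exact ConcreteCategory.congr_hom (((normalizedMooreComplex (ModuleCat.{u} R)).obj T).iCycles_d n
      ((ComplexShape.down ℕ).next n)) z
  · intro v hv
    have hv' : v ∈ normSub T n := by
      cases n with
      | zero => trivial
      | succ n =>
        rw [mem_cyc_succ] at hv
        exact (mem_normSub_succ T v).2 fun i => hv _
    obtain ⟨x, rfl⟩ := exists_normArrow T n hv'
    let S := ((normalizedMooreComplex (ModuleCat.{u} R)).obj T).sc n
    have hx : S.g x = 0 := (d_eq_zero_iff T n x).2 hv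
    refine ⟨S.moduleCatCyclesIso.inv ⟨x, hx⟩, ?_⟩
    exact congrArg (normArrow T n).hom
      (ConcreteCategory.congr_hom S.moduleCatCyclesIso_inv_iCycles (⟨x, hx⟩ : LinearMap.ker S.g.hom))

/-- The homology class of a cycle. -/
noncomputable def cycClass (n : ℕ) : cyc T n →ₗ[R] piMod n T :=
  (((normalizedMooreComplex (ModuleCat.{u} R)).obj T).homologyπ n).hom ∘ₗ
    ((LinearEquiv.ofInjective _ (cycArrow_injective T n)).trans
      (LinearEquiv.ofEq _ _ (range_cycArrow T n))).symm.toLinearMap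

/-- An element of `T_n` represents a homology class if and only if it is a cycle with this class. -/
lemma represents_iff (n : ℕ) (v : (toSSet T) _⦋n⦌) (h : piMod n T) :
    Represents T n v h ↔ ∃ hv : v ∈ cyc T n, cycClass T n ⟨v, hv⟩ = h := by
  let e := (LinearEquiv.ofInjective _ (cycArrow_injective T n)).trans
      (LinearEquiv.ofEq _ _ (range_cycArrow T n))
  constructor
  · rintro ⟨z, rfl, rfl⟩
    refine ⟨(range_cycArrow T n).le ⟨z, rfl⟩, ?_⟩
    exact congrArg (((normalizedMooreComplex (ModuleCat.{u} R)).obj T).homologyπ n).hom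
      (e.symm_apply_apply z)
  · rintro ⟨hv, rfl⟩
    refine ⟨e.symm ⟨v, hv⟩, ?_, rfl⟩
    exact congrArg Subtype.val (e.apply_symm_apply ⟨v, hv⟩)

lemma cycClass_surjective (n : ℕ) : Function.Surjective (cycClass T n) := by
  have h : Function.Surjective (((normalizedMooreComplex (ModuleCat.{u} R)).obj T).homologyπ n).hom :=
    (ModuleCat.epi_iff_surjective _).1 inferInstance
  exact h.comp (LinearEquiv.surjective ((LinearEquiv.ofInjective _ (cycArrow_injective T n)).trans
      (LinearEquiv.ofEq _ _ (range_cycArrow T n))).symm)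

/-- Boundaries are the zeroth faces of normalised simplices. -/
lemma cycClass_eq_zero_iff (n : ℕ) (v : cyc T n) : cycClass T n v = 0 ↔
    ∃ y ∈ normSub T (n + 1), (T.δ 0).hom y = v.1 := by
  let K := (normalizedMooreComplex (ModuleCat.{u} R)).obj T
  let e := (LinearEquiv.ofInjective _ (cycArrow_injective T n)).trans
      (LinearEquiv.ofEq _ _ (range_cycArrow T n))
  obtain ⟨z, rfl⟩ := e.surjective v
  have h1 : cycClass T n (e z) = (K.homologyπ n).hom z :=
    congrArg (K.homologyπ n).hom (e.symm_apply_apply z)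
  rw [h1]
  have hex : (ShortComplex.mk (K.toCycles (n + 1) n) (K.homologyπ n)
      (K.toCycles_comp_homologyπ _ _)).Exact :=
    ShortComplex.exact_of_g_is_cokernel _ (K.homologyIsCokernel (n + 1) n (ChainComplex.prev _ n))
  rw [ShortComplex.moduleCat_exact_iff] at hex
  have hd : ∀ y, normArrow T n ((K.d (n + 1) n).hom y) = (T.δ 0).hom (normArrow T (n + 1) y) :=
    fun y => ConcreteCategory.congr_hom (d_normArrow T n) y
  have ht : ∀ y, (K.iCycles n).hom ((K.toCycles (n + 1) n).hom y) = (K.d (n + 1) n).hom y :=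
    fun y => ConcreteCategory.congr_hom (K.toCycles_i (n + 1) n) y
  constructor
  · intro hz
    obtain ⟨y, hy⟩ := hex z hz
    refine ⟨normArrow T (n + 1) y, normArrow_mem T _ y, ?_⟩
    rw [← hd, ← ht]
    exact congrArg (fun w => normArrow T n ((K.iCycles n).hom w)) hy
  · rintro ⟨w, hw, hw'⟩
    obtain ⟨y, rfl⟩ := exists_normArrow T _ hw
    have : z = (K.toCycles (n + 1) n).hom y := by
      apply cycArrow_injective T n
      change (e z).1 = normArrow T n ((K.iCycles n).hom ((K.toCycles (n + 1) n).hom y))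
      rw [ht, hd]
      exact hw'.symm
    rw [this]
    exact ConcreteCategory.congr_hom (K.toCycles_comp_homologyπ (n + 1) n) y

variable {T}

lemma Represents.unique {n : ℕ} {v : (toSSet T) _⦋n⦌} {h h' : piMod n T} (r : Represents T n v h)
    (r' : Represents T n v h') : h = h' := by
  rw [represents_iff] at r r'
  obtain ⟨hv, rfl⟩ := r
  obtain ⟨hv', rfl⟩ := r'
  rfl

lemma exists_represents {n : ℕ} (h : piMod n T) : ∃ v, Represents T n v h := by
  obtain ⟨v, rfl⟩ := cycClass_surjective T n h
  exact ⟨v.1, (represents_iff T n _ _).2 ⟨v.2, rfl⟩⟩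

lemma Represents.add {n : ℕ} {v v' : T.obj (op (.mk n))} {h h' : piMod n T}
    (r : Represents T n v h) (r' : Represents T n v' h') :
    Represents T n (v + v' : T.obj (op (.mk n))) (h + h') := by
  rw [represents_iff] at r r' ⊢
  obtain ⟨hv, rfl⟩ := r
  obtain ⟨hv', rfl⟩ := r'
  exact ⟨add_mem hv hv', (cycClass T n).map_add ⟨v, hv⟩ ⟨v', hv'⟩⟩

lemma Represents.mem {n : ℕ} {v : (toSSet T) _⦋n⦌} {h : piMod n T} (r : Represents T n v h) :
    v ∈ cyc T n := ((represents_iff T n v h).1 r).1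

lemma exists_represents_of_mem {n : ℕ} {v : (toSSet T) _⦋n⦌} (hv : v ∈ cyc T n) :
    ∃ h, Represents T n v h := ⟨_, (represents_iff T n v _).2 ⟨hv, rfl⟩⟩

lemma Represents.eq_iff {n : ℕ} {v v' : T.obj (op (.mk n))} {h h' : piMod n T}
    (r : Represents T n v h) (r' : Represents T n v' h') :
    h = h' ↔ ∃ y ∈ normSub T (n + 1), (T.δ 0).hom y = v - v' := by
  rw [represents_iff] at r r'
  obtain ⟨hv, rfl⟩ := r
  obtain ⟨hv', rfl⟩ := r'
  rw [← sub_eq_zero, ← _root_.map_sub, cycClass_eq_zero_iff]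
  rfl

end HomotopyOfModules

/-! ### Homotopy groups of simplicial modules -/

section PointedSimplices
variable {R : Type u} [CommRing R] {T : SimplicialObject (ModuleCat.{u} R)} {n : ℕ}

/-- The element of `T_n` given by a pointed simplex. -/
def ptVal (τ : (toSSet T).PtSimplex n (zeroVertex T)) : T.obj (op (.mk n)) :=
  yonedaEquiv τ.map

lemma yonedaEquiv_const_zero :
    yonedaEquiv (SSet.const (zeroVertex T) : (Δ[n] : SSet.{u}) ⟶ toSSet T) =
      (0 : T.obj (op (.mk n))) :=
  _root_.map_zero (T.map _).hom

/-- The element of `T_n` given by a map from the standard simplex. -/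
def mapVal (f : (Δ[n] : SSet.{u}) ⟶ toSSet T) : T.obj (op (.mk n)) := yonedaEquiv f

/-- The map from the standard simplex given by an element of `T_n`. -/
def valMap (v : T.obj (op (.mk n))) : (Δ[n] : SSet.{u}) ⟶ toSSet T := yonedaEquiv.symm v

@[simp] lemma mapVal_valMap (v : T.obj (op (.mk n))) : mapVal (valMap v) = v :=
  yonedaEquiv.apply_symm_apply _

lemma mapVal_injective {f g : (Δ[n] : SSet.{u}) ⟶ toSSet T} (h : mapVal f = mapVal g) : f = g :=
  yonedaEquiv.injective h

lemma mapVal_const : mapVal (SSet.const (zeroVertex T) : (Δ[n] : SSet.{u}) ⟶ toSSet T) = 0 :=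
  yonedaEquiv_const_zero

lemma mapVal_δ (f : (Δ[n + 1] : SSet.{u}) ⟶ toSSet T) (i : Fin (n + 2)) :
    mapVal (stdSimplex.δ i ≫ f) = (T.δ i).hom (mapVal f) :=
  stdSimplex.yonedaEquiv_δ_comp _ _

lemma ptVal_mem (τ : (toSSet T).PtSimplex n (zeroVertex T)) : ptVal τ ∈ cyc T n := by
  cases n with
  | zero => trivial
  | succ n =>
    refine (mem_cyc_succ T _).2 fun i => ?_
    refine (mapVal_δ τ.map i).symm.trans ?_
    rw [τ.δ_map, mapVal_const]

/-- The pointed simplex given by a cycle. -/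
def ptOfCyc {v : T.obj (op (.mk n))} (hv : v ∈ cyc T n) :
    (toSSet T).PtSimplex n (zeroVertex T) :=
  match n, v, hv with
  | 0, v, _ => ptMk₀ (valMap v)
  | _ + 1, v, hv => ptMk (valMap v) fun i => mapVal_injective (by
      rw [mapVal_δ, mapVal_valMap, mapVal_const]
      exact (mem_cyc_succ T v).1 hv i)

lemma ptOfCyc_map {v : T.obj (op (.mk n))} (hv : v ∈ cyc T n) : (ptOfCyc hv).map = valMap v := by
  cases n <;> rfl

lemma ptVal_ptOfCyc {v : T.obj (op (.mk n))} (hv : v ∈ cyc T n) : ptVal (ptOfCyc hv) = v := by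
  change mapVal _ = v
  rw [ptOfCyc_map, mapVal_valMap]

/-- The class in `π_n(T)` of a pointed simplex. -/
noncomputable def ptClass (τ : (toSSet T).PtSimplex n (zeroVertex T)) : piMod n T :=
  cycClass T n ⟨ptVal τ, ptVal_mem τ⟩

lemma represents_ptVal (τ : (toSSet T).PtSimplex n (zeroVertex T)) :
    Represents T n (ptVal τ) (ptClass τ) :=
  (represents_iff T n _ _).2 ⟨ptVal_mem τ, rfl⟩

/-- `v` is a face of index `i` of a simplex all of whose other faces vanish. -/
def IsFace (i : Fin (n + 2)) (v : T.obj (op (.mk n))) : Prop :=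
  ∃ y : T.obj (op (.mk (n + 1))), (T.δ i).hom y = v ∧ ∀ j, j ≠ i → (T.δ j).hom y = 0

lemma degenerate_faces {v : T.obj (op (.mk n))} (hv : v ∈ cyc T n) (i : Fin (n + 1)) :
    ∃ s : T.obj (op (.mk (n + 1))), (T.δ i.castSucc).hom s = v ∧ (T.δ i.succ).hom s = v ∧
      ∀ j, j ≠ i.castSucc → j ≠ i.succ → (T.δ j).hom s = 0 := by
  let r := PtSimplex.RelStruct.refl (ptOfCyc hv) i
  refine ⟨mapVal r.map, ?_, ?_, fun j h1 h2 => ?_⟩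
  · rw [← mapVal_δ, r.δ_castSucc_map, ptOfCyc_map, mapVal_valMap]
  · rw [← mapVal_δ, r.δ_succ_map, ptOfCyc_map, mapVal_valMap]
  · rw [← mapVal_δ, relStruct_other r j h1 h2, mapVal_const]

lemma isFace_succ_iff {v : T.obj (op (.mk n))} (hv : v ∈ cyc T n) (i : Fin (n + 1)) :
    IsFace i.succ v ↔ IsFace i.castSucc v := by
  -- subtracting from a degenerate simplex, whose faces of index `i` and `i + 1` are both `v`,
  -- exchanges these two positions
  obtain ⟨s, s1, s2, s3⟩ := degenerate_faces hv i
  constructor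
  · rintro ⟨y, h1, h2⟩
    refine ⟨s - y, ?_, fun j hj => ?_⟩
    · rw [_root_.map_sub, s1, h2 _ Fin.castSucc_lt_succ.ne, sub_zero]
    · by_cases hj' : j = i.succ
      · rw [hj', _root_.map_sub, s2, h1, sub_self]
      · rw [_root_.map_sub, s3 j hj hj', h2 j hj', sub_zero]
  · rintro ⟨y, h1, h2⟩
    refine ⟨s - y, ?_, fun j hj => ?_⟩
    · rw [_root_.map_sub, s2, h2 _ Fin.castSucc_lt_succ.ne', sub_zero]
    · by_cases hj' : j = i.castSucc
      · rw [hj', _root_.map_sub, s1, h1, sub_self]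
      · rw [_root_.map_sub, s3 j hj' hj, h2 j hj', sub_zero]

lemma isFace_iff_zero {v : T.obj (op (.mk n))} (hv : v ∈ cyc T n) (i : Fin (n + 2)) :
    IsFace i v ↔ IsFace 0 v := by
  induction i using Fin.induction with
  | zero => rfl
  | succ i ih => rw [isFace_succ_iff hv, ih]

lemma isFace_zero_iff {v : T.obj (op (.mk n))} :
    IsFace 0 v ↔ ∃ y ∈ normSub T (n + 1), (T.δ 0).hom y = v := by
  constructor
  · rintro ⟨y, h1, h2⟩
    exact ⟨y, (mem_normSub_succ T y).2 fun i => h2 _ (Fin.succ_ne_zero i), h1⟩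
  · rintro ⟨y, h1, h2⟩
    rw [mem_normSub_succ] at h1
    refine ⟨y, h2, fun j hj => ?_⟩
    obtain ⟨j, rfl⟩ := Fin.exists_succ_eq.2 hj
    exact h1 j

/-- Two pointed simplices have the same class if and only if they are related by a `RelStruct` of
any given index. -/
lemma ptClass_eq_iff (σ τ : (toSSet T).PtSimplex n (zeroVertex T)) (i : Fin (n + 1)) :
    ptClass σ = ptClass τ ↔ Nonempty (PtSimplex.RelStruct σ τ i) := by
  rw [(represents_ptVal σ).eq_iff (represents_ptVal τ), ← isFace_zero_iff,
    ← isFace_iff_zero (sub_mem (ptVal_mem σ) (ptVal_mem τ)) i.castSucc]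
  obtain ⟨s, s1, s2, s3⟩ := degenerate_faces (ptVal_mem τ) i
  constructor
  · rintro ⟨y, h1, h2⟩
    have h3 : ∀ j, j ≠ i.castSucc → j ≠ i.succ →
        stdSimplex.δ j ≫ valMap (y + s) = SSet.const (zeroVertex T) := fun j hj hj' => by
      apply mapVal_injective
      rw [mapVal_δ, mapVal_valMap, mapVal_const, _root_.map_add, h2 j hj, s3 j hj hj', add_zero]
    refine ⟨⟨valMap (y + s), mapVal_injective ?_, mapVal_injective ?_, ?_, ?_⟩⟩
    · rw [mapVal_δ, mapVal_valMap, _root_.map_add, h1, s1, sub_add_cancel]; rfl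
    · rw [mapVal_δ, mapVal_valMap, _root_.map_add, h2 _ Fin.castSucc_lt_succ.ne', s2, zero_add]; rfl
    · exact fun j hj => h3 j hj.ne (hj.trans Fin.castSucc_lt_succ).ne
    · exact fun j hj => h3 j (Fin.castSucc_lt_succ.trans hj).ne' hj.ne'
  · rintro ⟨r⟩
    refine ⟨mapVal r.map - s, ?_, fun j hj => ?_⟩
    · rw [_root_.map_sub, s1, ← mapVal_δ, r.δ_castSucc_map]; rfl
    · by_cases hj' : j = i.succ
      · rw [hj', _root_.map_sub, s2, ← mapVal_δ, r.δ_succ_map]; exact sub_self _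
      · rw [_root_.map_sub, s3 j hj hj', ← mapVal_δ, relStruct_other r j hj hj', mapVal_const,
          sub_zero]

lemma ptClass_eq_of_mk_eq {σ τ : (toSSet T).PtSimplex n (zeroVertex T)}
    (h : KPi.mk σ = KPi.mk τ) : ptClass σ = ptClass τ :=
  KPi.eq_of_relStruct_invariant ptClass (fun i f g r => (ptClass_eq_iff f g i).2 ⟨r⟩) h

lemma mk_eq_iff (σ τ : (toSSet T).PtSimplex n (zeroVertex T)) :
    KPi.mk σ = KPi.mk τ ↔ ptClass σ = ptClass τ := by
  refine ⟨ptClass_eq_of_mk_eq, fun h => ?_⟩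
  obtain ⟨r⟩ := (ptClass_eq_iff σ τ 0).1 h
  exact KPi.mk_eq_of_relStruct r

/-- The map from homotopy classes of pointed simplices of a simplicial module to the homology of
its normalised complex. -/
noncomputable def kpiClass (c : KPi n (toSSet T) (zeroVertex T)) : piMod n T :=
  ptClass c.exists_mk.choose

lemma kpiClass_mk (τ : (toSSet T).PtSimplex n (zeroVertex T)) : kpiClass (KPi.mk τ) = ptClass τ :=
  ptClass_eq_of_mk_eq (KPi.mk τ).exists_mk.choose_spec

lemma exists_ptClass (h : piMod n T) : ∃ τ : (toSSet T).PtSimplex n (zeroVertex T),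
    ptClass τ = h := by
  obtain ⟨v, hv⟩ := exists_represents h
  refine ⟨ptOfCyc hv.mem, (represents_ptVal _).unique ?_⟩
  rw [ptVal_ptOfCyc]
  exact hv

lemma kpiClass_injective : Function.Injective (kpiClass (T := T) (n := n)) := by
  intro c c' h
  obtain ⟨σ, rfl⟩ := c.exists_mk
  obtain ⟨τ, rfl⟩ := c'.exists_mk
  rw [kpiClass_mk, kpiClass_mk] at h
  exact (mk_eq_iff σ τ).2 h

lemma ptClass_const :
    ptClass (RelativeMorphism.const : (toSSet T).PtSimplex n (zeroVertex T)) = 0 := by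
  refine (cycClass T n).map_zero.symm ▸ congrArg (cycClass T n) (Subtype.ext ?_)
  exact mapVal_const

lemma kpiClass_eq_zero_iff (c : KPi n (toSSet T) (zeroVertex T)) :
    kpiClass c = 0 ↔ c = KPi.mk RelativeMorphism.const := by
  rw [← ptClass_const, ← kpiClass_mk]
  exact kpiClass_injective.eq_iff

/-- A simplex exhibiting the sum of two pointed simplices as their product. -/
lemma exists_mulStruct (σ τ ρ : (toSSet T).PtSimplex n (zeroVertex T)) (i : Fin n)
    (h : ptVal ρ = ptVal σ + ptVal τ) : Nonempty (PtSimplex.MulStruct σ τ ρ i) := by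
  -- add the degenerate simplices that exhibit `τ` and `σ` as products with the unit
  let a := PtSimplex.MulStruct.oneMul τ i
  let b := PtSimplex.MulStruct.mulOne σ i
  have key : ∀ j, mapVal (stdSimplex.δ j ≫ valMap (mapVal a.map + mapVal b.map)) =
      mapVal (stdSimplex.δ j ≫ a.map) + mapVal (stdSimplex.δ j ≫ b.map) := fun j => by
    rw [mapVal_δ, mapVal_δ, mapVal_δ, mapVal_valMap, _root_.map_add]
  have hc : mapVal (RelativeMorphism.const :
    (toSSet T).PtSimplex n (zeroVertex T)).map = 0 := mapVal_const
  refine ⟨⟨valMap (mapVal a.map + mapVal b.map), mapVal_injective ?_, mapVal_injective ?_,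
    mapVal_injective ?_, fun j hj => mapVal_injective ?_, fun j hj => mapVal_injective ?_⟩⟩
  · rw [key, a.δ_castSucc_castSucc_map, b.δ_castSucc_castSucc_map, hc, add_zero]
  · rw [key, a.δ_succ_castSucc_map, b.δ_succ_castSucc_map, add_comm]
    exact h.symm
  · rw [key, a.δ_succ_succ_map, b.δ_succ_succ_map, hc, zero_add]
  · rw [key, a.δ_map_of_lt j hj, b.δ_map_of_lt j hj, mapVal_const, add_zero]
  · rw [key, a.δ_map_of_gt j hj, b.δ_map_of_gt j hj, mapVal_const, add_zero]

lemma ptClass_add {σ τ ρ : (toSSet T).PtSimplex n (zeroVertex T)} (h : ptVal ρ = ptVal σ + ptVal τ) :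
    ptClass ρ = ptClass σ + ptClass τ := by
  refine (represents_ptVal ρ).unique ?_
  rw [h]
  exact (represents_ptVal σ).add (represents_ptVal τ)

/-- Products of pointed simplices are sums in homology: a simplex exhibiting `ρ` as a product
differs from the one exhibiting the sum by a simplex with `ρ - (σ + τ)` as its only non-zero face.
-/
lemma ptClass_eq_add {σ τ ρ : (toSSet T).PtSimplex n (zeroVertex T)} {i : Fin n}
    (m : PtSimplex.MulStruct σ τ ρ i) : ptClass ρ = ptClass σ + ptClass τ := by
  have hm : ptVal σ + ptVal τ ∈ cyc T n := add_mem (ptVal_mem σ) (ptVal_mem τ)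
  obtain ⟨w⟩ := exists_mulStruct σ τ (ptOfCyc hm) i (ptVal_ptOfCyc hm)
  rw [← ptClass_add (ptVal_ptOfCyc hm), (represents_ptVal ρ).eq_iff (represents_ptVal _),
    ← isFace_zero_iff, ← isFace_iff_zero (sub_mem (ptVal_mem _) (ptVal_mem _)) i.castSucc.succ]
  have key : ∀ j, (T.δ j).hom (mapVal m.map - mapVal w.map) =
      mapVal (stdSimplex.δ j ≫ m.map) - mapVal (stdSimplex.δ j ≫ w.map) := fun j => by
    rw [mapVal_δ, mapVal_δ, _root_.map_sub]
  refine ⟨mapVal m.map - mapVal w.map, ?_, fun j hj => ?_⟩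
  · rw [key, m.δ_succ_castSucc_map, w.δ_succ_castSucc_map]; rfl
  · rw [key, sub_eq_zero]
    rcases lt_trichotomy j i.castSucc.castSucc with h | rfl | h
    · rw [m.δ_map_of_lt j h, w.δ_map_of_lt j h]
    · rw [m.δ_castSucc_castSucc_map, w.δ_castSucc_castSucc_map]
    · rcases lt_trichotomy j i.succ.succ with h' | rfl | h'
      · exact absurd (by simp [Fin.lt_def, Fin.ext_iff] at *; omega) hj
      · rw [m.δ_succ_succ_map, w.δ_succ_succ_map]
      · rw [m.δ_map_of_gt j h', w.δ_map_of_gt j h']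

lemma kpiClass_eq_add {a b c : KPi (n + 1) (toSSet T) (zeroVertex T)} (h : KPi.IsMul a b c) :
    kpiClass c = kpiClass a + kpiClass b := by
  obtain ⟨s, t, r, rfl, rfl, rfl, ⟨m⟩⟩ := h
  rw [kpiClass_mk, kpiClass_mk, kpiClass_mk, ptClass_eq_add m]

end PointedSimplices

/-! ### Replacing a map by a fibration with an equivalent fibre -/

section Replacement
variable {X Y E E' T C : SSet.{u}}

lemma mem_ofSimplex_iff {z : X _⦋0⦌} {m : SimplexCategoryᵒᵖ} {y : X.obj m} :
    y ∈ (Subcomplex.ofSimplex z).obj m ↔ y = pt z m := by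
  rw [Subcomplex.mem_ofSimplex_obj_iff]
  constructor
  · rintro ⟨f, rfl⟩
    rw [Subsingleton.elim f (SimplexCategory.const m.unop ⦋0⦌ 0)]
  · rintro rfl
    exact ⟨_, rfl⟩

lemma pt_zero (z : X _⦋0⦌) : pt z (op ⦋0⦌) = z :=
  (congrArg (fun f => X.map f z) (Subsingleton.elim _ (𝟙 (op ⦋0⦌)))).trans (by simp)

/-- A contractible simplicial set has a contraction to a given vertex that fixes this vertex. -/
lemma exists_contraction (hC : IsTrivialFibration (terminal.from C)) (c₀ : C _⦋0⦌) :
    ∃ h : C ⊗ Δ[1] ⟶ C, cylEnd 0 ≫ h = SSet.const c₀ ∧ cylEnd 1 ≫ h = 𝟙 C ∧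
      ∀ n (t : (Δ[1] : SSet.{u}).obj n), h.app n (pt c₀ n, t) = pt c₀ n := by
  obtain ⟨h, h0, h1, h2, -⟩ := exists_homotopy_of_trivialFibration (Subcomplex.ofSimplex c₀) hC
    (SSet.const c₀) (𝟙 C) (SSet.const c₀) (terminal.from _) rfl (by
      ext n ⟨x, hx⟩
      rw [mem_ofSimplex_iff] at hx
      exact hx.symm)
    (const_terminal_eq _ _) (const_terminal_eq _ _) (const_terminal_eq _ _)
  refine ⟨h, h0, h1, fun n t => ?_⟩
  exact app_congr h2 n (⟨pt c₀ n, mem_ofSimplex_iff.2 rfl⟩, t)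

/-- The inclusion of `Y` into the product with a contractible simplicial set. -/
lemma anodyne_lift_const (hC : IsTrivialFibration (terminal.from C)) (c₀ : C _⦋0⦌) :
    anodyneExtensions (lift (𝟙 Y) (SSet.const c₀)) := by
  obtain ⟨h, h0, h1, h2⟩ := exists_contraction hC c₀
  have : Mono (lift (𝟙 Y) (SSet.const c₀ : Y ⟶ C)) :=
    mono_of_mono_fac (lift_fst (𝟙 Y) (SSet.const c₀ : Y ⟶ C))
  refine anodyne_of_deformation 0 1 _ (fst Y C)
    (lift (fst _ _ ≫ fst _ _) (lift (fst _ _ ≫ snd _ _) (snd _ _) ≫ h)) ?_ ?_ ?_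
  · refine CartesianMonoidalCategory.hom_ext _ _ rfl ?_
    ext n x
    exact app_congr h0 n x.2
  · refine CartesianMonoidalCategory.hom_ext _ _ rfl ?_
    ext n x
    exact app_congr h1 n x.2
  · refine CartesianMonoidalCategory.hom_ext _ _ rfl ?_
    ext n x
    exact h2 n x.2

lemma yonedaEquiv_symm_eq_const (o : T _⦋0⦌) :
    (yonedaEquiv.symm o : Δ[0] ⟶ T) = SSet.const o := by
  apply yonedaEquiv.injective
  rw [Equiv.apply_symm_apply]
  exact (pt_zero o).symm

lemma isFibreOver_of_isPullback {F : SSet.{u}} {ι : F ⟶ E} {t : F ⟶ Δ[0]} {p : E ⟶ T} {o : T _⦋0⦌}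
    (h : IsPullback ι t p (yonedaEquiv.symm o)) : IsFibreOver ι p o := by
  rw [yonedaEquiv_symm_eq_const] at h
  refine ⟨⟨fun a b hab => h.hom_ext hab ?_⟩, h.w, fun g hg =>
    ⟨h.lift g (SSet.const (stdSimplex.objEquiv.symm (𝟙 _))) hg, h.lift_fst _ _ _⟩⟩
  exact stdSimplex.isTerminalObj₀.hom_ext _ _

lemma exists_isFibreOver (p : E ⟶ T) (o : T _⦋0⦌) :
    ∃ (F : SSet.{u}) (ι : F ⟶ E), IsFibreOver ι p o :=
  ⟨_, _, isFibreOver_of_isPullback (IsPullback.of_hasPullback p (yonedaEquiv.symm o))⟩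

/-- The inclusion of the fibre over a vertex into the base change along a contractible
simplicial set over the base is anodyne, with a retraction. -/
lemma anodyne_fibre {F P : SSet.{u}} (hC : IsTrivialFibration (terminal.from C)) (c₀ : C _⦋0⦌)
    {κ : P ⟶ C} (hκ : IsFibration κ) {f : F ⟶ P} (hf : IsFibreOver f κ c₀) :
    anodyneExtensions f ∧ ∃ r : P ⟶ F, f ≫ r = 𝟙 F := by
  obtain ⟨h, h0, h1, h2⟩ := exists_contraction hC c₀
  have := hf.mono
  -- lift the contraction of the base to a deformation of `P` into the fibre
  obtain ⟨l, l1, l2, l3⟩ := exists_homotopy_lift 1 f hκ (𝟙 P) (fst _ _ ≫ f) (κ ▷ Δ[1] ≫ h)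
    rfl (by rw [← Category.assoc, cylEnd_whiskerRight, Category.assoc, h1]; simp) (by
      ext n x
      refine (app_congr hf.w n x.1).trans (((h2 n x.2).symm.trans ?_))
      exact congrArg (fun y => h.app n (y, x.2)) (app_congr hf.w n x.1).symm)
  obtain ⟨r, hr⟩ := hf.exists_lift (cylEnd 0 ≫ l) (by
    rw [Category.assoc, l3, ← Category.assoc, cylEnd_whiskerRight, Category.assoc, h0]
    rfl)
  refine ⟨anodyne_of_deformation 0 1 f r l hr.symm l1 l2, r, ?_⟩
  rw [← cancel_mono f, Category.assoc, hr, ← Category.assoc, ← cylEnd_whiskerRight,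
    Category.assoc, l2, ← Category.assoc, cylEnd_fst]

/-- A trivial fibration has a section through a given point which is an anodyne extension; it is a
homotopy inverse, relative to this point. -/
lemma exists_anodyne_section {q : E ⟶ X} (hq : IsTrivialFibration q) (e : E _⦋0⦌) :
    ∃ (s : X ⟶ E) (l : E ⊗ Δ[1] ⟶ E), s ≫ q = 𝟙 X ∧ s.app _ (q.app _ e) = e ∧
      anodyneExtensions s ∧ ι₀ ≫ l = q ≫ s ∧ ι₁ ≫ l = 𝟙 E ∧
      ∀ m (t : (Δ[1] : SSet.{u}).obj m), l.app m (pt e m, t) = pt e m := by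
  have := hq.hasLiftingProperty (Subcomplex.ofSimplex (q.app _ e)).ι
  have sq : CommSq (SSet.const e) (Subcomplex.ofSimplex (q.app _ e)).ι q (𝟙 X) := ⟨by
    ext n ⟨x, hx⟩
    rw [mem_ofSimplex_iff] at hx
    exact (app_pt q rfl n).trans hx.symm⟩
  have hs : sq.lift.app _ (q.app _ e) = e := by
    have := app_congr sq.fac_left (op ⦋0⦌) ⟨q.app _ e, Subcomplex.mem_ofSimplex_obj _⟩
    refine this.trans ?_
    exact pt_zero e
  obtain ⟨s, hsq, hs⟩ : ∃ s : X ⟶ E, s ≫ q = 𝟙 X ∧ s.app _ (q.app _ e) = e :=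
    ⟨sq.lift, sq.fac_right, hs⟩
  have : Mono s := mono_of_mono_fac hsq
  obtain ⟨l, l0, l1, l2, -⟩ := exists_homotopy_of_trivialFibration (Subcomplex.range s) hq
    (q ≫ s) (𝟙 E) (fst _ _ ≫ (Subcomplex.range s).ι) (fst _ _ ≫ q) (by
      ext n ⟨_, x, rfl⟩
      exact congrArg (s.app n) (app_congr hsq n x).symm) rfl
    (by rw [Category.assoc, hsq]; rfl) rfl rfl
  have h := congrArg (fun u => Subcomplex.toRange s ▷ Δ[1] ≫ u) l2
  refine ⟨s, l, hsq, hs, anodyne_of_deformation 0 1 s q l l0 l1 h, l0, l1, fun m t => ?_⟩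
  have := app_congr h m (pt (q.app _ e) m, t)
  have he := app_pt s hs m
  refine (congrArg (fun z => l.app m (z, t)) he.symm).trans (this.trans he)

/-- Replacement of a map `p` by a Kan fibration with an equivalent fibre. The hypothesis says that
the base change of `p` to a contractible simplicial set over the base is a product. -/
lemma exists_fibration_replacement {p : E ⟶ T} {g : C ⟶ T} (hg : IsFibration g)
    (hC : IsTrivialFibration (terminal.from C)) (c₀ : C _⦋0⦌) {o : T _⦋0⦌} (ho : g.app _ c₀ = o)
    {j : Y ⟶ E} {a : Y ⊗ C ⟶ E} (sq : IsPullback a (snd Y C) p g)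
    (ha : lift (𝟙 Y) (SSet.const c₀) ≫ a = j) :
    ∃ (E' F' : SSet.{u}) (i : E ⟶ E') (p' : E' ⟶ T) (ι : F' ⟶ E') (j' : Y ⟶ F'),
      i ≫ p' = p ∧ anodyneExtensions i ∧ IsFibration p' ∧ IsFibreOver ι p' o ∧ j' ≫ ι = j ≫ i ∧
      anodyneExtensions j' := by
  let Φ := (kanFactorization.factorizationData p)
  have hi : anodyneExtensions Φ.i := by
    rw [anodyneExtensions_eq_llp_rlp]; exact Φ.hi
  obtain ⟨F', ι, hι⟩ := exists_isFibreOver Φ.p o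
  have sq' := IsPullback.of_hasPullback Φ.p g
  have hc : IsFibration (pullback.snd Φ.p g) := IsFibration.of_isPullback sq'.flip Φ.hp
  let k : Y ⊗ C ⟶ pullback Φ.p g := pullback.lift (a ≫ Φ.i) (snd _ _) (by
    rw [Category.assoc, Φ.fac, sq.w])
  -- the base change `Y × C ⟶ E' ×_T C` of the anodyne extension `E ⟶ E'`
  have hk : anodyneExtensions k := anodyne_baseChange hg sq sq' hi Φ.fac
    (pullback.lift_fst _ _ _) (pullback.lift_snd _ _ _)
  let f : F' ⟶ pullback Φ.p g := pullback.lift ι (SSet.const c₀) (by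
    rw [hι.w, const_comp' g ho])
  have := hι.mono
  -- the fibre of `E' ⟶ T` is also a fibre of the base change of `E'` over the contractible `C`
  have hf : IsFibreOver f (pullback.snd Φ.p g) c₀ := by
    refine ⟨mono_of_mono_fac (pullback.lift_fst _ _ _ : f ≫ _ = ι), pullback.lift_snd _ _ _,
      fun {A} b hb => ?_⟩
    obtain ⟨b', hb'⟩ := hι.exists_lift (b ≫ pullback.fst _ _) (by
      rw [Category.assoc, pullback.condition, ← Category.assoc, hb, const_comp' g ho])
    refine ⟨b', pullback.hom_ext ?_ ?_⟩
    · rw [Category.assoc, pullback.lift_fst, hb']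
    · rw [Category.assoc, pullback.lift_snd, hb]; rfl
  obtain ⟨hf1, r, hr⟩ := anodyne_fibre hC c₀ hc hf
  obtain ⟨j', hj'⟩ := hι.exists_lift (j ≫ Φ.i) (by
    rw [Category.assoc, Φ.fac, ← ha, Category.assoc, sq.w, ← Category.assoc, lift_snd,
      const_comp' g ho])
  have hjf : j' ≫ f = lift (𝟙 Y) (SSet.const c₀) ≫ k := by
    refine pullback.hom_ext ?_ ?_
    · rw [Category.assoc, Category.assoc, pullback.lift_fst, pullback.lift_fst, hj', ← ha,
        Category.assoc]
    · rw [Category.assoc, Category.assoc, pullback.lift_snd, pullback.lift_snd, lift_snd]; rfl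
  refine ⟨Φ.Z, F', Φ.i, Φ.p, ι, j', Φ.fac, hi, Φ.hp, hι, hj', ?_⟩
  have h1 : anodyneExtensions (j' ≫ f) := by
    rw [hjf]
    exact anodyneExtensions.comp_mem _ _ (anodyne_lift_const hC c₀) hk
  -- `Y ⟶ F'` is a retract of `Y ⟶ E' ×_T C`, since `F'` is a retract of `E' ×_T C`
  refine anodyneExtensions.of_retract (f := j') (g := j' ≫ f) ?_ h1
  exact { i := Arrow.homMk (𝟙 _) f (by simp)
          r := Arrow.homMk (𝟙 _) r (by simp [hr])
          retract := by ext <;> simp [hr] }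

end Replacement

/-! ### Connected components and edges -/

section Components
variable {X Y E F T : SSet.{u}}

lemma δ_δ {n : ℕ} (W : E _⦋n + 2⦌) {i j : Fin (n + 2)} (h : i ≤ j) :
    E.δ i (E.δ j.succ W) = E.δ j (E.δ i.castSucc W) :=
  ConcreteCategory.congr_hom (SimplicialObject.δ_comp_δ E h) W

lemma δ_σ_vertex (x : E _⦋0⦌) (j : Fin 2) : E.δ j (E.σ 0 x) = x := by
  fin_cases j
  · exact ConcreteCategory.congr_hom (SimplicialObject.δ_comp_σ_self E (i := (0 : Fin 1))) x
  · exact ConcreteCategory.congr_hom (SimplicialObject.δ_comp_σ_succ E (i := (0 : Fin 1))) x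

/-- The discrete simplicial set on a type. -/
abbrev discrete (S : Type u) : SSet.{u} := (Functor.const _).obj S

lemma discrete_yonedaEquiv_δ {S : Type u} {n : ℕ} (f : (Δ[n + 1] : SSet.{u}) ⟶ discrete S)
    (i : Fin (n + 2)) : yonedaEquiv (stdSimplex.δ i ≫ f) = yonedaEquiv f :=
  stdSimplex.yonedaEquiv_δ_comp _ _

instance (S : Type u) : KanComplex (discrete S) := by
  refine KanComplex.iff.2 fun n i f hf => ?_
  obtain ⟨j₀, hj₀⟩ := exists_ne i
  refine ⟨yonedaEquiv.symm (yonedaEquiv (f j₀ hj₀) : S), fun j hj => ?_⟩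
  apply yonedaEquiv.injective
  rw [discrete_yonedaEquiv_δ, Equiv.apply_symm_apply]
  have key : ∀ j k (hj : j ≠ i) (hk : k ≠ i), j < k →
      (yonedaEquiv (f j hj) : S) = yonedaEquiv (f k hk) := by
    intro j k hj hk hjk
    cases n with
    | zero => omega
    | succ n =>
      have := congrArg (SSet.yonedaEquiv (X := discrete S)) (hf j k hj hk hjk)
      exact (discrete_yonedaEquiv_δ _ _).symm.trans (this.trans (discrete_yonedaEquiv_δ _ _))
  rcases lt_trichotomy j₀ j with h | h | h
  · exact key _ _ _ _ h
  · subst h; rfl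
  · exact (key _ _ _ _ h).symm

lemma discrete_δ_eq {S : Type u} (f : X ⟶ discrete S) (γ : X _⦋1⦌) :
    (f.app _ (X.δ 1 γ) : S) = f.app _ (X.δ 0 γ) :=
  (map_app_apply f (SimplexCategory.δ 1).op γ).trans
    (map_app_apply f (SimplexCategory.δ 0).op γ).symm

lemma mk_vertex_eq {n : SimplexCategoryᵒᵖ} (x : X.obj n) (f g : ⦋0⦌ ⟶ n.unop) :
    π₀.mk (X.map f.op x) = π₀.mk (X.map g.op x) := by
  wlog h : f.toOrderHom 0 ≤ g.toOrderHom 0 generalizing f g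
  · exact (this g f (le_of_not_ge h)).symm
  let m : ⦋1⦌ ⟶ n.unop := SimplexCategory.mkOfLe (n := n.unop.len) _ _ h
  have h1 : X.δ 1 (X.map m.op x) = X.map f.op x := by
    have : SimplexCategory.δ 1 ≫ m = f := by
      ext a
      fin_cases a
      rfl
    rw [← this, op_comp, X.map_comp]
    rfl
  have h0 : X.δ 0 (X.map m.op x) = X.map g.op x := by
    have : SimplexCategory.δ 0 ≫ m = g := by
      ext a
      fin_cases a
      rfl
    rw [← this, op_comp, X.map_comp]
    rfl
  exact π₀.sound (Edge.mk (X.map m.op x) h1 h0)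

/-- The map from a simplicial set to a discrete one given by an invariant of its components. -/
def toDiscrete {S : Type u} (c : π₀ X → S) : X ⟶ discrete S where
  app n := ↾fun x => c (π₀.mk (X.map (SimplexCategory.const ⦋0⦌ n.unop 0).op x))
  naturality m n θ := by
    ext x
    refine congrArg c ?_
    refine Eq.trans ?_ (mk_vertex_eq x (SimplexCategory.const ⦋0⦌ n.unop 0 ≫ θ.unop) _)
    rw [op_comp, X.map_comp]
    rfl

lemma toDiscrete_app {S : Type u} (c : π₀ X → S) (x : X _⦋0⦌) :
    (toDiscrete c).app _ x = c (π₀.mk x) :=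
  congrArg (fun y => c (π₀.mk y)) (pt_zero x)

/-- Anodyne extensions induce bijections on components, as can be tested with maps to discrete
simplicial sets, which are Kan complexes. -/
lemma mapπ₀_bijective_of_anodyne {i : X ⟶ Y} (hi : anodyneExtensions i) :
    Function.Bijective (mapπ₀ i) := by
  constructor
  · obtain ⟨v, hv⟩ := exists_extension_of_anodyne hi (toDiscrete (id : π₀ X → π₀ X))
    let r : π₀ Y → π₀ X := π₀.lift (fun y => v.app _ y) (fun y y' e => by
      have := discrete_δ_eq v e.edge
      rwa [e.src_eq, e.tgt_eq] at this)
    refine Function.LeftInverse.injective (g := r) fun c => ?_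
    induction c with | mk x =>
    exact (app_congr hv _ x).trans (toDiscrete_app _ x)
  · intro c
    induction c with | mk y =>
    -- the indicator function of the image of `π₀ X` agrees with the constant function true on `X`,
    -- and hence on `Y`
    let g : Y ⟶ discrete (ULift.{u} Prop) := toDiscrete fun c => ⟨c ∈ Set.range (mapπ₀ i)⟩
    let f : Y ⟶ discrete (ULift.{u} Prop) := toDiscrete fun c => ⟨True⟩
    have hfg : i ≫ f = i ≫ g := by
      ext n x
      refine congrArg ULift.up (propext ⟨fun _ => ?_, fun _ => trivial⟩)
      refine ⟨π₀.mk (X.map (SimplexCategory.const ⦋0⦌ n.unop 0).op x), ?_⟩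
      exact congrArg π₀.mk (map_app_apply i _ x)
    obtain ⟨l, l0, l1, -⟩ := exists_homotopy_extension hi f g (fst _ _ ≫ i ≫ f) rfl
      (by rw [hfg]; rfl)
    have h : (f.app _ y : ULift.{u} Prop) = g.app _ y := by
      let e : (Y ⊗ Δ[1]) _⦋1⦌ := (Y.σ 0 y, stdSimplex.objEquiv.symm (𝟙 _))
      have := discrete_δ_eq l e
      have a0 := app_congr l0 _ y
      have a1 := app_congr l1 _ y
      have e0 : (Y ⊗ Δ[1]).δ 0 e = ι₁.app _ y :=
        Prod.ext (δ_σ_vertex y 0) (stdSimplex_ext fun a => by fin_cases a; rfl)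
      have e1 : (Y ⊗ Δ[1]).δ 1 e = ι₀.app _ y :=
        Prod.ext (δ_σ_vertex y 1) (stdSimplex_ext fun a => by fin_cases a; rfl)
      rw [e0, e1] at this
      exact a0.symm.trans (this.trans a1)
    have h2 : (g.app _ y : ULift.{u} Prop) = ⟨π₀.mk y ∈ Set.range (mapπ₀ i)⟩ := toDiscrete_app _ y
    have h3 := congrArg ULift.down (h.trans h2)
    exact h3.mp trivial

/-- Lifting of edges along a fibration, with one given end. -/
lemma exists_edge_lift {p : E ⟶ T} (hp : IsFibration p) (i : Fin 2) (e : E _⦋0⦌) (t : T _⦋1⦌)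
    (h : ∀ j, j ≠ i → T.δ j t = p.app _ e) :
    ∃ ε : E _⦋1⦌, p.app _ ε = t ∧ ∀ j, j ≠ i → E.δ j ε = e := by
  have := (modelCategoryQuillen.fibration_iff p).2 hp
  have hc : horn.IsCompatible (i := i) (fun (j : Fin 2) (_ : j ≠ i) =>
      (yonedaEquiv.symm e : (Δ[0] : SSet.{u}) ⟶ E)) := trivial
  obtain ⟨ε, h1, h2⟩ := hc.exists_lift p (yonedaEquiv.symm t) (fun j hj => by
    apply yonedaEquiv.injective
    rw [stdSimplex.yonedaEquiv_δ_comp, yonedaEquiv_comp, Equiv.apply_symm_apply,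
      Equiv.apply_symm_apply, h j hj])
  refine ⟨yonedaEquiv ε, ?_, fun j hj => ?_⟩
  · rw [← yonedaEquiv_comp, h2, Equiv.apply_symm_apply]
  · rw [← stdSimplex.yonedaEquiv_δ_comp, h1 j hj, Equiv.apply_symm_apply]

lemma exists_triangle_fill {p : E ⟶ T} (hp : IsFibration p) (i : Fin 3) (f : Fin 3 → E _⦋1⦌)
    (t : T _⦋2⦌) (hf : ∀ (j k : Fin 2), j.castSucc ≠ i → k.succ ≠ i → j ≤ k →
      E.δ k (f j.castSucc) = E.δ j (f k.succ)) (hft : ∀ j, j ≠ i → p.app _ (f j) = T.δ j t) :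
    ∃ W : E _⦋2⦌, (∀ j, j ≠ i → E.δ j W = f j) ∧ p.app _ W = t := by
  obtain ⟨W, h1, h2⟩ := exists_fill hp (i := i) (fun j => yonedaEquiv.symm (f j))
    (yonedaEquiv.symm t) (fun j k hj hk hjk => by
      apply yonedaEquiv.injective
      rw [stdSimplex.yonedaEquiv_δ_comp, stdSimplex.yonedaEquiv_δ_comp, Equiv.apply_symm_apply,
        Equiv.apply_symm_apply, hf j k hj hk hjk]) (fun j hj => by
      apply yonedaEquiv.injective
      rw [stdSimplex.yonedaEquiv_δ_comp, yonedaEquiv_comp, Equiv.apply_symm_apply,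
        Equiv.apply_symm_apply, hft j hj])
  refine ⟨yonedaEquiv W, fun j hj => ?_, ?_⟩
  · rw [← stdSimplex.yonedaEquiv_δ_comp, h1 j hj, Equiv.apply_symm_apply]
  · rw [← yonedaEquiv_comp, h2, Equiv.apply_symm_apply]

/-- Composition of edges along a fibration. -/
lemma exists_edge_comp {p : E ⟶ T} (hp : IsFibration p) (γ ε : E _⦋1⦌) (h : E.δ 0 γ = E.δ 1 ε)
    (t : T _⦋2⦌) (h2 : T.δ 2 t = p.app _ γ) (h0 : T.δ 0 t = p.app _ ε) :
    ∃ ε' : E _⦋1⦌, E.δ 1 ε' = E.δ 1 γ ∧ E.δ 0 ε' = E.δ 0 ε ∧ p.app _ ε' = T.δ 1 t := by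
  obtain ⟨W, h3, h4⟩ := exists_triangle_fill hp 1 ![ε, ε, γ] t (by
    intro j k hj hk hjk
    fin_cases j <;> fin_cases k <;> simp_all) (by
    intro j hj
    fin_cases j <;> simp_all)
  have d0 : E.δ 0 W = ε := h3 0 (by simp)
  have d2 : E.δ 2 W = γ := h3 2 (by simp)
  refine ⟨E.δ 1 W, ?_, ?_, ?_⟩
  · rw [← d2]
    exact (δ_δ W (i := 1) (j := 1) le_rfl).symm
  · rw [← d0]
    exact δ_δ W (i := 0) (j := 0) le_rfl
  · rw [← h4]; exact map_app_apply p _ W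

/-- Division of edges along a fibration. -/
lemma exists_edge_div {p : E ⟶ T} (hp : IsFibration p) (γ ε : E _⦋1⦌) (h : E.δ 1 γ = E.δ 1 ε)
    (t : T _⦋2⦌) (h2 : T.δ 2 t = p.app _ γ) (h1 : T.δ 1 t = p.app _ ε) :
    ∃ ε' : E _⦋1⦌, E.δ 1 ε' = E.δ 0 γ ∧ E.δ 0 ε' = E.δ 0 ε ∧ p.app _ ε' = T.δ 0 t := by
  obtain ⟨W, h3, h4⟩ := exists_triangle_fill hp 0 ![ε, ε, γ] t (by
    intro j k hj hk hjk
    fin_cases j <;> fin_cases k <;> simp_all) (by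
    intro j hj
    fin_cases j <;> simp_all)
  have d1 : E.δ 1 W = ε := h3 1 (by simp)
  have d2 : E.δ 2 W = γ := h3 2 (by simp)
  refine ⟨E.δ 0 W, ?_, ?_, ?_⟩
  · rw [← d2]
    exact (δ_δ W (i := 0) (j := 1) (by simp)).symm
  · rw [← d1]
    exact (δ_δ W (i := 0) (j := 0) le_rfl).symm
  · rw [← h4]; exact map_app_apply p _ W

lemma mk_eq_mk_iff_exists_edge [KanComplex E] (x y : E _⦋0⦌) :
    π₀.mk x = π₀.mk y ↔ ∃ γ : E _⦋1⦌, E.δ 1 γ = x ∧ E.δ 0 γ = y := by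
  have hE := KanComplex.isFibration_from E
  -- the base of the fibration is a point, so all conditions in the base hold trivially
  have ht : ∀ m (a b : (⊤_ SSet.{u}).obj m), a = b := fun m a b => yonedaEquiv.symm.injective
    (const_terminal_eq (A := Δ[m.unop.len]) _ _)
  have t : (⊤_ SSet.{u}) _⦋2⦌ := (terminal.from E).app _ (pt x _)
  constructor
  · intro h
    rw [π₀.mk_eq_mk_iff] at h
    induction h with
    | rel x y h => obtain ⟨e⟩ := h; exact ⟨e.edge, e.src_eq, e.tgt_eq⟩
    | refl x => exact ⟨E.σ 0 x, δ_σ_vertex x 1, δ_σ_vertex x 0⟩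
    | symm x y _ ih =>
      obtain ⟨γ, h1, h0⟩ := ih
      obtain ⟨ε, e1, e0, -⟩ := exists_edge_div hE γ (E.σ 0 x) (by rw [h1, δ_σ_vertex])
        t (ht _ _ _) (ht _ _ _)
      exact ⟨ε, e1.trans h0, e0.trans (δ_σ_vertex x 0)⟩
    | trans x y z _ _ ih ih' =>
      obtain ⟨γ, h1, h0⟩ := ih
      obtain ⟨γ', h1', h0'⟩ := ih'
      obtain ⟨ε, e1, e0, -⟩ := exists_edge_comp hE γ γ' (by rw [h0, h1']) t (ht _ _ _) (ht _ _ _)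
      exact ⟨ε, e1.trans h1, e0.trans h0'⟩
  · rintro ⟨γ, rfl, rfl⟩
    exact π₀.sound (Edge.mk' γ)

open scoped modelCategoryQuillen in
lemma IsFibration.kanComplex {p : E ⟶ T} (hp : IsFibration p) [KanComplex T] : KanComplex E := by
  have h : IsFibration (p ≫ terminal.from T) :=
    MorphismProperty.comp_mem modelCategoryQuillen.J.rlp _ _ hp (KanComplex.isFibration_from T)
  rw [show p ≫ terminal.from T = terminal.from E from const_terminal_eq _ _] at h
  exact (isFibrant_iff _).2 ((modelCategoryQuillen.fibration_iff _).2 h)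

open scoped modelCategoryQuillen in
lemma IsFibreOver.kanComplex {ι : F ⟶ E} {p : E ⟶ T} {o : T _⦋0⦌} (hF : IsFibreOver ι p o)
    (hp : IsFibration p) : KanComplex F := by
  have := hF.mono
  refine (isFibrant_iff _).2 ((modelCategoryQuillen.fibration_iff _).2 ?_)
  intro A B i hi
  refine ⟨fun {t b} sq => ?_⟩
  have := hp i hi
  have sq' : CommSq (t ≫ ι) i p (SSet.const o) := ⟨by rw [Category.assoc, hF.w]; rfl⟩
  obtain ⟨l, hl⟩ := hF.exists_lift sq'.lift sq'.fac_right
  exact ⟨⟨⟨l, by rw [← cancel_mono ι, Category.assoc, hl, sq'.fac_left], const_terminal_eq _ _⟩⟩⟩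

end Components

/-! ### Paths over loops in a simplicial module -/

section Paths
variable {R : Type u} [CommRing R] {T : SimplicialObject (ModuleCat.{u} R)} {E F : SSet.{u}}
  {ι : F ⟶ E} {p : E ⟶ toSSet T}

/-- There is an edge of `E` between vertices of the fibre over a cycle representing `u`. -/
def IsPath (ι : F ⟶ E) (p : E ⟶ toSSet T) (x w : F _⦋0⦌) (u : piMod 1 T) : Prop :=
  ∃ ε : E _⦋1⦌, Represents T 1 (p.app _ ε) u ∧ E.δ 1 ε = ι.app _ x ∧ E.δ 0 ε = ι.app _ w

/-- The triangle that composes two loops of a simplicial module has their sum as its long edge. -/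
lemma exists_add_triangle {a b : T.obj (op ⦋1⦌)} (ha : a ∈ cyc T 1) (hb : b ∈ cyc T 1) :
    ∃ t : (toSSet T) _⦋2⦌, (toSSet T).δ 2 t = a ∧ (toSSet T).δ 0 t = b ∧
      (toSSet T).δ 1 t = (a + b : T.obj (op ⦋1⦌)) := by
  obtain ⟨r⟩ := exists_mulStruct (ptOfCyc ha) (ptOfCyc hb) (ptOfCyc (add_mem ha hb)) 0 (by
    rw [ptVal_ptOfCyc, ptVal_ptOfCyc, ptVal_ptOfCyc])
  refine ⟨mapVal r.map, ?_, ?_, ?_⟩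
  · refine (mapVal_δ r.map 2).symm.trans ?_
    rw [show stdSimplex.δ 2 ≫ r.map = _ from r.δ_succ_succ_map, ptOfCyc_map, mapVal_valMap]
  · refine (mapVal_δ r.map 0).symm.trans ?_
    rw [show stdSimplex.δ 0 ≫ r.map = _ from r.δ_castSucc_castSucc_map, ptOfCyc_map, mapVal_valMap]
  · refine (mapVal_δ r.map 1).symm.trans ?_
    rw [show stdSimplex.δ 1 ≫ r.map = _ from r.δ_succ_castSucc_map, ptOfCyc_map, mapVal_valMap]

lemma IsPath.trans (hp : IsFibration p) {x w z : F _⦋0⦌} {u v : piMod 1 T}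
    (h : IsPath ι p x w u) (h' : IsPath ι p w z v) : IsPath ι p x z (u + v) := by
  obtain ⟨γ, r, h1, h0⟩ := h
  obtain ⟨γ', r', h1', h0'⟩ := h'
  obtain ⟨t, t2, t0, t1⟩ := exists_add_triangle r.mem r'.mem
  obtain ⟨ε, e1, e0, e⟩ := exists_edge_comp hp γ γ' (h0.trans h1'.symm) t t2 t0
  exact ⟨ε, by rw [e, t1]; exact r.add r', e1.trans h1, e0.trans h0'⟩

/-- Paths over loops starting at the same vertex can be divided. -/
lemma IsPath.div (hp : IsFibration p) {x w z : F _⦋0⦌} {u v : piMod 1 T}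
    (h : IsPath ι p x w u) (h' : IsPath ι p x z (u + v)) : IsPath ι p w z v := by
  obtain ⟨γ, r, h1, h0⟩ := h
  obtain ⟨γ', r', h1', h0'⟩ := h'
  let a : T.obj (op ⦋1⦌) := p.app _ γ
  let c : T.obj (op ⦋1⦌) := p.app _ γ'
  obtain ⟨t, t2, t0, t1⟩ := exists_add_triangle r.mem (sub_mem r'.mem r.mem : c - a ∈ cyc T 1)
  have hac : a + (c - a) = c := by abel
  obtain ⟨ε, e1, e0, e⟩ := exists_edge_div hp γ γ' (h1.trans h1'.symm) t t2 (t1.trans hac)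
  obtain ⟨v', hv'⟩ := exists_represents_of_mem (sub_mem r'.mem r.mem : c - a ∈ cyc T 1)
  have : u + v' = u + v := by
    have := r.add hv'
    exact this.unique (by change Represents T 1 (a + (c - a)) _; rw [hac]; exact r')
  rw [add_left_cancel this] at hv'
  exact ⟨ε, by rw [e, t0]; exact hv', e1.trans h0, e0.trans h0'⟩

lemma app_const_zero (hF : IsFibreOver ι p (zeroVertex T)) {n : ℕ} (f : F _⦋n⦌) :
    p.app _ (ι.app _ f) = (0 : T.obj (op ⦋n⦌)) :=
  (app_congr hF.w _ f).trans (_root_.map_zero (T.map _).hom)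

lemma IsFibreOver.exists_simplex (hF : IsFibreOver ι p (zeroVertex T)) {n : ℕ} (e : E _⦋n⦌)
    (he : p.app _ e = (0 : T.obj (op ⦋n⦌))) : ∃ f : F _⦋n⦌, ι.app _ f = e := by
  obtain ⟨g, hg⟩ := hF.exists_lift (yonedaEquiv.symm e) (by
    apply yonedaEquiv.injective
    rw [yonedaEquiv_comp, Equiv.apply_symm_apply, he]
    exact yonedaEquiv_const_zero.symm)
  refine ⟨yonedaEquiv g, ?_⟩
  rw [← yonedaEquiv_comp, hg, Equiv.apply_symm_apply]

lemma IsFibreOver.app_injective (hF : IsFibreOver ι p (zeroVertex T)) {n : ℕ} {f g : F _⦋n⦌}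
    (h : ι.app _ f = ι.app _ g) : f = g := by
  have := hF.mono
  apply yonedaEquiv.symm.injective
  rw [← cancel_mono ι]
  apply yonedaEquiv.injective
  rw [yonedaEquiv_comp, yonedaEquiv_comp, Equiv.apply_symm_apply, Equiv.apply_symm_apply, h]

lemma represents_zero (n : ℕ) : Represents T n (0 : T.obj (op ⦋n⦌)) 0 :=
  (represents_iff T n _ _).2 ⟨zero_mem _, _root_.map_zero _⟩

/-- Paths over null-homologous loops can be moved into the fibre. -/
lemma isPath_zero_iff (hp : IsFibration p) (hF : IsFibreOver ι p (zeroVertex T)) (x w : F _⦋0⦌) :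
    IsPath ι p x w 0 ↔ π₀.mk x = π₀.mk w := by
  have := hF.kanComplex hp
  rw [mk_eq_mk_iff_exists_edge]
  constructor
  · rintro ⟨ε, r, h1, h0⟩
    obtain ⟨y, hy, hy0⟩ := (r.eq_iff (represents_zero 1)).1 rfl
    rw [sub_zero] at hy0
    have hy' := (mem_normSub_succ T y).1 hy
    -- the triangle `y` has the faces `p(ε)`, `0`, `0`, and its lift moves `ε` to a path over `0`
    obtain ⟨ε', e1, e0, e⟩ := exists_edge_comp hp (E.σ 0 (ι.app _ x)) ε (by rw [δ_σ_vertex, h1])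
      (y : (toSSet T) _⦋2⦌) (by
        refine (hy' 1).trans ?_
        refine (app_const_zero hF (F.σ 0 x)).symm.trans ?_
        exact congrArg _ (map_app_apply ι _ x)) hy0
    obtain ⟨f, rfl⟩ := hF.exists_simplex ε' (e.trans (hy' 0))
    refine ⟨f, hF.app_injective ?_, hF.app_injective ?_⟩
    · exact (map_app_apply ι _ f).trans (e1.trans (δ_σ_vertex _ _))
    · exact (map_app_apply ι _ f).trans (e0.trans h0)
  · rintro ⟨γ, rfl, rfl⟩
    refine ⟨ι.app _ γ, ?_, (map_app_apply ι _ γ).symm, (map_app_apply ι _ γ).symm⟩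
    rw [app_const_zero hF]
    exact represents_zero 1

lemma exists_isPath (hp : IsFibration p) (hF : IsFibreOver ι p (zeroVertex T)) (x : F _⦋0⦌)
    (u : piMod 1 T) : ∃ w, IsPath ι p x w u := by
  obtain ⟨t, ht⟩ := exists_represents u
  have hc := (mem_cyc_succ T _).1 ht.mem
  obtain ⟨ε, h1, h2⟩ := exists_edge_lift hp 0 (ι.app _ x) t (fun j _ =>
    (hc j).trans (app_const_zero hF x).symm)
  obtain ⟨w, hw⟩ := hF.exists_simplex (E.δ 0 ε) (by
    refine (map_app_apply p _ ε).trans ?_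
    rw [h1]
    exact hc 0)
  exact ⟨w, ε, by rw [h1]; exact ht, h2 1 (by simp), hw.symm⟩

lemma mk_app_eq_iff_exists_isPath [KanComplex E] (hF : IsFibreOver ι p (zeroVertex T))
    (x w : F _⦋0⦌) : π₀.mk (ι.app _ x) = π₀.mk (ι.app _ w) ↔ ∃ u, IsPath ι p x w u := by
  rw [mk_eq_mk_iff_exists_edge]
  constructor
  · rintro ⟨ε, h1, h0⟩
    obtain ⟨u, hu⟩ := exists_represents_of_mem (T := T) (n := 1) (v := p.app _ ε)
      ((mem_cyc_succ T _).2 fun i => by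
        refine (map_app_apply p _ ε).symm.trans ?_
        fin_cases i
        · exact (congrArg _ h0).trans (app_const_zero hF w)
        · exact (congrArg _ h1).trans (app_const_zero hF x))
    exact ⟨u, ε, hu, h1, h0⟩
  · rintro ⟨u, ε, -, h1, h0⟩
    exact ⟨ε, h1, h0⟩

/-- A functional relation compatible with addition is the graph of an action. -/
lemma exists_addAction {S U : Type*} [AddCommGroup U] (P : S → S → U → Prop)
    (trans : ∀ {a b c u v}, P a b u → P b c v → P a c (u + v))
    (div : ∀ {a b c u v}, P a b u → P a c (u + v) → P b c v)
    (zero : ∀ {a b}, P a b 0 ↔ a = b) (ex : ∀ a u, ∃ b, P a b u) :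
    ∃ _ : AddAction U S, ∀ a b u, u +ᵥ a = b ↔ P a b u := by
  choose act hact using ex
  have un : ∀ {a b c u}, P a b u → P a c u → b = c := fun h h' =>
    zero.1 (div h (by rwa [add_zero]))
  refine ⟨{ vadd := fun u a => act a u
            zero_vadd := fun a => un (hact a 0) (zero.2 rfl)
            add_vadd := fun u v a => un (hact a (u + v)) (by
              rw [add_comm]; exact trans (hact a v) (hact _ u)) }, fun a b u => ?_⟩
  exact ⟨fun h => h ▸ hact a u, fun h => un (hact a u) h⟩

/-- The class in `π₀(T)` of a vertex. -/
noncomputable def vertexClass (v : T.obj (op ⦋0⦌)) : piMod 0 T := cycClass T 0 ⟨v, trivial⟩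

lemma represents_vertexClass (v : T.obj (op ⦋0⦌)) : Represents T 0 v (vertexClass v) :=
  (represents_iff T 0 _ _).2 ⟨trivial, rfl⟩

lemma vertexClass_eq_iff (v w : T.obj (op ⦋0⦌)) : vertexClass v = vertexClass w ↔
    ∃ y : (toSSet T) _⦋1⦌, (toSSet T).δ 0 y = v ∧ (toSSet T).δ 1 y = w := by
  rw [(represents_vertexClass v).eq_iff (represents_vertexClass w)]
  constructor
  · rintro ⟨y, hy, h0⟩
    -- translate by a degenerate edge to pass between edges from `w` to `v` and normalised ones
    refine ⟨(y + (T.σ 0).hom w : T.obj (op ⦋1⦌)), ?_, ?_⟩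
    · refine (_root_.map_add (T.δ 0).hom _ _).trans ?_
      rw [h0, show (T.δ 0).hom ((T.σ 0).hom w) = w from δ_σ_vertex (E := toSSet T) w 0]
      abel
    · refine (_root_.map_add (T.δ 1).hom _ _).trans ?_
      rw [show (T.δ 1).hom y = 0 from (mem_normSub_succ T y).1 hy 0,
        show (T.δ 1).hom ((T.σ 0).hom w) = w from δ_σ_vertex (E := toSSet T) w 1, zero_add]
  · rintro ⟨y, rfl, rfl⟩
    let y' : T.obj (op ⦋1⦌) := y
    refine ⟨y' - (T.σ 0).hom ((T.δ 1).hom y'), (mem_normSub_succ T _).2 fun i => ?_, ?_⟩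
    · fin_cases i
      refine (_root_.map_sub (T.δ 1).hom _ _).trans ?_
      rw [show (T.δ 1).hom ((T.σ 0).hom ((T.δ 1).hom y')) = _ from
        δ_σ_vertex (E := toSSet T) ((T.δ 1).hom y') 1, sub_self]
    · refine (_root_.map_sub (T.δ 0).hom _ _).trans ?_
      rw [show (T.δ 0).hom ((T.σ 0).hom ((T.δ 1).hom y')) = _ from
        δ_σ_vertex (E := toSSet T) ((T.δ 1).hom y') 0]
      rfl

end Paths

/-! ### The long exact sequence of an obstruction map -/

section LongExactSequence
variable {R : Type u} [CommRing R] {T : SimplicialObject (ModuleCat.{u} R)}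
  {X Y : SSet.{u}} {φ : Y ⟶ X} (Q : ObstructionMap φ T)

/-- A replacement of the map `p` of an obstruction map by a Kan fibration, with an equivalent
fibre. -/
structure FibrationReplacement where
  E' : SSet.{u}
  F' : SSet.{u}
  i : Q.E ⟶ E'
  p' : E' ⟶ toSSet T
  ι : F' ⟶ E'
  j' : Y ⟶ F'
  fac : i ≫ p' = Q.p
  anodyne_i : anodyneExtensions i
  fibration : IsFibration p'
  fibre : IsFibreOver ι p' (zeroVertex T)
  comm : j' ≫ ι = Q.j ≫ i
  anodyne_j' : anodyneExtensions j'

variable {Q} (D : FibrationReplacement Q) [KanComplex (toSSet T)]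

namespace FibrationReplacement

instance : KanComplex D.E' := D.fibration.kanComplex

instance : KanComplex D.F' := D.fibre.kanComplex D.fibration

omit [KanComplex (toSSet T)] in
lemma comm_app (n : ℕ) (y : Y _⦋n⦌) : D.ι.app _ (D.j'.app _ y) = D.i.app _ (Q.j.app _ y) :=
  app_congr D.comm _ y

omit [KanComplex (toSSet T)] in
lemma fac_app (n : ℕ) (e : Q.E _⦋n⦌) : D.p'.app _ (D.i.app _ e) = Q.p.app _ e :=
  app_congr D.fac _ e

section Components

omit [KanComplex (toSSet T)] in
/-- Trivial fibrations induce bijections on components. -/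
lemma mapπ₀_q_bijective : Function.Bijective (mapπ₀ Q.q) := by
  by_cases hne : Nonempty (Q.E _⦋0⦌)
  · obtain ⟨e⟩ := hne
    obtain ⟨s, -, hs, -, h, -⟩ := exists_anodyne_section Q.trivialFibration e
    have h1 := mapπ₀_bijective_of_anodyne h
    have h2 : ∀ c, mapπ₀ Q.q (mapπ₀ s c) = c := fun c => by
      rw [← mapπ₀_comp_apply, hs, mapπ₀_id_apply]
    refine ⟨fun a b hab => ?_, fun c => ⟨_, h2 c⟩⟩
    obtain ⟨a, rfl⟩ := h1.2 a
    obtain ⟨b, rfl⟩ := h1.2 b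
    rw [h2, h2] at hab
    rw [hab]
  · have he : IsEmpty (π₀ Q.E) := ⟨fun c => hne ⟨c.mk_surjective.choose⟩⟩
    refine ⟨fun a => he.elim a, fun c => ?_⟩
    obtain ⟨x, -⟩ := c.mk_surjective
    have := Q.trivialFibration.hasLiftingProperty (⊥ : X.Subcomplex).ι
    have sq : CommSq (Subcomplex.isInitialBot.to Q.E) (⊥ : X.Subcomplex).ι Q.q (𝟙 X) :=
      ⟨Subcomplex.isInitialBot.hom_ext _ _⟩
    exact absurd ⟨sq.lift.app _ x⟩ hne

omit [KanComplex (toSSet T)] in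
lemma mk_map_φ_eq_iff (a b : Y _⦋0⦌) : π₀.mk (φ.app _ a) = π₀.mk (φ.app _ b) ↔
    π₀.mk (D.ι.app _ (D.j'.app _ a)) = π₀.mk (D.ι.app _ (D.j'.app _ b)) := by
  rw [D.comm_app, D.comm_app, ← Q.q_j, ← Q.q_j]
  exact ((mapπ₀_q_bijective (Q := Q)).1.eq_iff (a := π₀.mk (Q.j.app _ a))
    (b := π₀.mk (Q.j.app _ b))).trans (mapπ₀_bijective_of_anodyne D.anodyne_i).1.eq_iff.symm

omit [KanComplex (toSSet T)] in
/-- The action of `π₁` of the base on the components of the fibre. -/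
lemma exists_action : ∃ _ : AddAction (piMod 1 T) (π₀ Y), ∀ (a b : Y _⦋0⦌) (u : piMod 1 T),
    u +ᵥ π₀.mk a = π₀.mk b ↔ IsPath D.ι D.p' (D.j'.app _ a) (D.j'.app _ b) u := by
  have hj := mapπ₀_bijective_of_anodyne D.anodyne_j'
  have hp := D.fibration
  have hF := D.fibre
  -- as `Y` and the fibre have the same components, the relation given by paths depends only on the
  -- components of the end points
  have iff0 : ∀ a b : Y _⦋0⦌, IsPath D.ι D.p' (D.j'.app _ a) (D.j'.app _ b) 0 ↔
      π₀.mk a = π₀.mk b := fun a b => by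
    rw [isPath_zero_iff hp hF, ← mapπ₀_mk, ← mapπ₀_mk, hj.1.eq_iff]
  have congr2 : ∀ {a b b' : Y _⦋0⦌} {u}, IsPath D.ι D.p' (D.j'.app _ a) (D.j'.app _ b) u →
      π₀.mk b = π₀.mk b' → IsPath D.ι D.p' (D.j'.app _ a) (D.j'.app _ b') u := fun {_ _ _ u} h h' => by
    have := h.trans hp ((iff0 _ _).2 h')
    rwa [add_zero] at this
  have congr1 : ∀ {a a' b : Y _⦋0⦌} {u}, IsPath D.ι D.p' (D.j'.app _ a) (D.j'.app _ b) u →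
      π₀.mk a = π₀.mk a' → IsPath D.ι D.p' (D.j'.app _ a') (D.j'.app _ b) u := fun h h' => by
    refine IsPath.div hp ((iff0 _ _).2 h') ?_
    rwa [zero_add]
  obtain ⟨inst, h⟩ := exists_addAction (S := π₀ Y) (U := piMod 1 T) (fun c d u => ∃ a b : Y _⦋0⦌,
      π₀.mk a = c ∧ π₀.mk b = d ∧ IsPath D.ι D.p' (D.j'.app _ a) (D.j'.app _ b) u)
    (by
      rintro _ _ _ u v ⟨a, b, rfl, rfl, h⟩ ⟨b', c, hb, rfl, h'⟩
      exact ⟨a, c, rfl, rfl, (congr2 h hb.symm).trans hp h'⟩)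
    (by
      rintro _ _ _ u v ⟨a, b, rfl, rfl, h⟩ ⟨a', c, ha, rfl, h'⟩
      exact ⟨b, c, rfl, rfl, h.div hp (congr1 h' ha)⟩)
    (by
      intro c d
      constructor
      · rintro ⟨a, b, rfl, rfl, h⟩
        exact (iff0 _ _).1 h
      · rintro rfl
        obtain ⟨a, rfl⟩ := c.mk_surjective
        exact ⟨a, a, rfl, rfl, (iff0 _ _).2 rfl⟩)
    (by
      intro c u
      obtain ⟨a, rfl⟩ := c.mk_surjective
      obtain ⟨w, hw⟩ := exists_isPath hp hF (D.j'.app _ a) u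
      obtain ⟨d, hd⟩ := hj.2 (π₀.mk w)
      obtain ⟨b, rfl⟩ := d.mk_surjective
      refine ⟨π₀.mk b, a, b, rfl, rfl, ?_⟩
      rw [← add_zero u]
      exact hw.trans hp ((isPath_zero_iff hp hF _ _).2 hd.symm))
  refine ⟨inst, fun a b u => (h _ _ _).trans ⟨?_, fun h => ⟨a, b, rfl, rfl, h⟩⟩⟩
  rintro ⟨a', b', ha, hb, h⟩
  exact congr1 (congr2 h hb) ha

include D in
/-- The map `o` on components, and exactness at the components of the total space. -/
lemma exists_o₀ : ∃ o₀ : π₀ X → piMod 0 T, Q.Induces₀ o₀ ∧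
    ∀ c, o₀ c = 0 ↔ c ∈ Set.range (mapπ₀ φ) := by
  -- the class of the image in `T` is an invariant of the components of `E`
  let f : π₀ Q.E → piMod 0 T := π₀.lift (fun e => vertexClass (Q.p.app _ e)) fun e e' γ =>
    ((vertexClass_eq_iff _ _).2 ⟨Q.p.app _ γ.edge, by
      exact (map_app_apply Q.p _ _).symm.trans (congrArg _ γ.tgt_eq), by
      exact (map_app_apply Q.p _ _).symm.trans (congrArg _ γ.src_eq)⟩).symm
  let ψ := Equiv.ofBijective _ (mapπ₀_q_bijective (Q := Q))
  have hψ : ∀ e, ψ.symm (mapπ₀ Q.q e) = e := ψ.symm_apply_apply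
  refine ⟨fun c => f (ψ.symm c), fun e h r => ?_, fun c => ?_⟩
  · refine (congrArg f (hψ (π₀.mk e))).trans ?_
    exact (represents_vertexClass _).unique r
  · obtain ⟨c, rfl⟩ := (mapπ₀_q_bijective (Q := Q)).2 c
    change f (ψ.symm (mapπ₀ Q.q c)) = 0 ↔ _
    rw [hψ]
    obtain ⟨e, rfl⟩ := c.mk_surjective
    have h0 : vertexClass (0 : T.obj (op ⦋0⦌)) = 0 := _root_.map_zero (cycClass T 0)
    constructor
    · intro h
      obtain ⟨t, t0, t1⟩ := (vertexClass_eq_iff (Q.p.app _ e) 0).1 (h.trans h0.symm)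
      -- lift the edge between `p(e)` and `0` to an edge of `E'` ending in `e`; its other end lies
      -- in the fibre
      obtain ⟨ε, e1, e2⟩ := exists_edge_lift D.fibration 1 (D.i.app _ e) t (fun j hj => by
        rw [D.fac_app, ← t0]
        fin_cases j
        · rfl
        · exact absurd rfl hj)
      obtain ⟨w, hw⟩ := D.fibre.exists_simplex (D.E'.δ 1 ε) (by
        refine (map_app_apply D.p' _ ε).trans ?_
        rw [e1]; exact t1)
      obtain ⟨d, hd⟩ := (mapπ₀_bijective_of_anodyne D.anodyne_j').2 (π₀.mk w)
      obtain ⟨y, rfl⟩ := d.mk_surjective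
      refine ⟨π₀.mk y, ?_⟩
      rw [mapπ₀_mk, ← Q.q_j, ← mapπ₀_mk]
      refine congrArg _ ((mapπ₀_bijective_of_anodyne D.anodyne_i).1 ?_)
      rw [mapπ₀_mk, mapπ₀_mk, ← D.comm_app]
      refine (congrArg (mapπ₀ D.ι) hd).trans ((congrArg π₀.mk hw).trans ?_)
      exact (mk_eq_mk_iff_exists_edge _ _).2 ⟨ε, rfl, e2 0 (by simp)⟩
    · rintro ⟨d, hd⟩
      obtain ⟨y, rfl⟩ := d.mk_surjective
      rw [mapπ₀_mk, ← Q.q_j, ← mapπ₀_mk, (mapπ₀_q_bijective (Q := Q)).1.eq_iff] at hd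
      rw [← hd]
      refine (congrArg vertexClass (Q.p_j y)).trans h0

end Components

section Higher
variable (y : Y _⦋0⦌)

/-- The image of `y` in the total space of the replacement. -/
abbrev base : D.E' _⦋0⦌ := D.ι.app _ (D.j'.app _ y)

omit [KanComplex (toSSet T)] in
lemma p'_base : D.p'.app _ (D.base y) = zeroVertex T :=
  (congrArg _ (D.comm_app 0 y)).trans ((D.fac_app 0 _).trans (Q.p_j y))

/-- The identification of `π_n(X)` with `π_n` of the total space of the replacement. -/
lemma exists_toTotal : ∃ (v : X ⟶ D.E') (hv : v.app _ (φ.app _ y) = D.base y), anodyneExtensions v ∧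
    ∀ (n : ℕ) (c : PiGroup n Q.E (Q.j.app _ y)),
      toKan v hv (c.map Q.q (Q.q_j y)) = toKan D.i (D.comm_app 0 y).symm c := by
  obtain ⟨s, l, hs, hs', h, l0, l1, l2⟩ := exists_anodyne_section Q.trivialFibration (Q.j.app _ y)
  rw [Q.q_j] at hs'
  have hv : (s ≫ D.i).app _ (φ.app _ y) = D.base y :=
    (congrArg (D.i.app _) hs').trans (D.comm_app 0 y).symm
  refine ⟨s ≫ D.i, hv, anodyneExtensions.comp_mem _ _ h D.anodyne_i, fun n c => ?_⟩
  have hq : (Q.q ≫ s ≫ D.i).app _ (Q.j.app _ y) = D.base y :=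
    (congrArg (fun z => D.i.app _ (s.app _ z)) (Q.q_j y)).trans hv
  rw [toKan_map Q.q (Q.q_j y) (s ≫ D.i) hv _ rfl hq]
  refine toKan_congr (l ≫ D.i) ?_ ?_ (fun m t => ?_) hq _ c
  · rw [← Category.assoc, l0, Category.assoc]
  · rw [← Category.assoc, l1, Category.id_comp]
  · exact (congrArg (D.i.app m) (l2 m t)).trans (app_pt D.i (D.comm_app 0 y).symm m)

omit [KanComplex (toSSet T)] in
/-- The boundary map of the replacement. -/
lemma exists_d : ∃ d : ∀ n, piMod (n + 1) T → PiGroup n Y y,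
    ∀ n (τ : (toSSet T).PtSimplex (n + 1) (zeroVertex T)) (ε : (Δ[n + 1] : SSet.{u}) ⟶ D.E')
      (w : D.F'.PtSimplex n (D.j'.app _ y)), IsBoundaryLift D.ι D.p' (D.base y) ε τ w →
      toKan D.j' rfl (d n (ptClass τ)) = KPi.mk w := by
  have h : ∀ n (u : piMod (n + 1) T), ∃ c : PiGroup n Y y,
      ∀ (τ : (toSSet T).PtSimplex (n + 1) (zeroVertex T)) (ε : (Δ[n + 1] : SSet.{u}) ⟶ D.E')
      (w : D.F'.PtSimplex n (D.j'.app _ y)), ptClass τ = u →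
      IsBoundaryLift D.ι D.p' (D.base y) ε τ w → toKan D.j' rfl c = KPi.mk w := by
    intro n u
    obtain ⟨τ, hτ⟩ := exists_ptClass u
    obtain ⟨ε, w, h⟩ := exists_isBoundaryLift D.fibration D.fibre rfl (D.p'_base y) τ
    obtain ⟨c, hc⟩ := (toKan_bijective (n := n) D.anodyne_j' rfl).2 (KPi.mk w)
    refine ⟨c, fun τ' ε' w' hτ' h' => ?_⟩
    obtain ⟨r⟩ := (ptClass_eq_iff τ τ' 1).1 (hτ.trans hτ'.symm)
    rw [hc]
    exact mk_eq_of_isBoundaryLift D.fibration D.fibre rfl (D.p'_base y) h h' r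
  choose d hd using h
  exact ⟨d, fun n τ ε w => hd n _ τ ε w rfl⟩

omit [KanComplex (toSSet T)] in
/-- A lift of a cycle to `E` gives a lift in the replacement. -/
lemma isBoundaryLift_of_isLift {n : ℕ} {ε : Q.E _⦋n + 2⦌} {w : Y _⦋n + 1⦌} {u : piMod (n + 2) T}
    (h : Q.IsLift ε y w u) : ∃ (τ : (toSSet T).PtSimplex (n + 2) (zeroVertex T))
      (w' : D.F'.PtSimplex (n + 1) (D.j'.app _ y)), ptClass τ = u ∧
      yonedaEquiv w'.map = D.j'.app _ w ∧
      IsBoundaryLift D.ι D.p' (D.base y) (yonedaEquiv.symm (D.i.app _ ε)) τ w' := by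
  obtain ⟨hr, h0, h1⟩ := h
  have := D.fibre.mono
  let ε' : (Δ[n + 2] : SSet.{u}) ⟶ D.E' := yonedaEquiv.symm (D.i.app _ ε)
  have hε : ∀ i, yonedaEquiv (stdSimplex.δ i ≫ ε') = D.i.app _ (Q.E.δ i ε) := fun i => by
    rw [stdSimplex.yonedaEquiv_δ_comp, Equiv.apply_symm_apply]
    exact (map_app_apply D.i _ ε).symm
  have hε0 : stdSimplex.δ 0 ≫ ε' = yonedaEquiv.symm (D.j'.app _ w) ≫ D.ι := by
    apply yonedaEquiv.injective
    rw [hε, h0, yonedaEquiv_comp, Equiv.apply_symm_apply, D.comm_app]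
  have hε1 : ∀ k, k ≠ 0 → stdSimplex.δ k ≫ ε' = SSet.const (D.base y) := fun k hk => by
    obtain ⟨k, rfl⟩ := Fin.exists_succ_eq.2 hk
    apply yonedaEquiv.injective
    rw [hε, h1]
    refine (congrArg (D.i.app _) (map_app_apply Q.j _ y)).trans ?_
    refine (map_app_apply D.i _ _).trans ?_
    exact congrArg _ (D.comm_app 0 y).symm
  refine ⟨ptOfCyc hr.mem, ptMk (yonedaEquiv.symm (D.j'.app _ w)) fun i => ?_, ?_, ?_, ?_, hε0, hε1⟩
  · rw [← cancel_mono D.ι, Category.assoc, ← hε0, const_comp' D.ι rfl, ← Fin.castSucc_zero,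
      ← stdSimplex.δ_comp_δ_assoc (Fin.zero_le i), hε1 _ (Fin.succ_ne_zero i)]
    rfl
  · have := represents_ptVal (ptOfCyc hr.mem)
    rw [ptVal_ptOfCyc] at this
    exact this.unique hr
  · exact Equiv.apply_symm_apply _ _
  · rw [ptOfCyc_map]
    apply yonedaEquiv.injective
    rw [yonedaEquiv_comp, Equiv.apply_symm_apply, D.fac_app]
    exact (Equiv.apply_symm_apply _ _).symm

/-- The long exact sequence of an obstruction map in positive degrees is the one of the replacement,
transported along the anodyne extensions from `Y` to the fibre and from `X` to the total space. -/
lemma exists_higher [AddAction (piMod 1 T) (π₀ Y)] (hact : ∀ (a b : Y _⦋0⦌) (u : piMod 1 T),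
    u +ᵥ π₀.mk a = π₀.mk b ↔ IsPath D.ι D.p' (D.j'.app _ a) (D.j'.app _ b) u) :
    ∃ (o : ∀ n, PiGroup (n + 1) X (φ.app _ y) → piMod (n + 1) T)
      (d : ∀ n, piMod (n + 2) T → PiGroup (n + 1) Y y),
      (∀ n, Q.Induces y (n + 1) (o n)) ∧
      (∀ n, Q.InducesBoundary y (n + 1) (d n)) ∧
      (∀ n a b c, PiGroup.IsMul a b c → o n c = o n a + o n b) ∧
      (∀ n u v, PiGroup.IsMul (d n u) (d n v) (d n (u + v))) ∧
      (∀ n c, o n c = 0 ↔ c ∈ Set.range (PiGroup.map φ (x := y) rfl)) ∧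
      (∀ n u, d n u = 1 ↔ u ∈ Set.range (o (n + 1))) ∧
      (∀ n (a : PiGroup (n + 1) Y y), a.map φ rfl = 1 ↔ a ∈ Set.range (d n)) ∧
      (∀ g : piMod 1 T, g +ᵥ π₀.mk y = π₀.mk y ↔ g ∈ Set.range (o 0)) := by
  obtain ⟨v, hv, hva, hvq⟩ := D.exists_toTotal y
  obtain ⟨d, hd⟩ := D.exists_d y
  have hp := D.fibration
  have hF := D.fibre
  have hb := D.p'_base y
  have hj {n} := toKan_bijective (n := n) D.anodyne_j' (rfl : D.j'.app _ y = _)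
  have hvb {n} := toKan_bijective (n := n) hva hv
  let o : ∀ n, PiGroup n X (φ.app _ y) → piMod n T := fun n c =>
    kpiClass (KPi.map D.p' hb (toKan v hv c))
  -- the square formed by the map of fibres and the inclusion of the fibre commutes on `π_n`
  have sq : ∀ n (a : PiGroup n Y y),
      toKan v hv (a.map φ rfl) = KPi.map D.ι rfl (toKan D.j' rfl a) := fun n a => by
    have hqv : (Q.q ≫ v).app _ (Q.j.app _ y) = D.base y := (congrArg _ (Q.q_j y)).trans hv
    have hji : (Q.j ≫ D.i).app _ y = D.base y := (D.comm_app 0 y).symm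
    have h1 : a.map φ rfl = (a.map Q.j rfl).map Q.q (Q.q_j y) := hvb.1 <|
      (toKan_map φ rfl v hv (φ ≫ v) rfl hv a).trans <|
        (toKan_map Q.j rfl (Q.q ≫ v) hqv (φ ≫ v) (by rw [← Category.assoc, Q.fac]) hv a).symm.trans
          (toKan_map Q.q (Q.q_j y) v hv (Q.q ≫ v) rfl hqv _).symm
    rw [h1, hvq]
    exact (toKan_map Q.j rfl D.i (D.comm_app 0 y).symm (Q.j ≫ D.i) rfl hji a).trans
      (map_toKan D.j' rfl D.ι rfl (Q.j ≫ D.i) D.comm hji a).symm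
  have exists_bl : ∀ n (u : piMod (n + 1) T), ∃ τ ε w,
      IsBoundaryLift D.ι D.p' (D.base y) ε τ w ∧ ptClass τ = u ∧
        toKan D.j' rfl (d n u) = KPi.mk (n := n) w := fun n u => by
    obtain ⟨τ, rfl⟩ := exists_ptClass u
    obtain ⟨ε, w, h⟩ := exists_isBoundaryLift hp hF rfl hb τ
    exact ⟨τ, ε, w, h, rfl, hd n τ ε w h⟩
  have oeq : ∀ n c (s : D.E'.PtSimplex n (D.base y)), toKan v hv c = KPi.mk s →
      o n c = ptClass (ptMap D.p' hb s) := fun n c s h => by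
    change kpiClass (KPi.map D.p' hb (toKan v hv c)) = _
    rw [h, KPi.map_mk, kpiClass_mk]
  refine ⟨fun n => o (n + 1), fun n => d (n + 1), ?_, ?_, ?_, ?_, ?_, ?_, ?_, ?_⟩ <;>
    beta_reduce
  -- `o` is computed by the map `p`
  · intro n c t h hr hc
    change kpiClass (KPi.map D.p' hb (toKan v hv _)) = h
    rw [hvq]
    refine (congrArg kpiClass (map_toKan D.i _ D.p' hb Q.p D.fac (Q.p_j y) c)).trans ?_
    obtain ⟨τ, hτ, hτ'⟩ := toKan_of_isRepresentedBy (𝟙 _) (z := zeroVertex T) rfl hc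
    refine (congrArg kpiClass (hτ'.trans
      (toKan_map Q.p (Q.p_j y) (𝟙 _) rfl Q.p (by simp) (Q.p_j y) c)).symm).trans ?_
    rw [kpiClass_mk]
    have := represents_ptVal τ
    rw [show ptVal τ = t from hτ] at this
    exact this.unique hr
  -- `d` is computed by lifts of cycles to `E`
  · intro n ε w u h
    obtain ⟨τ, w', rfl, hw, h'⟩ := D.isBoundaryLift_of_isLift y h
    exact isRepresentedBy_of_toKan D.anodyne_j' rfl w' hw (hd _ _ _ _ h').symm
  -- `o` is a homomorphism
  · intro n a b c h
    exact kpiClass_eq_add ((isMul_toKan v hv h).map D.p' hb)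
  -- `d` is a homomorphism
  · intro n a b
    obtain ⟨τ, ε, w, h, hτ, hw⟩ := exists_bl _ a
    obtain ⟨τ', ε', w', h', hτ', hw'⟩ := exists_bl _ b
    have hm : ptVal τ + ptVal τ' ∈ cyc T (n + 2) := add_mem (ptVal_mem _) (ptVal_mem _)
    have hm' : ptVal (ptOfCyc hm) = ptVal τ + ptVal τ' := ptVal_ptOfCyc hm
    obtain ⟨ε'', w'', h''⟩ := exists_isBoundaryLift hp hF rfl hb (ptOfCyc hm)
    have hw'' := hd _ _ _ _ h''
    rw [ptClass_add hm', hτ, hτ'] at hw''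
    refine isMul_of_toKan D.anodyne_j' rfl ?_
    rw [hw, hw', hw'']
    obtain ⟨r⟩ := exists_mulStruct τ τ' (ptOfCyc hm) (Fin.last (n + 1)) hm'
    exact isMul_of_isBoundaryLift hp hF rfl hb h h' h'' r
  -- exactness at `π_{n+1}(X)`
  · intro n c
    obtain ⟨s, hs⟩ := KPi.exists_mk (toKan v hv c)
    constructor
    · intro h
      rw [oeq _ _ _ hs.symm, ← kpiClass_mk, kpiClass_eq_zero_iff, mk_eq_one_iff] at h
      obtain ⟨f, hf⟩ := exists_of_isNull_comp hp hF rfl hb s h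
      obtain ⟨a, ha⟩ := hj.2 (KPi.mk f)
      refine ⟨a, hvb.1 ?_⟩
      rw [sq, ha, ← hs, ← hf]; rfl
    · rintro ⟨a, rfl⟩
      obtain ⟨f, hf⟩ := KPi.exists_mk (toKan D.j' rfl a)
      have := sq _ a
      rw [← hf] at this
      refine (oeq _ _ (ptMap D.ι rfl f) this).trans ?_
      rw [← kpiClass_mk, kpiClass_eq_zero_iff]
      congr 1
      ext1
      change (f.map ≫ D.ι) ≫ D.p' = SSet.const _
      rw [Category.assoc, hF.w]; rfl
  -- exactness at `π_{n+2}(T)`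
  · intro n u
    obtain ⟨τ, ε, w, h, hτ, hw⟩ := exists_bl _ u
    constructor
    · intro h1
      rw [h1, toKan_one] at hw
      obtain ⟨s, hs⟩ := exists_of_isNull_boundary hF rfl hb h ((mk_eq_one_iff w).1 hw.symm)
      obtain ⟨c, hc⟩ := hvb.2 (KPi.mk s)
      refine ⟨c, ?_⟩
      rw [oeq _ _ _ hc, ← hτ, ← kpiClass_mk, hs, kpiClass_mk]
    · rintro ⟨c, hc⟩
      obtain ⟨s, hs⟩ := KPi.exists_mk (toKan v hv c)
      rw [oeq _ _ _ hs.symm] at hc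
      have h2 := hd _ (ptMap D.p' hb s) s.map RelativeMorphism.const ⟨rfl, by
        rw [s.δ_map]; exact (const_comp' D.ι rfl).symm, fun k _ => s.δ_map k⟩
      rw [hc] at h2
      exact hj.1 (h2.trans (toKan_one _).symm)
  -- exactness at `π_{n+1}(Y)`
  · intro n a
    obtain ⟨f, hf⟩ := KPi.exists_mk (toKan D.j' rfl a)
    have h1 : a.map φ rfl = 1 ↔ IsNull (ptMap D.ι rfl f) := by
      rw [← hvb.1.eq_iff, toKan_one hv, sq, ← hf, KPi.map_mk, mk_eq_one_iff]
    rw [h1]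
    constructor
    · rintro ⟨z, z0, z1⟩
      have hz : ∀ k, stdSimplex.δ k ≫ z ≫ D.p' = SSet.const (zeroVertex T) := fun k => by
        by_cases hk : k = 0
        · rw [hk, ← Category.assoc, z0]
          change (f.map ≫ D.ι) ≫ D.p' = _
          rw [Category.assoc, hF.w]; rfl
        · rw [← Category.assoc, z1 k hk, const_comp' D.p' hb]
      have h2 := hd _ (ptMk (z ≫ D.p') hz) z f ⟨rfl, z0, z1⟩
      exact ⟨_, hj.1 (h2.trans hf)⟩
    · rintro ⟨u, rfl⟩
      obtain ⟨τ, ε, w, h, hτ, hw⟩ := exists_bl _ u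
      rw [← mk_eq_one_iff, ← KPi.map_mk, hf, hw, KPi.map_mk, mk_eq_one_iff]
      exact ⟨ε, h.zero, h.pos⟩
  -- the stabiliser of the component of `y`
  · intro g
    rw [hact]
    constructor
    · rintro ⟨ε, hr, h1, h0⟩
      have hs : ∀ i, stdSimplex.δ i ≫ (yonedaEquiv.symm ε : Δ[0 + 1] ⟶ D.E') =
          SSet.const (D.base y) := fun i => by
        apply yonedaEquiv.injective
        rw [stdSimplex.yonedaEquiv_δ_comp, Equiv.apply_symm_apply]
        refine Eq.trans ?_ (pt_zero _).symm
        fin_cases i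
        · exact h0
        · exact h1
      obtain ⟨c, hc⟩ := hvb.2 (KPi.mk (ptMk _ hs))
      refine ⟨c, (oeq _ _ _ hc).trans ?_⟩
      have := represents_ptVal (ptMap D.p' hb (ptMk _ hs))
      refine this.unique ?_
      convert hr using 1
      change yonedaEquiv (yonedaEquiv.symm ε ≫ D.p') = _
      rw [yonedaEquiv_comp, Equiv.apply_symm_apply]
    · rintro ⟨c, rfl⟩
      obtain ⟨s, hs⟩ := KPi.exists_mk (toKan v hv c)
      have hs' : ∀ i, D.E'.δ i (yonedaEquiv s.map) = D.base y := fun i => by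
        rw [← stdSimplex.yonedaEquiv_δ_comp, s.δ_map]
        exact pt_zero _
      refine ⟨yonedaEquiv s.map, ?_, hs' 1, hs' 0⟩
      have h := represents_ptVal (ptMap D.p' hb s)
      change Represents T 1 _ (o 1 c)
      rw [oeq _ _ _ hs.symm]
      convert h using 1
      exact (yonedaEquiv_comp _ _).symm

end Higher

end FibrationReplacement

/-- The homotopical consequences of a presentation of a map as a homotopy fibre. -/
theorem ObstructionMap.exists_exact {C : SSet.{u}} {g : C ⟶ toSSet T} (hg : IsFibration g)
    (hC : IsTrivialFibration (terminal.from C)) (c₀ : C _⦋0⦌) (ho : g.app _ c₀ = zeroVertex T)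
    {a : Y ⊗ C ⟶ Q.E} (sq : IsPullback a (snd Y C) Q.p g)
    (ha : lift (𝟙 Y) (SSet.const c₀) ≫ a = Q.j) :
    ∃ (o₀ : π₀ X → piMod 0 T) (_ : AddAction (piMod 1 T) (π₀ Y)),
      Q.Induces₀ o₀ ∧ Q.InducesAction (fun g a => g +ᵥ a) ∧
      (∀ c, o₀ c = 0 ↔ c ∈ Set.range (mapπ₀ φ)) ∧
      (∀ a b : π₀ Y, mapπ₀ φ a = mapπ₀ φ b ↔ ∃ g : piMod 1 T, g +ᵥ a = b) ∧
      ∀ y : Y _⦋0⦌, ∃ (o : ∀ n, PiGroup (n + 1) X (φ.app _ y) → piMod (n + 1) T)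
        (d : ∀ n, piMod (n + 2) T → PiGroup (n + 1) Y y),
        (∀ n, Q.Induces y (n + 1) (o n)) ∧
        (∀ n, Q.InducesBoundary y (n + 1) (d n)) ∧
        (∀ n a b c, PiGroup.IsMul a b c → o n c = o n a + o n b) ∧
        (∀ n u v, PiGroup.IsMul (d n u) (d n v) (d n (u + v))) ∧
        (∀ n c, o n c = 0 ↔ c ∈ Set.range (PiGroup.map φ (x := y) rfl)) ∧
        (∀ n u, d n u = 1 ↔ u ∈ Set.range (o (n + 1))) ∧
        (∀ n (a : PiGroup (n + 1) Y y), a.map φ rfl = 1 ↔ a ∈ Set.range (d n)) ∧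
        (∀ g : piMod 1 T, g +ᵥ π₀.mk y = π₀.mk y ↔ g ∈ Set.range (o 0)) := by
  obtain ⟨E', F', i, p', ι, j', h1, h2, h3, h4, h5, h6⟩ :=
    exists_fibration_replacement hg hC c₀ ho sq ha
  obtain ⟨D⟩ : Nonempty (FibrationReplacement Q) :=
    ⟨⟨E', F', i, p', ι, j', h1, h2, h3, h4, h5, h6⟩⟩
  obtain ⟨o₀, ho₀, ho₀'⟩ := D.exists_o₀
  obtain ⟨inst, hact⟩ := D.exists_action
  refine ⟨o₀, inst, ho₀, ?_, ho₀', ?_, fun y => D.exists_higher y hact⟩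
  · rintro ε y w u ⟨hr, h0, h1⟩
    refine (hact y w u).2 ⟨D.i.app _ ε, ?_, ?_, ?_⟩
    · rw [D.fac_app]; exact hr
    · refine (map_app_apply D.i _ ε).symm.trans ?_
      refine (congrArg (D.i.app _) ((h1 0).trans (congrArg _ (pt_zero y)))).trans ?_
      exact (D.comm_app 0 y).symm
    · refine (map_app_apply D.i _ ε).symm.trans ?_
      exact (congrArg (D.i.app _) h0).trans (D.comm_app 0 w).symm
  · intro a b
    obtain ⟨a, rfl⟩ := a.mk_surjective
    obtain ⟨b, rfl⟩ := b.mk_surjective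
    rw [mapπ₀_mk, mapπ₀_mk, D.mk_map_φ_eq_iff, mk_app_eq_iff_exists_isPath D.fibre]
    exact exists_congr fun g => (hact a b g).symm

end LongExactSequence

/-! ### Normalised simplices and Eilenberg–MacLane objects -/

section Normalization
open AlgebraicTopology
variable {R : Type u} [CommRing R] {V W : SimplicialObject (ModuleCat.{u} R)}

lemma naturality_apply (f : V ⟶ W) {m n : SimplexCategoryᵒᵖ} (θ : m ⟶ n) (v : V.obj m) :
    (f.app n).hom ((V.map θ).hom v) = (W.map θ).hom ((f.app m).hom v) :=
  ConcreteCategory.congr_hom (f.naturality θ) v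

/-- The map of normalised complexes is the restriction of the map of simplicial modules. -/
lemma map_normArrow (f : V ⟶ W) (n : ℕ)
    (x : ((normalizedMooreComplex (ModuleCat.{u} R)).obj V).X n) :
    normArrow W n (((normalizedMooreComplex (ModuleCat.{u} R)).map f).f n x) =
      (f.app (op ⦋n⦌)).hom (normArrow V n x) := by
  have hf : (NormalizedMooreComplex.objX W n).Factors
      (normArrow V n ≫ f.app (op ⦋n⦌)) := by
    cases n with
    | zero => exact Subobject.top_factors _
    | succ n =>
      refine (Subobject.finset_inf_factors _).mpr fun i _ => kernelSubobject_factors _ _ ?_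
      ext y
      refine (naturality_apply f (SimplexCategory.δ i.succ).op _).symm.trans ?_
      exact (congrArg (f.app _).hom ((mem_normSub_succ V _).1 (normArrow_mem V (n + 1) y) i)).trans
        (_root_.map_zero _)
  have h : ((normalizedMooreComplex (ModuleCat.{u} R)).map f).f n ≫ normArrow W n =
      normArrow V n ≫ f.app (op ⦋n⦌) := Subobject.factorThru_arrow _ _ hf
  exact ConcreteCategory.congr_hom h x

lemma app_mem_normSub (f : V ⟶ W) {n : ℕ} {v : V.obj (op ⦋n⦌)} (hv : v ∈ normSub V n) :
    (f.app _).hom v ∈ normSub W n := by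
  obtain ⟨x, rfl⟩ := exists_normArrow V n hv
  rw [← map_normArrow]
  exact normArrow_mem _ _ _

lemma app_mem_cyc (f : V ⟶ W) {n : ℕ} {v : V.obj (op ⦋n⦌)} (hv : v ∈ cyc V n) :
    (f.app _).hom v ∈ cyc W n := by
  cases n with
  | zero => trivial
  | succ n =>
    rw [mem_cyc_succ] at hv ⊢
    intro i
    refine (naturality_apply f (SimplexCategory.δ i).op v).symm.trans ?_
    exact (congrArg _ (hv i)).trans (_root_.map_zero _)

/-- A submodule containing the normalised simplices of another one contains it. -/
lemma mem_of_forall_normSub (J J' : ∀ n, Submodule R (V.obj n))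
    (hJ : ∀ {m n} (θ : m ⟶ n), ∀ x ∈ J m, (V.map θ).hom x ∈ J n)
    (hJ' : ∀ {m n} (θ : m ⟶ n), ∀ x ∈ J' m, (V.map θ).hom x ∈ J' n)
    (h : ∀ n : ℕ, ∀ x ∈ normSub V n, x ∈ J' _ → x ∈ J _) {n : SimplexCategoryᵒᵖ} {x : V.obj n}
    (hx : x ∈ J' n) : x ∈ J n := by
  obtain ⟨⟨n⟩⟩ := n
  have := eq_of_norm_eq (fun n => J n ⊓ J' n) J' (fun θ x hx => ⟨hJ θ x hx.1, hJ' θ x hx.2⟩) hJ'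
    (fun n => inf_le_right) (fun n x hx hx' => ⟨h n x hx hx', hx'⟩) n
  exact (this.ge hx).1

lemma surjective_of_normSub (f : V ⟶ W)
    (h : ∀ n : ℕ, ∀ w ∈ normSub W n, ∃ v, (f.app (op ⦋n⦌)).hom v = w) (n : SimplexCategoryᵒᵖ) :
    Function.Surjective (f.app n).hom := fun w =>
  mem_of_forall_normSub (fun n => LinearMap.range (f.app n).hom) (fun _ => ⊤) (by
    rintro m n θ _ ⟨x, rfl⟩
    exact ⟨_, naturality_apply f θ x⟩) (fun _ _ _ => trivial) (fun n w hw _ => h n w hw)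
    (Submodule.mem_top (x := w))

lemma hom_ext_of_normSub {f g : V ⟶ W}
    (h : ∀ n : ℕ, ∀ v ∈ normSub V n, (f.app (op ⦋n⦌)).hom v = (g.app (op ⦋n⦌)).hom v) : f = g := by
  refine NatTrans.ext (funext fun n => ModuleCat.hom_ext (LinearMap.ext fun v => ?_))
  exact mem_of_forall_normSub (fun n => LinearMap.eqLocus (f.app n).hom (g.app n).hom)
    (fun _ => ⊤) (fun θ x hx => by
      rw [LinearMap.mem_eqLocus] at hx ⊢
      rw [naturality_apply, naturality_apply, hx]) (fun _ _ _ => trivial)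
    (fun n w hw _ => h n w hw) (Submodule.mem_top (x := v))

end Normalization

section EilenbergMacLane
open AlgebraicTopology
variable {k : Type u} [Field k] {U : SimplicialObject (ModuleCat.{u} k)} (m : ℕ)

/-- The normalisation of `K^m`. -/
noncomputable def normIso : (normalizedMooreComplex (ModuleCat.{u} k)).obj (eilenbergMacLane k m) ≅
    (HomologicalComplex.single (ModuleCat.{u} k) (ComplexShape.down ℕ) m).obj (ModuleCat.of k k) :=
  Abelian.DoldKan.equivalence.counitIso.app _

/-- The normalisation of `K^m` in degree `m`. -/
noncomputable def normEquivX :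
    ((normalizedMooreComplex (ModuleCat.{u} k)).obj (eilenbergMacLane k m)).X m ≃ₗ[k] k :=
  ((HomologicalComplex.eval _ _ m).mapIso (normIso m) ≪≫
    HomologicalComplex.singleObjXSelf (ComplexShape.down ℕ) m (ModuleCat.of k k)).toLinearEquiv

variable (k) in
/-- The generator of `K^m` in degree `m`. -/
noncomputable def gen : (eilenbergMacLane k m).obj (op ⦋m⦌) :=
  normArrow _ m ((normEquivX m).symm 1)

lemma normSub_eilenbergMacLane {n : ℕ} (h : n ≠ m) : normSub (eilenbergMacLane k m) n = ⊥ := by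
  have h1 := (HomologicalComplex.isZero_single_obj_X (ComplexShape.down ℕ) m (ModuleCat.of k k) n
    h).of_iso ((HomologicalComplex.eval _ _ n).mapIso (normIso m))
  have h2 : Subsingleton (((normalizedMooreComplex (ModuleCat.{u} k)).obj
    (eilenbergMacLane k m)).X n) := ModuleCat.subsingleton_of_isZero h1
  have := ((normEquiv (eilenbergMacLane k m) n).toEquiv.subsingleton_congr).1 h2
  exact (Submodule.subsingleton_iff_eq_bot).1 this

lemma gen_mem_normSub : gen k m ∈ normSub (eilenbergMacLane k m) m := normArrow_mem _ _ _

lemma normArrow_eilenbergMacLane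
    (x : ((normalizedMooreComplex (ModuleCat.{u} k)).obj (eilenbergMacLane k m)).X m) :
    normArrow _ m x = normEquivX m x • gen k m := by
  have h : x = normEquivX m x • (normEquivX m).symm 1 := by
    rw [← LinearEquiv.map_smul, smul_eq_mul, mul_one, LinearEquiv.symm_apply_apply]
  refine Eq.trans (congrArg (normArrow _ m) h) ?_
  exact _root_.map_smul (normArrow _ m).hom _ _

lemma exists_eq_smul_gen {v : (eilenbergMacLane k m).obj (op ⦋m⦌)}
    (hv : v ∈ normSub (eilenbergMacLane k m) m) : ∃ c : k, v = c • gen k m := by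
  obtain ⟨x, rfl⟩ := exists_normArrow _ m hv
  exact ⟨_, normArrow_eilenbergMacLane m x⟩

lemma gen_ne_zero : gen k m ≠ 0 := by
  have h3 : Function.Injective (normArrow (eilenbergMacLane k m) m).hom := arrow_injective _ m
  intro h
  have h0 : (normEquivX (k := k) m).symm 1 = 0 := by
    apply h3
    rw [_root_.map_zero]
    exact h
  exact one_ne_zero ((LinearEquiv.map_eq_zero_iff _).1 h0)

lemma eilenbergMacLane_hom_ext {f g : eilenbergMacLane k m ⟶ U}
    (h : (f.app _).hom (gen k m) = (g.app _).hom (gen k m)) : f = g := by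
  refine hom_ext_of_normSub fun n v hv => ?_
  by_cases hn : n = m
  · subst hn
    obtain ⟨c, rfl⟩ := exists_eq_smul_gen n hv
    rw [_root_.map_smul, _root_.map_smul, h]
  · rw [normSub_eilenbergMacLane m hn, Submodule.mem_bot] at hv
    rw [hv, _root_.map_zero, _root_.map_zero]

/-- Maps of normalised complexes come from maps of simplicial vector spaces, by the Dold–Kan
correspondence. -/
lemma full_normalizedMooreComplex : (normalizedMooreComplex (ModuleCat.{u} k)).Full :=
  inferInstanceAs (Abelian.DoldKan.equivalence (A := ModuleCat.{u} k)).functor.Full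

/-- Maps out of `K^m` are given by cycles. -/
lemma exists_hom_of_cycle {z : U.obj (op ⦋m⦌)} (hz : z ∈ cyc U m) :
    ∃ f : eilenbergMacLane k m ⟶ U, (f.app _).hom (gen k m) = z := by
  have hz' : z ∈ normSub U m := by
    cases m with
    | zero => trivial
    | succ m => exact (mem_normSub_succ U z).2 fun i => (mem_cyc_succ U z).1 hz _
  obtain ⟨x, rfl⟩ := exists_normArrow U m hz'
  let l : ModuleCat.of k k ⟶ ((normalizedMooreComplex (ModuleCat.{u} k)).obj U).X m :=
    ModuleCat.ofHom (LinearMap.toSpanSingleton k _ x)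
  have hl : ∀ j, (ComplexShape.down ℕ).Rel m j →
      l ≫ ((normalizedMooreComplex (ModuleCat.{u} k)).obj U).d m j = 0 := by
    intro j hj
    obtain rfl : (ComplexShape.down ℕ).next m = j := (ComplexShape.down ℕ).next_eq' hj
    refine ModuleCat.hom_ext (LinearMap.ext_ring ?_)
    refine Eq.trans (congrArg (((normalizedMooreComplex (ModuleCat.{u} k)).obj U).d m _).hom
      (one_smul k x)) ((d_eq_zero_iff U m x).2 hz)
  have := full_normalizedMooreComplex (k := k)
  obtain ⟨f, hf⟩ := (normalizedMooreComplex (ModuleCat.{u} k)).map_surjective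
    ((normIso (k := k) m).hom ≫ HomologicalComplex.mkHomFromSingle l hl)
  refine ⟨f, (map_normArrow f m ((normEquivX m).symm 1)).symm.trans (congrArg (normArrow U m) ?_)⟩
  rw [hf, HomologicalComplex.comp_f, HomologicalComplex.mkHomFromSingle_f]
  refine Eq.trans ?_ (one_smul k x)
  exact congrArg (LinearMap.toSpanSingleton k _ x) ((normEquivX (k := k) m).apply_symm_apply 1)

/-- Maps into `K^m` are given by linear forms on the normalisation that vanish on boundaries. -/
lemma exists_hom_of_form (l : normSub U m →ₗ[k] k)
    (hl : ∀ (y : U.obj (op ⦋m + 1⦌)) (_ : y ∈ normSub U (m + 1)) (h : (U.δ 0).hom y ∈ normSub U m),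
      l ⟨_, h⟩ = 0) :
    ∃ f : U ⟶ eilenbergMacLane k m, ∀ v : normSub U m, (f.app _).hom v.1 = l v • gen k m := by
  let l' : ((normalizedMooreComplex (ModuleCat.{u} k)).obj U).X m ⟶ ModuleCat.of k k :=
    ModuleCat.ofHom (l ∘ₗ (normEquiv U m).toLinearMap)
  have he : ∀ x, ((normEquiv U m) x).1 = normArrow U m x := fun x => rfl
  have hl' : ∀ i, (ComplexShape.down ℕ).Rel i m →
      ((normalizedMooreComplex (ModuleCat.{u} k)).obj U).d i m ≫ l' = 0 := by
    rintro i rfl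
    refine ModuleCat.hom_ext (LinearMap.ext fun y => ?_)
    have h1 : normArrow U m (((normalizedMooreComplex (ModuleCat.{u} k)).obj U).d (m + 1) m y) =
      (U.δ 0).hom (normArrow U (m + 1) y) := ConcreteCategory.congr_hom (d_normArrow U m) y
    have h2 := hl _ (normArrow_mem U (m + 1) y) (h1 ▸ normArrow_mem U m _)
    exact Eq.trans (congrArg l (Subtype.ext ((he _).trans h1))) h2
  have := full_normalizedMooreComplex (k := k)
  obtain ⟨f, hf⟩ := (normalizedMooreComplex (ModuleCat.{u} k)).map_surjective
    (HomologicalComplex.mkHomToSingle l' hl' ≫ (normIso (k := k) m).inv)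
  refine ⟨f, ?_⟩
  rintro ⟨v, hv⟩
  obtain ⟨x, rfl⟩ := exists_normArrow U m hv
  refine (map_normArrow f m x).symm.trans ?_
  rw [hf, normArrow_eilenbergMacLane, HomologicalComplex.comp_f, HomologicalComplex.mkHomToSingle_f]
  refine congrArg (· • gen k m) ?_
  exact (normEquivX (k := k) m).apply_symm_apply (l' x)

lemma gen_mem_cyc : gen k m ∈ cyc (eilenbergMacLane k m) m := by
  cases m with
  | zero => trivial
  | succ m =>
    refine (mem_cyc_succ _ _).2 (Fin.cases ?_ ((mem_normSub_succ _ _).1 (gen_mem_normSub _)))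
    have h : ((eilenbergMacLane k (m + 1)).δ 0).hom (gen k (m + 1)) ∈
        normSub (eilenbergMacLane k (m + 1)) m := by
      have := normArrow_mem (eilenbergMacLane k (m + 1)) m
        (((normalizedMooreComplex (ModuleCat.{u} k)).obj _).d (m + 1) m
          ((normEquivX (k := k) (m + 1)).symm 1))
      have h1 := ConcreteCategory.congr_hom (d_normArrow (eilenbergMacLane k (m + 1)) m)
        ((normEquivX (k := k) (m + 1)).symm 1)
      exact h1 ▸ this
    rwa [normSub_eilenbergMacLane (m + 1) m.lt_succ_self.ne, Submodule.mem_bot] at h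

end EilenbergMacLane

/-! ### The cone on a simplicial vector space -/

section Contraction
variable {R : Type u} [CommRing R] {T : SimplicialObject (ModuleCat.{u} R)}

/-- The normalised complex of a contractible simplicial module is exact. -/
lemma exists_boundary_of_contraction (H : toSSet T ⊗ Δ[1] ⟶ toSSet T)
    (h0 : ι₀ ≫ H = SSet.const (zeroVertex T)) (h1 : ι₁ ≫ H = 𝟙 _)
    (hz : ∀ m (t : (Δ[1] : SSet.{u}).obj m), H.app m (pt (zeroVertex T) m, t) =
      pt (zeroVertex T) m) {n : ℕ} {z : T.obj (op ⦋n⦌)} (h : z ∈ cyc T n) :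
    ∃ y ∈ normSub T (n + 1), (T.δ 0).hom y = z := by
  have hf : (SSet.const (zeroVertex T) : toSSet T ⟶ _).app _ (zeroVertex T) = zeroVertex T :=
    _root_.map_zero (T.map _).hom
  -- the identity and the zero map induce the same map on homotopy classes of pointed simplices
  have h2 : KPi.mk (ptMap (SSet.const (zeroVertex T)) hf (ptOfCyc h)) =
      KPi.mk (ptMap (𝟙 _) rfl (ptOfCyc h)) :=
    KPi.map_congr H h0 h1 hz hf rfl (KPi.mk (ptOfCyc h))
  have h3 := ptClass_eq_of_mk_eq h2
  have h4 : ptVal (ptMap (SSet.const (zeroVertex T)) hf (ptOfCyc h)) = 0 := by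
    refine Eq.trans ?_ (mapVal_const (n := n) (T := T))
    rfl
  have h5 : ptVal (ptMap (𝟙 _) rfl (ptOfCyc h)) = z := ptVal_ptOfCyc h
  obtain ⟨y, hy, hy'⟩ := ((represents_ptVal _).eq_iff (represents_ptVal _)).1 h3.symm
  exact ⟨y, hy, hy'.trans ((congrArg₂ (· - ·) h5 h4).trans (sub_zero z))⟩

end Contraction

section Cone

lemma lTensor_map_of_comp_eq {k A A' B B' C C' : Type*} [CommRing k] [AddCommGroup A] [Module k A]
    [AddCommGroup A'] [Module k A'] [AddCommGroup B] [Module k B] [AddCommGroup B'] [Module k B']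
    [AddCommGroup C] [Module k C] [AddCommGroup C'] [Module k C'] (a : A →ₗ[k] A')
    (b : B →ₗ[k] B') (c : C →ₗ[k] C') (f : B →ₗ[k] C) (f' : B' →ₗ[k] C') (h : f' ∘ₗ b = c ∘ₗ f)
    (x : A ⊗[k] B) : LinearMap.lTensor A' f' (TensorProduct.map a b x) =
      TensorProduct.map a c (LinearMap.lTensor A f x) := by
  rw [← LinearMap.comp_apply, ← LinearMap.comp_apply, LinearMap.lTensor_comp_map,
    LinearMap.map_comp_lTensor, h]

variable (k : Type u) [Field k]

/-- The simplicial vector space of functions on the vertices of the standard simplices. It is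
contractible, and constant functions form a subobject with quotient `K^1`. -/
def vertexFun : SimplicialObject (ModuleCat.{u} k) where
  obj n := ModuleCat.of k (Fin (n.unop.len + 1) → k)
  map θ := ModuleCat.ofHom (LinearMap.funLeft k k θ.unop.toOrderHom)
  map_id _ := rfl
  map_comp _ _ := rfl

variable {k}

lemma normSub_vertexFun (n : ℕ) : normSub (vertexFun k) (n + 2) = ⊥ := by
  rw [eq_bot_iff]
  intro f hf
  rw [mem_normSub_succ] at hf
  rw [Submodule.mem_bot]
  funext j
  -- every vertex of a simplex of dimension at least two lies on a face of positive index
  have key : ∀ i : Fin (n + 2), j ≠ i.succ → f j = 0 := fun i hi => by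
    obtain ⟨l, rfl⟩ := Fin.exists_succAbove_eq hi
    exact congrFun (hf i) l
  by_cases h : j = Fin.succ 0
  · exact key 1 (by rw [h]; exact fun h' => absurd (Fin.succ_injective _ h') (by simp))
  · exact key 0 h

lemma normSub_one_vertexFun {f : (vertexFun k).obj (op ⦋1⦌)} :
    f ∈ normSub (vertexFun k) 1 ↔ f (0 : Fin 2) = 0 := by
  rw [mem_normSub_succ]
  constructor
  · exact fun h => congrFun (h 0) (0 : Fin 1)
  · intro h i
    funext j
    obtain rfl : i = 0 := Fin.fin_one_eq_zero i
    obtain rfl : j = (0 : Fin 1) := Fin.fin_one_eq_zero j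
    exact h

lemma isFD_vertexFun : IsFD (vertexFun k) := by
  rw [isFD_iff]
  refine ⟨fun n => ?_, 1, fun n hn => ?_⟩
  · have : Module.Finite k ((vertexFun k).obj (op ⦋n⦌)) :=
      inferInstanceAs (Module.Finite k (Fin (n + 1) → k))
    infer_instance
  · obtain ⟨n, rfl⟩ : ∃ n', n = n' + 2 := ⟨n - 2, by omega⟩
    exact normSub_vertexFun n

variable (k) in
/-- The constant functions. -/
def constFun (n : SimplexCategoryᵒᵖ) : k →ₗ[k] (vertexFun k).obj n :=
  LinearMap.pi fun _ : Fin (n.unop.len + 1) => LinearMap.id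

/-- The quotient of the functions on vertices by the constant functions is `K^1`. -/
lemma exists_vertexFun_proj : ∃ f : vertexFun k ⟶ eilenbergMacLane k 1,
    (∀ n, Function.Surjective (f.app n).hom) ∧
    ∀ n, Function.Exact (constFun k n) (f.app n).hom := by
  -- in degree `1` the normalised functions are those that vanish at the vertex `0`; take the value
  -- at the vertex `1` as the linear form
  obtain ⟨f, hf⟩ := exists_hom_of_form (U := vertexFun k) 1
    ((LinearMap.proj (1 : Fin 2) : (Fin 2 → k) →ₗ[k] k) ∘ₗ (normSub (vertexFun k) 1).subtype)
    (fun y hy h => by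
      rw [normSub_vertexFun, Submodule.mem_bot] at hy
      subst hy
      exact congrFun (_root_.map_zero ((vertexFun k).δ 0).hom) (1 : Fin 2))
  have hc : ∀ n (c : k), (f.app n).hom (constFun k n c) = 0 := by
    intro n c
    have h0 : (f.app (op ⦋0⦌)).hom (constFun k _ c) = 0 := by
      have : (f.app (op ⦋0⦌)).hom (constFun k _ c) ∈ normSub (eilenbergMacLane k 1) 0 := trivial
      rwa [normSub_eilenbergMacLane 1 zero_ne_one, Submodule.mem_bot] at this
    have h1 := naturality_apply f (SimplexCategory.const n.unop ⦋0⦌ 0).op (constFun k _ c)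
    rw [h0, _root_.map_zero] at h1
    exact h1
  refine ⟨f, surjective_of_normSub f fun n w hw => ?_, fun n x => ⟨fun hx => ?_, ?_⟩⟩
  · by_cases hn : n = 1
    · subst hn
      obtain ⟨c, rfl⟩ := exists_eq_smul_gen 1 hw
      refine ⟨(![0, c] : Fin 2 → k), ?_⟩
      exact hf ⟨(![0, c] : Fin 2 → k), normSub_one_vertexFun.2 rfl⟩
    · rw [normSub_eilenbergMacLane 1 hn, Submodule.mem_bot] at hw
      exact ⟨0, by rw [hw, _root_.map_zero]⟩
  -- it suffices to compare the kernel with the constant functions on normalised simplices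
  · refine mem_of_forall_normSub (fun n => LinearMap.range (constFun k n))
      (fun n => LinearMap.ker (f.app n).hom) ?_ ?_ ?_ (LinearMap.mem_ker.2 hx)
    · rintro m n θ _ ⟨c, rfl⟩
      exact ⟨c, rfl⟩
    · intro m n θ x hx
      rw [LinearMap.mem_ker] at hx ⊢
      rw [naturality_apply, hx, _root_.map_zero]
    · intro n v hv hv'
      match n with
      | 0 =>
        refine ⟨v (0 : Fin 1), funext fun j => ?_⟩
        obtain rfl : j = (0 : Fin 1) := Fin.fin_one_eq_zero j
        rfl
      | 1 =>
        have h1 := (hf ⟨v, hv⟩).symm.trans hv'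
        have h2 : v (1 : Fin 2) = 0 := (smul_eq_zero.1 h1).resolve_right (gen_ne_zero 1)
        have h3 := normSub_one_vertexFun.1 hv
        refine ⟨0, funext fun (j : Fin 2) => ?_⟩
        fin_cases j
        · exact h3.symm
        · exact h2.symm
      | n + 2 =>
        rw [normSub_vertexFun, Submodule.mem_bot] at hv
        rw [hv]
        exact zero_mem _
  · rintro ⟨c, rfl⟩
    exact hc n c

/-- The value at a vertex of the homotopy from `0` to `1` on the interval. -/
def vertexVal {m : SimplexCategoryᵒᵖ} (t : (Δ[1] : SSet.{u}).obj m) (j : Fin (m.unop.len + 1)) : k :=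
  ((stdSimplex.objEquiv t).toOrderHom j).val

/-- Multiplication by the values of a simplex of the interval. -/
def vertexMul {m : SimplexCategoryᵒᵖ} (t : (Δ[1] : SSet.{u}).obj m) :
    (vertexFun k).obj m →ₗ[k] (vertexFun k).obj m :=
  LinearMap.mulLeft k (vertexVal t : Fin (m.unop.len + 1) → k)

lemma vertexMul_map {m n : SimplexCategoryᵒᵖ} (θ : m ⟶ n) (t : (Δ[1] : SSet.{u}).obj m) :
    vertexMul (Δ[1].map θ t) ∘ₗ ((vertexFun k).map θ).hom =
      ((vertexFun k).map θ).hom ∘ₗ vertexMul t := rfl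

/-- The contraction of `V ⊗ D` induced by that of `D`, the simplicial vector space of functions
on vertices. -/
def coneContraction (V : SimplicialObject (ModuleCat.{u} k)) :
    toSSet (tensor V (vertexFun k)) ⊗ Δ[1] ⟶ toSSet (tensor V (vertexFun k)) where
  app m := ↾(fun x : (V.obj m ⊗[k] (vertexFun k).obj m) × (Δ[1] : SSet.{u}).obj m =>
    (LinearMap.lTensor (V.obj m) (vertexMul x.2) x.1 : V.obj m ⊗[k] (vertexFun k).obj m))
  naturality m n θ := by
    ext ⟨x, t⟩
    change LinearMap.lTensor _ (vertexMul (Δ[1].map θ t))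
      (TensorProduct.map (V.map θ).hom ((vertexFun k).map θ).hom x) =
      TensorProduct.map (V.map θ).hom ((vertexFun k).map θ).hom (LinearMap.lTensor _ (vertexMul t) x)
    exact lTensor_map_of_comp_eq _ _ _ _ _ (vertexMul_map θ t) x

lemma exists_boundary_cone (V : SimplicialObject (ModuleCat.{u} k)) {n : ℕ}
    {z : (tensor V (vertexFun k)).obj (op ⦋n⦌)} (h : z ∈ cyc (tensor V (vertexFun k)) n) :
    ∃ y ∈ normSub (tensor V (vertexFun k)) (n + 1),
      ((tensor V (vertexFun k)).δ 0).hom y = z := by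
  refine exists_boundary_of_contraction (coneContraction V) ?_ ?_ (fun m t => ?_) h
  · ext m x
    have h0 : vertexMul (k := k) ((ι₀ (X := toSSet (tensor V (vertexFun k)))).app m x).2 = 0 := by
      refine LinearMap.ext fun f => funext fun j => ?_
      exact (congrArg (· * f j) Nat.cast_zero).trans (zero_mul _)
    refine Eq.trans (congrArg (fun g => LinearMap.lTensor (V.obj m) g x) h0) ?_
    refine Eq.trans (LinearMap.congr_fun (LinearMap.lTensor_zero _) _) ?_
    exact (_root_.map_zero ((tensor V (vertexFun k)).map
      (SimplexCategory.const m.unop ⦋0⦌ 0).op).hom).symm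
  · ext m x
    have h0 : vertexMul (k := k) ((ι₁ (X := toSSet (tensor V (vertexFun k)))).app m x).2 =
        LinearMap.id := by
      refine LinearMap.ext fun f => funext fun j => ?_
      exact (congrArg (· * f j) Nat.cast_one).trans (one_mul _)
    refine Eq.trans (congrArg (fun g => LinearMap.lTensor (V.obj m) g x) h0) ?_
    exact LinearMap.congr_fun (LinearMap.lTensor_id _ _) _
  · have : pt (zeroVertex (tensor V (vertexFun k))) m =
      (0 : V.obj m ⊗[k] (vertexFun k).obj m) :=
      _root_.map_zero ((tensor V (vertexFun k)).map (SimplexCategory.const m.unop ⦋0⦌ 0).op).hom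
    rw [this]
    exact _root_.map_zero (LinearMap.lTensor (V.obj m) (vertexMul t))

end Cone

section ConeObject
variable {Λ : Type u} [CommRing Λ] [IsLocalRing Λ] (V : SFDVect Λ)

/-- The cone on a simplicial vector space `V`, the tensor product of `V` with the functions on the
vertices of the standard simplices. -/
noncomputable def coneObj : SFDVect Λ :=
  ⟨tensor V.obj (vertexFun _), isFD_tensor V.property isFD_vertexFun⟩

/-- The inclusion of `V` in its cone, through the constant functions. -/
noncomputable def coneIncl : V ⟶ coneObj V :=
  homOfLinear (fun n => (TensorProduct.mk _ (V.obj.obj n) ((vertexFun _).obj n)).flip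
    (constFun _ n 1)) (fun _ _ => rfl)

/-- The projection from the cone on `V` to `V ⊗ K^1`. -/
noncomputable def coneProj : coneObj V ⟶ shift V 1 :=
  homOfLinear (fun n => LinearMap.lTensor (V.obj.obj n) (exists_vertexFun_proj.choose.app n).hom)
    (fun {m n} θ x => by
      change LinearMap.lTensor _ _ (TensorProduct.map (V.obj.map θ).hom _ x) =
        TensorProduct.map (V.obj.map θ).hom _ (LinearMap.lTensor _ _ x)
      exact lTensor_map_of_comp_eq _ _ _ _ _ (LinearMap.ext fun f => naturality_apply _ θ f) x)

lemma coneIncl_injective (n : SimplexCategoryᵒᵖ) :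
    Function.Injective ((coneIncl V).hom.app n).hom := by
  let r : V.obj.obj n ⊗[ResidueField Λ] (vertexFun (ResidueField Λ)).obj n →ₗ[ResidueField Λ]
      V.obj.obj n := (TensorProduct.rid _ _).toLinearMap ∘ₗ
    LinearMap.lTensor _ (LinearMap.proj (0 : Fin (n.unop.len + 1)))
  refine Function.LeftInverse.injective (g := r) fun v => ?_
  exact one_smul (ResidueField Λ) v

lemma coneProj_surjective (n : SimplexCategoryᵒᵖ) :
    Function.Surjective ((coneProj V).hom.app n).hom :=
  LinearMap.lTensor_surjective _ (exists_vertexFun_proj.choose_spec.1 n)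

lemma cone_exact (n : SimplexCategoryᵒᵖ) :
    Function.Exact ((coneIncl V).hom.app n).hom ((coneProj V).hom.app n).hom := by
  have h := lTensor_exact (V.obj.obj n) (f := constFun (ResidueField Λ) n)
    (g := (exists_vertexFun_proj.choose.app n).hom) (exists_vertexFun_proj.choose_spec.2 n)
    (exists_vertexFun_proj.choose_spec.1 n)
  intro x
  refine (h x).trans ⟨?_, ?_⟩
  · rintro ⟨w, rfl⟩
    obtain ⟨v, rfl⟩ := (TensorProduct.rid _ _).symm.surjective w
    exact ⟨v, rfl⟩
  · rintro ⟨v, rfl⟩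
    exact ⟨(TensorProduct.rid _ _).symm v, rfl⟩

end ConeObject

/-! ### Surjections of simplicial modules and Artinian extensions -/

section Homology
open AlgebraicTopology DoldKan
variable {R : Type u} [CommRing R] {V W : SimplicialObject (ModuleCat.{u} R)}

variable (V) in
lemma PInfty_mem_normSub (n : ℕ) (x : V.obj (op ⦋n⦌)) :
    ((PInfty (X := V)).f n).hom x ∈ normSub V n := by
  cases n with
  | zero => trivial
  | succ n =>
    refine (mem_normSub_succ V _).2 fun i => ?_
    have h3 : HigherFacesVanish (n + 1) ((PInfty (X := V)).f (n + 1)) := by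
      rw [PInfty_f]; exact HigherFacesVanish.of_P (n + 1) n
    exact ConcreteCategory.congr_hom (h3 i (by omega)) x

lemma PInfty_of_mem_normSub {n : ℕ} {x : V.obj (op ⦋n⦌)} (hx : x ∈ normSub V n) :
    ((PInfty (X := V)).f n).hom x = x := by
  obtain ⟨z, rfl⟩ := exists_normArrow V n hx
  exact ConcreteCategory.congr_hom
    (HomologicalComplex.congr_hom (inclusionOfMooreComplexMap_comp_PInfty V) n) z

/-- Normalised simplices can be lifted along a surjection, by projecting a lift to the
normalisation. -/
lemma exists_normSub_lift (f : V ⟶ W) (hf : ∀ n, Function.Surjective (f.app n).hom) {n : ℕ}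
    {w : W.obj (op ⦋n⦌)} (hw : w ∈ normSub W n) : ∃ v ∈ normSub V n, (f.app _).hom v = w := by
  obtain ⟨x, rfl⟩ := hf _ w
  refine ⟨_, PInfty_mem_normSub V n x, ?_⟩
  have h : f.app (op ⦋n⦌) ≫ (PInfty (X := W)).f n = (PInfty (X := V)).f n ≫ f.app (op ⦋n⦌) :=
    PInfty_f_naturality n f
  exact (ConcreteCategory.congr_hom h x).symm.trans (PInfty_of_mem_normSub hw)

lemma cyc_le_normSub (n : ℕ) : cyc V n ≤ normSub V n := by
  cases n with
  | zero => exact le_top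
  | succ n =>
    exact fun v hv => (mem_normSub_succ V v).2 fun i => (mem_cyc_succ V v).1 hv _

lemma δ_zero_mem_cyc {n : ℕ} {v : V.obj (op ⦋n + 1⦌)} (hv : v ∈ normSub V (n + 1)) :
    (V.δ 0).hom v ∈ cyc V n := by
  cases n with
  | zero => trivial
  | succ n =>
    rw [mem_normSub_succ] at hv
    refine (mem_cyc_succ V _).2 fun j => ?_
    have h1 : V.δ j.succ ≫ V.δ 0 = V.δ 0 ≫ V.δ j := V.δ_comp_δ (Fin.zero_le j)
    refine (ConcreteCategory.congr_hom h1 v).symm.trans ?_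
    exact (congrArg (V.δ 0).hom (hv j)).trans (_root_.map_zero _)

/-- The map induced on homotopy groups. -/
noncomputable def piModMap (f : V ⟶ W) (n : ℕ) : piMod n V →ₗ[R] piMod n W :=
  (HomologicalComplex.homologyMap ((normalizedMooreComplex (ModuleCat.{u} R)).map f) n).hom

lemma piModMap_cycClass (f : V ⟶ W) (n : ℕ) (v : cyc V n) :
    piModMap f n (cycClass V n v) = cycClass W n ⟨(f.app _).hom v.1, app_mem_cyc f v.2⟩ := by
  obtain ⟨v, hv⟩ := v
  obtain ⟨h, z, rfl, rfl⟩ := exists_represents_of_mem hv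
  have h1 : cycClass V n ⟨_, hv⟩ = _ := ((represents_iff V n _ _).1 ⟨z, rfl, rfl⟩).2
  have h2 : Represents W n _ _ := ⟨HomologicalComplex.cyclesMap
    ((normalizedMooreComplex (ModuleCat.{u} R)).map f) n z, rfl, rfl⟩
  obtain ⟨h3, h4⟩ := (represents_iff W n _ _).1 h2
  rw [h1]
  have h5 := ConcreteCategory.congr_hom (HomologicalComplex.homologyπ_naturality
    ((normalizedMooreComplex (ModuleCat.{u} R)).map f) n) z
  refine Eq.trans h5 (h4.symm.trans (congrArg (cycClass W n) (Subtype.ext ?_)))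
  refine Eq.trans ?_ (map_normArrow f n _)
  exact congrArg (normArrow W n) (ConcreteCategory.congr_hom (HomologicalComplex.cyclesMap_i
    ((normalizedMooreComplex (ModuleCat.{u} R)).map f) n) z)

/-- A surjection of simplicial modules whose kernel has vanishing homotopy groups induces
isomorphisms on homotopy groups. -/
lemma piModMap_bijective_of_ker (f : V ⟶ W) (hf : ∀ n, Function.Surjective (f.app n).hom)
    (hk : ∀ (n : ℕ) (z : V.obj (op ⦋n⦌)), z ∈ cyc V n → (f.app _).hom z = 0 →
      ∃ y ∈ normSub V (n + 1), (f.app _).hom y = 0 ∧ (V.δ 0).hom y = z) (n : ℕ) :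
    Function.Bijective (piModMap f n) := by
  constructor
  · rw [injective_iff_map_eq_zero]
    intro c hc
    obtain ⟨v, rfl⟩ := cycClass_surjective V n c
    rw [piModMap_cycClass, cycClass_eq_zero_iff] at hc
    obtain ⟨w, hw, hw'⟩ := hc
    obtain ⟨x, hx, rfl⟩ := exists_normSub_lift f hf hw
    -- the difference between `v` and the boundary of a lift of `w` is a cycle of the kernel, hence
    -- a boundary
    obtain ⟨y, hy, -, hy'⟩ := hk n (v.1 - (V.δ 0).hom x) (sub_mem v.2 (δ_zero_mem_cyc hx)) (by
      rw [_root_.map_sub, sub_eq_zero]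
      exact hw'.symm.trans (naturality_apply f (SimplexCategory.δ 0).op x).symm)
    refine (cycClass_eq_zero_iff V n v).2 ⟨y + x, add_mem hy hx, ?_⟩
    rw [_root_.map_add, hy', sub_add_cancel]
  · intro c
    obtain ⟨w, rfl⟩ := cycClass_surjective W n c
    suffices h : ∃ v ∈ cyc V n, (f.app _).hom v = w.1 by
      obtain ⟨v, hv, hvw⟩ := h
      refine ⟨cycClass V n ⟨v, hv⟩, ?_⟩
      rw [piModMap_cycClass]
      exact congrArg _ (Subtype.ext hvw)
    obtain ⟨v, hv, hvw⟩ := exists_normSub_lift f hf (cyc_le_normSub n w.2)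
    match n, w, v, hv, hvw with
    | 0, w, v, hv, hvw => exact ⟨v, trivial, hvw⟩
    | n + 1, w, v, hv, hvw =>
      -- correct a lift `v` of the cycle `w` by an element of the kernel with the same boundary
      obtain ⟨y, hy, hy', hy''⟩ := hk n ((V.δ 0).hom v) (δ_zero_mem_cyc hv) (by
        refine (naturality_apply f (SimplexCategory.δ 0).op v).trans ?_
        exact (congrArg (W.δ 0).hom hvw).trans ((mem_cyc_succ W _).1 w.2 0))
      refine ⟨v - y, (mem_cyc_succ V _).2 (Fin.cases ?_ fun i => ?_), ?_⟩
      rotate_left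
      · rw [_root_.map_sub, hy'', sub_self]
      · rw [_root_.map_sub, (mem_normSub_succ V _).1 hv, (mem_normSub_succ V _).1 hy, sub_self]
      · rw [_root_.map_sub, hy', sub_zero, hvw]

lemma quasiIso_of_ker (f : V ⟶ W) (hf : ∀ n, Function.Surjective (f.app n).hom)
    (hk : ∀ (n : ℕ) (z : V.obj (op ⦋n⦌)), z ∈ cyc V n → (f.app _).hom z = 0 →
      ∃ y ∈ normSub V (n + 1), (f.app _).hom y = 0 ∧ (V.δ 0).hom y = z) :
    QuasiIso ((normalizedMooreComplex (ModuleCat.{u} R)).map f) := by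
  rw [quasiIso_iff]
  intro n
  rw [quasiIsoAt_iff_isIso_homologyMap]
  exact (ConcreteCategory.isIso_iff_bijective _).2 (piModMap_bijective_of_ker f hf hk n)

end Homology

section SArt
variable {Λ : Type u} [CommRing Λ] [IsLocalRing Λ]

omit [IsLocalRing Λ] in
lemma SArt.naturality_apply {A B : SArt Λ} (f : A ⟶ B) {m n : SimplexCategoryᵒᵖ} (θ : m ⟶ n)
    (a : A.obj.obj m) : (f.hom.app n).hom ((A.obj.map θ).hom a) =
      (B.obj.map θ).hom ((f.hom.app m).hom a) :=
  ConcreteCategory.congr_hom (f.hom.naturality θ) a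

/-- Morphisms from natural families of algebra maps. -/
def SArt.homMk {A B : SArt Λ} (f : ∀ n, A.obj.obj n →ₐ[Λ] B.obj.obj n)
    (hf : ∀ {m n} (θ : m ⟶ n) (a : A.obj.obj m),
      f n ((A.obj.map θ).hom a) = (B.obj.map θ).hom (f m a)) : A ⟶ B :=
  ObjectProperty.homMk
    { app := fun n => CommAlgCat.ofHom (f n)
      naturality := fun m n θ => by
        ext a
        exact hf θ a }

/-- Fibre products in the category of Artinian simplicial algebras can be recognised on
elements. -/
lemma SArt.isPullback_of_elements {P A B C : SArt Λ} {a : P ⟶ A} {b : P ⟶ B} {f : A ⟶ C}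
    {g : B ⟶ C} (w : a ≫ f = b ≫ g)
    (h : ∀ n (x : A.obj.obj n) (y : B.obj.obj n), (f.hom.app n).hom x = (g.hom.app n).hom y →
      ∃ z : P.obj.obj n, (a.hom.app n).hom z = x ∧ (b.hom.app n).hom z = y)
    (h' : ∀ n (z z' : P.obj.obj n), (a.hom.app n).hom z = (a.hom.app n).hom z' →
      (b.hom.app n).hom z = (b.hom.app n).hom z' → z = z') : IsPullback a b f g := by
  have key : ∀ (s : PullbackCone f g) (n) (x : s.pt.obj.obj n), ∃ z : P.obj.obj n,
      (a.hom.app n).hom z = (s.fst.hom.app n).hom x ∧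
        (b.hom.app n).hom z = (s.snd.hom.app n).hom x := fun s n x =>
    h n _ _ (congrArg (fun φ : s.pt ⟶ C => (φ.hom.app n).hom x) s.condition)
  choose l hl hl' using key
  -- the map into `P` is determined by its two components, hence it is a homomorphism
  let L : ∀ (s : PullbackCone f g) (n), s.pt.obj.obj n →ₐ[Λ] P.obj.obj n := fun s n =>
    { toFun := l s n
      map_one' := h' n _ _ (by simp [hl]) (by simp [hl'])
      map_zero' := h' n _ _ (by simp [hl]) (by simp [hl'])
      map_mul' := fun x y => h' n _ _ (by simp [hl]) (by simp [hl'])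
      map_add' := fun x y => h' n _ _ (by simp [hl]) (by simp [hl'])
      commutes' := fun c => h' n _ _ (by rw [hl, AlgHom.commutes, AlgHom.commutes])
        (by rw [hl', AlgHom.commutes, AlgHom.commutes]) }
  refine ⟨⟨w⟩, ⟨PullbackCone.IsLimit.mk w (fun s => SArt.homMk (L s) fun {m n} θ x => ?_)
    (fun s => SArt.hom_ext fun n x => hl s n x) (fun s => SArt.hom_ext fun n x => hl' s n x)
    fun s φ h1 h2 => SArt.hom_ext fun n x => ?_⟩⟩
  · refine h' n _ _ ?_ ?_
    · refine (hl s n _).trans ?_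
      rw [SArt.naturality_apply, SArt.naturality_apply]
      exact congrArg (A.obj.map θ).hom (hl s m x).symm
    · refine (hl' s n _).trans ?_
      rw [SArt.naturality_apply, SArt.naturality_apply]
      exact congrArg (B.obj.map θ).hom (hl' s m x).symm
  · refine h' n _ _ ?_ ?_
    · refine Eq.trans ?_ (hl s n x).symm
      exact congrArg (fun ψ : s.pt ⟶ A => (ψ.hom.app n).hom x) h1
    · refine Eq.trans ?_ (hl' s n x).symm
      exact congrArg (fun ψ : s.pt ⟶ B => (ψ.hom.app n).hom x) h2

/-- A surjection of simplicial algebras onto an Artinian one is Artinian if its kernel is a square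
zero ideal which is a simplicial vector space with finite-dimensional normalisation. -/
lemma isArtinianSimplicial_of_extension {C : SimplicialObject (CommAlgCat.{u} Λ)} {A : SArt Λ}
    (π : C ⟶ A.obj) (hπ : ∀ n, Function.Surjective (π.app n).hom)
    {V : SimplicialObject (ModuleCat.{u} (ResidueField Λ))} (hV : IsFD V)
    (incl : ∀ n, V.obj n →+ C.obj n)
    (incl_smul : ∀ n (l : Λ) (v : V.obj n), incl n (residue Λ l • v) = l • incl n v)
    (incl_map : ∀ {m n : SimplexCategoryᵒᵖ} (θ : m ⟶ n) (v : V.obj m),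
      incl n ((V.map θ).hom v) = (C.map θ).hom (incl m v))
    (incl_mul : ∀ n (v w : V.obj n), incl n v * incl n w = 0)
    (range_incl : ∀ n (a : C.obj n), (π.app n).hom a = 0 → a ∈ Set.range (incl n)) :
    IsArtinianSimplicial Λ C := by
  -- an ideal of `C_n` is controlled by its image in `A_n` and its intersection with `V_n`
  let P : ∀ n, Ideal (C.obj n) → Submodule (ResidueField Λ) (V.obj n) := fun n J =>
    { carrier := {v | incl n v ∈ J}
      zero_mem' := by
        change incl n 0 ∈ J
        rw [_root_.map_zero]; exact J.zero_mem
      add_mem' := fun {v w} hv hw => by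
        change incl n (v + w) ∈ J
        rw [_root_.map_add]; exact J.add_mem hv hw
      smul_mem' := fun c v hv => by
        obtain ⟨l, rfl⟩ := residue_surjective c
        change incl n (residue Λ l • v) ∈ J
        rw [incl_smul, Algebra.smul_def]; exact J.mul_mem_left _ hv }
  have key : ∀ n (J J' : Ideal (C.obj n)), J' ≤ J →
      J.map (π.app n).hom.toRingHom ≤ J'.map (π.app n).hom.toRingHom → P n J ≤ P n J' →
      J ≤ J' := by
    intro n J J' h1 h2 h3 x hx
    obtain ⟨y, hy, hxy⟩ := (Ideal.mem_map_iff_of_surjective _ (hπ n)).1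
      (h2 (Ideal.mem_map_of_mem _ hx))
    obtain ⟨v, hv⟩ := range_incl n (x - y) (by
      rw [_root_.map_sub, sub_eq_zero]; exact hxy.symm)
    have h4 : v ∈ P n J := by
      change incl n v ∈ J
      rw [hv]; exact J.sub_mem hx (h1 hy)
    have h5 : incl n v ∈ J' := h3 h4
    rw [hv] at h5
    simpa using J'.add_mem h5 hy
  -- an element `x` with `x y = 1 + v`, where `v` has square zero, is a unit; so `C_n ⟶ A_n` is
  -- local
  have hloc : ∀ n, IsLocalHom (π.app n).hom.toRingHom := fun n => ⟨fun x hx => by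
    obtain ⟨y, hy⟩ := hx.exists_right_inv
    obtain ⟨y, rfl⟩ := hπ n y
    obtain ⟨v, hv⟩ := range_incl n (x * y - 1) (by
      rw [_root_.map_sub, _root_.map_mul, _root_.map_one, sub_eq_zero]; exact hy)
    have h1 := incl_mul n v v
    rw [hv] at h1
    exact IsUnit.of_mul_eq_one (y * (2 - x * y)) (by linear_combination - h1)⟩
  constructor
  · intro n
    have hA := A.property.isLocalArtinian n
    have := hA.isLocalRing
    have := hA.isArtinianRing
    have := hloc n
    have hC : IsLocalRing (C.obj n) := RingHom.domain_isLocalRing (π.app n).hom.toRingHom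
    refine ⟨hC, ?_, fun y => ?_⟩
    · have hVn : Module.Finite (ResidueField Λ) (V.obj n) := by
        obtain ⟨⟨n⟩⟩ := n
        exact finite_of_isFD hV n
      have h1 : WellFoundedLT (Ideal (A.obj.obj n)) := inferInstanceAs (IsArtinian _ _)
      have h2 : WellFoundedLT (Submodule (ResidueField Λ) (V.obj n)) :=
        inferInstanceAs (IsArtinian _ _)
      have h3 : WellFoundedLT (Ideal (C.obj n)) := by
        refine StrictMono.wellFoundedLT (β := Ideal (A.obj.obj n) × Submodule (ResidueField Λ) (V.obj n))
          (f := fun J => (J.map (π.app n).hom.toRingHom, P n J)) fun J J' h => ?_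
        refine lt_of_le_not_ge ⟨Ideal.map_mono h.le, fun v hv => h.le hv⟩ fun h' => ?_
        exact h.not_ge (key n J' J h.le h'.1 h'.2)
      exact h3
    · obtain ⟨x, rfl⟩ := residue_surjective y
      obtain ⟨l, hl⟩ := hA.residue_surjective (residue _ ((π.app n).hom x))
      refine ⟨l, ?_⟩
      change residue (C.obj n) (algebraMap Λ _ l) = residue (C.obj n) x
      have hl' : residue (A.obj.obj n) (algebraMap Λ _ l) = residue _ ((π.app n).hom x) := hl
      rw [← sub_eq_zero, ← _root_.map_sub, residue_eq_zero_iff, mem_maximalIdeal,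
        mem_nonunits_iff] at hl' ⊢
      intro hu
      refine hl' ?_
      rw [← AlgHom.commutes (π.app n).hom, ← _root_.map_sub]
      exact hu.map (π.app n).hom
  · intro J hJ
    have hmono : ∀ i i', i ≤ i' → ∀ n, (J i').ideal n ≤ (J i).ideal n := fun i i' h n =>
      antitone_nat_of_succ_le (f := fun i => (J i).ideal n) (fun i => hJ i n) h
    -- the intersections with `V` and the images in `A` become stationary
    obtain ⟨N, hN⟩ := dcc_of_isFD hV (fun i n => P n ((J i).ideal n)) (fun i m n θ x hx => by
      change incl n _ ∈ (J i).ideal n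
      rw [incl_map]
      exact (J i).map_mem θ _ hx) (fun i n v hv => hJ i n hv)
    obtain ⟨M, hM⟩ := A.property.dcc
      (fun i =>
        { ideal := fun n => ((J i).ideal n).map (π.app n).hom.toRingHom
          map_mem := fun {m n} θ a ha => by
            obtain ⟨x, hx, rfl⟩ := (Ideal.mem_map_iff_of_surjective _ (hπ m)).1 ha
            have h1 : (A.obj.map θ).hom ((π.app m).hom x) = (π.app n).hom ((C.map θ).hom x) :=
              (ConcreteCategory.congr_hom (π.naturality θ) x).symm
            refine (congrArg (· ∈ Ideal.map (π.app n).hom.toRingHom ((J i).ideal n)) h1).mpr ?_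
            exact Ideal.mem_map_of_mem _ ((J i).map_mem θ x hx) })
      (fun i n => Ideal.map_mono (hJ i n))
    refine ⟨max N M, fun i hi n => le_antisymm (hmono _ _ hi n) ?_⟩
    refine key n _ _ (hmono _ _ hi n) ?_ ?_
    · exact ((hM _ (le_max_right N M) n).trans (hM i (le_trans (le_max_right _ _) hi) n).symm).le
    · exact ((hN _ (le_max_left N M) n).trans (hN i (le_trans (le_max_left _ _) hi) n).symm).le

end SArt

/-! ### The algebra `A ×_k (k ⊕ V)` and small extensions -/

section ProductWithSquareZero
variable {Λ : Type u} [CommRing Λ] [IsLocalRing Λ]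

/-- The map from a level of an Artinian simplicial algebra to the residue field. -/
noncomputable def resHom (A : SArt Λ) (n : SimplexCategoryᵒᵖ) :
    A.obj.obj n →ₐ[Λ] ResidueField Λ :=
  (exists_algHom_residue (A.property.isLocalArtinian n)).some

lemma resHom_app {A B : SArt Λ} (f : A ⟶ B) (n : SimplexCategoryᵒᵖ) (a : A.obj.obj n) :
    resHom B n ((f.hom.app n).hom a) = resHom A n a :=
  DFunLike.congr_fun (algHom_residue_unique (A.property.isLocalArtinian n)
    ((resHom B n).comp (f.hom.app n).hom) (resHom A n)) a

lemma resHom_map (A : SArt Λ) {m n : SimplexCategoryᵒᵖ} (θ : m ⟶ n) (a : A.obj.obj m) :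
    resHom A n ((A.obj.map θ).hom a) = resHom A m a :=
  DFunLike.congr_fun (algHom_residue_unique (A.property.isLocalArtinian m)
    ((resHom A n).comp (A.obj.map θ).hom) (resHom A m)) a

lemma resHom_sqZero {V : SFDVect Λ} (n : SimplexCategoryᵒᵖ) (x : SqZero Λ (V.obj.obj n)) :
    resHom ((sqZero Λ).obj V) n x = x.fst :=
  DFunLike.congr_fun (algHom_residue_unique (((sqZero Λ).obj V).property.isLocalArtinian n)
    (resHom ((sqZero Λ).obj V) n) (SqZero.fstHom _)) x

/-- Elements of `A_n` are congruent to elements of `Λ` modulo the maximal ideal. -/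
lemma resHom_eq_of_sub_mem {A : SArt Λ} {n : SimplexCategoryᵒᵖ} {a : A.obj.obj n} (l : Λ)
    (h : resHom A n a = residue Λ l) : a - algebraMap Λ _ l ∈ nonunits (A.obj.obj n) := by
  intro hu
  have h1 := hu.map (resHom A n)
  rw [_root_.map_sub, h, AlgHom.commutes] at h1
  refine h1.ne_zero (sub_eq_zero.2 rfl)

/-- The ring `A_n` acts on the kernel of a small extension through its residue field. -/
lemma SmallExtension.mul_incl_eq {I : SimplicialObject (ModuleCat.{u} (ResidueField Λ))}
    {A B : SArt Λ} {f : A ⟶ B} (e : SmallExtension I f) {n : SimplexCategoryᵒᵖ}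
    (a : A.obj.obj n) (v : I.obj n) : a * e.incl n v = e.incl n (resHom A n a • v) := by
  obtain ⟨l, hl⟩ := residue_surjective (resHom A n a)
  have h1 := e.mul_incl n _ v (resHom_eq_of_sub_mem l hl.symm)
  rw [sub_mul, sub_eq_zero] at h1
  rw [← hl, e.incl_smul, h1, Algebra.smul_def]

lemma SmallExtension.app_incl {I : SimplicialObject (ModuleCat.{u} (ResidueField Λ))}
    {A B : SArt Λ} {f : A ⟶ B} (e : SmallExtension I f) {n : SimplexCategoryᵒᵖ} (v : I.obj n) :
    (f.hom.app n).hom (e.incl n v) = 0 := (e.range_incl n _).1 ⟨v, rfl⟩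

lemma SmallExtension.resHom_incl {I : SimplicialObject (ModuleCat.{u} (ResidueField Λ))}
    {A B : SArt Λ} {f : A ⟶ B} (e : SmallExtension I f) {n : SimplexCategoryᵒᵖ} (v : I.obj n) :
    resHom A n (e.incl n v) = 0 := by
  rw [← resHom_app f, e.app_incl, _root_.map_zero]

lemma SmallExtension.incl_mul_incl {I : SimplicialObject (ModuleCat.{u} (ResidueField Λ))}
    {A B : SArt Λ} {f : A ⟶ B} (e : SmallExtension I f) {n : SimplexCategoryᵒᵖ} (v w : I.obj n) :
    e.incl n v * e.incl n w = 0 := by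
  rw [e.mul_incl_eq, e.resHom_incl, zero_smul, _root_.map_zero]

variable (A : SArt Λ) (V : SFDVect Λ)

/-- The fibre product `A_n ×_k (k ⊕ V_n)`. -/
noncomputable abbrev ExtLevel (n : SimplexCategoryᵒᵖ) :
    Subalgebra Λ (A.obj.obj n × SqZero Λ (V.obj.obj n)) :=
  AlgHom.equalizer ((resHom A n).comp (AlgHom.fst Λ _ _))
    ((SqZero.fstHom (V.obj.obj n)).comp (AlgHom.snd Λ _ _))

variable {A V}

lemma mem_extLevel {n : SimplexCategoryᵒᵖ} {x : A.obj.obj n × SqZero Λ (V.obj.obj n)} :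
    x ∈ ExtLevel A V n ↔ resHom A n x.1 = x.2.fst := Iff.rfl

lemma extLevel_ext {n : SimplexCategoryᵒᵖ} {x y : ExtLevel A V n} (h1 : x.1.1 = y.1.1)
    (h2 : x.1.2.snd = y.1.2.snd) : x = y :=
  Subtype.ext (Prod.ext h1 (SqZero.ext ((mem_extLevel.1 x.2).symm.trans
    ((congrArg (resHom A n) h1).trans (mem_extLevel.1 y.2))) h2))

variable (A V)

/-- The simplicial structure of `A ×_k (k ⊕ V)`. -/
noncomputable def extMap {m n : SimplexCategoryᵒᵖ} (θ : m ⟶ n) :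
    ExtLevel A V m →ₐ[Λ] ExtLevel A V n :=
  ((AlgHom.prodMap (A.obj.map θ).hom (SqZero.map (V.obj.map θ).hom)).comp
      (ExtLevel A V m).val).codRestrict (ExtLevel A V n) fun x =>
        mem_extLevel.2 ((resHom_map A θ _).trans (mem_extLevel.1 x.2))

/-- The simplicial algebra `A ×_k (k ⊕ V)`. -/
noncomputable def extObj : SimplicialObject (CommAlgCat.{u} Λ) where
  obj n := CommAlgCat.of Λ (ExtLevel A V n)
  map {m n} θ := CommAlgCat.ofHom (extMap A V θ)
  map_id n := by
    refine CommAlgCat.hom_ext (AlgHom.ext fun (x : ExtLevel A V n) => ?_)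
    have h1 := ConcreteCategory.congr_hom (A.obj.map_id n) x.1.1
    have h2 := ConcreteCategory.congr_hom (V.obj.map_id n) x.1.2.snd
    exact extLevel_ext (x := extMap A V (𝟙 n) x) (y := x) h1 h2
  map_comp {m n p} a b := by
    refine CommAlgCat.hom_ext (AlgHom.ext fun (x : ExtLevel A V m) => ?_)
    have h1 := ConcreteCategory.congr_hom (A.obj.map_comp a b) x.1.1
    have h2 := ConcreteCategory.congr_hom (V.obj.map_comp a b) x.1.2.snd
    exact extLevel_ext (x := extMap A V (a ≫ b) x) (y := extMap A V b (extMap A V a x)) h1 h2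

/-- The element `(a, ρ(a) + v)` of `A ×_k (k ⊕ V)`. -/
noncomputable def extMk {n : SimplexCategoryᵒᵖ} (a : A.obj.obj n) (v : V.obj.obj n) :
    ExtLevel A V n := ⟨(a, SqZero.mk (resHom A n a) v), rfl⟩

/-- The inclusion of `V` in `A ×_k (k ⊕ V)`. -/
noncomputable def extIncl (n : SimplexCategoryᵒᵖ) : V.obj.obj n →+ ExtLevel A V n where
  toFun v := extMk A V 0 v
  map_zero' := extLevel_ext rfl rfl
  map_add' _ _ := extLevel_ext (add_zero _).symm rfl

variable {A V} in
lemma extIncl_smul {n : SimplexCategoryᵒᵖ} (l : Λ) (v : V.obj.obj n) :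
    extIncl A V n (residue Λ l • v) = l • extIncl A V n v := by
  refine extLevel_ext (smul_zero _).symm ?_
  refine Eq.trans ?_ (congrArg SqZero.snd (Algebra.smul_def l
    (SqZero.mk (resHom A n 0) v : SqZero Λ (V.obj.obj n)))).symm
  change residue Λ l • v = residue Λ l • v + resHom A n 0 • (0 : V.obj.obj n)
  rw [smul_zero, add_zero]

variable {A V} in
lemma extIncl_map {m n : SimplexCategoryᵒᵖ} (θ : m ⟶ n) (v : V.obj.obj m) :
    extIncl A V n ((V.obj.map θ).hom v) = extMap A V θ (extIncl A V m v) :=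
  extLevel_ext (_root_.map_zero (A.obj.map θ).hom).symm rfl

variable {A V} in
lemma extIncl_mul {n : SimplexCategoryᵒᵖ} (v w : V.obj.obj n) :
    extIncl A V n v * extIncl A V n w = 0 := by
  refine extLevel_ext (zero_mul _) ?_
  change resHom A n 0 • w + resHom A n 0 • v = 0
  rw [_root_.map_zero, zero_smul, zero_smul, add_zero]

lemma isArtinianSimplicial_extObj : IsArtinianSimplicial Λ (extObj A V) := by
  refine isArtinianSimplicial_of_extension (A := A)
    { app := fun n => CommAlgCat.ofHom ((AlgHom.fst Λ _ _).comp (ExtLevel A V n).val)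
      naturality := fun m n θ => rfl } (fun n a => ⟨extMk A V a 0, rfl⟩) V.property
    (extIncl A V) (fun n l v => extIncl_smul l v) (fun {m n} θ v => extIncl_map θ v)
    (fun n v w => extIncl_mul v w) fun n x hx => ?_
  exact ⟨SqZero.snd (x : ExtLevel A V n).1.2, extLevel_ext (Eq.symm hx) rfl⟩

/-- The Artinian simplicial algebra `A ×_k (k ⊕ V)`. -/
noncomputable def ext : SArt Λ := ⟨extObj A V, isArtinianSimplicial_extObj A V⟩

/-- The projection to `A`. -/
noncomputable def extFst : ext A V ⟶ A :=
  SArt.homMk (fun n => (AlgHom.fst Λ _ _).comp (ExtLevel A V n).val) fun _ _ => rfl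

/-- The projection to `k ⊕ V`. -/
noncomputable def extSnd : ext A V ⟶ (sqZero Λ).obj V :=
  SArt.homMk (fun n => (AlgHom.snd Λ _ _).comp (ExtLevel A V n).val) fun _ _ => rfl

lemma isPullback_ext {K : SArt Λ} (hK : IsTerminal K) :
    IsPullback (extFst A V) (extSnd A V) (hK.from A) (hK.from _) := by
  refine SArt.isPullback_of_elements (hK.hom_ext _ _) (fun n x y h => ?_) fun n z z' h h' => ?_
  · have h1 : resHom A n x = SqZero.fst y := by
      rw [← resHom_app (hK.from A), h, resHom_app]
      exact resHom_sqZero n y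
    exact ⟨(⟨(x, y), h1⟩ : ExtLevel A V n), rfl, rfl⟩
  · exact Subtype.ext (Prod.ext h h')

/-- Square zero algebras preserve kernels. -/
lemma isPullback_sqZero {V' V W : SFDVect Λ} (a : V' ⟶ V) (b : V ⟶ W)
    (ha : ∀ n, Function.Injective (a.hom.app n).hom)
    (hab : ∀ n, Function.Exact (a.hom.app n).hom (b.hom.app n).hom) :
    IsPullback ((sqZero Λ).map a) ((sqZero Λ).map (SFDVect.zeroHom V' (SFDVect.zero Λ)))
      ((sqZero Λ).map b) ((sqZero Λ).map (SFDVect.zeroHom (SFDVect.zero Λ) W)) := by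
  refine SArt.isPullback_of_elements ?_ (fun n x y h => ?_) fun n z z' h h' => ?_
  · rw [← Functor.map_comp, ← Functor.map_comp]
    congr 1
    exact SFDVect.hom_ext fun n x => (hab n).apply_apply_eq_zero x
  · have h1 : SqZero.fst (M := V.obj.obj n) x = SqZero.fst (M := PUnit) y :=
      congrArg (SqZero.fst (M := W.obj.obj n)) h
    have h2 : (b.hom.app n).hom (SqZero.snd (M := V.obj.obj n) x) = 0 :=
      congrArg (SqZero.snd (M := W.obj.obj n)) h
    obtain ⟨v, hv⟩ := (hab n _).1 h2
    exact ⟨SqZero.mk (SqZero.fst (M := V.obj.obj n) x) v, SqZero.ext rfl hv, SqZero.ext h1 rfl⟩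
  · have h1 : SqZero.fst (M := V'.obj.obj n) z = SqZero.fst (M := V'.obj.obj n) z' :=
      congrArg (SqZero.fst (M := V.obj.obj n)) h
    have h2 := congrArg (SqZero.snd (M := V.obj.obj n)) h
    exact SqZero.ext h1 (ha n h2)

variable {A V}
variable {I : SimplicialObject (ModuleCat.{u} (ResidueField Λ))} {B : SArt Λ} {f : A ⟶ B}
  (e : SmallExtension I f)

/-- The action `(a, v) ↦ a + v` of the kernel of a small extension, in one level. -/
noncomputable def SmallExtension.actHom (n : SimplexCategoryᵒᵖ) :
    ExtLevel A e.ker n →ₐ[Λ] A.obj.obj n where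
  toFun x := x.1.1 + e.incl n x.1.2.snd
  map_one' := (congrArg (1 + ·) (_root_.map_zero (e.incl n))).trans (add_zero _)
  map_zero' := (congrArg (0 + ·) (_root_.map_zero (e.incl n))).trans (add_zero _)
  map_add' x y :=
    (congrArg (x.1.1 + y.1.1 + ·) (_root_.map_add (e.incl n) _ _)).trans (add_add_add_comm _ _ _ _)
  map_mul' x y := by
    have h1 : e.incl n (x * y).1.2.snd = x.1.1 * e.incl n y.1.2.snd +
        y.1.1 * e.incl n x.1.2.snd := by
      have h3 := e.mul_incl_eq (n := n) x.1.1 y.1.2.snd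
      have h4 := e.mul_incl_eq (n := n) y.1.1 x.1.2.snd
      rw [h3, h4, ← _root_.map_add, mem_extLevel.1 x.2, mem_extLevel.1 y.2]
      rfl
    have h2 := e.incl_mul_incl (n := n) x.1.2.snd y.1.2.snd
    rw [h1]
    change x.1.1 * y.1.1 + _ = _
    linear_combination - h2
  commutes' l := (congrArg (algebraMap Λ (A.obj.obj n) l + ·)
    (_root_.map_zero (e.incl n))).trans (add_zero _)

/-- The action `(a, v) ↦ a + v` of the kernel of a small extension. -/
noncomputable def SmallExtension.act : ext A e.ker ⟶ A :=
  SArt.homMk (fun n => e.actHom n) fun {m n} θ (x : ExtLevel A e.ker m) => by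
    refine Eq.trans ?_ (_root_.map_add (A.obj.map θ).hom _ _).symm
    exact congrArg ((A.obj.map θ).hom x.1.1 + ·) (e.incl_map θ _)

/-- The fibre product of `A` with itself over `B` is `A ×_k (k ⊕ I)`. -/
lemma SmallExtension.isPullback_act : IsPullback e.act (extFst A e.ker) f f := by
  refine SArt.isPullback_of_elements (SArt.hom_ext fun n x => ?_) (fun n x y h => ?_)
    fun n z z' h h' => ?_
  · refine (_root_.map_add (f.hom.app n).hom _ _).trans ?_
    exact (congrArg (_ + ·) (e.app_incl _)).trans (add_zero _)
  · obtain ⟨v, hv⟩ := (e.range_incl n (x - y)).2 (by rw [_root_.map_sub, h, sub_self])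
    refine ⟨extMk A e.ker y v, ?_, rfl⟩
    exact (congrArg (y + ·) hv).trans (add_sub_cancel _ _)
  · have h1 : (z : ExtLevel A e.ker n).1.1 = (z' : ExtLevel A e.ker n).1.1 := h'
    have h2 : (z : ExtLevel A e.ker n).1.1 + e.incl n (z : ExtLevel A e.ker n).1.2.snd =
      (z' : ExtLevel A e.ker n).1.1 + e.incl n (z' : ExtLevel A e.ker n).1.2.snd := h
    rw [h1, add_right_inj] at h2
    exact extLevel_ext h1 (e.injective n h2)

end ProductWithSquareZero

/-! ### Attaching the cone on the kernel of a small extension -/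

section Acyclic
variable {Λ : Type u} [CommRing Λ] [IsLocalRing Λ]

/-- A surjection is acyclic if its kernel has vanishing homotopy groups. -/
lemma isAcyclic_of_extension {C A : SArt Λ} (π : C ⟶ A) (hπ : IsSurjective π)
    {V : SimplicialObject (ModuleCat.{u} (ResidueField Λ))}
    (hV : ∀ (n : ℕ) (z : V.obj (op ⦋n⦌)), z ∈ cyc V n → ∃ y ∈ normSub V (n + 1), (V.δ 0).hom y = z)
    (incl : ∀ n, V.obj n →+ C.obj.obj n)
    (incl_map : ∀ {m n : SimplexCategoryᵒᵖ} (θ : m ⟶ n) (v : V.obj m),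
      incl n ((V.map θ).hom v) = (C.obj.map θ).hom (incl m v))
    (incl_injective : ∀ n, Function.Injective (incl n))
    (range_incl : ∀ n (a : C.obj.obj n), (π.hom.app n).hom a = 0 ↔ a ∈ Set.range (incl n)) :
    IsAcyclic π := by
  refine quasiIso_of_ker (underlyingModule.map π) hπ fun n z hz hz' => ?_
  obtain ⟨v, rfl⟩ := (range_incl _ z).1 hz'
  have key : ∀ (n : ℕ) (i : Fin (n + 2)) (w : V.obj (op ⦋n + 1⦌)),
      ((underlyingModule.obj C).δ i).hom (incl _ w) = 0 ↔ (V.δ i).hom w = 0 := fun n i w => by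
    rw [← map_eq_zero_iff _ (incl_injective (op ⦋n⦌))]
    exact Eq.congr_left (incl_map (SimplexCategory.δ i).op w).symm
  obtain ⟨y, hy, hy'⟩ := hV n v (by
    cases n with
    | zero => trivial
    | succ n => exact (mem_cyc_succ V v).2 fun i => (key n i v).1 ((mem_cyc_succ _ _).1 hz i))
  refine ⟨incl _ y, (mem_normSub_succ _ _).2 fun i => ?_, (range_incl _ _).2 ⟨y, rfl⟩, ?_⟩
  · exact (key n i.succ y).2 ((mem_normSub_succ V y).1 hy i)
  · exact (incl_map (SimplexCategory.δ 0).op y).symm.trans (congrArg (incl (op ⦋n⦌)) hy')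

lemma isSurjective_sqZero_map {V W : SFDVect Λ} (b : V ⟶ W)
    (hb : ∀ n, Function.Surjective (b.hom.app n).hom) : IsSurjective ((sqZero Λ).map b) := by
  intro n x
  obtain ⟨v, hv⟩ := hb n (SqZero.snd (M := W.obj.obj n) x)
  exact ⟨SqZero.mk (SqZero.fst (M := W.obj.obj n) x) v, SqZero.ext rfl hv⟩

/-- A surjection of simplicial vector spaces with acyclic kernel gives an acyclic surjection of
square zero algebras. -/
lemma isAcyclic_sqZero_map {V' V W : SFDVect Λ} (a : V' ⟶ V) (b : V ⟶ W)
    (ha : ∀ n, Function.Injective (a.hom.app n).hom)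
    (hb : ∀ n, Function.Surjective (b.hom.app n).hom)
    (hab : ∀ n, Function.Exact (a.hom.app n).hom (b.hom.app n).hom)
    (hV : ∀ (n : ℕ) (z : V'.obj.obj (op ⦋n⦌)), z ∈ cyc V'.obj n →
      ∃ y ∈ normSub V'.obj (n + 1), (V'.obj.δ 0).hom y = z) : IsAcyclic ((sqZero Λ).map b) := by
  refine isAcyclic_of_extension _ (isSurjective_sqZero_map b hb) hV
    (fun n => { toFun := fun v => (SqZero.mk 0 ((a.hom.app n).hom v) : SqZero Λ (V.obj.obj n))
                map_zero' := SqZero.ext rfl (_root_.map_zero (a.hom.app n).hom)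
                map_add' := fun v w => SqZero.ext (add_zero (0 : ResidueField Λ)).symm
                  (_root_.map_add (a.hom.app n).hom v w) })
    (fun θ v => SqZero.ext rfl (naturality_apply a.hom θ v))
    (fun n v w h => ha n (congrArg (SqZero.snd (M := V.obj.obj n)) h)) fun n x => ⟨fun h => ?_, ?_⟩
  · obtain ⟨v, hv⟩ := (hab n _).1 (congrArg (SqZero.snd (M := W.obj.obj n)) h)
    exact ⟨v, SqZero.ext (congrArg (SqZero.fst (M := W.obj.obj n)) h).symm hv⟩
  · rintro ⟨v, rfl⟩
    exact SqZero.ext rfl ((hab n).apply_apply_eq_zero v)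

end Acyclic

section ConeExtension
variable {Λ : Type u} [CommRing Λ] [IsLocalRing Λ]
  {I : SimplicialObject (ModuleCat.{u} (ResidueField Λ))} {A B : SArt Λ} {f : A ⟶ B}
  (e : SmallExtension I f)

namespace SmallExtension

/-- The inclusion of the kernel of a small extension in its cone. -/
noncomputable def toCone (n : SimplexCategoryᵒᵖ) :
    I.obj n →ₗ[ResidueField Λ] (coneObj e.ker).obj.obj n := ((coneIncl e.ker).hom.app n).hom

lemma toCone_injective (n : SimplexCategoryᵒᵖ) : Function.Injective (e.toCone n) :=
  coneIncl_injective e.ker n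

lemma toCone_map {m n : SimplexCategoryᵒᵖ} (θ : m ⟶ n) (i : I.obj m) :
    e.toCone n ((I.map θ).hom i) = ((coneObj e.ker).obj.map θ).hom (e.toCone m i) :=
  naturality_apply (coneIncl e.ker).hom θ i

lemma coneProj_toCone {n : SimplexCategoryᵒᵖ} (i : I.obj n) :
    ((coneProj e.ker).hom.app n).hom (e.toCone n i) = 0 :=
  (cone_exact e.ker n).apply_apply_eq_zero i

lemma exists_toCone {n : SimplexCategoryᵒᵖ} {v : (coneObj e.ker).obj.obj n}
    (h : ((coneProj e.ker).hom.app n).hom v = 0) : ∃ i, e.toCone n i = v :=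
  (cone_exact e.ker n v).1 h

/-- The antidiagonal copy of the kernel `I` in `A ×_k (k ⊕ CI)`, where `CI` is the cone on `I`. -/
noncomputable def coneIdeal (n : SimplexCategoryᵒᵖ) : Ideal (ExtLevel A (coneObj e.ker) n) where
  carrier := {x | ∃ i : I.obj n, x.1.1 = e.incl n i ∧
    x.1.2.snd = - e.toCone n i}
  zero_mem' := ⟨0, (_root_.map_zero _).symm, by rw [_root_.map_zero, neg_zero]; rfl⟩
  add_mem' := by
    rintro x y ⟨i, h1, h2⟩ ⟨j, h3, h4⟩
    refine ⟨i + j, ?_, ?_⟩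
    · rw [_root_.map_add, ← h1, ← h3]; rfl
    · rw [_root_.map_add, neg_add, ← h2, ← h4]; rfl
  smul_mem' := by
    rintro x y ⟨i, h1, h2⟩
    refine ⟨resHom A n x.1.1 • i, ?_, ?_⟩
    · rw [← e.mul_incl_eq, ← h1]; rfl
    · have h3 : y.1.2.fst = 0 := by
        rw [← mem_extLevel.1 y.2, h1, e.resHom_incl]
      rw [_root_.map_smul, ← smul_neg, ← h2, mem_extLevel.1 x.2]
      change x.1.2.fst • y.1.2.snd + y.1.2.fst • x.1.2.snd = _
      rw [h3, zero_smul, add_zero]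

lemma mem_coneIdeal {n : SimplexCategoryᵒᵖ} {x : ExtLevel A (coneObj e.ker) n} :
    x ∈ e.coneIdeal n ↔ ∃ i : I.obj n, x.1.1 = e.incl n i ∧
      x.1.2.snd = - e.toCone n i := Iff.rfl

/-- The simplicial structure of the quotient by the ideals `coneIdeal`. -/
noncomputable def coneMap {m n : SimplexCategoryᵒᵖ} (θ : m ⟶ n) :
    (ExtLevel A (coneObj e.ker) m ⧸ e.coneIdeal m) →ₐ[Λ]
      (ExtLevel A (coneObj e.ker) n ⧸ e.coneIdeal n) :=
  Ideal.quotientMapₐ _ (extMap A (coneObj e.ker) θ) (by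
    rintro x ⟨i, h1, h2⟩
    refine ⟨(I.map θ).hom i, ?_, ?_⟩
    · exact (congrArg (A.obj.map θ).hom h1).trans (e.incl_map θ i).symm
    · refine (congrArg ((coneObj e.ker).obj.map θ).hom h2).trans ?_
      refine (_root_.map_neg _ _).trans (congrArg _ ?_)
      exact (e.toCone_map θ i).symm)

/-- The quotient of `A ×_k (k ⊕ CI)` by the antidiagonal copy of `I`. -/
noncomputable def coneExtObj : SimplicialObject (CommAlgCat.{u} Λ) where
  obj n := CommAlgCat.of Λ (ExtLevel A (coneObj e.ker) n ⧸ e.coneIdeal n)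
  map θ := CommAlgCat.ofHom (e.coneMap θ)
  map_id n := by
    refine CommAlgCat.hom_ext (AlgHom.ext fun x => ?_)
    obtain ⟨x, rfl⟩ := Ideal.Quotient.mk_surjective x
    exact congrArg (Ideal.Quotient.mk (e.coneIdeal n))
      (ConcreteCategory.congr_hom ((extObj A (coneObj e.ker)).map_id n) x)
  map_comp {m n p} a b := by
    refine CommAlgCat.hom_ext (AlgHom.ext fun x => ?_)
    obtain ⟨x, rfl⟩ := Ideal.Quotient.mk_surjective x
    exact congrArg (Ideal.Quotient.mk (e.coneIdeal p))
      (ConcreteCategory.congr_hom ((extObj A (coneObj e.ker)).map_comp a b) x)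

/-- The map from the quotient of `A ×_k (k ⊕ CI)` to `B`, in one level. -/
noncomputable def conePrHom (n : SimplexCategoryᵒᵖ) :
    (ExtLevel A (coneObj e.ker) n ⧸ e.coneIdeal n) →ₐ[Λ] B.obj.obj n :=
  Ideal.Quotient.liftₐ _ ((f.hom.app n).hom.comp ((AlgHom.fst Λ _ _).comp (Subalgebra.val _)))
    fun x hx => by
      obtain ⟨i, h1, -⟩ := e.mem_coneIdeal.1 hx
      exact (congrArg (f.hom.app n).hom h1).trans (e.app_incl i)

/-- The inclusion of the cone on `I`. -/
noncomputable def inclCone (n : SimplexCategoryᵒᵖ) :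
    (coneObj e.ker).obj.obj n →+ (ExtLevel A (coneObj e.ker) n ⧸ e.coneIdeal n) :=
  (Ideal.Quotient.mk (e.coneIdeal n)).toAddMonoidHom.comp (extIncl A (coneObj e.ker) n)

lemma inclCone_injective (n : SimplexCategoryᵒᵖ) : Function.Injective (e.inclCone n) := by
  rw [injective_iff_map_eq_zero]
  intro v hv
  obtain ⟨i, h1, h2⟩ := e.mem_coneIdeal.1
    ((Ideal.Quotient.eq_zero_iff_mem (I := e.coneIdeal n)).1 hv)
  have h3 : i = 0 := e.injective n (h1.symm.trans (_root_.map_zero (e.incl n)).symm)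
  rw [h3, _root_.map_zero, neg_zero] at h2
  exact h2

lemma conePrHom_eq_zero_iff (n : SimplexCategoryᵒᵖ)
    (a : ExtLevel A (coneObj e.ker) n ⧸ e.coneIdeal n) :
    e.conePrHom n a = 0 ↔ a ∈ Set.range (e.inclCone n) := by
  constructor
  · intro h
    obtain ⟨x, rfl⟩ := Ideal.Quotient.mk_surjective a
    obtain ⟨i, hi⟩ := (e.range_incl n x.1.1).2 h
    refine ⟨x.1.2.snd + e.toCone n i, ?_⟩
    refine (Ideal.Quotient.mk_eq_mk_iff_sub_mem _ _).2 ⟨-i, ?_, ?_⟩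
    · rw [_root_.map_neg, hi]
      exact zero_sub _
    · rw [_root_.map_neg, neg_neg]
      exact add_sub_cancel_left _ _
  · rintro ⟨v, rfl⟩
    exact _root_.map_zero (f.hom.app n).hom

lemma inclCone_smul (n : SimplexCategoryᵒᵖ) (l : Λ) (v : (coneObj e.ker).obj.obj n) :
    e.inclCone n (residue Λ l • v) = l • e.inclCone n v := by
  exact (congrArg (Ideal.Quotient.mk (e.coneIdeal n)) (extIncl_smul l v)).trans
    (_root_.map_smul (Ideal.Quotient.mkₐ Λ (e.coneIdeal n)) l (extIncl A (coneObj e.ker) n v))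

lemma inclCone_map {m n : SimplexCategoryᵒᵖ} (θ : m ⟶ n) (v : (coneObj e.ker).obj.obj m) :
    e.inclCone n (((coneObj e.ker).obj.map θ).hom v) = e.coneMap θ (e.inclCone m v) :=
  congrArg (Ideal.Quotient.mk (e.coneIdeal n)) (extIncl_map θ v)

lemma inclCone_mul {n : SimplexCategoryᵒᵖ} (v w : (coneObj e.ker).obj.obj n) :
    e.inclCone n v * e.inclCone n w = 0 :=
  (congrArg (Ideal.Quotient.mk (e.coneIdeal n)) (extIncl_mul v w)).trans (_root_.map_zero _)

lemma isArtinianSimplicial_coneExtObj : IsArtinianSimplicial Λ e.coneExtObj := by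
  refine isArtinianSimplicial_of_extension (A := B)
    { app := fun n => CommAlgCat.ofHom (e.conePrHom n)
      naturality := fun m n θ => ?_ } (fun n b => ?_) (coneObj e.ker).property
    e.inclCone e.inclCone_smul e.inclCone_map (fun n v w => e.inclCone_mul v w)
    fun n x hx => (e.conePrHom_eq_zero_iff n x).1 hx
  · refine CommAlgCat.hom_ext (AlgHom.ext fun x => ?_)
    obtain ⟨x, rfl⟩ := Ideal.Quotient.mk_surjective x
    exact SArt.naturality_apply f θ x.1.1
  · obtain ⟨a, rfl⟩ := e.surjective n b
    exact ⟨Ideal.Quotient.mk _ (extMk A _ a 0), rfl⟩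

/-- The Artinian simplicial algebra obtained from `A` by attaching the cone on the kernel `I` of
`A ⟶ B`, that is, `A ×_k (k ⊕ CI)` modulo the antidiagonal copy of `I`. It is equivalent to `B`. -/
noncomputable def coneExt : SArt Λ := ⟨e.coneExtObj, e.isArtinianSimplicial_coneExtObj⟩

/-- The quotient map `A ×_k (k ⊕ CI) ⟶ coneExt`. -/
noncomputable def coneQuot : ext A (coneObj e.ker) ⟶ e.coneExt :=
  SArt.homMk (fun n => Ideal.Quotient.mkₐ Λ (e.coneIdeal n)) fun _ _ => rfl

lemma coneQuot_surjective : IsSurjective e.coneQuot := fun n =>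
  Ideal.Quotient.mk_surjective (I := e.coneIdeal n)

/-- The acyclic surjection `coneExt ⟶ B`. -/
noncomputable def conePr : e.coneExt ⟶ B :=
  SArt.homMk e.conePrHom fun {m n} θ x => by
    obtain ⟨x, rfl⟩ := Ideal.Quotient.mk_surjective x
    exact SArt.naturality_apply f θ x.1.1

lemma isSurjective_conePr : IsSurjective e.conePr := fun n b => by
  obtain ⟨a, rfl⟩ := e.surjective n b
  exact ⟨Ideal.Quotient.mk _ (extMk A _ a 0), rfl⟩

lemma isAcyclic_conePr : IsAcyclic e.conePr :=
  isAcyclic_of_extension _ e.isSurjective_conePr (fun _ _ hz => exists_boundary_cone I hz)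
    e.inclCone e.inclCone_map e.inclCone_injective e.conePrHom_eq_zero_iff

/-- The collapse of `A` in `coneExt`. -/
noncomputable def coneCollapse : e.coneExt ⟶ (sqZero Λ).obj (shift e.ker 1) :=
  SArt.homMk (fun n => Ideal.Quotient.liftₐ _
    ((SqZero.map ((coneProj e.ker).hom.app n).hom).comp
      ((AlgHom.snd Λ _ _).comp (Subalgebra.val _)))
    fun x hx => by
      obtain ⟨i, h1, h2⟩ := e.mem_coneIdeal.1 hx
      refine SqZero.ext ?_ ?_
      · refine (mem_extLevel.1 x.2).symm.trans ?_
        rw [h1, e.resHom_incl]; rfl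
      · refine (congrArg ((coneProj e.ker).hom.app n).hom h2).trans ?_
        rw [_root_.map_neg, e.coneProj_toCone, neg_zero]; rfl)
    fun {m n} θ x => by
      obtain ⟨x, rfl⟩ := Ideal.Quotient.mk_surjective x
      exact SArt.naturality_apply ((sqZero Λ).map (coneProj e.ker)) θ x.1.2

/-- The inclusion of `A` in `A ×_k (k ⊕ V)`. -/
noncomputable def _root_.DerivedDef.extInl (A : SArt Λ) (V : SFDVect Λ) : A ⟶ ext A V :=
  SArt.homMk (fun n =>
    { toFun := fun a => (extMk A V a 0 : ExtLevel A V n)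
      map_one' := extLevel_ext rfl rfl
      map_zero' := extLevel_ext rfl rfl
      map_add' := fun a b => extLevel_ext rfl (add_zero _).symm
      map_mul' := fun a b => extLevel_ext rfl (by
        refine Eq.symm ?_
        change resHom A n a • (0 : V.obj.obj n) + resHom A n b • (0 : V.obj.obj n) = 0
        rw [smul_zero, smul_zero, add_zero])
      commutes' := fun l => extLevel_ext rfl rfl }) fun {m n} θ a =>
    extLevel_ext rfl (_root_.map_zero (V.obj.map θ).hom).symm

/-- The fibre product of `coneExt` and `k ⊕ CI` over `k ⊕ (I ⊗ K^1)` is `A ×_k (k ⊕ CI)`. -/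
lemma isPullback_coneQuot : IsPullback e.coneQuot (extSnd A (coneObj e.ker)) e.coneCollapse
    ((sqZero Λ).map (coneProj e.ker)) := by
  refine SArt.isPullback_of_elements rfl (fun n x y h => ?_) fun n z z' h h' => ?_
  · obtain ⟨x, rfl⟩ := e.coneQuot_surjective n x
    have h0 : SqZero.map ((coneProj e.ker).hom.app n).hom (ExtLevel A (coneObj e.ker) n |>.val x).2 =
      SqZero.map ((coneProj e.ker).hom.app n).hom y := h
    have h1 : resHom A n (ExtLevel A (coneObj e.ker) n |>.val x).1 =
      SqZero.fst (M := (coneObj e.ker).obj.obj n) y :=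
      Eq.trans (mem_extLevel.1 (Subtype.property (p := (· ∈ ExtLevel A (coneObj e.ker) n)) x))
        (congrArg (SqZero.fst (M := (shift e.ker 1).obj.obj n)) h0)
    have h2 : ((coneProj e.ker).hom.app n).hom (ExtLevel A (coneObj e.ker) n |>.val x).2.snd =
      ((coneProj e.ker).hom.app n).hom (SqZero.snd (M := (coneObj e.ker).obj.obj n) y) :=
      congrArg (SqZero.snd (M := (shift e.ker 1).obj.obj n)) h0
    -- two lifts of the same element of `I ⊗ K^1` to the cone differ by an element `i` of `I`, and
    -- the representative of `x` can be changed by the antidiagonal image of `i`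
    obtain ⟨i, hi⟩ := e.exists_toCone (n := n)
      (v := SqZero.snd (M := (coneObj e.ker).obj.obj n) y -
        (ExtLevel A (coneObj e.ker) n |>.val x).2.snd)
      (by rw [_root_.map_sub, h2, sub_self])
    have h3 : resHom A n ((ExtLevel A (coneObj e.ker) n |>.val x).1 - e.incl n i) =
      SqZero.fst (M := (coneObj e.ker).obj.obj n) y := by
      rw [_root_.map_sub, e.resHom_incl, sub_zero, h1]
    refine ⟨(⟨(_, y), h3⟩ : ExtLevel A (coneObj e.ker) n), ?_, rfl⟩
    refine Eq.symm ((Ideal.Quotient.mk_eq_mk_iff_sub_mem (I := e.coneIdeal n) _ _).2 ⟨i, ?_, ?_⟩)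
    · exact sub_sub_cancel _ _
    · rw [hi, neg_sub]; rfl
  · obtain ⟨i, h1, h2⟩ := (Ideal.Quotient.mk_eq_mk_iff_sub_mem (I := e.coneIdeal n) z z').1 h
    have h3 : e.toCone n i = 0 := by
      have h4 : (ExtLevel A (coneObj e.ker) n |>.val z).2 = (ExtLevel A (coneObj e.ker) n |>.val z').2 :=
        h'
      rw [← neg_eq_zero, ← h2]
      exact sub_eq_zero.2 (congrArg SqZero.snd h4)
    rw [(map_eq_zero_iff _ (e.toCone_injective n)).1 h3, _root_.map_zero] at h1
    exact Subtype.ext (Prod.ext (sub_eq_zero.1 h1) h')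

end SmallExtension
end ConeExtension

/-! ### The relative tangent functor -/

section TangentFunctor
variable {Λ : Type u} [CommRing Λ] [IsLocalRing Λ]

lemma Tan.map_zero {H : SArt Λ ⥤ Type u} [PreservesFiniteLimits H] {V W : SFDVect Λ} (a : V ⟶ W) :
    Tan.map H a 0 = 0 := by
  have h := Tan.map_add a (0 : Tan H V) 0
  rw [add_zero] at h
  exact left_eq_add.1 h

variable (F : SArt Λ ⥤ SSet.{u}) [PreservesFiniteLimits F]

/-- The zero simplices of `F(k ⊕ V)`. -/
noncomputable def tanZero (V : SFDVect Λ) (m : SimplexCategoryᵒᵖ) :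
    (F.obj ((sqZero Λ).obj V)).obj m := (0 : Tan (level F m) V)

lemma map_tanZero (V : SFDVect Λ) {m n : SimplexCategoryᵒᵖ} (θ : m ⟶ n) :
    (F.obj ((sqZero Λ).obj V)).map θ (tanZero F V m) = tanZero F V n :=
  _root_.map_zero (Tan.natTrans (levelMap F θ) V)

lemma app_tanZero {V W : SFDVect Λ} (b : V ⟶ W) (m : SimplexCategoryᵒᵖ) :
    (F.map ((sqZero Λ).map b)).app m (tanZero F V m) = tanZero F W m :=
  Tan.map_zero (H := level F m) b

lemma pt_tanZero (V : SFDVect Λ) (m : SimplexCategoryᵒᵖ) :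
    pt (tanZero F V (op ⦋0⦌)) m = tanZero F V m := map_tanZero F V _

lemma eq_tanZero (m : SimplexCategoryᵒᵖ) (x : (F.obj ((sqZero Λ).obj (SFDVect.zero Λ))).obj m) :
    x = tanZero F _ m := by
  obtain ⟨o, ho⟩ := Tan.zero_unique (level F m)
  exact (ho x).trans (ho _).symm

/-- Morphisms that factor through `k` send everything to zero. -/
lemma app_eq_tanZero {A : SArt Λ} {V : SFDVect Λ} (h : A ⟶ (sqZero Λ).obj (SFDVect.zero Λ))
    (m : SimplexCategoryᵒᵖ) (x : (F.obj A).obj m) :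
    (F.map (h ≫ (sqZero Λ).map (SFDVect.zeroHom _ V))).app m x = tanZero F V m := by
  rw [F.map_comp]
  refine (congrArg ((F.map ((sqZero Λ).map (SFDVect.zeroHom _ V))).app m)
    (eq_tanZero F m ((F.map h).app m x))).trans ?_
  exact app_tanZero F _ m

variable {F} {G : SArt Λ ⥤ SSet.{u}} [PreservesFiniteLimits G] (α : F ⟶ G)

/-- The inclusion of `tan(F/G)(V)` in `F(k ⊕ V)`. -/
def tanIncl (V : SFDVect Λ) : toSSet (tangentRel α V) ⟶ F.obj ((sqZero Λ).obj V) where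
  app m := ↾(fun x : LinearMap.ker (Tan.natTrans (levelHom α m) V) => x.1)
  naturality _ _ _ := rfl

lemma tanIncl_injective (V : SFDVect Λ) (m : SimplexCategoryᵒᵖ) :
    Function.Injective ((tanIncl α V).app m) := fun _ _ h => Subtype.ext h

lemma app_tanIncl (V : SFDVect Λ) {m : SimplexCategoryᵒᵖ}
    (x : (toSSet (tangentRel α V)).obj m) :
    (α.app _).app m ((tanIncl α V).app m x) = tanZero G V m := LinearMap.mem_ker.1 x.2

lemma exists_tanIncl (V : SFDVect Λ) {m : SimplexCategoryᵒᵖ}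
    {x : (F.obj ((sqZero Λ).obj V)).obj m} (h : (α.app _).app m x = tanZero G V m) :
    ∃ t, (tanIncl α V).app m t = x := ⟨⟨x, h⟩, rfl⟩

/-- A map into `F(k ⊕ V)` which vanishes in `G(k ⊕ V)` factors through `tan(F/G)(V)`. -/
lemma exists_tanLift {V : SFDVect Λ} {Z : SSet.{u}} (g : Z ⟶ F.obj ((sqZero Λ).obj V))
    (h : ∀ m z, (α.app _).app m (g.app m z) = tanZero G V m) : ∃ g', g' ≫ tanIncl α V = g :=
  ⟨{ app := fun m => ↾(fun z => (⟨g.app m z, h m z⟩ :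
        LinearMap.ker (Tan.natTrans (levelHom α m) V)))
     naturality := fun m n θ => by
      ext z
      exact Subtype.ext (map_app_apply g θ z) }, rfl⟩

/-- The functoriality of `tan(F/G)(V)` in `V`. -/
noncomputable def tanMap {V W : SFDVect Λ} (b : V ⟶ W) : tangentRel α V ⟶ tangentRel α W where
  app m := ModuleCat.ofHom
    (({ toFun := Tan.map (level F m) b
        map_add' := Tan.map_add b
        map_smul' := Tan.map_smul b } :
      Tan (level F m) V →ₗ[ResidueField Λ] Tan (level F m) W).restrict fun x hx => by
        have h : Tan.natTrans (levelHom α m) W (Tan.map (level F m) b x) =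
            Tan.map (level G m) b (Tan.natTrans (levelHom α m) V x) :=
          ConcreteCategory.congr_hom ((levelHom α m).naturality ((sqZero Λ).map b)) x
        rw [LinearMap.mem_ker] at hx ⊢
        exact h.trans ((congrArg _ hx).trans (Tan.map_zero b)))
  naturality m n θ := by
    refine ModuleCat.hom_ext (LinearMap.ext fun x => Subtype.ext ?_)
    exact map_app_apply (F.map ((sqZero Λ).map b)) θ _

/-- The map of simplicial sets underlying `tanMap`. -/
noncomputable abbrev tanMapSSet {V W : SFDVect Λ} (b : V ⟶ W) :
    toSSet (tangentRel α V) ⟶ toSSet (tangentRel α W) :=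
  Functor.whiskerRight (tanMap α b) (forget _)

lemma tanMap_comp {V W X : SFDVect Λ} (a : V ⟶ W) (b : W ⟶ X) :
    tanMap α (a ≫ b) = tanMap α a ≫ tanMap α b := by
  refine NatTrans.ext (funext fun m => ModuleCat.hom_ext (LinearMap.ext fun x => Subtype.ext ?_))
  exact Tan.map_comp (level F m) a b _

lemma tanMap_id (V : SFDVect Λ) : tanMap α (𝟙 V) = 𝟙 _ := by
  refine NatTrans.ext (funext fun m => ModuleCat.hom_ext (LinearMap.ext fun x => Subtype.ext ?_))
  exact Tan.map_id (level F m) _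

lemma tanMap_addHom {V W : SFDVect Λ} (a b : V ⟶ W) {m : SimplexCategoryᵒᵖ}
    (x : (tangentRel α V).obj m) : ((tanMap α (SFDVect.addHom a b)).app m).hom x =
      ((tanMap α a).app m).hom x + ((tanMap α b).app m).hom x :=
  Subtype.ext (Tan.add_map (H := level F m) a b _).symm

lemma tanMap_zeroHom {V W : SFDVect Λ} {m : SimplexCategoryᵒᵖ}
    (x : (tangentRel α V).obj m) : ((tanMap α (SFDVect.zeroHom V W)).app m).hom x = 0 :=
  Subtype.ext (Tan.zero_map (H := level F m) _)

/-- A surjection `V → W` exhibits `tan(F/G)(V) → tan(F/G)(W)` as a base change of the relative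
map of the surjection `k ⊕ V → k ⊕ W`. -/
lemma exists_isPullback_tanMap {V W : SFDVect Λ} (b : V ⟶ W) :
    ∃ t : toSSet (tangentRel α W) ⟶ relTarget α ((sqZero Λ).map b),
      IsPullback (tanMapSSet α b) (tanIncl α V) t (relMap α ((sqZero Λ).map b)) := by
  have hP := IsPullback.of_hasPullback (α.app ((sqZero Λ).obj W)) (G.map ((sqZero Λ).map b))
  have w : tanIncl α W ≫ α.app _ = SSet.const (tanZero G V (op ⦋0⦌)) ≫ G.map ((sqZero Λ).map b) := by
    ext m x
    refine (app_tanIncl α W x).trans ?_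
    refine Eq.trans ?_ (congrArg ((G.map ((sqZero Λ).map b)).app m) (pt_tanZero G V m)).symm
    exact (app_tanZero G b m).symm
  refine ⟨pullback.lift (tanIncl α W) (SSet.const (tanZero G V (op ⦋0⦌))) w,
    isPullback_of_elements ?_ (fun m x y h => ?_) fun m z z' _ h => tanIncl_injective α V m h⟩
  · refine pullback.hom_ext ?_ ?_
    · rw [Category.assoc, Category.assoc, pullback.lift_fst, pullback.lift_fst]
      rfl
    · rw [Category.assoc, Category.assoc, pullback.lift_snd, pullback.lift_snd]
      ext m x
      exact (pt_tanZero G V m).trans (app_tanIncl α V x).symm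
  · have h1 := congrArg ((pullback.fst _ _ : relTarget α ((sqZero Λ).map b) ⟶ _).app m) h
    have h2 := congrArg ((pullback.snd _ _ : relTarget α ((sqZero Λ).map b) ⟶ _).app m) h
    have h1' : (tanIncl α W).app m x = (F.map ((sqZero Λ).map b)).app m y :=
      ((app_congr (pullback.lift_fst _ _ w) m x).symm.trans h1).trans
        (app_congr (pullback.lift_fst (F.map ((sqZero Λ).map b)) (α.app _)
          (α.naturality ((sqZero Λ).map b))) m y)
    have h2' : pt (tanZero G V (op ⦋0⦌)) m = (α.app ((sqZero Λ).obj V)).app m y :=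
      ((app_congr (pullback.lift_snd _ _ w) m x).symm.trans h2).trans
        (app_congr (pullback.lift_snd (F.map ((sqZero Λ).map b)) (α.app _)
          (α.naturality ((sqZero Λ).map b))) m y)
    obtain ⟨t, ht⟩ := exists_tanIncl α V (h2'.symm.trans (pt_tanZero G V m))
    refine ⟨t, tanIncl_injective α W m ?_, ht⟩
    rw [h1', ← ht]
    rfl

variable {α} in
/-- Surjections of coefficients induce fibrations of tangent spaces. -/
lemma QuasiSmooth.fibration_tanMap (hα : QuasiSmooth α) {V W : SFDVect Λ} (b : V ⟶ W)
    (hb : ∀ n, Function.Surjective (b.hom.app n).hom) : IsFibration (tanMapSSet α b) := by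
  obtain ⟨t, ht⟩ := exists_isPullback_tanMap α b
  exact IsFibration.of_isPullback ht (hα.fibration _ (isSurjective_sqZero_map b hb))

lemma isIso_terminal_tangent_zero :
    IsIso (terminal.from (toSSet (tangentRel α (SFDVect.zero Λ)))) := by
  have h : IsTerminal (toSSet (tangentRel α (SFDVect.zero Λ))) :=
    IsTerminal.ofUniqueHom (fun _ => SSet.const (zeroVertex _)) fun Z f => by
      ext m z
      exact tanIncl_injective α _ m ((eq_tanZero F m _).trans (eq_tanZero F m _).symm)
  exact isIso_of_isTerminal h terminalIsTerminal _

lemma zeroHom_surjective (V : SFDVect Λ) (n) :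
    Function.Surjective ((SFDVect.zeroHom V (SFDVect.zero Λ)).hom.app n).hom := fun _ => ⟨0, rfl⟩

open scoped modelCategoryQuillen in
variable {α} in
lemma QuasiSmooth.kanComplex_tangent (hα : QuasiSmooth α) (V : SFDVect Λ) :
    KanComplex (toSSet (tangentRel α V)) := by
  have h1 := hα.fibration_tanMap (SFDVect.zeroHom V (SFDVect.zero Λ)) (zeroHom_surjective V)
  have h2 := isIso_terminal_tangent_zero α
  have h3 : IsFibration (tanMapSSet α (SFDVect.zeroHom V (SFDVect.zero Λ)) ≫ terminal.from _) :=
    MorphismProperty.comp_mem modelCategoryQuillen.J.rlp _ _ h1 (MorphismProperty.of_isIso _ _)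
  rw [show _ ≫ terminal.from _ = terminal.from _ from terminal.hom_ext _ _] at h3
  exact (isFibrant_iff _).2 ((modelCategoryQuillen.fibration_iff _).2 h3)

variable {α} in
/-- The tangent space of a simplicial vector space without homotopy is contractible. -/
lemma QuasiSmooth.contractible_tangent (hα : QuasiSmooth α) (V : SFDVect Λ)
    (hV : ∀ (n : ℕ) (z : V.obj.obj (op ⦋n⦌)), z ∈ cyc V.obj n →
      ∃ y ∈ normSub V.obj (n + 1), (V.obj.δ 0).hom y = z) :
    IsTrivialFibration (terminal.from (toSSet (tangentRel α V))) := by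
  obtain ⟨t, ht⟩ := exists_isPullback_tanMap α (SFDVect.zeroHom V (SFDVect.zero Λ))
  have h1 := IsTrivialFibration.of_isPullback ht (hα.trivialFibration _
    (isSurjective_sqZero_map _ (zeroHom_surjective V))
    (isAcyclic_sqZero_map (𝟙 V) _ (fun _ => Function.injective_id) (zeroHom_surjective V)
      (fun n x => ⟨fun _ => ⟨x, rfl⟩, fun _ => rfl⟩) hV))
  have h2 := isIso_terminal_tangent_zero α
  have h3 : IsTrivialFibration
      (tanMapSSet α (SFDVect.zeroHom V (SFDVect.zero Λ)) ≫ terminal.from _) :=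
    MorphismProperty.comp_mem modelCategoryQuillen.I.rlp _ _ h1 (MorphismProperty.of_isIso _ _)
  rwa [show _ ≫ terminal.from _ = terminal.from _ from terminal.hom_ext _ _] at h3

end TangentFunctor

/-! ### The obstruction map of a small extension -/

section Pairing
variable {Λ : Type u} [CommRing Λ] [IsLocalRing Λ] (F : SArt Λ ⥤ SSet.{u})
  [PreservesFiniteLimits F] (A : SArt Λ) (V : SFDVect Λ)

omit [IsLocalRing Λ] [PreservesFiniteLimits F] in
lemma map_comp_app {A B C : SArt Λ} (f : A ⟶ B) (g : B ⟶ C) {m : SimplexCategoryᵒᵖ}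
    (x : (F.obj A).obj m) : (F.map (f ≫ g)).app m x = (F.map g).app m ((F.map f).app m x) :=
  app_congr (F.map_comp f g) m x

omit [IsLocalRing Λ] [PreservesFiniteLimits F] in
lemma naturality_app {F G : SArt Λ ⥤ SSet.{u}} (α : F ⟶ G) {A B : SArt Λ} (f : A ⟶ B)
    {m : SimplexCategoryᵒᵖ} (x : (F.obj A).obj m) :
    (α.app B).app m ((F.map f).app m x) = (G.map f).app m ((α.app A).app m x) :=
  app_congr (α.naturality f) m x

lemma isPullback_map_ext : IsPullback (F.map (extFst A V)) (F.map (extSnd A V))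
    (F.map (isTerminalSqZeroZero.from A)) (F.map (isTerminalSqZeroZero.from _)) :=
  (isPullback_ext A V isTerminalSqZeroZero).map F

variable {A V}

lemma ext_of_ext {m : SimplexCategoryᵒᵖ} {x y : (F.obj (ext A V)).obj m}
    (h1 : (F.map (extFst A V)).app m x = (F.map (extFst A V)).app m y)
    (h2 : (F.map (extSnd A V)).app m x = (F.map (extSnd A V)).app m y) : x = y :=
  ext_of_isPullback (isPullback_map_ext F A V) h1 h2

/-- A map to `F(A ×_k (k ⊕ V))` from its components. -/
lemma exists_extLift {Z : SSet.{u}} (g : Z ⟶ F.obj A) (h : Z ⟶ F.obj ((sqZero Λ).obj V)) :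
    ∃ l : Z ⟶ F.obj (ext A V), l ≫ F.map (extFst A V) = g ∧ l ≫ F.map (extSnd A V) = h := by
  have w : g ≫ F.map (isTerminalSqZeroZero.from A) = h ≫ F.map (isTerminalSqZeroZero.from _) := by
    ext m z
    exact (eq_tanZero F m _).trans (eq_tanZero F m _).symm
  exact ⟨(isPullback_map_ext F A V).lift g h w, (isPullback_map_ext F A V).lift_fst _ _ _,
    (isPullback_map_ext F A V).lift_snd _ _ _⟩

variable (A V) in
lemma extInl_extSnd : extInl A V ≫ extSnd A V =
    isTerminalSqZeroZero.from A ≫ (sqZero Λ).map (SFDVect.zeroHom _ V) :=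
  SArt.hom_ext fun n x => SqZero.ext (fst_unique _ _ n x) rfl

lemma app_extInl_extSnd {m : SimplexCategoryᵒᵖ} (x : (F.obj A).obj m) :
    (F.map (extSnd A V)).app m ((F.map (extInl A V)).app m x) = tanZero F V m := by
  rw [← map_comp_app, extInl_extSnd, app_eq_tanZero]

omit [PreservesFiniteLimits F] in
lemma app_extInl_extFst {m : SimplexCategoryᵒᵖ} (x : (F.obj A).obj m) :
    (F.map (extFst A V)).app m ((F.map (extInl A V)).app m x) = x := by
  rw [← map_comp_app, show extInl A V ≫ extFst A V = 𝟙 A from rfl, F.map_id]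
  rfl

end Pairing

section Presentation
variable {Λ : Type u} [CommRing Λ] [IsLocalRing Λ] {F G : SArt Λ ⥤ SSet.{u}}
  [PreservesFiniteLimits F] [PreservesFiniteLimits G] {α : F ⟶ G}
  {I : SimplicialObject (ModuleCat.{u} (ResidueField Λ))} {A B : SArt Λ} {f : A ⟶ B}
  (e : SmallExtension I f)

/-- The inclusion of `A` in `coneExt`. -/
noncomputable def SmallExtension.coneInl : A ⟶ e.coneExt := extInl A (coneObj e.ker) ≫ e.coneQuot

lemma SmallExtension.coneInl_conePr : e.coneInl ≫ e.conePr = f := rfl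

/-- The composite of the inclusion of `A` in `coneExt` with the collapse factors through `k`. -/
lemma SmallExtension.coneInl_coneCollapse : e.coneInl ≫ e.coneCollapse =
    isTerminalSqZeroZero.from A ≫ (sqZero Λ).map (SFDVect.zeroHom _ (shift e.ker 1)) :=
  SArt.hom_ext fun n x => SqZero.ext (fst_unique _ _ n x)
    (_root_.map_zero ((coneProj e.ker).hom.app n).hom)

omit [IsLocalRing Λ] [PreservesFiniteLimits F] [PreservesFiniteLimits G] in
variable (α) in
lemma relTarget_ext {A B : SArt Λ} {f : A ⟶ B} {m : SimplexCategoryᵒᵖ}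
    {x y : (relTarget α f).obj m}
    (h1 : (pullback.fst (α.app B) (G.map f)).app m x = (pullback.fst (α.app B) (G.map f)).app m y)
    (h2 : (pullback.snd (α.app B) (G.map f)).app m x = (pullback.snd (α.app B) (G.map f)).app m y) :
    x = y := ext_of_isPullback (IsPullback.of_hasPullback _ _) h1 h2

omit [IsLocalRing Λ] [PreservesFiniteLimits F] [PreservesFiniteLimits G] in
variable (α) in
lemma relTarget_w {A B : SArt Λ} {f : A ⟶ B} {m : SimplexCategoryᵒᵖ}
    (x : (relTarget α f).obj m) :
    (α.app B).app m ((pullback.fst (α.app B) (G.map f)).app m x) =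
      (G.map f).app m ((pullback.snd (α.app B) (G.map f)).app m x) :=
  app_congr pullback.condition m x

omit [IsLocalRing Λ] [PreservesFiniteLimits F] [PreservesFiniteLimits G] in
/-- The acyclic surjection `C → B` of a factorisation `A → C → B` induces a trivial fibration of
relative targets. -/
lemma QuasiSmooth.trivialFibration_relTarget (hα : QuasiSmooth α) {A B C : SArt Λ} (i : A ⟶ C)
    (π : C ⟶ B) (hπ : IsSurjective π) (hπ' : IsAcyclic π) {f : A ⟶ B} (h : i ≫ π = f)
    (q : relTarget α i ⟶ relTarget α f)
    (h1 : q ≫ pullback.fst _ _ = pullback.fst _ _ ≫ F.map π)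
    (h2 : q ≫ pullback.snd _ _ = pullback.snd _ _) : IsTrivialFibration q := by
  subst h
  have w : (pullback.fst _ _ : relTarget α (i ≫ π) ⟶ _) ≫ α.app B =
      (pullback.snd _ _ ≫ G.map i) ≫ G.map π :=
    (pullback.condition.trans (congrArg (pullback.snd _ _ ≫ ·) (G.map_comp i π))).trans
      (Category.assoc _ _ _).symm
  -- `q` is a base change of the relative map of the acyclic surjection `C ⟶ B`
  refine IsTrivialFibration.of_isPullback (isPullback_of_elements (b := pullback.fst _ _)
    (f := pullback.lift _ _ w) (g := relMap α π) ?_ (fun m x y hxy => ?_) fun m z z' hz hz' => ?_)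
    (hα.trivialFibration π hπ hπ')
  · refine pullback.hom_ext ?_ ?_
    · rw [Category.assoc, Category.assoc, pullback.lift_fst, pullback.lift_fst, h1]
    · rw [Category.assoc, Category.assoc, pullback.lift_snd, pullback.lift_snd, ← Category.assoc, h2,
        pullback.condition]
  · have e1 := congrArg ((pullback.fst _ _ : relTarget α π ⟶ _).app m) hxy
    have e2 := congrArg ((pullback.snd _ _ : relTarget α π ⟶ _).app m) hxy
    have e1' : (pullback.fst _ _ : relTarget α (i ≫ π) ⟶ _).app m x = (F.map π).app m y :=
      ((app_congr (pullback.lift_fst _ _ w) m x).symm.trans e1).trans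
        (app_congr (pullback.lift_fst (F.map π) (α.app _) (α.naturality π)) m y)
    have e2' : (G.map i).app m ((pullback.snd _ _ : relTarget α (i ≫ π) ⟶ _).app m x) =
        (α.app C).app m y :=
      ((app_congr (pullback.lift_snd _ _ w) m x).symm.trans e2).trans
        (app_congr (pullback.lift_snd (F.map π) (α.app _) (α.naturality π)) m y)
    obtain ⟨z, hz, hz'⟩ := exists_of_isPullback
      (IsPullback.of_hasPullback (α.app C) (G.map i)) y _ e2'.symm
    refine ⟨z, relTarget_ext α ?_ ?_, hz⟩
    · exact (app_congr h1 m z).trans ((congrArg ((F.map π).app m) hz).trans e1'.symm)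
    · exact (app_congr h2 m z).trans hz'
  · refine relTarget_ext α hz' ?_
    refine (app_congr h2 m z).symm.trans (Eq.trans ?_ (app_congr h2 m z'))
    exact congrArg ((pullback.snd _ _ : relTarget α (i ≫ π) ⟶ _).app m) hz

/-- The obstruction map of a small extension, together with the square that exhibits the base
change of `p : E → T` along the tangent space of the cone as a product. -/
theorem QuasiSmooth.exists_obstructionMap (hα : QuasiSmooth α) :
    ∃ (Q : ObstructionMap (relMap α f) (tangentRel α (shift e.ker 1)))
      (a : F.obj A ⊗ toSSet (tangentRel α (coneObj e.ker)) ⟶ Q.E),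
      IsPullback a (snd _ _) Q.p (tanMapSSet α (coneProj e.ker)) ∧
      lift (𝟙 _) (SSet.const (zeroVertex _)) ≫ a = Q.j := by
  -- `F(A) × tan(F/G)(CI)` maps to `F(A ×_k (k ⊕ CI))`, as `F` preserves fibre products
  obtain ⟨P, hP1, hP2⟩ := exists_extLift F
    (fst (F.obj A) (toSSet (tangentRel α (coneObj e.ker)))) (snd _ _ ≫ tanIncl α (coneObj e.ker))
  have hP1' : ∀ m z, (F.map (extFst A (coneObj e.ker))).app m (P.app m z) = z.1 :=
    fun m z => app_congr hP1 m z
  have hP2' : ∀ m z, (F.map (extSnd A (coneObj e.ker))).app m (P.app m z) =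
    (tanIncl α _).app m z.2 := fun m z => app_congr hP2 m z
  -- the second component vanishes in `G(k ⊕ CI)`, so the image in `G` comes from `G(A)`
  have hαP : ∀ m z, (α.app _).app m (P.app m z) =
      (G.map (extInl A (coneObj e.ker))).app m ((α.app A).app m z.1) := fun m z => by
    refine ext_of_ext G ?_ ?_
    · rw [← naturality_app, hP1', app_extInl_extFst]
    · rw [← naturality_app, hP2', app_extInl_extSnd, app_tanIncl]
  have wa : (P ≫ F.map e.coneQuot) ≫ α.app e.coneExt =
      (fst (F.obj A) (toSSet (tangentRel α (coneObj e.ker))) ≫ α.app A) ≫ G.map e.coneInl := by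
    ext m z
    refine (naturality_app α e.coneQuot _).trans ?_
    refine (congrArg ((G.map e.coneQuot).app m) (hαP m z)).trans ?_
    exact (map_comp_app G _ _ _).symm
  -- the collapse maps `E` to `tan(F/G)(I ⊗ K^1)`, since it is zero on `A`
  obtain ⟨p, hp⟩ := exists_tanLift α
    ((pullback.fst _ _ : relTarget α e.coneInl ⟶ _) ≫ F.map e.coneCollapse) (fun m z => by
      refine (naturality_app α e.coneCollapse _).trans ?_
      refine (congrArg ((G.map e.coneCollapse).app m) (relTarget_w α z)).trans ?_
      rw [← map_comp_app, e.coneInl_coneCollapse, app_eq_tanZero])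
  have hp' : ∀ m z, (tanIncl α _).app m (p.app m z) = (F.map e.coneCollapse).app m
      ((pullback.fst (α.app e.coneExt) (G.map e.coneInl)).app m z) := fun m z => app_congr hp m z
  let a : F.obj A ⊗ toSSet (tangentRel α (coneObj e.ker)) ⟶ relTarget α e.coneInl :=
    pullback.lift _ _ wa
  have ha1 : ∀ m z, (pullback.fst (α.app e.coneExt) (G.map e.coneInl)).app m (a.app m z) =
    (F.map e.coneQuot).app m (P.app m z) := fun m z => app_congr (pullback.lift_fst _ _ wa) m z
  have ha2 : ∀ m z, (pullback.snd (α.app e.coneExt) (G.map e.coneInl)).app m (a.app m z) =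
    (α.app A).app m z.1 := fun m z => app_congr (pullback.lift_snd _ _ wa) m z
  have S := e.isPullback_coneQuot.map F
  have S' := e.isPullback_coneQuot.map G
  have sq : IsPullback a (snd _ _) p (tanMapSSet α (coneProj e.ker)) := by
    refine isPullback_of_elements ?_ (fun m x c h => ?_) fun m z z' h h' => ?_
    · ext m z
      refine tanIncl_injective α _ m ((hp' m _).trans ?_)
      refine (congrArg ((F.map e.coneCollapse).app m) (ha1 m z)).trans ?_
      refine (app_congr S.w m (P.app m z)).trans ?_
      exact congrArg ((F.map ((sqZero Λ).map (coneProj e.ker))).app m) (hP2' m z)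
    -- an element of `E` and one of `tan(F/G)(CI)` with the same image give an element of
    -- `F(A ×_k (k ⊕ CI))`, because `F` preserves the fibre product `isPullback_coneQuot`
    · obtain ⟨w, hw1, hw2⟩ := exists_of_isPullback S
        ((pullback.fst (α.app e.coneExt) (G.map e.coneInl)).app m x)
        ((tanIncl α (coneObj e.ker)).app m c)
        ((hp' m x).symm.trans (congrArg ((tanIncl α _).app m) h))
      have hw3 : (α.app _).app m w = (G.map (extInl A (coneObj e.ker))).app m
          ((pullback.snd (α.app e.coneExt) (G.map e.coneInl)).app m x) := by
        refine ext_of_isPullback S' ?_ ?_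
        · rw [← naturality_app, hw1, relTarget_w, ← map_comp_app]
          rfl
        · rw [← naturality_app, hw2, app_extInl_extSnd, app_tanIncl]
      let z : (F.obj A ⊗ toSSet (tangentRel α (coneObj e.ker))).obj m :=
        ((F.map (extFst A (coneObj e.ker))).app m w, c)
      have hz : P.app m z = w := ext_of_ext F (hP1' m z) ((hP2' m z).trans hw2.symm)
      refine ⟨z, relTarget_ext α ?_ ?_, rfl⟩
      · rw [ha1, hz, hw1]
      · refine (ha2 m z).trans ((naturality_app α _ w).trans ?_)
        rw [hw3, app_extInl_extFst]
    · have h1 : P.app m z = P.app m z' := by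
        refine ext_of_isPullback S ?_ ?_
        · rw [← ha1, ← ha1, h]
        · rw [hP2', hP2']
          exact congrArg ((tanIncl α _).app m) h'
      refine Prod.ext ?_ h'
      rw [← hP1', ← hP1', h1]
  have wq : ((pullback.fst _ _ : relTarget α e.coneInl ⟶ _) ≫ F.map e.conePr) ≫ α.app B =
      pullback.snd _ _ ≫ G.map f := by
    rw [Category.assoc, α.naturality, ← Category.assoc, pullback.condition, Category.assoc,
      ← G.map_comp, e.coneInl_conePr]
  have hj : lift (𝟙 (F.obj A)) (SSet.const (zeroVertex _)) ≫ a = relMap α e.coneInl := by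
    refine NatTrans.ext (funext fun m => ConcreteCategory.hom_ext _ _ fun y => ?_)
    let z : (F.obj A ⊗ toSSet (tangentRel α (coneObj e.ker))).obj m := (y, pt (zeroVertex _) m)
    have hz : P.app m z = (F.map (extInl A (coneObj e.ker))).app m y := by
      refine ext_of_ext F ?_ ?_
      · rw [hP1', app_extInl_extFst]
      · rw [hP2', app_extInl_extSnd]
        exact congrArg ((tanIncl α _).app m) (_root_.map_zero ((tangentRel α _).map _).hom)
    refine relTarget_ext α ((ha1 m z).trans ?_) ((ha2 m z).trans ?_)
    · rw [hz, ← map_comp_app]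
      exact (app_congr (pullback.lift_fst (F.map e.coneInl) (α.app A) (α.naturality _)) m y).symm
    · exact (app_congr (pullback.lift_snd (F.map e.coneInl) (α.app A) (α.naturality _)) m y).symm
  have hja : ∀ m (y : (F.obj A).obj m), a.app m (y, pt (zeroVertex _) m) =
      (relMap α e.coneInl).app m y := fun m y => app_congr hj m y
  have hap : ∀ m z, p.app m (a.app m z) = (tanMapSSet α (coneProj e.ker)).app m z.2 :=
    fun m z => app_congr sq.w m z
  have h00 : (tanMapSSet α (coneProj e.ker)).app (op ⦋0⦌) (zeroVertex _) = zeroVertex _ :=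
    _root_.map_zero ((tanMap α (coneProj e.ker)).app (op ⦋0⦌)).hom
  have h0 : ∀ m, (tanMapSSet α (coneProj e.ker)).app m (pt (zeroVertex _) m) =
      pt (zeroVertex (tangentRel α (shift e.ker 1))) m := fun m =>
    app_pt _ h00 m
  -- the fibre of `p` over `0` is the part of the product over the point `0` of `tan(F/G)(CI)`
  have hpb : IsPullback (relMap α e.coneInl) (stdSimplex.isTerminalObj₀.from _) p
      (yonedaEquiv.symm (zeroVertex (tangentRel α (shift e.ker 1)))) := by
    rw [yonedaEquiv_symm_eq_const]
    refine isPullback_of_elements ?_ (fun m x c h => ?_) fun m y y' h _ => ?_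
    · refine NatTrans.ext (funext fun m => ConcreteCategory.hom_ext _ _ fun y => ?_)
      exact (congrArg (p.app m) (hja m y)).symm.trans ((hap m _).trans (h0 m))
    · obtain ⟨z, hz, hz'⟩ := exists_of_isPullback sq x (pt (zeroVertex _) m) (h.trans (h0 m).symm)
      refine ⟨z.1, ?_, ?_⟩
      · have hz2 : z = (z.1, pt (zeroVertex _) m) := Prod.ext rfl hz'
        exact (hja m z.1).symm.trans ((congrArg (a.app m) hz2).symm.trans hz)
      · exact stdSimplex.objEquiv.injective (SimplexCategory.isTerminalZero.hom_ext _ _)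
    · have := ext_of_isPullback sq (z := (y, pt (zeroVertex _) m)) (z' := (y', pt (zeroVertex _) m))
        ((hja m y).trans (h.trans (hja m y').symm)) rfl
      exact congrArg Prod.fst this
  refine ⟨{ E := relTarget α e.coneInl
            q := pullback.lift _ _ wq
            p := p
            j := relMap α e.coneInl
            toPoint := _
            trivialFibration := hα.trivialFibration_relTarget e.coneInl e.conePr
              e.isSurjective_conePr e.isAcyclic_conePr e.coneInl_conePr _
              (pullback.lift_fst _ _ _) (pullback.lift_snd _ _ _)
            fac := ?_
            isPullback := hpb }, a, sq, hj⟩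
  refine pullback.hom_ext ?_ ?_
  · rw [Category.assoc, pullback.lift_fst, pullback.lift_fst, ← Category.assoc, pullback.lift_fst,
      ← F.map_comp, e.coneInl_conePr]
  · rw [Category.assoc, pullback.lift_snd, pullback.lift_snd, pullback.lift_snd]

end Presentation

/-! ### The fibres of the relative map of a small extension -/

section Fibre
variable {Λ : Type u} [CommRing Λ] [IsLocalRing Λ] {F G : SArt Λ ⥤ SSet.{u}}
  [PreservesFiniteLimits F] [PreservesFiniteLimits G] (α : F ⟶ G)
  {I : SimplicialObject (ModuleCat.{u} (ResidueField Λ))} {A B : SArt Λ} {f : A ⟶ B}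
  (e : SmallExtension I f)

lemma SmallExtension.extInl_act : extInl A e.ker ≫ e.act = 𝟙 A :=
  SArt.hom_ext fun n x =>
    (congrArg (x + ·) (_root_.map_zero (e.incl n))).trans (add_zero x)

/-- The fibre of `F(A) → F(B) ×_{G(B)} G(A)` over the image of `y` is the orbit of `y` under the
action of `tan(F/G)(I)`, and this action is free. -/
theorem SmallExtension.exists_isPullback_fibre (y : (F.obj A) _⦋0⦌) :
    ∃ (i : toSSet (tangentRel α e.ker) ⟶ F.obj A) (t : toSSet (tangentRel α e.ker) ⟶ Δ[0]),
      IsPullback i t (relMap α f) (yonedaEquiv.symm ((relMap α f).app _ y)) ∧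
      i.app _ (zeroVertex _) = y := by
  -- the elements `(y, v)` of `F(A ×_k (k ⊕ I))`, to which the action `a + v` is applied
  obtain ⟨P, hP1, hP2⟩ := exists_extLift F (SSet.const y) (tanIncl α e.ker)
  have hP1' : ∀ m v, (F.map (extFst A e.ker)).app m (P.app m v) = pt y m :=
    fun m v => app_congr hP1 m v
  have hP2' : ∀ m v, (F.map (extSnd A e.ker)).app m (P.app m v) = (tanIncl α _).app m v :=
    fun m v => app_congr hP2 m v
  have hαP : ∀ m v, (α.app _).app m (P.app m v) =
      (G.map (extInl A e.ker)).app m ((α.app A).app m (pt y m)) := fun m v => by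
    refine ext_of_ext G ?_ ?_
    · rw [← naturality_app, hP1', app_extInl_extFst]
    · rw [← naturality_app, hP2', app_extInl_extSnd, app_tanIncl]
  have hact : ∀ {H : SArt Λ ⥤ SSet.{u}} m (x : (H.obj A).obj m),
      (H.map e.act).app m ((H.map (extInl A e.ker)).app m x) = x := fun {H} m x => by
    rw [← map_comp_app, e.extInl_act, H.map_id]
    rfl
  have S := e.isPullback_act.map F
  have S' := e.isPullback_act.map G
  have r1 : ∀ m x, (pullback.fst (α.app B) (G.map f)).app m ((relMap α f).app m x) =
    (F.map f).app m x := fun m x => app_congr (pullback.lift_fst _ _ (α.naturality f)) m x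
  have r2 : ∀ m x, (pullback.snd (α.app B) (G.map f)).app m ((relMap α f).app m x) =
    (α.app A).app m x := fun m x => app_congr (pullback.lift_snd _ _ (α.naturality f)) m x
  refine ⟨P ≫ F.map e.act, stdSimplex.isTerminalObj₀.from _, ?_, ?_⟩
  · rw [yonedaEquiv_symm_eq_const]
    refine isPullback_of_elements ?_ (fun m x c h => ?_) fun m v v' h _ => ?_
    · refine NatTrans.ext (funext fun m => ConcreteCategory.hom_ext _ _ fun v => ?_)
      refine Eq.trans ?_ (app_pt (relMap α f) rfl m)
      refine relTarget_ext α ?_ ?_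
      · refine (r1 m _).trans (Eq.trans ?_ (r1 m _).symm)
        exact (app_congr S.w m (P.app m v)).trans (congrArg ((F.map f).app m) (hP1' m v))
      · refine (r2 m _).trans (Eq.trans ?_ (r2 m _).symm)
        refine (naturality_app α e.act _).trans ?_
        exact (congrArg ((G.map e.act).app m) (hαP m v)).trans (hact m _)
    · have h' : (relMap α f).app m x = (relMap α f).app m (pt y m) :=
        h.trans (app_pt (relMap α f) rfl m).symm
      have h1 : (F.map f).app m x = (F.map f).app m (pt y m) :=
        (r1 m x).symm.trans ((congrArg _ h').trans (r1 m _))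
      have h2 : (α.app A).app m x = (α.app A).app m (pt y m) :=
        (r2 m x).symm.trans ((congrArg _ h').trans (r2 m _))
      -- an element `x` of `F(A)` with the same image as `y` in `F(B)` gives a pair `(x, y)` in
      -- `F(A ×_B A) = F(A ×_k (k ⊕ I))`
      obtain ⟨w, hw1, hw2⟩ := exists_of_isPullback S x (pt y m) h1
      have hw3 : (α.app _).app m w =
          (G.map (extInl A e.ker)).app m ((α.app A).app m (pt y m)) := by
        refine ext_of_isPullback S' ?_ ?_
        · rw [← naturality_app, hw1, hact, h2]
        · rw [← naturality_app, hw2, app_extInl_extFst]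
      obtain ⟨v, hv⟩ := exists_tanIncl α e.ker
        (x := (F.map (extSnd A e.ker)).app m w) (by
          rw [naturality_app, hw3, app_extInl_extSnd])
      have hPv : P.app m v = w :=
        ext_of_ext F ((hP1' m v).trans hw2.symm) ((hP2' m v).trans hv)
      exact ⟨v, (congrArg ((F.map e.act).app m) hPv).trans hw1,
        stdSimplex.objEquiv.injective (SimplexCategory.isTerminalZero.hom_ext _ _)⟩
    · have hv : P.app m v = P.app m v' :=
        ext_of_isPullback S h ((hP1' m v).trans (hP1' m v').symm)
      refine tanIncl_injective α _ m ?_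
      rw [← hP2', hv, hP2']
  · have h0 : P.app _ (zeroVertex _) = (F.map (extInl A e.ker)).app _ y := by
      refine ext_of_ext F ?_ ?_
      · rw [hP1', app_extInl_extFst, pt_zero]
      · rw [hP2', app_extInl_extSnd]
        rfl
    exact (congrArg ((F.map e.act).app _) h0).trans (hact _ y)

variable {α}

/-- The obstruction map of a small extension and its homotopical consequences. -/
lemma QuasiSmooth.smallExtension (hα : QuasiSmooth α) :
    ∃ (Q : ObstructionMap (relMap α f) (tangentRel α (shift e.ker 1)))
      (o₀ : π₀ (relTarget α f) → piMod 0 (tangentRel α (shift e.ker 1)))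
      (_ : AddAction (piMod 1 (tangentRel α (shift e.ker 1))) (π₀ (F.obj A))),
      Q.Induces₀ o₀ ∧
      Q.InducesAction (fun g a => g +ᵥ a) ∧
      (∀ c, o₀ c = 0 ↔ c ∈ Set.range (mapπ₀ (relMap α f))) ∧
      (∀ a b : π₀ (F.obj A), mapπ₀ (relMap α f) a = mapπ₀ (relMap α f) b ↔
        ∃ g : piMod 1 (tangentRel α (shift e.ker 1)), g +ᵥ a = b) ∧
      ∀ y : (F.obj A) _⦋0⦌,
        (∃ (i : toSSet (tangentRel α e.ker) ⟶ F.obj A) (t : toSSet (tangentRel α e.ker) ⟶ Δ[0]),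
          IsPullback i t (relMap α f) (yonedaEquiv.symm ((relMap α f).app _ y)) ∧
          i.app _ (zeroVertex _) = y) ∧
        ∃ (o : ∀ n, PiGroup (n + 1) (relTarget α f) ((relMap α f).app _ y) →
              piMod (n + 1) (tangentRel α (shift e.ker 1)))
          (d : ∀ n, piMod (n + 2) (tangentRel α (shift e.ker 1)) →
              PiGroup (n + 1) (F.obj A) y),
          (∀ n, Q.Induces y (n + 1) (o n)) ∧
          (∀ n, Q.InducesBoundary y (n + 1) (d n)) ∧
          (∀ n a b c, PiGroup.IsMul a b c → o n c = o n a + o n b) ∧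
          (∀ n u v, PiGroup.IsMul (d n u) (d n v) (d n (u + v))) ∧
          (∀ n c, o n c = 0 ↔ c ∈ Set.range (PiGroup.map (relMap α f) (x := y) rfl)) ∧
          (∀ n u, d n u = 1 ↔ u ∈ Set.range (o (n + 1))) ∧
          (∀ n (a : PiGroup (n + 1) (F.obj A) y),
            a.map (relMap α f) rfl = 1 ↔ a ∈ Set.range (d n)) ∧
          (∀ g : piMod 1 (tangentRel α (shift e.ker 1)),
            g +ᵥ π₀.mk y = π₀.mk y ↔ g ∈ Set.range (o 0)) := by
  obtain ⟨Q, a, sq, ha⟩ := hα.exists_obstructionMap e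
  have := hα.kanComplex_tangent (shift e.ker 1)
  obtain ⟨o₀, act, h1, h2, h3, h4, h5⟩ := Q.exists_exact
    (hα.fibration_tanMap (coneProj e.ker) (coneProj_surjective e.ker))
    (hα.contractible_tangent (coneObj e.ker) fun n z h => exists_boundary_cone _ h)
    (zeroVertex _) (_root_.map_zero ((tanMap α (coneProj e.ker)).app (op ⦋0⦌)).hom) sq ha
  exact ⟨Q, o₀, act, h1, h2, h3, h4, fun y => ⟨e.exists_isPullback_fibre α y, h5 y⟩⟩

end Fibre

/-! ### Connecting isomorphisms and direct sums -/

section Connecting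
variable {R : Type u} [CommRing R] {A B C : SimplicialObject (ModuleCat.{u} R)}

lemma mem_cyc_of_app_mem (i : A ⟶ B) (hi : ∀ n, Function.Injective (i.app n).hom) {n : ℕ}
    {a : A.obj (op ⦋n⦌)} (h : (i.app _).hom a ∈ cyc B n) : a ∈ cyc A n := by
  cases n with
  | zero => trivial
  | succ n =>
    refine (mem_cyc_succ A a).2 fun j => hi _ ?_
    refine (naturality_apply i (SimplexCategory.δ j).op a).trans ?_
    exact ((mem_cyc_succ B _).1 h j).trans (_root_.map_zero _).symm

lemma mem_normSub_of_app_mem (i : A ⟶ B) (hi : ∀ n, Function.Injective (i.app n).hom) {n : ℕ}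
    {a : A.obj (op ⦋n⦌)} (h : (i.app _).hom a ∈ normSub B n) : a ∈ normSub A n := by
  cases n with
  | zero => trivial
  | succ n =>
    refine (mem_normSub_succ A a).2 fun j => hi _ ?_
    refine (naturality_apply i (SimplexCategory.δ j.succ).op a).trans ?_
    exact ((mem_normSub_succ B _).1 h j).trans (_root_.map_zero _).symm

lemma nonempty_equiv_of_ker_eq {S M N : Type*} [AddCommGroup S] [AddCommGroup M] [AddCommGroup N]
    [Module R S] [Module R M] [Module R N] (f : S →ₗ[R] M) (g : S →ₗ[R] N)
    (hf : Function.Surjective f) (hg : Function.Surjective g) (h : ∀ s, f s = 0 ↔ g s = 0) :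
    Nonempty (M ≃ₗ[R] N) :=
  ⟨(f.quotKerEquivOfSurjective hf).symm ≪≫ₗ Submodule.quotEquivOfEq _ _ (SetLike.ext h) ≪≫ₗ
    g.quotKerEquivOfSurjective hg⟩

/-- The connecting isomorphism of a short exact sequence with exact middle term. Surjectivity of
`p` is needed, and assumed, only on normalised simplices of positive degree. -/
lemma nonempty_connecting_equiv (i : A ⟶ B) (p : B ⟶ C)
    (hi : ∀ n, Function.Injective (i.app n).hom)
    (hip : ∀ n, Function.Exact (i.app n).hom (p.app n).hom)
    (hp : ∀ (n : ℕ) (w : C.obj (op ⦋n + 1⦌)), w ∈ normSub C (n + 1) →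
      ∃ b ∈ normSub B (n + 1), (p.app _).hom b = w)
    (hB : ∀ (n : ℕ) (z : B.obj (op ⦋n⦌)), z ∈ cyc B n →
      ∃ y ∈ normSub B (n + 1), (B.δ 0).hom y = z) (n : ℕ) :
    Nonempty (piMod (n + 1) C ≃ₗ[R] piMod n A) := by
  have hi0 : ∀ {m : ℕ} (a : A.obj (op ⦋m + 1⦌)),
      (i.app _).hom ((A.δ 0).hom a) = (B.δ 0).hom ((i.app _).hom a) :=
    fun a => naturality_apply i (SimplexCategory.δ 0).op a
  have hp0 : ∀ {m : ℕ} (b : B.obj (op ⦋m + 1⦌)),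
      (p.app _).hom ((B.δ 0).hom b) = (C.δ 0).hom ((p.app _).hom b) :=
    fun b => naturality_apply p (SimplexCategory.δ 0).op b
  -- the graph of the connecting map: the pairs `(b, a)` with `b` normalised and `δ₀ b = i a`; it
  -- projects onto both homology groups, and these projections have the same kernel
  let S : Submodule R (B.obj (op ⦋n + 1⦌) × A.obj (op ⦋n⦌)) :=
    (normSub B (n + 1)).comap (LinearMap.fst _ _ _) ⊓
      LinearMap.eqLocus ((B.δ 0).hom ∘ₗ LinearMap.fst _ _ _) ((i.app _).hom ∘ₗ LinearMap.snd _ _ _)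
  have hS : ∀ x, x ∈ S ↔ x.1 ∈ normSub B (n + 1) ∧ (B.δ 0).hom x.1 = (i.app _).hom x.2 :=
    fun x => Iff.rfl
  have hS1 : ∀ x : S, (p.app _).hom x.1.1 ∈ cyc C (n + 1) := by
    rintro ⟨⟨b, a⟩, hx⟩
    obtain ⟨h1, h2⟩ := (hS _).1 hx
    refine (mem_cyc_succ C _).2 (Fin.cases ?_ ((mem_normSub_succ C _).1 (app_mem_normSub p h1)))
    refine (hp0 b).symm.trans ((congrArg (p.app _).hom h2).trans ?_)
    exact (hip _).apply_apply_eq_zero a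
  have hS2 : ∀ x : S, x.1.2 ∈ cyc A n := by
    rintro ⟨⟨b, a⟩, hx⟩
    obtain ⟨h1, h2⟩ := (hS _).1 hx
    refine mem_cyc_of_app_mem i hi ?_
    rw [← h2]
    exact δ_zero_mem_cyc h1
  let f : S →ₗ[R] piMod (n + 1) C := cycClass C (n + 1) ∘ₗ
    LinearMap.codRestrict (cyc C (n + 1)) ((p.app _).hom ∘ₗ LinearMap.fst _ _ _ ∘ₗ S.subtype) hS1
  let g : S →ₗ[R] piMod n A := cycClass A n ∘ₗ
    LinearMap.codRestrict (cyc A n) (LinearMap.snd _ _ _ ∘ₗ S.subtype) hS2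
  have hf : ∀ x : S, f x = cycClass C (n + 1) ⟨_, hS1 x⟩ := fun _ => rfl
  have hg : ∀ x : S, g x = cycClass A n ⟨_, hS2 x⟩ := fun _ => rfl
  have hex : ∀ {m : SimplexCategoryᵒᵖ} (b : B.obj m), (p.app _).hom b = 0 →
      ∃ a, (i.app _).hom a = b := fun b hb => ((hip _) b).1 hb
  refine nonempty_equiv_of_ker_eq f g (fun c => ?_) (fun c => ?_) fun x => ?_
  · obtain ⟨⟨w, hw⟩, rfl⟩ := cycClass_surjective C (n + 1) c
    obtain ⟨b, hb, hbw⟩ := hp n w (cyc_le_normSub _ hw)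
    obtain ⟨a, ha⟩ := hex ((B.δ 0).hom b) (by
      rw [hp0, hbw]
      exact (mem_cyc_succ C w).1 hw 0)
    refine ⟨⟨(b, a), (hS _).2 ⟨hb, ha.symm⟩⟩, ?_⟩
    rw [hf]
    exact congrArg _ (Subtype.ext hbw)
  · obtain ⟨⟨a, ha⟩, rfl⟩ := cycClass_surjective A n c
    obtain ⟨b, hb, hba⟩ := hB n _ (app_mem_cyc i ha)
    exact ⟨⟨(b, a), (hS _).2 ⟨hb, hba⟩⟩, hg _⟩
  · obtain ⟨⟨b, a⟩, hx⟩ := x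
    obtain ⟨h1, h2⟩ := (hS _).1 hx
    rw [hf, hg, cycClass_eq_zero_iff, cycClass_eq_zero_iff]
    constructor
    · rintro ⟨w, hw, hw'⟩
      obtain ⟨b', hb', rfl⟩ := hp (n + 1) w hw
      -- if `p b` is the boundary of `p b'`, then `b - δ₀ b'` comes from an `a'` with boundary `a`
      obtain ⟨a', ha'⟩ := hex (b - (B.δ 0).hom b') (by
        rw [_root_.map_sub, hp0, sub_eq_zero]
        exact hw'.symm)
      have hb0 : (B.δ 0).hom b' ∈ cyc B (n + 1) := δ_zero_mem_cyc hb'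
      refine ⟨a', mem_normSub_of_app_mem i hi ?_, hi _ ?_⟩
      · rw [ha']
        exact sub_mem h1 (cyc_le_normSub _ hb0)
      · rw [hi0, ha', _root_.map_sub, show (B.δ 0).hom ((B.δ 0).hom b') = 0 from
          (mem_cyc_succ B _).1 hb0 0, sub_zero]
        exact h2
    · rintro ⟨a', ha', ha''⟩
      -- if `a` is the boundary of `a'`, then `b - i a'` is a cycle, hence a boundary, and so is its
      -- image
      have hc : b - (i.app _).hom a' ∈ cyc B (n + 1) := by
        have h3 : b - (i.app _).hom a' ∈ normSub B (n + 1) := sub_mem h1 (app_mem_normSub i ha')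
        refine (mem_cyc_succ B _).2 (Fin.cases ?_ ((mem_normSub_succ B _).1 h3))
        rw [_root_.map_sub, sub_eq_zero, ← hi0, ha'']
        exact h2
      obtain ⟨y, hy, hy'⟩ := hB (n + 1) _ hc
      refine ⟨(p.app _).hom y, app_mem_normSub p hy, ?_⟩
      rw [← hp0, hy', _root_.map_sub, (hip _).apply_apply_eq_zero, sub_zero]

end Connecting

section SplitSum
variable {k : Type*} [Field k] {Y : Type*} [AddCommGroup Y] [Module k Y] {X P : ℕ → Type*}
  [∀ m, AddCommGroup (X m)] [∀ m, Module k (X m)] [∀ m, AddCommGroup (P m)] [∀ m, Module k (P m)]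

/-- A module with copies of the `X m`, indexed by a basis of `P m`, as direct summands. -/
lemma nonempty_equiv_directSum {J : ℕ → Type*} [∀ m, Fintype (J m)]
    (b : ∀ m, Module.Basis (J m) k (P m)) (N : ℕ) (hN : ∀ m, N ≤ m → IsEmpty (J m))
    (ι : ∀ m, J m → X m →ₗ[k] Y) (π : ∀ m, J m → Y →ₗ[k] X m)
    (h1 : ∀ m a, π m a ∘ₗ ι m a = LinearMap.id) (h2 : ∀ m a a', a ≠ a' → π m a ∘ₗ ι m a' = 0)
    (h3 : ∀ m m' a a', m ≠ m' → π m a ∘ₗ ι m' a' = 0)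
    (h : ∑ m ∈ Finset.range N, ∑ a, ι m a ∘ₗ π m a = LinearMap.id) :
    Nonempty (Y ≃ₗ[k] ⨁ m, X m ⊗[k] P m) := by
  classical
  let L : (⨁ m, X m ⊗[k] P m) →ₗ[k] Y := DirectSum.toModule k ℕ Y fun m =>
    TensorProduct.lift ((b m).constr k (ι m)).flip
  -- the map `x ↦ x ⊗ b_a` to the direct sum
  let r : ∀ m, J m → X m →ₗ[k] ⨁ m, X m ⊗[k] P m := fun m a =>
    DirectSum.lof k ℕ (fun m => X m ⊗[k] P m) m ∘ₗ (TensorProduct.mk k (X m) (P m)).flip (b m a)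
  let R : Y →ₗ[k] ⨁ m, X m ⊗[k] P m := ∑ m ∈ Finset.range N, ∑ a, r m a ∘ₗ π m a
  have hL : ∀ m a x, L (r m a x) = ι m a x := fun m a x => by
    refine (DirectSum.toModule_lof k m _).trans ?_
    refine (TensorProduct.lift.tmul _ _).trans ?_
    rw [LinearMap.flip_apply, Module.Basis.constr_basis]
  have hR : ∀ y, R y = ∑ m ∈ Finset.range N, ∑ a, r m a (π m a y) := fun y => by
    simp only [R, LinearMap.sum_apply, LinearMap.comp_apply]
  have hLR : L ∘ₗ R = LinearMap.id := by
    refine LinearMap.ext fun y => ?_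
    rw [← h]
    simp only [LinearMap.comp_apply, hR, _root_.map_sum, hL, LinearMap.sum_apply]
  have hRr : ∀ m a x, R (ι m a x) = r m a x := fun m a x => by
    have hm : m ∈ Finset.range N := Finset.mem_range.2 (by
      by_contra hm
      exact (hN m (not_lt.1 hm)).false a)
    rw [hR, Finset.sum_eq_single_of_mem m hm, Finset.sum_eq_single_of_mem a (Finset.mem_univ a)]
    · exact congrArg _ (LinearMap.congr_fun (h1 m a) x)
    · intro a' _ ha'
      exact (congrArg _ (LinearMap.congr_fun (h2 m a' a ha') x)).trans (_root_.map_zero _)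
    · intro m' _ hm'
      refine Finset.sum_eq_zero fun a' _ => ?_
      exact (congrArg _ (LinearMap.congr_fun (h3 m' m a' a hm') x)).trans (_root_.map_zero _)
  have hRL : R ∘ₗ L = LinearMap.id := by
    refine DirectSum.linearMap_ext k fun m => TensorProduct.ext (LinearMap.ext fun x =>
      (b m).ext fun a => ?_)
    exact (congrArg R (hL m a x)).trans (hRr m a x)
  exact ⟨LinearEquiv.ofLinearMap R L hRL hLR⟩

/-- If only one of the `P m` is non-zero, and that one is a line, the direct sum has only one
term. -/
lemma nonempty_equiv_directSum_single (n : ℕ) (g : P n) (hg : g ≠ 0)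
    (hspan : ∀ p : P n, ∃ c : k, p = c • g) (hP : ∀ m, m ≠ n → ∀ p : P m, p = 0) :
    Nonempty ((⨁ m, X m ⊗[k] P m) ≃ₗ[k] X n) := by
  classical
  have hli : LinearIndependent k (fun _ : Unit => g) := by
    simpa using (LinearIndependent.of_subsingleton (R := k) (v := fun _ : Unit => g) () hg)
  let b : Module.Basis Unit k (P n) := Module.Basis.mk hli (by
    rintro p -
    obtain ⟨c, rfl⟩ := hspan p
    exact Submodule.smul_mem _ _ (Submodule.subset_span ⟨(), rfl⟩))
  let e : X n ≃ₗ[k] X n ⊗[k] P n := (TensorProduct.rid k (X n)).symm ≪≫ₗ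
    TensorProduct.congr (LinearEquiv.refl k _)
      ((LinearEquiv.funUnique Unit k k).symm ≪≫ₗ b.equivFun.symm)
  refine ⟨(LinearEquiv.ofBijective
    (DirectSum.lof k ℕ (fun m => X m ⊗[k] P m) n ∘ₗ e.toLinearMap) ⟨?_, ?_⟩).symm⟩
  · exact (DirectSum.of_injective n).comp e.injective
  · rw [← LinearMap.range_eq_top, eq_top_iff]
    rintro x -
    induction x using DirectSum.induction_on with
    | zero => exact zero_mem _
    | add x y hx hy => exact add_mem hx hy
    | of m x =>
      by_cases hm : m = n
      · subst hm
        exact ⟨e.symm x, congrArg (DirectSum.lof k ℕ (fun m => X m ⊗[k] P m) m)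
          (e.apply_symm_apply x)⟩
      · have : x = 0 := by
          induction x using TensorProduct.induction_on with
          | zero => rfl
          | add x y hx hy => rw [hx, hy, add_zero]
          | tmul x p => rw [hP m hm p, TensorProduct.tmul_zero]
        rw [this, _root_.map_zero]
        exact zero_mem _

end SplitSum

/-! ### Homotopy groups of tangent spaces -/

section NormalisedLifts
variable {R : Type u} [CommRing R] {B C : SimplicialObject (ModuleCat.{u} R)}

/-- Fibrations lift normalised simplices of positive degree. -/
lemma exists_normSub_lift_of_fibration (p : B ⟶ C)
    (hp : IsFibration (Functor.whiskerRight p (forget _) : toSSet B ⟶ toSSet C)) (n : ℕ)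
    (w : C.obj (op ⦋n + 1⦌)) (hw : w ∈ normSub C (n + 1)) :
    ∃ b ∈ normSub B (n + 1), (p.app _).hom b = w := by
  have := (modelCategoryQuillen.fibration_iff _).2 hp
  have hc : horn.IsCompatible (i := 0) (fun (j : Fin (n + 2)) (_ : j ≠ 0) =>
      (SSet.const (zeroVertex B) : (Δ[n] : SSet.{u}) ⟶ toSSet B)) := by
    cases n with
    | zero => trivial
    | succ n => intro j k _ _ _; rfl
  have h0 : (Functor.whiskerRight p (forget _) : toSSet B ⟶ toSSet C).app (op ⦋0⦌)
      (zeroVertex B) = zeroVertex C := _root_.map_zero (p.app _).hom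
  obtain ⟨ε, h1, h2⟩ := hc.exists_lift _ (valMap w) (fun j hj => by
    obtain ⟨j, rfl⟩ := Fin.exists_succ_eq.2 hj
    rw [const_comp' _ h0]
    refine mapVal_injective ?_
    rw [mapVal_const, mapVal_δ, mapVal_valMap]
    exact ((mem_normSub_succ C w).1 hw j).symm)
  refine ⟨mapVal ε, (mem_normSub_succ B _).2 fun j => ?_, ?_⟩
  · rw [← mapVal_δ, h1 _ (Fin.succ_ne_zero j), mapVal_const]
  · exact (congrArg mapVal h2).trans (mapVal_valMap w)

end NormalisedLifts

section TangentHomotopy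
variable {Λ : Type u} [CommRing Λ] [IsLocalRing Λ] {F G : SArt Λ ⥤ SSet.{u}}
  [PreservesFiniteLimits F] [PreservesFiniteLimits G] {α : F ⟶ G}

/-- The relative tangent space preserves injections. -/
lemma tanMap_injective {V' V W : SFDVect Λ} (a : V' ⟶ V) (b : V ⟶ W)
    (ha : ∀ n, Function.Injective (a.hom.app n).hom)
    (hab : ∀ n, Function.Exact (a.hom.app n).hom (b.hom.app n).hom) (m : SimplexCategoryᵒᵖ) :
    Function.Injective ((tanMap α a).app m).hom := fun _ _ h =>
  tanIncl_injective α _ m (ext_of_isPullback ((isPullback_sqZero a b ha hab).map F)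
    (congrArg ((tanIncl α V).app m) h) ((eq_tanZero F m _).trans (eq_tanZero F m _).symm))

/-- The relative tangent space preserves kernels. -/
lemma tanMap_exact {V' V W : SFDVect Λ} (a : V' ⟶ V) (b : V ⟶ W)
    (ha : ∀ n, Function.Injective (a.hom.app n).hom)
    (hab : ∀ n, Function.Exact (a.hom.app n).hom (b.hom.app n).hom) (m : SimplexCategoryᵒᵖ) :
    Function.Exact ((tanMap α a).app m).hom ((tanMap α b).app m).hom := by
  have S := (isPullback_sqZero a b ha hab).map F
  have S' := (isPullback_sqZero a b ha hab).map G
  intro x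
  constructor
  · intro h
    obtain ⟨y, hy, -⟩ := exists_of_isPullback S ((tanIncl α V).app m x)
      (tanZero F (SFDVect.zero Λ) m)
      ((congrArg ((tanIncl α W).app m) h).trans (app_tanZero F _ m).symm)
    obtain ⟨z, hz⟩ := exists_tanIncl α V' (x := y) (ext_of_isPullback S' (by
      rw [← naturality_app, hy, app_tanIncl, app_tanZero])
      ((eq_tanZero G m _).trans (eq_tanZero G m _).symm))
    refine ⟨z, tanIncl_injective α V m ?_⟩
    exact (congrArg ((F.map ((sqZero Λ).map a)).app m) hz).trans hy
  · rintro ⟨z, rfl⟩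
    have h0 : a ≫ b = SFDVect.zeroHom V' W :=
      SFDVect.hom_ext fun n x => (hab n).apply_apply_eq_zero x
    have h1 := tanMap_comp α a b
    rw [h0] at h1
    have h2 := congrArg (fun f => (f.app m).hom z) h1
    exact h2.symm.trans (tanMap_zeroHom α z)

/-- The tangent space of a simplicial vector space without homotopy has no homotopy. -/
lemma QuasiSmooth.exists_boundary_tangent (hα : QuasiSmooth α) (V : SFDVect Λ)
    (hV : ∀ (n : ℕ) (z : V.obj.obj (op ⦋n⦌)), z ∈ cyc V.obj n →
      ∃ y ∈ normSub V.obj (n + 1), (V.obj.δ 0).hom y = z) (n : ℕ)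
    (z : (tangentRel α V).obj (op ⦋n⦌)) (hz : z ∈ cyc (tangentRel α V) n) :
    ∃ y ∈ normSub (tangentRel α V) (n + 1), ((tangentRel α V).δ 0).hom y = z := by
  obtain ⟨H, h0, h1, h2⟩ := exists_contraction (hα.contractible_tangent V hV) (zeroVertex _)
  exact exists_boundary_of_contraction H h0 h1 h2 hz

/-- Shifting the coefficients shifts the homotopy groups of the tangent space. -/
lemma QuasiSmooth.nonempty_piMod_shift (hα : QuasiSmooth α) (V : SFDVect Λ) (n : ℕ) :
    Nonempty (piMod (n + 1) (tangentRel α (shift V 1)) ≃ₗ[ResidueField Λ]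
      piMod n (tangentRel α V)) :=
  nonempty_connecting_equiv (tanMap α (coneIncl V)) (tanMap α (coneProj V))
    (tanMap_injective _ _ (coneIncl_injective V) (cone_exact V))
    (tanMap_exact _ _ (coneIncl_injective V) (cone_exact V))
    (exists_normSub_lift_of_fibration _ (hα.fibration_tanMap _ (coneProj_surjective V)))
    (hα.exists_boundary_tangent _ fun _ _ h => exists_boundary_cone _ h) n

/-- Tensoring with `K^1` shifts the homotopy groups. -/
lemma nonempty_piMod_shift_obj (V : SFDVect Λ) (n : ℕ) :
    Nonempty (piMod (n + 1) (shift V 1).obj ≃ₗ[ResidueField Λ] piMod n V.obj) :=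
  nonempty_connecting_equiv (coneIncl V).hom (coneProj V).hom
    (coneIncl_injective V) (cone_exact V)
    (fun _ _ hw => exists_normSub_lift _ (coneProj_surjective V) hw)
    (fun _ _ h => exists_boundary_cone _ h) n

/-- `V ⊗ K^1` is connected. -/
lemma exists_boundary_shift (V : SFDVect Λ) (z : (shift V 1).obj.obj (op ⦋0⦌)) :
    ∃ y ∈ normSub (shift V 1).obj 1, ((shift V 1).obj.δ 0).hom y = z := by
  obtain ⟨b, rfl⟩ := coneProj_surjective V _ z
  obtain ⟨y, hy, rfl⟩ := exists_boundary_cone V.obj (n := 0) (z := b) trivial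
  exact ⟨_, app_mem_normSub (coneProj V).hom hy,
    (naturality_apply (coneProj V).hom (SimplexCategory.δ 0).op y).symm⟩

variable (α) in
/-- The map on homotopy groups of tangent spaces induced by a map of coefficients. -/
noncomputable def tanPi (n : ℕ) {V W : SFDVect Λ} : (V ⟶ W) →+
    (piMod n (tangentRel α V) →ₗ[ResidueField Λ] piMod n (tangentRel α W)) :=
  AddMonoidHom.mk' (fun b => piModMap (tanMap α b) n) fun a b => by
    refine LinearMap.ext fun c => ?_
    obtain ⟨v, rfl⟩ := cycClass_surjective _ n c
    refine (piModMap_cycClass _ n v).trans ?_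
    refine Eq.trans ?_ (congrArg₂ (· + ·) (piModMap_cycClass _ n v) (piModMap_cycClass _ n v)).symm
    refine Eq.trans ?_ ((cycClass _ n).map_add _ _)
    exact congrArg _ (Subtype.ext (tanMap_addHom α a b v.1))

lemma tanPi_comp (n : ℕ) {V W X : SFDVect Λ} (a : V ⟶ W) (b : W ⟶ X) :
    tanPi α n (a ≫ b) = tanPi α n b ∘ₗ tanPi α n a := by
  refine LinearMap.ext fun c => ?_
  obtain ⟨v, rfl⟩ := cycClass_surjective _ n c
  refine (piModMap_cycClass _ n v).trans ?_
  refine Eq.trans ?_ (congrArg (piModMap (tanMap α b) n) (piModMap_cycClass _ n v)).symm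
  refine Eq.trans ?_ (piModMap_cycClass _ n _).symm
  exact congrArg _ (Subtype.ext (congrArg (fun f => (f.app _).hom v.1) (tanMap_comp α a b)))

lemma tanPi_id (n : ℕ) (V : SFDVect Λ) : tanPi α n (𝟙 V) = LinearMap.id := by
  refine LinearMap.ext fun c => ?_
  obtain ⟨v, rfl⟩ := cycClass_surjective _ n c
  refine (piModMap_cycClass _ n v).trans ?_
  exact congrArg _ (Subtype.ext (congrArg (fun f => (f.app _).hom v.1) (tanMap_id α V)))

lemma isFD_subObj {k : Type u} [Field k] {V : SimplicialObject (ModuleCat.{u} k)} (hV : IsFD V)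
    (J : ∀ n, Submodule k (V.obj n))
    (hJ : ∀ {m n} (θ : m ⟶ n), ∀ x ∈ J m, (V.map θ).hom x ∈ J n) : IsFD (subObj J hJ) := by
  have hf := finite_of_isFD hV
  rw [isFD_iff] at hV ⊢
  obtain ⟨-, m, hm⟩ := hV
  let i : subObj J hJ ⟶ V :=
    { app := fun n => ModuleCat.ofHom (J n).subtype
      naturality := fun _ _ _ => rfl }
  refine ⟨fun n => ?_, m, fun n hn => ?_⟩
  · have := hf n
    have : Module.Finite k ((subObj J hJ).obj (op ⦋n⦌)) :=
      inferInstanceAs (Module.Finite k (J (op ⦋n⦌)))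
    infer_instance
  · refine (Submodule.eq_bot_iff _).2 fun x hx => Subtype.ext ?_
    have h1 : (i.app _).hom x ∈ normSub V n := app_mem_normSub i hx
    rw [hm n hn] at h1
    exact (Submodule.mem_bot _).1 h1

/-- An idempotent that induces zero on homology induces zero on the homotopy groups of the tangent
space, because its image is acyclic. -/
lemma QuasiSmooth.tanPi_eq_zero (hα : QuasiSmooth α) (n : ℕ) {U : SFDVect Λ} (e : U ⟶ U)
    (hee : ∀ m (x : U.obj.obj m), (e.hom.app m).hom ((e.hom.app m).hom x) = (e.hom.app m).hom x)
    (he : ∀ (m : ℕ) (z : U.obj.obj (op ⦋m⦌)), z ∈ cyc U.obj m → (e.hom.app _).hom z = z →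
      ∃ y ∈ normSub U.obj (m + 1), (U.obj.δ 0).hom y = z) : tanPi α n e = 0 := by
  -- the image of the idempotent, as the space of its fixed points
  let J : ∀ m, Submodule (ResidueField Λ) (U.obj.obj m) := fun m =>
    LinearMap.eqLocus (e.hom.app m).hom LinearMap.id
  have hJ : ∀ {m n} (θ : m ⟶ n), ∀ x ∈ J m, (U.obj.map θ).hom x ∈ J n := fun {m n} θ x hx =>
    (naturality_apply e.hom θ x).trans (congrArg (U.obj.map θ).hom hx)
  let C : SFDVect Λ := ⟨subObj J hJ, isFD_subObj U.property J hJ⟩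
  let i : C ⟶ U := homOfLinear (fun m => (J m).subtype) fun _ _ => rfl
  let r : U ⟶ C := homOfLinear
    (fun m => LinearMap.codRestrict (J m) (e.hom.app m).hom (hee m))
    fun θ x => Subtype.ext (naturality_apply e.hom θ x)
  have hi : ∀ m, Function.Injective (i.hom.app m).hom := fun m => Subtype.val_injective
  have hr : r ≫ i = e := SFDVect.hom_ext fun _ _ => rfl
  -- a cycle of the image bounds in `U`, and applying `e` it bounds in the image
  have hC : ∀ (m : ℕ) (z : C.obj.obj (op ⦋m⦌)), z ∈ cyc C.obj m →
      ∃ y ∈ normSub C.obj (m + 1), (C.obj.δ 0).hom y = z := by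
    rintro m z hz
    obtain ⟨y, hy, hyz⟩ := he m z.1 (app_mem_cyc i.hom hz) z.2
    refine ⟨(r.hom.app _).hom y, app_mem_normSub r.hom hy, Subtype.ext ?_⟩
    refine (naturality_apply e.hom (SimplexCategory.δ 0).op y).symm.trans ?_
    exact (congrArg (e.hom.app _).hom hyz).trans z.2
  rw [← hr, tanPi_comp]
  refine LinearMap.ext fun c => ?_
  refine (congrArg (tanPi α n i) (?_ : tanPi α n r c = 0)).trans (_root_.map_zero _)
  obtain ⟨v, hv⟩ := cycClass_surjective _ n (tanPi α n r c)
  rw [← hv]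
  exact (cycClass_eq_zero_iff _ n v).2 (hα.exists_boundary_tangent C hC n v.1 v.2)

end TangentHomotopy

section Splitting
variable {k : Type u} [Field k] {U : SimplicialObject (ModuleCat.{u} k)}

/-- Linear forms on `π_m(U)` are induced by maps to `K^m`. -/
lemma exists_hom_of_dual (m : ℕ) (l : piMod m U →ₗ[k] k) :
    ∃ f : U ⟶ eilenbergMacLane k m, ∀ z : cyc U m,
      (f.app _).hom z.1 = l (cycClass U m z) • gen k m := by
  let l₀ : (cyc U m).comap (normSub U m).subtype →ₗ[k] k := l ∘ₗ cycClass U m ∘ₗ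
    LinearMap.codRestrict (cyc U m) ((normSub U m).subtype ∘ₗ Submodule.subtype _) fun x => x.2
  -- extend the linear form from the cycles to the normalised simplices
  obtain ⟨l', hl'⟩ := LinearMap.exists_extend l₀
  have h1 : ∀ z : cyc U m, l' ⟨z.1, cyc_le_normSub m z.2⟩ = l (cycClass U m z) := fun z =>
    LinearMap.congr_fun hl' ⟨⟨z.1, cyc_le_normSub m z.2⟩, z.2⟩
  obtain ⟨f, hf⟩ := exists_hom_of_form m l' fun y hy h => by
    refine (h1 ⟨_, δ_zero_mem_cyc hy⟩).trans ?_
    rw [(cycClass_eq_zero_iff U m _).2 ⟨y, hy, rfl⟩, _root_.map_zero]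
  exact ⟨f, fun z => (hf ⟨z.1, cyc_le_normSub m z.2⟩).trans (by rw [h1])⟩

lemma finite_piMod (hU : IsFD U) (m : ℕ) : Module.Finite k (piMod m U) := by
  have := finite_of_isFD hU m
  exact Module.Finite.of_surjective (cycClass U m) (cycClass_surjective U m)

end Splitting

/-! ### Cohomology with coefficients -/

section Coefficients
variable {Λ : Type u} [CommRing Λ] [IsLocalRing Λ] {F G : SArt Λ ⥤ SSet.{u}}
  [PreservesFiniteLimits F] [PreservesFiniteLimits G] {α : F ⟶ G}

/-- Decomposition of the coefficients into Eilenberg–MacLane objects: up to an acyclic summand,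
`U` is the sum of copies of `K^m` indexed by bases of the spaces `π_m(U)`. -/
theorem QuasiSmooth.nonempty_piMod_directSum (hα : QuasiSmooth α) (U : SFDVect Λ)
    (hU : ∀ z : U.obj.obj (op ⦋0⦌), ∃ y ∈ normSub U.obj 1, (U.obj.δ 0).hom y = z) (n : ℕ) :
    Nonempty (piMod n (tangentRel α U) ≃ₗ[ResidueField Λ]
      ⨁ m : ℕ, piMod n (tangentRel α (KObj Λ (m + 1))) ⊗[ResidueField Λ] piMod (m + 1) U.obj) := by
  classical
  have hfin := finite_piMod U.property
  obtain ⟨-, N, hN⟩ := (isFD_iff U.obj).1 U.property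
  let b := fun m => Module.finBasis (ResidueField Λ) (piMod (m + 1) U.obj)
  -- only finitely many homotopy groups are non-zero, as the normalisation is bounded
  have hJ : ∀ m, N ≤ m → IsEmpty (Fin (Module.finrank (ResidueField Λ) (piMod (m + 1) U.obj))) := by
    intro m hm
    have : Subsingleton (piMod (m + 1) U.obj) := by
      refine subsingleton_of_forall_eq 0 fun c => ?_
      obtain ⟨v, rfl⟩ := cycClass_surjective _ _ c
      have hv := cyc_le_normSub _ v.2
      rw [hN (m + 1) (by omega), Submodule.mem_bot] at hv
      rw [show v = 0 from Subtype.ext hv, _root_.map_zero]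
    rw [Module.finrank_zero_of_subsingleton]
    infer_instance
  -- cycles representing the bases, and maps `K^(m+1) ⟶ U ⟶ K^(m+1)` given by these cycles and the
  -- dual bases
  choose s hs using fun m a => cycClass_surjective U.obj (m + 1) (b m a)
  choose f hf using fun m a => exists_hom_of_cycle (m + 1) (s m a).2
  choose g hg using fun m a => exists_hom_of_dual (U := U.obj) (m + 1) ((b m).coord a)
  let ι : ∀ m, Fin (Module.finrank (ResidueField Λ) (piMod (m + 1) U.obj)) →
    (KObj Λ (m + 1) ⟶ U) := fun m a => ObjectProperty.homMk (f m a)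
  let π : ∀ m, Fin (Module.finrank (ResidueField Λ) (piMod (m + 1) U.obj)) →
    (U ⟶ KObj Λ (m + 1)) := fun m a => ObjectProperty.homMk (g m a)
  have hfg : ∀ m a a', ((g m a).app _).hom (((f m a').app _).hom (gen _ (m + 1))) =
      (b m).coord a (b m a') • gen _ (m + 1) := fun m a a' => by
    rw [hf, hg, hs]
  have h1 : ∀ m a, ι m a ≫ π m a = 𝟙 _ := fun m a =>
    ObjectProperty.hom_ext _ (eilenbergMacLane_hom_ext (m + 1) ((hfg m a a).trans (by
      rw [Module.Basis.coord_apply, Module.Basis.repr_self, Finsupp.single_eq_same, one_smul]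
      rfl)))
  have h2 : ∀ m a a', a ≠ a' → ι m a' ≫ π m a = 0 := fun m a a' ha =>
    ObjectProperty.hom_ext _ (eilenbergMacLane_hom_ext (m + 1) ((hfg m a a').trans (by
      rw [Module.Basis.coord_apply, Module.Basis.repr_self, Finsupp.single_eq_of_ne ha,
        zero_smul]
      rfl)))
  have h3 : ∀ m m' a a', m ≠ m' → ι m' a' ≫ π m a = 0 := fun m m' a a' hm =>
    ObjectProperty.hom_ext _ (eilenbergMacLane_hom_ext (m' + 1) (by
      have h := app_mem_normSub (f m' a' ≫ g m a) (gen_mem_normSub (m' + 1))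
      rw [normSub_eilenbergMacLane (m + 1) (by omega : m' + 1 ≠ m + 1), Submodule.mem_bot] at h
      exact h))
  -- the projection to the sum of the Eilenberg–MacLane objects
  let p : U ⟶ U := ∑ m ∈ Finset.range N, ∑ a, π m a ≫ ι m a
  have hp : ∀ m a, p ≫ π m a = π m a := fun m a => by
    have hm : m ∈ Finset.range N := Finset.mem_range.2 (by
      by_contra hm
      exact (hJ m (not_lt.1 hm)).false a)
    simp only [p, Preadditive.sum_comp, Category.assoc]
    rw [Finset.sum_eq_single_of_mem m hm, Finset.sum_eq_single_of_mem a (Finset.mem_univ a),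
      h1, Category.comp_id]
    · intro a' _ ha'
      rw [h2 _ _ _ ha'.symm, comp_zero]
    · intro m' _ hm'
      exact Finset.sum_eq_zero fun a' _ => by rw [h3 _ _ _ _ hm'.symm, comp_zero]
  -- the complementary idempotent `e` kills the homotopy groups of `U`, because all dual basis
  -- vectors vanish on its image; therefore it induces zero on those of the tangent space
  let e : U ⟶ U := 𝟙 U - p
  have heπ : ∀ m a, e ≫ π m a = 0 := fun m a => by
    rw [Preadditive.sub_comp, hp, Category.id_comp, sub_self]
  have hee : e ≫ e = e := by
    have : e ≫ p = 0 := by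
      simp only [p, Preadditive.comp_sum]
      refine Finset.sum_eq_zero fun m _ => Finset.sum_eq_zero fun a _ => ?_
      rw [← Category.assoc, heπ, zero_comp]
    rw [show e ≫ e = e ≫ 𝟙 U - e ≫ p from Preadditive.comp_sub _ _ _, this, sub_zero,
      Category.comp_id]
  have he : tanPi α n e = 0 := by
    refine hα.tanPi_eq_zero n e
      (fun m x => congrArg (fun h : U ⟶ U => (h.hom.app m).hom x) hee) fun m z hz hez => ?_
    cases m with
    | zero => exact hU z
    | succ m =>
      refine (cycClass_eq_zero_iff U.obj (m + 1) ⟨z, hz⟩).1 ((b m).ext_elem fun a => ?_)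
      have h4 : ((g m a).app _).hom z = 0 := by
        rw [← hez]
        exact congrArg (fun h : U ⟶ KObj Λ (m + 1) => (h.hom.app _).hom z) (heπ m a)
      rw [hg m a ⟨z, hz⟩] at h4
      rw [_root_.map_zero]
      exact (smul_eq_zero.1 h4).resolve_right (gen_ne_zero (m + 1))
  have hid : tanPi α n p = LinearMap.id := by
    rw [_root_.map_sub, tanPi_id, sub_eq_zero] at he
    exact he.symm
  refine nonempty_equiv_directSum b N hJ (fun m a => tanPi α n (ι m a))
    (fun m a => tanPi α n (π m a)) (fun m a => ?_) (fun m a a' ha => ?_)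
    (fun m m' a a' hm => ?_) ?_
  · rw [← tanPi_comp, h1, tanPi_id]
  · rw [← tanPi_comp, h2 m a a' ha, _root_.map_zero]
  · rw [← tanPi_comp, h3 m m' a a' hm, _root_.map_zero]
  · rw [← hid]
    simp only [p, _root_.map_sum, tanPi_comp]

lemma QuasiSmooth.nonempty_piMod_shift_directSum (hα : QuasiSmooth α) (V : SFDVect Λ) (n : ℕ) :
    Nonempty (piMod n (tangentRel α (shift V 1)) ≃ₗ[ResidueField Λ]
      ⨁ m : ℕ, piMod n (tangentRel α (KObj Λ (m + 1))) ⊗[ResidueField Λ] piMod m V.obj) := by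
  obtain ⟨e⟩ := hα.nonempty_piMod_directSum (shift V 1) (exists_boundary_shift V) n
  exact ⟨e ≪≫ₗ DFinsupp.mapRange.linearEquiv fun m =>
    TensorProduct.congr (LinearEquiv.refl _ _) (nonempty_piMod_shift_obj V m).some⟩

lemma eq_zero_of_mem_normSub_KObj {m n : ℕ} (h : m ≠ n)
    {v : (KObj Λ n).obj.obj (op ⦋m⦌)} (hv : v ∈ normSub (KObj Λ n).obj m) : v = 0 :=
  (Submodule.mem_bot _).1 ((normSub_eilenbergMacLane n h).le hv)

/-- Both sides are isomorphic to `π_{i+1}` of the tangent space of `K^n ⊗ K^1`, by the shift of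
homotopy groups and by the decomposition of the coefficients. -/
lemma QuasiSmooth.nonempty_piMod_KObj_succ (hα : QuasiSmooth α) (i n : ℕ) :
    Nonempty (piMod (i + 1) (tangentRel α (KObj Λ (n + 1))) ≃ₗ[ResidueField Λ]
      piMod i (tangentRel α (KObj Λ n))) := by
  obtain ⟨e₁⟩ := hα.nonempty_piMod_shift (KObj Λ n) i
  obtain ⟨e₂⟩ := hα.nonempty_piMod_shift_directSum (KObj Λ n) (i + 1)
  let z : cyc (KObj Λ n).obj n := ⟨gen _ n, gen_mem_cyc n⟩
  obtain ⟨e₃⟩ := nonempty_equiv_directSum_single (k := ResidueField Λ)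
    (X := fun m => piMod (i + 1) (tangentRel α (KObj Λ (m + 1))))
    (P := fun m => piMod m (KObj Λ n).obj) n (cycClass _ n z) (fun h => by
      obtain ⟨y, hy, hy'⟩ := (cycClass_eq_zero_iff _ n z).1 h
      rw [eq_zero_of_mem_normSub_KObj (by omega) hy, _root_.map_zero] at hy'
      exact gen_ne_zero n hy'.symm) (fun c => by
      obtain ⟨v, rfl⟩ := cycClass_surjective _ n c
      obtain ⟨c, hc⟩ := exists_eq_smul_gen n (cyc_le_normSub n v.2)
      exact ⟨c, (congrArg _ (Subtype.ext hc : v = c • z)).trans (_root_.map_smul _ _ _)⟩)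
    fun m hm c => by
      obtain ⟨v, rfl⟩ := cycClass_surjective _ m c
      have hv : v = 0 := Subtype.ext (eq_zero_of_mem_normSub_KObj hm (cyc_le_normSub m v.2))
      rw [hv, _root_.map_zero]
  exact ⟨e₃.symm ≪≫ₗ e₂.symm ≪≫ₗ e₁⟩

lemma QuasiSmooth.nonempty_piMod_KObj_add (hα : QuasiSmooth α) (i n r : ℕ) :
    Nonempty (piMod (i + r) (tangentRel α (KObj Λ (n + r))) ≃ₗ[ResidueField Λ]
      piMod i (tangentRel α (KObj Λ n))) := by
  induction r with
  | zero => exact ⟨LinearEquiv.refl _ _⟩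
  | succ r ih =>
    obtain ⟨e⟩ := ih
    obtain ⟨e'⟩ := hα.nonempty_piMod_KObj_succ (i + r) (n + r)
    exact ⟨e' ≪≫ₗ e⟩

/-- `π_i tan(F/G)(K^n)` depends only on `n - i`. -/
theorem QuasiSmooth.nonempty_piMod_cohomology (hα : QuasiSmooth α) (n i : ℕ) :
    Nonempty (piMod i (tangentRel α (KObj Λ n)) ≃ₗ[ResidueField Λ]
      cohomology α ((n : ℤ) - i)) := by
  obtain ⟨j, hj⟩ : ∃ j : ℤ, (n : ℤ) - i = j := ⟨_, rfl⟩
  have h := hα.nonempty_piMod_KObj_add (-j).toNat j.toNat (min n i)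
  rw [show (-j).toNat + min n i = i by omega, show j.toNat + min n i = n by omega] at h
  rw [hj]
  exact h

/-- The universal coefficient formula for the tangent spaces of `F/G`. -/
theorem QuasiSmooth.nonempty_piMod_cohomologyCoeff (hα : QuasiSmooth α) (V : SFDVect Λ) (n : ℕ) :
    Nonempty (piMod n (tangentRel α (shift V 1)) ≃ₗ[ResidueField Λ]
      cohomologyCoeff α V (1 - (n : ℤ))) := by
  obtain ⟨e⟩ := hα.nonempty_piMod_shift_directSum V n
  have h : ∀ m : ℕ, Nonempty (piMod n (tangentRel α (KObj Λ (m + 1))) ≃ₗ[ResidueField Λ]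
      cohomology α (1 - (n : ℤ) + m)) := fun m => by
    have := hα.nonempty_piMod_cohomology (m + 1) n
    rwa [show ((m + 1 : ℕ) : ℤ) - n = 1 - (n : ℤ) + m by push_cast; ring] at this
  exact ⟨e ≪≫ₗ DFinsupp.mapRange.linearEquiv fun m =>
    TensorProduct.congr (h m).some (LinearEquiv.refl _ _)⟩

end Coefficients

end DerivedDef

theorem mainTheorem4 {Λ : Type u} [CommRing Λ] [IsLocalRing Λ] [IsNoetherianRing Λ]
    [IsAdicComplete (maximalIdeal Λ) Λ] {F G : SArt Λ ⥤ SSet.{u}}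
    [PreservesFiniteLimits F] [PreservesFiniteLimits G] (α : F ⟶ G) (hα : QuasiSmooth α) :
    (∀ {I : SimplicialObject (ModuleCat.{u} (ResidueField Λ))} {A B : SArt Λ} {f : A ⟶ B}
      (e : SmallExtension I f),
      ∃ (Q : ObstructionMap (relMap α f) (tangentRel α (shift e.ker 1)))
        (o₀ : π₀ (relTarget α f) → piMod 0 (tangentRel α (shift e.ker 1)))
        (_ : AddAction (piMod 1 (tangentRel α (shift e.ker 1))) (π₀ (F.obj A))),
        Q.Induces₀ o₀ ∧
        Q.InducesAction (fun g a => g +ᵥ a) ∧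
        (∀ c, o₀ c = 0 ↔ c ∈ Set.range (mapπ₀ (relMap α f))) ∧
        (∀ a b : π₀ (F.obj A), mapπ₀ (relMap α f) a = mapπ₀ (relMap α f) b ↔
          ∃ g : piMod 1 (tangentRel α (shift e.ker 1)), g +ᵥ a = b) ∧
        ∀ y : (F.obj A) _⦋0⦌,
          (∃ (i : toSSet (tangentRel α e.ker) ⟶ F.obj A) (t : toSSet (tangentRel α e.ker) ⟶ Δ[0]),
            IsPullback i t (relMap α f) (yonedaEquiv.symm ((relMap α f).app _ y)) ∧
            i.app _ (zeroVertex _) = y) ∧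
          ∃ (o : ∀ n, PiGroup (n + 1) (relTarget α f) ((relMap α f).app _ y) →
                piMod (n + 1) (tangentRel α (shift e.ker 1)))
            (d : ∀ n, piMod (n + 2) (tangentRel α (shift e.ker 1)) →
                PiGroup (n + 1) (F.obj A) y),
            (∀ n, Q.Induces y (n + 1) (o n)) ∧
            (∀ n, Q.InducesBoundary y (n + 1) (d n)) ∧
            (∀ n a b c, PiGroup.IsMul a b c → o n c = o n a + o n b) ∧
            (∀ n u v, PiGroup.IsMul (d n u) (d n v) (d n (u + v))) ∧
            (∀ n c, o n c = 0 ↔ c ∈ Set.range (PiGroup.map (relMap α f) (x := y) rfl)) ∧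
            (∀ n u, d n u = 1 ↔ u ∈ Set.range (o (n + 1))) ∧
            (∀ n (a : PiGroup (n + 1) (F.obj A) y),
              a.map (relMap α f) rfl = 1 ↔ a ∈ Set.range (d n)) ∧
            (∀ g : piMod 1 (tangentRel α (shift e.ker 1)),
              g +ᵥ π₀.mk y = π₀.mk y ↔ g ∈ Set.range (o 0))) ∧
    (∀ n i : ℕ, Nonempty (piMod i (tangentRel α (KObj Λ n)) ≃ₗ[ResidueField Λ]
      cohomology α ((n : ℤ) - i))) ∧
    (∀ (V : SFDVect Λ) (n : ℕ), Nonempty (piMod n (tangentRel α (shift V 1)) ≃ₗ[ResidueField Λ]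
      cohomologyCoeff α V (1 - (n : ℤ)))) := ⟨fun e => hα.smallExtension e,
    hα.nonempty_piMod_cohomology, hα.nonempty_piMod_cohomologyCoeff⟩
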